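/- **Setting.** Let $K$ be a complete discretely valued field of characteristic $0$ with valuation ring $\mathcal O$, valuation $v$, and residue field $k$ of characteristic $p>0$. Let $\sigma_0:\mathcal O\to\mathcal O$ be a ring endomorphism lifting the $p$-power Frobenius of $k$, let $a\ge 1$ and $q=p^a$. The Robba ring $\mathcal R$ is the ring of series $\sum_{i\in\mathbb Z}c_iT^i$ with $c_i\in K$ for which there is $r>0$ such that $v(c_i)+si\to\infty$ as $i\to\pm\infty$ for all $0<s\le r$; $\mathcal R^{\mathrm{int}}$ is its subring of series with all $c_i\in\mathcal O$, and $\Omega^1_{\mathcal R}$ is free on $dT$. Let $W_n$ be the ring of series $\sum_I c_Ix^I$ over $\mathcal O$ in $n$ variables with $\liminf_I v(c_I)/|I|>0$. An integral dagger algebra is a quotient $A^{\mathrm{int}}=W_n/\mathfrak a$ that is flat over $\mathcal O$ and for which $A^{\mathrm{int}}\otimes_{\mathcal O}k$ is smooth over $k$; its dagger algebra is $A=A^{\mathrm{int}}\otimes_{\mathcal O}K$. The localization of $A$ at $f\in A^{\mathrm{int}}$ is the dagger algebra with integral model $W_{n+1}/(\mathfrak aW_{n+1}+(fx_{n+1}-1)W_{n+1})$.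 Let $\Omega^1_{A/K}$ be the $A$-module generated by $dx_1,\dots,dx_n$ modulo the relations $df=\sum_i(\partial f/\partial x_i)\,dx_i=0$ for $f\in\mathfrak a$. Suppose that $\sigma_0$ is extended to a lift $A^{\mathrm{int}}\to A^{\mathrm{int}}$ of the $p$-power Frobenius of $A^{\mathrm{int}}\otimes_{\mathcal O}k$, and put $\sigma=\sigma_0^a$ (it extends uniquely to localizations). For $u\in A$ with $u^\sigma=hu^q$, $h\in A^\times$, let $\Omega^1_{A/K}[d\log u]$ be obtained from $\Omega^1_{A/K}$ by adding a generator $d\log u$ with $u\,d\log u=du$, and let $d\sigma$ act on it by $da\mapsto d(a^\sigma)$ and $d\log u\mapsto q\,d\log u+h^{-1}dh$. A log-$(\sigma,\nabla)$-module over $A$ with respect to $u$ is a finite locally free $A$-module $M$ with a $\sigma$-linear map $F:M\to M$ inducing an isomorphism $M\otimes_{A,\sigma}A\cong M$ and an integrable connection $\nabla:M\to M\otimes_A\Omega^1_{A/K}[d\log u]$ such that $\nabla\circ F=(F\otimes d\sigma)\circ\nabla$. If $u=1$ it is called a $(\sigma,\nabla)$-module. **Theorem.** Let $A$ be a dagger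 algebra as above, with Frobenius lift $\sigma$, such that $\operatorname{Spec}(A^{\mathrm{int}}\otimes_{\mathcal O}k)$ is a connected (smooth, affine) curve over $k$. Let $u\in A^{\mathrm{int}}$ be such that its image in $A^{\mathrm{int}}\otimes_{\mathcal O}k$ generates a prime ideal with residue field $k$ (so the curve is automatically geometrically connected), and such that $u^\sigma=hu^q$ for a unit $h$ of $A$. Let $\rho_u:A^{\mathrm{int}}\to\mathcal O[[T]]$ be the $\mathcal O$-algebra homomorphism with $\rho_u(u)=T$; let $A'$ be the localization of $A$ at $u$, and extend $\rho_u$ to $A'^{\mathrm{int}}\to\mathcal R^{\mathrm{int}}$ and $A'\to\mathcal R$. Let $M$ be a free $(\sigma,\nabla)$-module over $A'$ which becomes unipotent over $\mathcal R$, i.e. $M\otimes_{A'}\mathcal R$ with its induced connection has a basis $\mathbf v_1,\dots,\mathbf v_n$ with $\nabla\mathbf v_i\in\operatorname{Span}_{\mathcal R}(\mathbf v_1,\dots,\mathbf v_{i-1})\otimes\Omega^1_{\mathcal R}$ for all $i$. Then there are a localization $A''$ of $A$ (at some $g\in A^{\mathrm{int}}$ that is not a zero divisor) in which $u$ is not invertible,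 and a log-$(\sigma,\nabla)$-module $N$ over $A''$ with respect to $u$, such that, with $B$ the localization of $A''$ at $u$ (which receives a map from $A'$), the $(\sigma,\nabla)$-modules $M\otimes_{A'}B$ and $N\otimes_{A''}B$ over $B$ are isomorphic. -/

import Mathlib

open Filter Topology TensorProduct

universe u v

noncomputable section

namespace Dagger

/-! ## The Robba ring -/

/-- `|c_i| e^{-s i}` for a bidirectional sequence `c` of coefficients. -/
def wt {K : Type u} [NormedField K] (s : ℝ) (f : ℤ → K) (i : ℤ) : ℝ :=
  ‖f i‖ * Real.exp (-(s * i))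

/-- The coefficient sequences of elements of the Robba ring: bidirectional series
`∑ c_i u^i`, `c_i ∈ K`, for which there is an `r > 0` such that for all `0 < s ≤ r` one has
`|c_i| e^{-s i} → 0` (that is, `v(c_i) + s i → ∞`) as `i → ±∞`. -/
def IsRobba {K : Type u} [NormedField K] (f : ℤ → K) : Prop :=
  ∃ r : ℝ, 0 < r ∧ ∀ s : ℝ, 0 < s → s ≤ r → Tendsto (wt s f) cofinite (𝓝 0)

section
variable {K : Type u} [NormedField K]

lemma wt_nonneg (s : ℝ) (f : ℤ → K) (i : ℤ) : 0 ≤ wt s f i := by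
  unfold wt; positivity

lemma bdd_of_tendsto {g : ℤ → ℝ} (h : Tendsto g cofinite (𝓝 0)) : ∃ C, ∀ i, g i ≤ C := by
  have h1 : ∀ᶠ i in cofinite, g i ≤ 1 := h.eventually_le_const one_pos
  have h2 : {i | ¬ g i ≤ 1}.Finite := h1
  obtain ⟨C, hC⟩ := (h2.image g).bddAbove
  refine ⟨max C 1, fun i => ?_⟩
  by_cases hi : g i ≤ 1
  · exact hi.trans (le_max_right _ _)
  · exact (hC ⟨i, hi, rfl⟩).trans (le_max_left _ _)

lemma summable_exp_abs {δ : ℝ} (hδ : 0 < δ) :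
    Summable (fun i : ℤ => Real.exp (-(δ * |(i : ℝ)|))) := by
  have h : Summable (fun n : ℕ => Real.exp (-(δ * n))) := by
    have := Real.summable_exp_nat_mul_iff.mpr (neg_lt_zero.mpr hδ)
    refine this.congr fun n => ?_
    congr 1; ring
  apply Summable.of_nat_of_neg
  · simpa using h
  · simpa using h

lemma isRobba_iff (f : ℤ → K) :
    IsRobba f ↔ ∃ r : ℝ, 0 < r ∧ ∀ s : ℝ, 0 < s → s < r → Summable (wt s f) := by
  constructor
  · rintro ⟨r, hr, h⟩
    refine ⟨r, hr, fun s hs hsr => ?_⟩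
    obtain ⟨C₁, h₁⟩ := bdd_of_tendsto (h (s / 2) (by linarith) (by linarith))
    obtain ⟨C₂, h₂⟩ := bdd_of_tendsto (h r hr le_rfl)
    set δ := min (s / 2) (r - s) with hδ
    have hδ0 : 0 < δ := lt_min (by linarith) (by linarith)
    have hC : ∀ i, wt s f i ≤ max C₁ C₂ * Real.exp (-(δ * |(i : ℝ)|)) := by
      intro i
      have hpos : 0 ≤ max C₁ C₂ := ((wt_nonneg _ _ _).trans (h₁ 0)).trans (le_max_left _ _)
      rcases le_total 0 (i : ℝ) with hi | hi
      · have : wt s f i = wt (s / 2) f i * Real.exp (-(s / 2 * i)) := by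
          unfold wt; rw [mul_assoc, ← Real.exp_add]; congr 2; ring
        rw [this, abs_of_nonneg hi]
        refine mul_le_mul ((h₁ i).trans (le_max_left _ _)) ?_ (Real.exp_nonneg _) hpos
        exact Real.exp_le_exp.mpr (neg_le_neg (mul_le_mul_of_nonneg_right (min_le_left _ _) hi))
      · have : wt s f i = wt r f i * Real.exp (-((r - s) * (-i))) := by
          unfold wt; rw [mul_assoc, ← Real.exp_add]; congr 2; ring
        rw [this, abs_of_nonpos hi]
        refine mul_le_mul ((h₂ i).trans (le_max_right _ _)) ?_ (Real.exp_nonneg _) hpos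
        exact Real.exp_le_exp.mpr
          (neg_le_neg (mul_le_mul_of_nonneg_right (min_le_right _ _) (by linarith)))
    exact Summable.of_nonneg_of_le (wt_nonneg s f) hC ((summable_exp_abs hδ0).mul_left _)
  · rintro ⟨r, hr, h⟩
    exact ⟨r / 2, by linarith, fun s hs hsr =>
      (h s hs (by linarith)).tendsto_cofinite_zero⟩

lemma exists_common {f g : ℤ → K} (hf : IsRobba f) (hg : IsRobba g) :
    ∃ r : ℝ, 0 < r ∧ ∀ s : ℝ, 0 < s → s < r → Summable (wt s f) ∧ Summable (wt s g) := by
  obtain ⟨r, hr, h⟩ := (isRobba_iff f).mp hf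
  obtain ⟨r', hr', h'⟩ := (isRobba_iff g).mp hg
  exact ⟨min r r', lt_min hr hr', fun s hs hsr =>
    ⟨h s hs (hsr.trans_le (min_le_left _ _)), h' s hs (hsr.trans_le (min_le_right _ _))⟩⟩

/-- Multiplication of bidirectional series: `(f g)_n = ∑_i f_i g_{n-i}`. -/
def conv (f g : ℤ → K) (n : ℤ) : K := ∑' i : ℤ, f i * g (n - i)

/-- The change of variables `(n, i) ↦ (i, n - i)`. -/
def shear : ℤ × ℤ ≃ ℤ × ℤ where
  toFun x := (x.2, x.1 - x.2)
  invFun x := (x.1 + x.2, x.1)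
  left_inv x := by ext <;> simp
  right_inv x := by ext <;> simp

lemma summable_shear {s : ℝ} {f g : ℤ → K} (hf : Summable (wt s f)) (hg : Summable (wt s g)) :
    Summable (fun x : ℤ × ℤ => wt s f x.2 * wt s g (x.1 - x.2)) :=
  (shear.summable_iff (f := fun x : ℤ × ℤ => wt s f x.1 * wt s g x.2)).mpr
    (hf.mul_of_nonneg hg (wt_nonneg s f) (wt_nonneg s g))

lemma wt_term (s : ℝ) (f g : ℤ → K) (n i : ℤ) :
    ‖f i * g (n - i)‖ = wt s f i * wt s g (n - i) * Real.exp (s * n) := by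
  unfold wt
  have : Real.exp (s * n) = (Real.exp (-(s * i)) * Real.exp (-(s * (n - i : ℤ))))⁻¹ := by
    rw [← Real.exp_add, ← Real.exp_neg]; congr 1; push_cast; ring
  rw [norm_mul, this]
  have h1 := (Real.exp_pos (-(s * i))).ne'
  have h2 := (Real.exp_pos (-(s * (n - i : ℤ)))).ne'
  field_simp

lemma summable_norm_term {s : ℝ} {f g : ℤ → K} (hf : Summable (wt s f))
    (hg : Summable (wt s g)) (n : ℤ) : Summable (fun i => ‖f i * g (n - i)‖) := by
  simp_rw [wt_term s f g n]
  exact ((summable_shear hf hg).prod_factor n).mul_right _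

lemma wt_conv_le {s : ℝ} {f g : ℤ → K} (hf : Summable (wt s f))
    (hg : Summable (wt s g)) (n : ℤ) :
    wt s (conv f g) n ≤ ∑' i, wt s f i * wt s g (n - i) := by
  have h : ‖conv f g n‖ ≤ ∑' i, ‖f i * g (n - i)‖ :=
    norm_tsum_le_tsum_norm (summable_norm_term hf hg n)
  simp_rw [wt_term s f g n, tsum_mul_right] at h
  unfold wt at h ⊢
  calc _ ≤ _ := mul_le_mul_of_nonneg_right h (Real.exp_nonneg _)
    _ = _ := by
      rw [mul_assoc, ← Real.exp_add, add_neg_cancel, Real.exp_zero, mul_one]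

lemma summable_wt_conv {s : ℝ} {f g : ℤ → K} (hf : Summable (wt s f))
    (hg : Summable (wt s g)) : Summable (wt s (conv f g)) :=
  Summable.of_nonneg_of_le (wt_nonneg s _) (wt_conv_le hf hg) (summable_shear hf hg).prod

lemma IsRobba.conv {f g : ℤ → K} (hf : IsRobba f) (hg : IsRobba g) : IsRobba (conv f g) := by
  obtain ⟨r, hr, h⟩ := exists_common hf hg
  exact (isRobba_iff _).mpr ⟨r, hr, fun s hs hsr =>
    summable_wt_conv (h s hs hsr).1 (h s hs hsr).2⟩

lemma conv_comm (f g : ℤ → K) : conv f g = conv g f := by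
  funext n
  unfold conv
  rw [← (Equiv.subLeft n).tsum_eq]
  refine tsum_congr fun i => ?_
  simp [mul_comm]

lemma conv_add [CompleteSpace K] {f g h : ℤ → K} (hf : IsRobba f) (hg : IsRobba g)
    (hh : IsRobba h) : conv f (g + h) = conv f g + conv f h := by
  obtain ⟨r, hr, H⟩ := exists_common hf hg
  obtain ⟨r', hr', H'⟩ := exists_common hf hh
  funext n
  have h1 := (summable_norm_term (H (r / 2) (by linarith) (by linarith)).1
    (H (r / 2) (by linarith) (by linarith)).2 n).of_norm
  have h2 := (summable_norm_term (H' (r' / 2) (by linarith) (by linarith)).1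
    (H' (r' / 2) (by linarith) (by linarith)).2 n).of_norm
  simp only [conv, Pi.add_apply]
  rw [← h1.tsum_add h2]
  simp only [mul_add]

lemma conv_single (c : K) (m : ℤ) (f : ℤ → K) (n : ℤ) :
    conv (Pi.single m c) f n = c * f (n - m) := by
  unfold conv
  rw [tsum_eq_single m]
  · simp
  · intro i hi
    simp [Pi.single_eq_of_ne hi]

lemma isRobba_single (m : ℤ) (c : K) : IsRobba (Pi.single m c : ℤ → K) := by
  refine ⟨1, one_pos, fun s _ _ => ?_⟩
  refine tendsto_nhds_of_eventually_eq ?_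
  filter_upwards [(Set.finite_singleton m).compl_mem_cofinite] with i hi
  simp [wt, Pi.single_eq_of_ne (show i ≠ m from hi)]

lemma conv_assoc [CompleteSpace K] {f g h : ℤ → K} (hf : IsRobba f) (hg : IsRobba g)
    (hh : IsRobba h) : conv (conv f g) h = conv f (conv g h) := by
  obtain ⟨r, hr, H⟩ := exists_common hf hg
  obtain ⟨r', hr', H'⟩ := (isRobba_iff h).mp hh
  set s := min r r' / 2 with hs
  have hm : 0 < min r r' := lt_min hr hr'
  have hs0 : 0 < s := by linarith
  have hsr : s < r := by have := min_le_left r r'; linarith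
  have hsr' : s < r' := by have := min_le_right r r'; linarith
  obtain ⟨Sf, Sg⟩ := H s hs0 hsr
  have Sh := H' s hs0 hsr'
  funext n
  have key : Summable (fun x : ℤ × ℤ => f x.2 * g (x.1 - x.2) * h (n - x.1)) := by
    apply Summable.of_norm
    obtain ⟨C, hC⟩ := bdd_of_tendsto Sh.tendsto_cofinite_zero
    refine Summable.of_nonneg_of_le (fun _ => norm_nonneg _) (fun x => ?_)
      ((summable_shear Sf Sg).mul_right (C * Real.exp (s * n)))
    have e : ‖f x.2 * g (x.1 - x.2) * h (n - x.1)‖ =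
        wt s f x.2 * wt s g (x.1 - x.2) * (wt s h (n - x.1) * Real.exp (s * n)) := by
      rw [norm_mul, wt_term s f g x.1 x.2]
      have e3 : ‖h (n - x.1)‖ * Real.exp (s * x.1) = wt s h (n - x.1) * Real.exp (s * n) := by
        unfold wt
        rw [mul_assoc, ← Real.exp_add]; congr 2; push_cast; ring
      rw [← e3]; ring
    rw [e]
    exact mul_le_mul_of_nonneg_left
      (mul_le_mul_of_nonneg_right (hC _) (Real.exp_nonneg _))
      (mul_nonneg (wt_nonneg _ _ _) (wt_nonneg _ _ _))
  have lhs : conv (conv f g) h n = ∑' j, ∑' i, f i * g (j - i) * h (n - j) := by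
    unfold conv
    exact tsum_congr fun j => tsum_mul_right.symm
  have rhs : conv f (conv g h) n = ∑' i, ∑' j, f i * g (j - i) * h (n - j) := by
    unfold conv
    refine tsum_congr fun i => ?_
    rw [← tsum_mul_left, ← (Equiv.subRight i).tsum_eq]
    refine tsum_congr fun j => ?_
    simp only [Equiv.subRight_apply]
    rw [show n - i - (j - i) = n - j by ring, mul_assoc]
  rw [lhs, rhs]
  exact Summable.tsum_comm (f := fun i j => f i * g (j - i) * h (n - j))
    ((Equiv.prodComm ℤ ℤ).summable_iff.mp key)

lemma IsRobba.add {f g : ℤ → K} (hf : IsRobba f) (hg : IsRobba g) : IsRobba (f + g) := by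
  obtain ⟨r, hr, h⟩ := exists_common hf hg
  refine (isRobba_iff _).mpr ⟨r, hr, fun s hs hsr => ?_⟩
  refine Summable.of_nonneg_of_le (wt_nonneg s _) (fun i => ?_)
    ((h s hs hsr).1.add (h s hs hsr).2)
  unfold wt
  rw [← add_mul]
  exact mul_le_mul_of_nonneg_right (norm_add_le _ _) (Real.exp_nonneg _)

end

/-- The Robba ring `R` over `K`, as a group of bidirectional series. -/
def Robba (K : Type u) [NormedField K] : AddSubgroup (ℤ → K) where
  carrier := {f | IsRobba f}
  add_mem' := IsRobba.add
  zero_mem' := ⟨1, one_pos, fun s _ _ => by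
    have : wt s (0 : ℤ → K) = fun _ => 0 := by funext i; simp [wt]
    rw [this]; exact tendsto_const_nhds⟩
  neg_mem' := fun {f} ⟨r, hr, h⟩ => ⟨r, hr, fun s h1 h2 => by
    have : wt s (-f) = wt s f := by funext i; simp [wt]
    rw [this]; exact h s h1 h2⟩

instance {K : Type u} [NormedField K] : Mul (Robba K) := ⟨fun f g => ⟨conv f.1 g.1, f.2.conv g.2⟩⟩

instance {K : Type u} [NormedField K] : One (Robba K) := ⟨⟨Pi.single 0 1, isRobba_single 0 1⟩⟩

/-- The Robba ring is a commutative ring under multiplication of series. -/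
instance {K : Type u} [NormedField K] [CompleteSpace K] : CommRing (Robba K) where
  __ := (inferInstance : AddCommGroup (Robba K))
  mul := (· * ·)
  one := 1
  mul_assoc f g h := Subtype.ext (conv_assoc f.2 g.2 h.2)
  mul_comm f g := Subtype.ext (conv_comm f.1 g.1)
  one_mul f := Subtype.ext (by funext n; exact (conv_single 1 0 f.1 n).trans (by simp))
  mul_one f := Subtype.ext ((conv_comm _ _).trans
    (by funext n; exact (conv_single 1 0 f.1 n).trans (by simp)))
  left_distrib f g h := Subtype.ext (conv_add f.2 g.2 h.2)
  right_distrib f g h := Subtype.ext (by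
    change conv (f.1 + g.1) h.1 = conv f.1 h.1 + conv g.1 h.1
    rw [conv_comm, conv_add h.2 f.2 g.2, conv_comm h.1, conv_comm h.1])
  zero_mul f := Subtype.ext (by
    funext n; change conv 0 f.1 n = 0; simp [conv])
  mul_zero f := Subtype.ext (by
    funext n; change conv f.1 0 n = 0; simp [conv])

namespace Robba

variable {K : Type u} [NormedField K] [CompleteSpace K]

/-- The constant series. -/
def C : K →+* Robba K where
  toFun c := ⟨Pi.single 0 c, isRobba_single 0 c⟩
  map_one' := rfl
  map_zero' := Subtype.ext (by simp)
  map_add' a b := Subtype.ext (by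
    change (Pi.single 0 (a + b) : ℤ → K) = Pi.single 0 a + Pi.single 0 b
    exact Pi.single_add (f := fun _ : ℤ => K) 0 a b)
  map_mul' a b := Subtype.ext (by
    funext n
    change _ = conv (Pi.single 0 a) (Pi.single 0 b) n
    rw [conv_single]
    by_cases h : n = 0
    · subst h; simp
    · simp [Pi.single_eq_of_ne h])

/-- A nonzero integer is invertible in the Robba ring. -/
lemma isUnit_natCast [CharZero K] {p : ℕ} (hp : p ≠ 0) : IsUnit (p : Robba K) := by
  have h : IsUnit (p : K) := (Nat.cast_ne_zero.mpr hp).isUnit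
  simpa using h.map (C (K := K))

/-- The derivation `d/du` of the Robba ring; `Ω¹` of the Robba ring is free on `du`, and it is
identified with the Robba ring itself through the basis `du`, so that `d f = (df/du) du`. -/
def deriv [IsUltrametricDist K] : Robba K →+ Robba K where
  toFun f := ⟨fun i => ((i + 1 : ℤ) : K) * f.1 (i + 1), by
    obtain ⟨r, hr, h⟩ := f.2
    refine ⟨r, hr, fun s h1 h2 => ?_⟩
    have h3 : Tendsto (fun i => Real.exp s * wt s f.1 (i + 1)) cofinite (𝓝 0) := by
      have := ((h s h1 h2).comp (add_left_injective (1 : ℤ)).tendsto_cofinite).const_mul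
        (Real.exp s)
      simpa using this
    refine squeeze_zero (wt_nonneg s _) (fun i => ?_) h3
    have h4 : Real.exp s * wt s f.1 (i + 1) = ‖f.1 (i + 1)‖ * Real.exp (-(s * i)) := by
      unfold wt
      rw [mul_left_comm, ← Real.exp_add]; congr 2; push_cast; ring
    rw [h4]
    unfold wt
    rw [norm_mul]
    refine mul_le_mul_of_nonneg_right ?_ (Real.exp_nonneg _)
    exact mul_le_of_le_one_left (norm_nonneg _) (IsUltrametricDist.norm_intCast_le_one K _)⟩
  map_zero' := Subtype.ext (by funext i; simp)
  map_add' f g := Subtype.ext (by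
    funext i
    change _ * (f.1 (i + 1) + g.1 (i + 1)) = _
    rw [mul_add]; rfl)

end Robba

/-! ## Monsky-Washnitzer algebras and dagger algebras -/

section

variable (K : Type u) [NormedField K] [IsUltrametricDist K]

/-- The valuation ring `O = {x ∈ K : |x| ≤ 1}` of a non-archimedean normed field `K`. -/
abbrev OK : Type u := (NormedField.valuation (K := K)).valuationSubring

/-- The Monsky-Washnitzer algebra `W_n`: power series `∑ c_I x^I` over `O` with
`liminf_I v(c_I) / |I| > 0`, i.e. with `|c_I| ρ^{|I|}` bounded for some real `ρ > 1`. -/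
def MW (n : ℕ) : Subalgebra (OK K) (MvPowerSeries (Fin n) (OK K)) where
  carrier := {f | ∃ ρ : ℝ, 1 < ρ ∧ ∃ B : ℝ, ∀ I : Fin n →₀ ℕ,
    ‖((MvPowerSeries.coeff I f : OK K) : K)‖ * ρ ^ I.degree ≤ B}
  mul_mem' := by
    rintro f g ⟨ρ, hρ, B, hf⟩ ⟨ρ', hρ', B', hg⟩
    refine ⟨min ρ ρ', lt_min hρ hρ', B * B', fun I => ?_⟩
    set t := min ρ ρ' with ht
    have ht1 : 1 < t := lt_min hρ hρ'
    have ht0 : 0 < t := by linarith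
    have hf' : ∀ I, ‖((MvPowerSeries.coeff I f : OK K) : K)‖ * t ^ I.degree ≤ B := fun I =>
      (mul_le_mul_of_nonneg_left (pow_le_pow_left₀ ht0.le (min_le_left _ _) _)
        (norm_nonneg _)).trans (hf I)
    have hg' : ∀ I, ‖((MvPowerSeries.coeff I g : OK K) : K)‖ * t ^ I.degree ≤ B' := fun I =>
      (mul_le_mul_of_nonneg_left (pow_le_pow_left₀ ht0.le (min_le_right _ _) _)
        (norm_nonneg _)).trans (hg I)
    have hB : 0 ≤ B := (by positivity : (0 : ℝ) ≤ _).trans (hf' 0)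
    have hB' : 0 ≤ B' := (by positivity : (0 : ℝ) ≤ _).trans (hg' 0)
    rw [← le_div_iff₀ (by positivity)]
    classical
    rw [MvPowerSeries.coeff_mul]
    push_cast
    refine IsUltrametricDist.norm_sum_le_of_forall_le_of_nonneg (by positivity) fun x hx => ?_
    rw [le_div_iff₀ (by positivity), norm_mul]
    have hd : I.degree = x.1.degree + x.2.degree := by
      rw [← Finset.HasAntidiagonal.mem_antidiagonal.mp hx, map_add]
    rw [hd, pow_add]
    calc _ = (‖((MvPowerSeries.coeff x.1 f : OK K) : K)‖ * t ^ x.1.degree) *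
        (‖((MvPowerSeries.coeff x.2 g : OK K) : K)‖ * t ^ x.2.degree) := by ring
      _ ≤ B * B' := mul_le_mul (hf' _) (hg' _) (by positivity) hB
  add_mem' := by
    rintro f g ⟨ρ, hρ, B, hf⟩ ⟨ρ', hρ', B', hg⟩
    refine ⟨min ρ ρ', lt_min hρ hρ', B + B', fun I => ?_⟩
    have ht0 : 0 < min ρ ρ' := by have := lt_min hρ hρ'; linarith
    have h1 := (mul_le_mul_of_nonneg_left (pow_le_pow_left₀ ht0.le (min_le_left ρ ρ') I.degree)
        (norm_nonneg ((MvPowerSeries.coeff I f : OK K) : K))).trans (hf I)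
    have h2 := (mul_le_mul_of_nonneg_left (pow_le_pow_left₀ ht0.le (min_le_right ρ ρ') I.degree)
        (norm_nonneg ((MvPowerSeries.coeff I g : OK K) : K))).trans (hg I)
    rw [map_add]
    push_cast
    have h3 := mul_le_mul_of_nonneg_right (norm_add_le
      ((MvPowerSeries.coeff I f : OK K) : K) ((MvPowerSeries.coeff I g : OK K) : K)) (pow_nonneg ht0.le I.degree)
    linarith
  algebraMap_mem' c := by
    refine ⟨2, one_lt_two, ‖(c : K)‖, fun I => ?_⟩
    classical
    rw [MvPowerSeries.algebraMap_apply, MvPowerSeries.coeff_C]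
    split_ifs with h
    · subst h; simp
    · simp

variable {K}

/-- The variable `x_i` of `W_n`. -/
def MW.X {n : ℕ} (i : Fin n) : MW K n := ⟨MvPowerSeries.X i, by
  refine ⟨2, one_lt_two, 2, fun I => ?_⟩
  classical
  rw [MvPowerSeries.coeff_X]
  split_ifs with h
  · subst h; simp
  · simp⟩

/-- The partial derivative `∂/∂x_i` on `W_n`. -/
def MW.pderiv {n : ℕ} (i : Fin n) : MW K n →ₗ[OK K] MW K n :=
  LinearMap.restrict (MvPowerSeries.pderiv (OK K) i : _ →ₗ[OK K] _)
    (p := Subalgebra.toSubmodule (MW K n)) (q := Subalgebra.toSubmodule (MW K n)) (by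
      rintro f ⟨ρ, hρ, B, hf⟩
      refine ⟨ρ, hρ, B, fun I => ?_⟩
      have hρ0 : 0 < ρ := by linarith
      refine le_trans ?_ (hf (I + Finsupp.single i 1))
      have h1 : ‖((MvPowerSeries.coeff I (MvPowerSeries.pderiv (OK K) i f) : OK K) : K)‖ ≤
          ‖((MvPowerSeries.coeff (I + Finsupp.single i 1) f : OK K) : K)‖ := by
        rw [MvPowerSeries.coeff_pderiv]
        push_cast
        rw [norm_mul]
        refine mul_le_of_le_one_right (norm_nonneg _) ?_
        have := IsUltrametricDist.norm_natCast_le_one K (I i + 1)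
        simpa using this
      refine mul_le_mul h1 ?_ (by positivity) (norm_nonneg _)
      rw [map_add]
      exact pow_le_pow_right₀ hρ.le (Nat.le_add_right _ _))

/-- The inclusion `W_n → W_{n+1}`, `x_i ↦ x_i` for `i ≤ n`. -/
def MW.incl (n : ℕ) : MW K n →ₐ[OK K] MW K (n + 1) :=
  ((MvPowerSeries.rename (R := OK K) (Fin.castSuccEmb (n := n))).comp (MW K n).val).codRestrict
    (MW K (n + 1)) (by
      rintro ⟨f, ρ, hρ, B, hf⟩
      refine ⟨ρ, hρ, B, fun I => ?_⟩
      have hB : 0 ≤ B := (by positivity : (0 : ℝ) ≤ _).trans (hf 0)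
      change ‖((MvPowerSeries.coeff I (MvPowerSeries.rename (Fin.castSuccEmb (n := n)) f) :
        OK K) : K)‖ * _ ≤ B
      by_cases hI : I ∈ Set.range (Finsupp.mapDomain (M := ℕ) (Fin.castSuccEmb (n := n)))
      · obtain ⟨J, rfl⟩ := hI
        rw [← Finsupp.embDomain_eq_mapDomain, MvPowerSeries.coeff_embDomain_rename,
          Finsupp.embDomain_eq_mapDomain, Finsupp.degree_mapDomain]
        exact hf J
      · rw [MvPowerSeries.coeff_rename_eq_zero _ _ hI]
        simpa using hB)

end

/-- A presentation of an algebra as a quotient `W_n / I` of a Monsky-Washnitzer algebra. -/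
structure DaggerPres (K : Type u) [NormedField K] [IsUltrametricDist K] where
  /-- The number of variables. -/
  n : ℕ
  /-- The ideal of relations. -/
  I : Ideal (MW K n)

namespace DaggerPres

variable {K : Type u} [NormedField K] [IsUltrametricDist K] (X Y : DaggerPres K)

/-- The integral algebra `A^int = W_n / I`. -/
def int : Type u := MW K X.n ⧸ X.I

instance : CommRing X.int := inferInstanceAs (CommRing (MW K X.n ⧸ X.I))

instance : Algebra (OK K) X.int := inferInstanceAs (Algebra (OK K) (MW K X.n ⧸ X.I))

/-- The quotient map `W_n → A^int`. -/
def proj : MW K X.n →ₐ[OK K] X.int := Ideal.Quotient.mkₐ (OK K) X.I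

/-- The special fibre `k ⊗_O A^int`, where `k` is the residue field of `O`. -/
abbrev special : Type u := IsLocalRing.ResidueField (OK K) ⊗[OK K] X.int

/-- The image in the special fibre of an element of `W_n`. -/
def red (f : MW K X.n) : X.special := 1 ⊗ₜ X.proj f

/-- `A^int = W_n / I` is an integral dagger algebra: it is flat over `O` with smooth special
fibre. -/
structure IsDagger : Prop where
  flat : Module.Flat (OK K) X.int
  smooth : Algebra.Smooth (IsLocalRing.ResidueField (OK K)) X.special

/-- The dagger algebra `A = A^int ⊗_O K = A^int[1/p]`. -/
def gen (p : ℕ) : Type u := Localization.Away (p : X.int)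

instance (p : ℕ) : CommRing (X.gen p) := inferInstanceAs (CommRing (Localization.Away (p : X.int)))

instance (p : ℕ) : Algebra X.int (X.gen p) :=
  inferInstanceAs (Algebra X.int (Localization.Away (p : X.int)))

instance (p : ℕ) : Algebra (OK K) (X.gen p) :=
  inferInstanceAs (Algebra (OK K) (Localization.Away (p : X.int)))

instance (p : ℕ) : IsScalarTower (OK K) X.int (X.gen p) :=
  inferInstanceAs (IsScalarTower (OK K) X.int (Localization.Away (p : X.int)))

instance (p : ℕ) : IsLocalization.Away (p : X.int) (X.gen p) :=
  inferInstanceAs (IsLocalization.Away (p : X.int) (Localization.Away (p : X.int)))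

/-- The image in `A` of an element of `W_n`. -/
def el (p : ℕ) (f : MW K X.n) : X.gen p := algebraMap X.int (X.gen p) (X.proj f)

variable {X Y} in
/-- The map `A → B` induced by a ring homomorphism `A^int → B^int`. -/
def genMap (p : ℕ) (φ : X.int →+* Y.int) : X.gen p →+* Y.gen p :=
  IsLocalization.map (M := Submonoid.powers (p : X.int)) (T := Submonoid.powers (p : Y.int)) _ φ
    (by
      rintro _ ⟨m, rfl⟩
      exact ⟨m, by simp⟩)

/-- The localization of `A` at `f`: with `A^int = W_n / I` and `f` represented by an element of
`W_n`, it is given by `W_{n+1} / (I W_{n+1} + (f x_{n+1} - 1) W_{n+1})`. -/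
def loc (f : MW K X.n) : DaggerPres K where
  n := X.n + 1
  I := X.I.map (MW.incl X.n) ⊔ Ideal.span {MW.incl X.n f * MW.X (Fin.last X.n) - 1}

/-- The canonical map from `A^int` to the localization at `f`. -/
def toLoc (f : MW K X.n) : X.int →ₐ[OK K] (X.loc f).int :=
  Ideal.quotientMapₐ (X.loc f).I (MW.incl X.n)
    (Ideal.map_le_iff_le_comap.mp le_sup_left)

/-! ### Differentials -/

/-- The submodule generated by the relations `∑ (∂f/∂x_i) dx_i = 0` for `f ∈ I`. -/
def omegaRel (p : ℕ) : Submodule (X.gen p) (Fin X.n → X.gen p) :=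
  Submodule.span (X.gen p) {w | ∃ f ∈ X.I, w = fun i => X.el p (MW.pderiv i f)}

/-- The module `Ω¹_{A/K}`: the free `A`-module on symbols `dx_1, …, dx_n` modulo the relations
`df = ∑ (∂f/∂x_i) dx_i = 0` for `f ∈ I`. -/
def Omega (p : ℕ) : Type u := (Fin X.n → X.gen p) ⧸ X.omegaRel p

instance (p : ℕ) : AddCommGroup (X.Omega p) :=
  inferInstanceAs (AddCommGroup ((Fin X.n → X.gen p) ⧸ X.omegaRel p))

instance (p : ℕ) : Module (X.gen p) (X.Omega p) :=
  inferInstanceAs (Module (X.gen p) ((Fin X.n → X.gen p) ⧸ X.omegaRel p))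

instance (p : ℕ) : Module (OK K) (X.Omega p) :=
  Module.compHom _ (algebraMap (OK K) (X.gen p))

instance (p : ℕ) : IsScalarTower (OK K) (X.gen p) (X.Omega p) :=
  IsScalarTower.of_algebraMap_smul fun _ _ => rfl

/-- The class in `Ω¹_{A/K}` of a combination `∑ w_i dx_i`. -/
def omegaMk (p : ℕ) : (Fin X.n → X.gen p) →ₗ[X.gen p] X.Omega p := (X.omegaRel p).mkQ

/-- The differential on `W_n`, with values in `Ω¹_{A/K}`: `df = ∑ (∂f/∂x_i) dx_i`. -/
def dMW (p : ℕ) : MW K X.n →ₗ[OK K] X.Omega p where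
  toFun f := X.omegaMk p fun i => X.el p (MW.pderiv i f)
  map_add' f g := by
    rw [← map_add]; congr 1; funext i; simp [el]
  map_smul' c f := by
    rw [RingHom.id_apply, ← algebraMap_smul (X.gen p) c (X.omegaMk p _), ← map_smul]
    congr 1; funext i
    simp only [el, map_smul, Pi.smul_apply, smul_eq_mul]
    rw [Algebra.smul_def, map_mul, ← IsScalarTower.algebraMap_apply]

/-- The differential on `A^int`, with values in `Ω¹_{A/K}`. -/
def dInt (p : ℕ) : X.int →ₗ[OK K] X.Omega p :=
  (X.I.restrictScalars (OK K)).liftQ (X.dMW p) (fun f hf => by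
    rw [LinearMap.mem_ker]
    exact (Submodule.Quotient.mk_eq_zero _).mpr (Submodule.subset_span ⟨f, hf, rfl⟩))

instance (p : ℕ) : IsLocalizedModule (Submonoid.powers (p : OK K))
    (IsScalarTower.toAlgHom (OK K) X.int (X.gen p)).toLinearMap := by
  have : IsLocalization (Algebra.algebraMapSubmonoid X.int (Submonoid.powers (p : OK K)))
      (X.gen p) := by
    have e : Algebra.algebraMapSubmonoid X.int (Submonoid.powers (p : OK K)) =
        Submonoid.powers (p : X.int) := by
      rw [Algebra.algebraMapSubmonoid, Submonoid.map_powers, map_natCast]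
    rw [e]
    exact (inferInstance : IsLocalization.Away (p : X.int) (X.gen p))
  exact isLocalizedModule_iff_isLocalization.mpr this

lemma isUnit_p (p : ℕ) : IsUnit (p : X.gen p) := by
  have := IsLocalization.Away.algebraMap_isUnit (S := X.gen p) (p : X.int)
  simpa using this

lemma isUnit_end_powers (p : ℕ) (x : Submonoid.powers (p : OK K)) :
    IsUnit (algebraMap (OK K) (Module.End (OK K) (X.Omega p)) x) := by
  obtain ⟨_, m, rfl⟩ := x
  obtain ⟨v, hv⟩ := (X.isUnit_p p).pow m
  rw [Module.End.isUnit_iff]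
  have : ∀ x : X.Omega p,
      (algebraMap (OK K) (Module.End (OK K) (X.Omega p)) ((p : OK K) ^ m)) x = v • x := by
    intro x
    rw [Module.algebraMap_end_apply, ← algebraMap_smul (X.gen p), map_pow, map_natCast, ← hv]
    rfl
  constructor
  · intro x y hxy
    simp only [this] at hxy
    exact smul_left_cancel v hxy
  · intro x
    exact ⟨v⁻¹ • x, by rw [this, smul_inv_smul]⟩

/-- The `K`-linear derivation `d : A → Ω¹_{A/K}`, the unique extension to `A = A^int[1/p]` of the
differential on `A^int`. -/
def d (p : ℕ) : X.gen p →ₗ[OK K] X.Omega p :=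
  IsLocalizedModule.lift (Submonoid.powers (p : OK K))
    (IsScalarTower.toAlgHom (OK K) X.int (X.gen p)).toLinearMap (X.dInt p) (X.isUnit_end_powers p)

/-- The relation `u (dlog u) = du`. -/
def logRel (p : ℕ) (u : X.gen p) : Submodule (X.gen p) (X.Omega p × X.gen p) :=
  Submodule.span (X.gen p) {(X.d p u, -u)}

/-- The logarithmic differentials `Ω¹_{A/K}[dlog u]`: one adds to `Ω¹_{A/K}` a generator `dlog u`
subject to `u (dlog u) = du`. For `u = 1` this is `Ω¹_{A/K}`. -/
def LogOmega (p : ℕ) (u : X.gen p) : Type u := (X.Omega p × X.gen p) ⧸ X.logRel p u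

instance (p : ℕ) (u : X.gen p) : AddCommGroup (X.LogOmega p u) :=
  inferInstanceAs (AddCommGroup ((X.Omega p × X.gen p) ⧸ X.logRel p u))

instance (p : ℕ) (u : X.gen p) : Module (X.gen p) (X.LogOmega p u) :=
  inferInstanceAs (Module (X.gen p) ((X.Omega p × X.gen p) ⧸ X.logRel p u))

/-- The class in `Ω¹_{A/K}[dlog u]` of `ω + a dlog u`. -/
def logMk (p : ℕ) (u : X.gen p) : (X.Omega p × X.gen p) →ₗ[X.gen p] X.LogOmega p u :=
  (X.logRel p u).mkQ

/-- The element `dlog u`. -/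
def dlog (p : ℕ) (u : X.gen p) : X.LogOmega p u := X.logMk p u (0, 1)

/-- The derivation `d : A → Ω¹_{A/K}[dlog u]`. -/
def logD (p : ℕ) (u : X.gen p) : X.gen p →+ X.LogOmega p u :=
  ((X.logMk p u).toAddMonoidHom.comp (AddMonoidHom.inl (X.Omega p) (X.gen p))).comp
    (X.d p).toAddMonoidHom

end DaggerPres

/-! ## Modules with connection and Frobenius -/

section

/-- A connection on an `A`-module `M` with values in `M ⊗ Ω`, with respect to `d : A → Ω`. -/
structure Connection {A : Type*} [CommRing A] {Ω : Type*} [AddCommGroup Ω] [Module A Ω]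
    (d : A →+ Ω) (M : Type*) [AddCommGroup M] [Module A M] where
  /-- The underlying additive map. -/
  nabla : M →+ M ⊗[A] Ω
  leibniz : ∀ (a : A) (m : M), nabla (a • m) = a • nabla m + m ⊗ₜ[A] d a

/-- The map `j : M → P`, semilinear along `φ : A → B`, is a base change: the induced map
`M ⊗_{A, φ} B → P` is bijective. -/
def IsBaseChangeAlong {A B : Type*} [CommRing A] [CommRing B] (φ : A →+* B)
    {M P : Type*} [AddCommGroup M] [Module A M] [AddCommGroup P] [Module B P]
    (j : M →ₛₗ[φ] P) : Prop :=
  letI : Algebra A B := φ.toAlgebra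
  letI : Module A P := Module.compHom P φ
  haveI : IsScalarTower A B P := IsScalarTower.of_algebraMap_smul fun _ _ => rfl
  IsBaseChange B (show M →ₗ[A] P from
    { toFun := j, map_add' := map_add j, map_smul' := fun a m => j.map_smulₛₗ a m })

/-- The exterior product `Ω × Ω → ⋀² Ω`. -/
def wedge (A : Type*) [CommRing A] (Ω : Type*) [AddCommGroup Ω] [Module A Ω] :
    Ω →ₗ[A] Ω →ₗ[A] ⋀[A]^2 Ω :=
  LinearMap.mk₂ A (fun x y => exteriorPower.ιMulti A 2 ![x, y])
    (fun x x' y => by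
      have e : ∀ z, Function.update ![0, y] 0 z = ![z, y] := fun z => by
        funext i; fin_cases i <;> rfl
      simpa only [e] using (exteriorPower.ιMulti A 2 (M := Ω)).map_update_add ![0, y] 0 x x')
    (fun c x y => by
      have e : ∀ z, Function.update ![0, y] 0 z = ![z, y] := fun z => by
        funext i; fin_cases i <;> rfl
      simpa only [e] using (exteriorPower.ιMulti A 2 (M := Ω)).map_update_smul ![0, y] 0 c x)
    (fun x y y' => by
      have e : ∀ z, Function.update ![x, 0] 1 z = ![x, z] := fun z => by
        funext i; fin_cases i <;> rfl
      simpa only [e] using (exteriorPower.ιMulti A 2 (M := Ω)).map_update_add ![x, 0] 1 y y')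
    (fun c x y => by
      have e : ∀ z, Function.update ![x, 0] 1 z = ![x, z] := fun z => by
        funext i; fin_cases i <;> rfl
      simpa only [e] using (exteriorPower.ιMulti A 2 (M := Ω)).map_update_smul ![x, 0] 1 c y)

end

namespace DaggerPres

variable {K : Type u} [NormedField K] [IsUltrametricDist K]

/-- Integrability `∇₁ ∘ ∇ = 0` of a connection with values in `M ⊗ Ω¹_{A/K}[dlog u]`. Here `d₁` is
the exterior derivative on one-forms, determined by `d₁(a ω) = da ∧ ω + a d₁ω`, `d₁(da) = 0` and
`d₁(dlog u) = 0`, and `∇₁(m ⊗ ω) = ∇m ∧ ω + m ⊗ d₁ω`. -/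
def IsIntegrable (X : DaggerPres K) (p : ℕ) (u : X.gen p) {M : Type v} [AddCommGroup M]
    [Module (X.gen p) M] (D : Connection (X.logD p u) M) : Prop :=
  ∃ (d₁ : X.LogOmega p u →+ ⋀[X.gen p]^2 (X.LogOmega p u))
    (nabla₁ : M ⊗[X.gen p] X.LogOmega p u →+ M ⊗[X.gen p] ⋀[X.gen p]^2 (X.LogOmega p u)),
    (∀ a ω, d₁ (a • ω) = wedge (X.gen p) (X.LogOmega p u) (X.logD p u a) ω + a • d₁ ω) ∧
    (∀ a, d₁ (X.logD p u a) = 0) ∧ d₁ (X.dlog p u) = 0 ∧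
    (∀ m ω, nabla₁ (m ⊗ₜ ω) =
      LinearMap.lTensor M ((wedge (X.gen p) (X.LogOmega p u)).flip ω) (D.nabla m) +
        m ⊗ₜ d₁ ω) ∧
    ∀ m, nabla₁ (D.nabla m) = 0

/-- `σ : A^int → A^int` is a lift of the `p`-power Frobenius map of the special fibre which extends
the given endomorphism `σK` of `O`. -/
structure IsFrobeniusLift (X : DaggerPres K) (p : ℕ) (σK : OK K →+* OK K)
    (σ : X.int →+* X.int) : Prop where
  extends_base : ∀ c, σ (algebraMap (OK K) X.int c) = algebraMap (OK K) X.int (σK c)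
  lifts_frobenius : ∀ x, σ x - x ^ p ∈
    (IsLocalRing.maximalIdeal (OK K)).map (algebraMap (OK K) X.int)

/-- The endomorphism of `A` given by the `a`-th power of an endomorphism of `A^int`. -/
def frob (X : DaggerPres K) (p a : ℕ) (σ : X.int →+* X.int) : X.gen p →+* X.gen p :=
  genMap p (σ ^ a)

end DaggerPres

/-- A log-`(σ, ∇)`-module over the dagger algebra `A = X.gen p` with respect to `u`. Here `σ` is the
given endomorphism of `A`, and `h` is the unit of `A` with `σ(u) = h u^q`. For `u = 1` and `h = 1`
this is a `(σ, ∇)`-module. -/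
structure LogSigmaNabla {K : Type u} [NormedField K] [IsUltrametricDist K] (X : DaggerPres K)
    (p q : ℕ) (σ : X.gen p →+* X.gen p) (u : X.gen p) (h : (X.gen p)ˣ) where
  /-- The underlying module. -/
  M : Type v
  [addCommGroup : AddCommGroup M]
  [module : Module (X.gen p) M]
  [finite : Module.Finite (X.gen p) M]
  [projective : Module.Projective (X.gen p) M]
  /-- The Frobenius structure, a `σ`-linear map. -/
  F : M →ₛₗ[σ] M
  /-- The map `M ⊗_{A,σ} A → M` induced by `F` is an isomorphism. -/
  isBaseChange_F : IsBaseChangeAlong σ F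
  /-- The connection. -/
  D : Connection (X.logD p u) M
  integrable : X.IsIntegrable p u D
  /-- `∇ ∘ F = (F ⊗ dσ) ∘ ∇`, where `dσ` is the `σ`-linear map with `dσ(da) = d(σ(a))` and
  `dσ(dlog u) = q dlog u + h⁻¹ dh`. -/
  horizontal : ∃ dσ : X.LogOmega p u →ₛₗ[σ] X.LogOmega p u,
    (∀ a, dσ (X.logD p u a) = X.logD p u (σ a)) ∧
    dσ (X.dlog p u) = (q : X.gen p) • X.dlog p u + (h⁻¹).1 • X.logD p u h.1 ∧
    ∀ m, D.nabla (F m) = TensorProduct.map F dσ (D.nabla m)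

attribute [instance] LogSigmaNabla.addCommGroup LogSigmaNabla.module LogSigmaNabla.finite
  LogSigmaNabla.projective

/-- `P` is the base change of the log-`(σ, ∇)`-module `M` along the map `φ` of dagger algebras: there
is a base change map `j : M → P` compatible with the Frobenius structures and the connections
(the latter with respect to the map `τ` of differentials induced by `φ`). -/
def IsPullback {K : Type u} [NormedField K] [IsUltrametricDist K] {X Y : DaggerPres K} {p q : ℕ}
    (φ : X.gen p →+* Y.gen p) {σX : X.gen p →+* X.gen p} {σY : Y.gen p →+* Y.gen p}
    {uX : X.gen p} {uY : Y.gen p} {hX : (X.gen p)ˣ} {hY : (Y.gen p)ˣ}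
    (M : LogSigmaNabla.{u, v} X p q σX uX hX) (P : LogSigmaNabla.{u, u} Y p q σY uY hY) : Prop :=
  ∃ (τ : X.LogOmega p uX →ₛₗ[φ] Y.LogOmega p uY) (j : M.M →ₛₗ[φ] P.M),
    (∀ a, τ (X.logD p uX a) = Y.logD p uY (φ a)) ∧
    IsBaseChangeAlong φ j ∧
    (∀ m, j (M.F m) = P.F (j m)) ∧
    ∀ m, P.D.nabla (j m) = TensorProduct.map j τ (M.D.nabla m)

section

variable {K : Type u} [NormedField K] [IsUltrametricDist K] [CompleteSpace K] [CharZero K]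

/-- The extension to `A = A^int[1/p]` of a ring homomorphism from `A^int` to the Robba ring. -/
def Robba.extend (X : DaggerPres K) (p : ℕ) [Fact p.Prime] (ρ : X.int →+* Robba K) :
    X.gen p →+* Robba K :=
  IsLocalization.Away.lift (p : X.int) (g := ρ) (by
    rw [map_natCast]; exact Robba.isUnit_natCast (Fact.out : p.Prime).ne_zero)

/-- The `(σ, ∇)`-module `M` over `A` becomes unipotent over the Robba ring `R` via `ρ : A → R`:
its base change `P` along `ρ`, with the induced connection, has a basis `v_1, …, v_n` with
`∇ v_i ∈ Span(v_1, …, v_{i-1}) ⊗ Ω¹`. -/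
def IsUnipotentAlong {X : DaggerPres K} {p q : ℕ} {σ : X.gen p →+* X.gen p}
    (M : LogSigmaNabla.{u, v} X p q σ 1 1) (ρ : X.gen p →+* Robba K) : Prop :=
  ∃ (P : Type u) (_ : AddCommGroup P) (_ : Module (Robba K) P)
    (D : Connection (Robba.deriv (K := K)) P)
    (τ : X.LogOmega p 1 →ₛₗ[ρ] Robba K) (j : M.M →ₛₗ[ρ] P),
    (∀ a, τ (X.logD p 1 a) = Robba.deriv (ρ a)) ∧
    IsBaseChangeAlong ρ j ∧
    (∀ m, D.nabla (j m) = TensorProduct.map j τ (M.D.nabla m)) ∧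
    ∃ (n : ℕ) (b : Module.Basis (Fin n) (Robba K) P), ∀ i,
      D.nabla (b i) ∈ Submodule.span (Robba K) {x | ∃ l < i, ∃ ω : Robba K, x = b l ⊗ₜ ω}

end

end Dagger

end

open Dagger

noncomputable section

namespace Dagger

set_option linter.unusedSectionVars false

/-! ## Smooth connected algebras over a field -/

/-! Around the point `u = 0` functions are replaced by their expansions in `T`, and the theorem
comes down to factoring one matrix over the Robba ring. In a basis of `M` the connection is a matrix
`A` for the derivation `θ = T d/dT`, and unipotence provides an invertible `U` over the Robba ring
that turns `A` into a strictly upper triangular matrix. The inverses of the integers grow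
subexponentially, so every series with only negative powers is in the image of `θ`. Hence a further
change of basis `G` leads to a strictly upper triangular `N'` without negative powers
(`Robba.exists_gauge`). A Birkhoff factorization `U G = W V` (`Robba.exists_birkhoff`) then
separates a matrix `W` with finitely many positive powers from a matrix `V` without negative powers,
the same being true of their inverses.

The matrix `W` is a change of basis defined over the punctured dagger algebra: up to powers of `p`
and of `T`, its entries are series in `1/u` with geometric decay, and these exist in `W_{n+1}`
(`DaggerPres.exists_of_nonpos`). In the new basis the connection matrix is `(V N' - θ V) V⁻¹`, which
has no negative powers. The Frobenius matrix `Ψ = W⁻¹ Φ W^σ` becomes, after the change of basis by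
`V`, a horizontal map between two strictly triangular systems without negative powers. Its entries
can be determined one after the other, and in characteristic zero a series has no negative powers
once its `θ`-derivative has none (`Robba.mem_plus_of_system`). So `Ψ` and `Ψ⁻¹` have no negative
powers either.

It remains to descend. An element of the punctured algebra whose expansion has no negative powers
comes from the unpunctured one (`DaggerPres.exists_nonneg_part`). This is overconvergent division by
`u`: if every generator has the form `c_i + u y_i`, one division costs a factor as close to `1` as
desired, and the decay of the coefficients of the powers of `1/u` pays for repeated divisions.
Expansions are injective: modulo `π` this is Krull's intersection theorem together with the
connectedness of the smooth special fibre. The passage from `k` to `O` is `MW.le_of_saturated`, a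
form of Nakayama's lemma for ideals of `W_n`, in which a division algorithm that respects degrees
keeps the quotients overconvergent.

The function `g` is the determinant of the matrix `δ_jk - u ∂y_j/∂x_k`. It equals `1` at the point,
so inverting it does not remove the point, and it makes `du` generate the differentials. Logarithmic
differentials are then free on `dlog u`, integrability is automatic, and modules are given by pairs
of matrices. -/

lemma exists_sq_mul_of_isArtinianRing {T : Type*} [CommRing T] [IsArtinianRing T] [IsReduced T]
    (x : T) : ∃ z, x ^ 2 * z = x := by
  obtain ⟨n, y, hy⟩ := IsArtinian.exists_pow_succ_smul_dvd x (1 : T)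
  simp only [smul_eq_mul, mul_one] at hy
  refine ⟨y, ?_⟩
  -- Since `x ^ n` kills `1 - x * y`, the product `x * (1 - x * y)` is nilpotent, and reducedness
  -- makes it zero.
  have h : (x * (1 - x * y)) ^ (n + 1) = 0 := by
    have : x ^ n * (1 - x * y) = 0 := by rw [mul_sub, mul_one, ← mul_assoc, ← pow_succ, hy, sub_self]
    calc _ = x * (1 - x * y) ^ n * (x ^ n * (1 - x * y)) := by rw [mul_pow, pow_succ, pow_succ]; ring
      _ = 0 := by rw [this, mul_zero]
  have h2 := pow_eq_zero_iff (n.succ_ne_zero) |>.mp h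
  linear_combination -h2

/-- Over the fraction field `B` of `R` the algebra becomes finite and reduced, hence von Neumann
regular, and `E = X * z` is an idempotent that fixes `X` and kills `Y`. An idempotent is integral,
and integral closure commutes with smooth base change, so `E` comes from `S ⊗ integralClosure R B`,
which is `S` because `R` is integrally closed. -/
lemma exists_idempotent_of_etale {R S : Type*} [CommRing R] [IsDomain R] [IsIntegrallyClosed R]
    [CommRing S] [Algebra R S] [Algebra.Etale R S] (x y : S) (hxy : x * y = 0) :
    ∃ e : S, e * e = e ∧ e * x = x ∧ e * y = 0 := by
  let B := FractionRing R
  have hinj : Function.Injective (Algebra.TensorProduct.includeLeft : S →ₐ[S] S ⊗[R] B) := by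
    have h1 := Module.Flat.lTensor_preserves_injective_linearMap (M := S)
      (Algebra.linearMap R B) (IsFractionRing.injective R B)
    have h2 : ⇑(Algebra.TensorProduct.includeLeft : S →ₐ[S] S ⊗[R] B) =
        ⇑((Algebra.linearMap R B).lTensor S) ∘ ⇑(TensorProduct.rid R S).symm := by
      ext s; simp
    rw [h2]
    exact h1.comp (TensorProduct.rid R S).symm.injective
  let e₀ : B ⊗[R] S ≃ₐ[R] S ⊗[R] B := Algebra.TensorProduct.comm R B S
  have : Algebra.FormallyUnramified B (B ⊗[R] S) := inferInstance
  have : Module.Finite B (B ⊗[R] S) := Algebra.FormallyUnramified.finite_of_free B (B ⊗[R] S)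
  have : IsReduced (B ⊗[R] S) := Algebra.FormallyUnramified.isReduced_of_field B (B ⊗[R] S)
  have : IsArtinianRing (B ⊗[R] S) := IsArtinianRing.of_finite B (B ⊗[R] S)
  obtain ⟨z, hz⟩ := exists_sq_mul_of_isArtinianRing (e₀.symm (x ⊗ₜ 1))
  set X : S ⊗[R] B := x ⊗ₜ 1
  set Y : S ⊗[R] B := y ⊗ₜ 1
  have hXY : X * Y = 0 := by simp [X, Y, hxy]
  have hz' : X ^ 2 * e₀ z = X := by
    have := congrArg e₀ hz
    simpa only [map_mul, map_pow, AlgEquiv.apply_symm_apply] using this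
  set E := X * e₀ z with hE
  have hEX : E * X = X := by rw [hE]; linear_combination hz'
  have hEE : E * E = E := by
    calc E * E = (E * X) * e₀ z := by rw [hE]; ring
      _ = E := by rw [hEX]
  have hEY : E * Y = 0 := by rw [hE]; linear_combination e₀ z * hXY
  have hint : IsIntegral S E := by
    refine ⟨Polynomial.X ^ 2 - Polynomial.X, ?_, ?_⟩
    · apply Polynomial.monic_X_pow_sub
      exact Polynomial.degree_X_le.trans_lt (by norm_num)
    · simp [pow_two, hEE]
  obtain ⟨w, hw⟩ := (TensorProduct.toIntegralClosure_bijective_of_smooth (R := R) (S := S)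
    (B := B)).2 ⟨E, hint⟩
  have hw2 : ∀ w : S ⊗[R] integralClosure R B, ∃ s : S, w = s ⊗ₜ 1 := by
    intro w
    induction w with
    | zero => exact ⟨0, by simp⟩
    | add a b ha hb =>
      obtain ⟨s, rfl⟩ := ha
      obtain ⟨t, rfl⟩ := hb
      exact ⟨s + t, by rw [add_tmul]⟩
    | tmul s b =>
      obtain ⟨r, hr⟩ := (IsIntegrallyClosed.isIntegral_iff (R := R) (K := B)).mp b.2
      refine ⟨r • s, ?_⟩
      have : b = r • (1 : integralClosure R B) := by
        apply Subtype.ext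
        rw [← hr]
        simp [Algebra.smul_def]
      rw [this, tmul_smul, smul_tmul']
  obtain ⟨s, rfl⟩ := hw2 w
  have hs : s ⊗ₜ[R] (1 : B) = E := by
    have := congrArg Subtype.val hw
    simpa [TensorProduct.toIntegralClosure] using this
  refine ⟨s, hinj ?_, hinj ?_, hinj ?_⟩
  · simpa [← hs] using hEE
  · simpa [← hs, X] using hEX
  · simpa [← hs, Y] using hEY

/-- The local rings of a smooth algebra over a field are domains. -/
lemma exists_notMem_mul_eq_zero_of_smooth {k S : Type*} [Field k] [CommRing S] [Algebra k S]
    [Algebra.Smooth k S] (Q : Ideal S) [Q.IsPrime] (x y : S) (hxy : x * y = 0) :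
    ∃ s ∉ Q, s * x = 0 ∨ s * y = 0 := by
  -- Near `Q` the algebra is étale over a polynomial ring, so the idempotent of the previous lemma
  -- exists there as `s / f ^ m`. One of `s` and `f ^ m - s` lies outside `Q`; the first kills `y`
  -- and the second kills `x`, up to powers of `f`.
  obtain ⟨f, hf, n, _, _, _⟩ :=
    Algebra.IsSmoothAt.exists_isStandardEtale_mvPolynomial (R := k) (p := Q)
  obtain ⟨e, -, he1, he2⟩ := exists_idempotent_of_etale (R := MvPolynomial (Fin n) k)
    (algebraMap S (Localization.Away f) x) (algebraMap S (Localization.Away f) y)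
    (by rw [← map_mul, hxy, map_zero])
  obtain ⟨m, s, hs⟩ := IsLocalization.Away.surj f e
  have key : ∀ t : S, algebraMap S (Localization.Away f) t = 0 → ∃ j, f ^ j * t = 0 := by
    intro t ht
    rw [IsLocalization.map_eq_zero_iff (Submonoid.powers f)] at ht
    obtain ⟨⟨_, j, rfl⟩, hj⟩ := ht
    exact ⟨j, hj⟩
  have hfj : ∀ j, f ^ j ∉ Q := fun j h => hf (Ideal.IsPrime.mem_of_pow_mem ‹_› _ h)
  by_cases hsQ : s ∈ Q
  · obtain ⟨j, hj⟩ := key ((f ^ m - s) * x) (by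
      rw [map_mul, map_sub, map_pow, ← hs]
      linear_combination -(algebraMap S (Localization.Away f) f) ^ m * he1)
    refine ⟨f ^ j * (f ^ m - s), ?_, Or.inl (by rw [mul_assoc]; exact hj)⟩
    intro h
    rcases Ideal.IsPrime.mem_or_mem ‹_› h with h | h
    · exact hfj _ h
    · exact hfj m (by simpa using Q.add_mem h hsQ)
  · obtain ⟨j, hj⟩ := key (s * y) (by
      rw [map_mul, ← hs]
      linear_combination (algebraMap S (Localization.Away f) f) ^ m * he2)
    refine ⟨f ^ j * s, ?_, Or.inr (by rw [mul_assoc]; exact hj)⟩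
    intro h
    rcases Ideal.IsPrime.mem_or_mem ‹_› h with h | h
    · exact hfj _ h
    · exact hsQ h

/-- A connected smooth algebra over a field embeds into its local rings. -/
lemma eq_zero_of_mul_eq_zero_of_smooth {k S : Type*} [Field k] [CommRing S] [Algebra k S]
    [Algebra.Smooth k S] [ConnectedSpace (PrimeSpectrum S)] (p : Ideal S) [hp : p.IsPrime]
    (s x : S) (hs : s ∉ p) (hsx : s * x = 0) : x = 0 := by
  have : IsNoetherianRing S := Algebra.FiniteType.isNoetherianRing k S
  -- `N` is the kernel of the localization map at `p`, and the element `e` constructed below,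
  -- outside `p`, kills all of it. Once `N` and its annihilator are comaximal, they split the ring
  -- by an idempotent in `N`, which must be `0` as the spectrum is connected and `p` survives.
  let N : Ideal S :=
    { carrier := {x | ∃ s ∉ p, s * x = 0}
      zero_mem' := ⟨1, (Ideal.ne_top_iff_one p).mp hp.ne_top, by simp⟩
      add_mem' := by
        rintro a b ⟨s, hs, hsa⟩ ⟨t, ht, htb⟩
        refine ⟨s * t, fun h => (hp.mem_or_mem h).elim hs ht, ?_⟩
        linear_combination t * hsa + s * htb
      smul_mem' := by
        rintro c a ⟨s, hs, hsa⟩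
        exact ⟨s, hs, by simp only [smul_eq_mul]; linear_combination c * hsa⟩ }
  obtain ⟨G, hG⟩ := (IsNoetherian.noetherian N : N.FG)
  have hGN : ∀ y ∈ G, ∃ s ∉ p, s * y = 0 := fun y hy => by
    have : y ∈ N := hG ▸ Ideal.subset_span hy
    exact this
  choose! t ht1 ht2 using hGN
  set e := ∏ y ∈ G, t y with he
  have hep : e ∉ p := by
    rw [he, Ideal.IsPrime.prod_mem_iff]
    rintro ⟨y, hy, h⟩
    exact ht1 y hy h
  have heN : ∀ y ∈ N, e * y = 0 := by
    intro y hy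
    rw [← hG] at hy
    refine Submodule.span_induction (fun z hz => ?_) (by simp) (fun a b _ _ ha hb => ?_)
      (fun c a _ ha => ?_) hy
    · obtain ⟨w, hw⟩ := Finset.dvd_prod_of_mem t hz
      rw [he, hw]
      linear_combination w * ht2 z hz
    · rw [mul_add, ha, hb, add_zero]
    · simp only [smul_eq_mul]
      linear_combination c * ha
  have htop : N ⊔ Submodule.annihilator N = ⊤ := by
    by_contra hne
    -- If `N` vanishes locally at `Q`, a product of elements outside `Q` annihilates `N`. Otherwise
    -- some `y ∈ N` survives at `Q`; as `y * e = 0` and the local ring is a domain, `e` is killed by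
    -- some `s ∉ Q`, so that `s ∈ N`. Both cases contradict the choice of `Q`.
    obtain ⟨Q, hQ, hle⟩ := Ideal.exists_le_maximal _ hne
    have hQp := hQ.isPrime
    by_cases hall : ∀ y ∈ N, ∃ s ∉ Q, s * y = 0
    · have hG' : ∀ y ∈ G, ∃ s ∉ Q, s * y = 0 := fun y hy => hall y (hG ▸ Ideal.subset_span hy)
      choose! w hw1 hw2 using hG'
      have h1 : ∏ y ∈ G, w y ∉ Q := by
        rw [Ideal.IsPrime.prod_mem_iff]
        rintro ⟨y, hy, h⟩
        exact hw1 y hy h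
      apply h1
      apply hle
      apply Ideal.mem_sup_right
      rw [Submodule.mem_annihilator]
      intro y hy
      rw [← hG] at hy
      simp only [smul_eq_mul]
      refine Submodule.span_induction (fun z hz => ?_) (by simp) (fun a b _ _ ha hb => ?_)
        (fun c a _ ha => ?_) hy
      · obtain ⟨v, hv⟩ := Finset.dvd_prod_of_mem w hz
        rw [hv]
        linear_combination v * hw2 z hz
      · rw [mul_add, ha, hb, add_zero]
      · simp only [smul_eq_mul]
        linear_combination c * ha
    · push Not at hall
      obtain ⟨y, hyN, hy⟩ := hall
      obtain ⟨s, hsQ, h | h⟩ := exists_notMem_mul_eq_zero_of_smooth (k := k) Q y e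
        (by rw [mul_comm]; exact heN y hyN)
      · exact hy s hsQ h
      · apply hsQ
        apply hle
        apply Ideal.mem_sup_left
        exact ⟨e, hep, by rw [mul_comm]; exact h⟩
  obtain ⟨b, hb, a, ha, hab⟩ := Submodule.mem_sup.mp (htop ▸ Submodule.mem_top : (1 : S) ∈ _)
  have hab0 : a * b = 0 := by simpa using Submodule.mem_annihilator.mp ha b hb
  have hidem : IsIdempotentElem b := by
    rw [IsIdempotentElem]
    linear_combination b * hab - hab0
  have hb0 : b = 0 := by
    have hcl : IsClopen (PrimeSpectrum.basicOpen b : Set (PrimeSpectrum S)) :=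
      PrimeSpectrum.isClopen_iff.mpr ⟨b, hidem, rfl⟩
    rcases isClopen_iff.mp hcl with h | h
    · have h1 : PrimeSpectrum.basicOpen b = ⊥ := SetLike.coe_injective h
      obtain ⟨m, hm⟩ := (PrimeSpectrum.basicOpen_eq_bot_iff b).mp h1
      rcases m with _ | m
      · have : Subsingleton S := subsingleton_of_zero_eq_one (by simpa using hm.symm)
        exact Subsingleton.elim _ _
      · rwa [hidem.pow_succ_eq] at hm
    · exfalso
      obtain ⟨s, hs, hsb⟩ := hb
      have h1 : (⟨p, hp⟩ : PrimeSpectrum S) ∈ PrimeSpectrum.basicOpen b := by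
        have : (⟨p, hp⟩ : PrimeSpectrum S) ∈ (PrimeSpectrum.basicOpen b : Set (PrimeSpectrum S)) :=
          h ▸ Set.mem_univ _
        exact this
      have h2 : s * b ∈ p := by rw [hsb]; exact p.zero_mem
      exact (hp.mem_or_mem h2).elim hs h1
  rw [hb0, zero_add] at hab
  have hx := Submodule.mem_annihilator.mp ha x ⟨s, hs, hsx⟩
  simpa [hab] using hx

/-- Krull's intersection theorem for a principal prime of a connected smooth algebra. -/
lemma eq_zero_of_forall_mem_span_pow {k S : Type*} [Field k] [CommRing S] [Algebra k S]
    [Algebra.Smooth k S] [ConnectedSpace (PrimeSpectrum S)] (u : S)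
    (hu : (Ideal.span {u}).IsPrime) (x : S) (hx : ∀ m : ℕ, x ∈ Ideal.span {u} ^ m) : x = 0 := by
  have : IsNoetherianRing S := Algebra.FiniteType.isNoetherianRing k S
  have h1 : x ∈ (⨅ i : ℕ, Ideal.span {u} ^ i • ⊤ : Submodule S S) := by
    rw [Submodule.mem_iInf]
    intro i
    simpa using hx i
  -- Krull's theorem gives `r * x = x` with `r` in the prime `(u)`, so `x` is killed by `1 - r`,
  -- which lies outside `(u)`.
  obtain ⟨⟨r, hr⟩, hrx⟩ := (Ideal.mem_iInf_smul_pow_eq_bot_iff (Ideal.span {u}) x).mp h1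
  refine eq_zero_of_mul_eq_zero_of_smooth (k := k) (Ideal.span {u}) (1 - r) x (fun h => ?_) ?_
  · exact hu.ne_top ((Ideal.eq_top_iff_one _).mpr (by simpa using Ideal.add_mem _ h hr))
  · simp only [smul_eq_mul] at hrx
    linear_combination -hrx

/-! ## Norm estimates in Monsky-Washnitzer algebras -/

section

variable {K : Type u} [NormedField K] [IsUltrametricDist K]

lemma mem_OK {x : K} : x ∈ (NormedField.valuation (K := K)).valuationSubring ↔ ‖x‖ ≤ 1 := Iff.rfl

lemma norm_OK_le (x : OK K) : ‖(x : K)‖ ≤ 1 := x.2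

lemma norm_lt_one_of_irreducible {π : OK K} (hπ : Irreducible π) : ‖(π : K)‖ < 1 := by
  refine lt_of_le_of_ne (norm_OK_le π) fun h => hπ.not_isUnit ?_
  have h0 : (π : K) ≠ 0 := fun h0 => by simp [h0] at h
  refine IsUnit.of_mul_eq_one ⟨(π : K)⁻¹, mem_OK.mpr (by rw [norm_inv, h, inv_one])⟩ ?_
  exact Subtype.ext (mul_inv_cancel₀ h0)

lemma norm_pos_of_irreducible {π : OK K} (hπ : Irreducible π) : 0 < ‖(π : K)‖ := by
  rw [norm_pos_iff]
  exact fun h => hπ.ne_zero (Subtype.ext h)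

lemma dvd_iff_norm_le {a x : OK K} (ha : a ≠ 0) : a ∣ x ↔ ‖(x : K)‖ ≤ ‖(a : K)‖ := by
  have ha' : (a : K) ≠ 0 := fun h => ha (Subtype.ext h)
  constructor
  · rintro ⟨y, rfl⟩
    push_cast
    rw [norm_mul]
    exact mul_le_of_le_one_right (norm_nonneg _) (norm_OK_le y)
  · intro h
    refine ⟨⟨(x : K) / a, mem_OK.mpr ?_⟩, Subtype.ext ?_⟩
    · rw [norm_div]
      exact div_le_one_of_le₀ h (norm_nonneg _)
    · exact (mul_div_cancel₀ _ ha').symm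

lemma pow_dvd_iff_norm_le {π : OK K} (hπ : Irreducible π) (N : ℕ) (x : OK K) :
    π ^ N ∣ x ↔ ‖(x : K)‖ ≤ ‖(π : K)‖ ^ N := by
  rw [dvd_iff_norm_le (pow_ne_zero _ hπ.ne_zero)]
  push_cast
  rw [norm_pow]

/-- The coefficients of an element of `W_n`. -/
def MW.cf {n : ℕ} (f : MW K n) (I : Fin n →₀ ℕ) : OK K := MvPowerSeries.coeff I f.1

variable {n m : ℕ}

namespace MW

lemma ext_cf {f g : MW K n} (h : ∀ I, cf f I = cf g I) : f = g :=
  Subtype.ext (MvPowerSeries.ext h)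

@[simp] lemma cf_zero (I : Fin n →₀ ℕ) : cf (0 : MW K n) I = 0 := rfl
@[simp] lemma cf_add (f g : MW K n) (I : Fin n →₀ ℕ) : cf (f + g) I = cf f I + cf g I := rfl
@[simp] lemma cf_sub (f g : MW K n) (I : Fin n →₀ ℕ) : cf (f - g) I = cf f I - cf g I := by
  simp [cf]
@[simp] lemma cf_smul (c : OK K) (f : MW K n) (I : Fin n →₀ ℕ) : cf (c • f) I = c * cf f I := by
  simp [cf]
@[simp] lemma cf_sum {ι : Type*} (s : Finset ι) (f : ι → MW K n) (I : Fin n →₀ ℕ) :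
    cf (∑ i ∈ s, f i) I = ∑ i ∈ s, cf (f i) I := by
  classical
  induction s using Finset.induction_on with
  | empty => simp
  | insert a s ha ih => rw [Finset.sum_insert ha, Finset.sum_insert ha, cf_add, ih]

lemma cf_mul [DecidableEq (Fin n)] (f g : MW K n) (I : Fin n →₀ ℕ) :
    cf (f * g) I = ∑ x ∈ Finset.HasAntidiagonal.antidiagonal I, cf f x.1 * cf g x.2 := by
  simp only [cf]
  exact MvPowerSeries.coeff_mul _ _ _

lemma algebraMap_pow_mul (c : OK K) (N : ℕ) (f : MW K n) :
    (algebraMap (OK K) (MW K n) c) ^ N * f = c ^ N • f := by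
  rw [← map_pow, Algebra.smul_def]

/-- `W_n` is stable under division by a constant. -/
lemma dvd_iff {a : OK K} (ha : a ≠ 0) (f : MW K n) :
    (∃ g : MW K n, f = a • g) ↔ ∀ I, a ∣ cf f I := by
  constructor
  · rintro ⟨g, rfl⟩ I
    exact ⟨cf g I, by simp⟩
  · intro h
    choose g hg using h
    have ha' : 0 < ‖(a : K)‖ := norm_pos_iff.mpr fun h => ha (Subtype.ext h)
    obtain ⟨ρ, hρ, B, hB⟩ := f.2
    refine ⟨⟨fun I => g I, ρ, hρ, B / ‖(a : K)‖, fun I => ?_⟩, ext_cf fun I => ?_⟩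
    · rw [le_div_iff₀ ha']
      refine le_trans (le_of_eq ?_) (hB I)
      change ‖((g I : OK K) : K)‖ * _ * _ = ‖((cf f I : OK K) : K)‖ * _
      rw [hg I]
      push_cast
      rw [norm_mul]; ring
    · rw [cf_smul, hg I]; rfl

lemma pow_dvd_iff {π : OK K} (hπ : Irreducible π) (N : ℕ) (f : MW K n) :
    (algebraMap (OK K) (MW K n) π) ^ N ∣ f ↔ ∀ I, π ^ N ∣ cf f I := by
  rw [← dvd_iff (pow_ne_zero _ hπ.ne_zero)]
  simp_rw [← algebraMap_pow_mul]
  rfl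

/-- The element `f` of `W_n` satisfies `|c_I| ρ^{|I|} ≤ B` for all `I`. -/
def GB (ρ B : ℝ) (f : MW K n) : Prop := ∀ I, ‖(cf f I : K)‖ * ρ ^ I.degree ≤ B

lemma exists_GB (f : MW K n) : ∃ ρ : ℝ, 1 < ρ ∧ ∃ B : ℝ, GB ρ B f := f.2

section
variable {ρ ρ' B B' : ℝ} {f g : MW K n}

lemma GB.nonneg (h : GB ρ B f) : 0 ≤ B := by
  refine le_trans ?_ (h 0)
  simp

lemma GB.mono (h : GB ρ B f) (hB : B ≤ B') : GB ρ B' f := fun I => (h I).trans hB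

lemma GB.mono_left (h : GB ρ B f) (h0 : 0 ≤ ρ') (hρ : ρ' ≤ ρ) : GB ρ' B f := fun I =>
  (mul_le_mul_of_nonneg_left (pow_le_pow_left₀ h0 hρ _) (norm_nonneg _)).trans (h I)

lemma GB.add (hf : GB ρ B f) (hg : GB ρ B g) (hρ : 0 ≤ ρ) : GB ρ B (f + g) := fun I => by
  rw [cf_add]
  push_cast
  refine (mul_le_mul_of_nonneg_right (IsUltrametricDist.norm_add_le_max _ _) (by positivity)).trans ?_
  rcases max_choice ‖(cf f I : K)‖ ‖(cf g I : K)‖ with h | h <;> rw [h]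
  · exact hf I
  · exact hg I

lemma GB.neg (hf : GB ρ B f) : GB ρ B (-f) := fun I => by
  have : cf (-f) I = - cf f I := by simp [cf]
  rw [this]
  push_cast
  rw [norm_neg]
  exact hf I

lemma GB.sub (hf : GB ρ B f) (hg : GB ρ B g) (hρ : 0 ≤ ρ) : GB ρ B (f - g) := by
  rw [sub_eq_add_neg]; exact hf.add hg.neg hρ

lemma GB.sum {ι : Type*} {s : Finset ι} {f : ι → MW K n} (hρ : 0 ≤ ρ) (hB : 0 ≤ B)
    (h : ∀ i ∈ s, GB ρ B (f i)) : GB ρ B (∑ i ∈ s, f i) := by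
  classical
  induction s using Finset.induction_on with
  | empty => intro I; simpa using hB
  | insert a s ha ih =>
    rw [Finset.sum_insert ha]
    exact (h a (by simp)).add (ih fun i hi => h i (by simp [hi])) hρ

lemma GB.smul (hf : GB ρ B f) (c : OK K) (hc : ‖(c : K)‖ * B ≤ B') : GB ρ B' (c • f) := fun I => by
  rw [cf_smul]
  push_cast
  rw [norm_mul, mul_assoc]
  exact (mul_le_mul_of_nonneg_left (hf I) (norm_nonneg _)).trans hc

lemma GB.smul_le (hf : GB ρ B f) (c : OK K) : GB ρ B (c • f) :=
  hf.smul c (mul_le_of_le_one_left hf.nonneg (norm_OK_le c))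

lemma GB.mul (hf : GB ρ B f) (hg : GB ρ B' g) (hρ : 0 < ρ) : GB ρ (B * B') (f * g) := fun I => by
  classical
  rw [cf_mul]
  push_cast
  rw [← le_div_iff₀ (by positivity)]
  refine IsUltrametricDist.norm_sum_le_of_forall_le_of_nonneg
    (div_nonneg (mul_nonneg hf.nonneg hg.nonneg) (by positivity)) fun x hx => ?_
  rw [le_div_iff₀ (by positivity), norm_mul, ← Finset.HasAntidiagonal.mem_antidiagonal.mp hx,
    map_add, pow_add]
  calc _ = (‖(cf f x.1 : K)‖ * ρ ^ x.1.degree) * (‖(cf g x.2 : K)‖ * ρ ^ x.2.degree) := by ring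
    _ ≤ _ := mul_le_mul (hf _) (hg _) (by positivity) hf.nonneg

lemma GB.of_smul {a : OK K} (ha : a ≠ 0) (hf : GB ρ B (a • f)) : GB ρ (B / ‖(a : K)‖) f := fun I => by
  have ha' : 0 < ‖(a : K)‖ := norm_pos_iff.mpr fun h => ha (Subtype.ext h)
  rw [le_div_iff₀ ha']
  refine le_trans (le_of_eq ?_) (hf I)
  rw [cf_smul]
  push_cast
  rw [norm_mul]; ring

lemma cf_algebraMap [DecidableEq (Fin n →₀ ℕ)] (c : OK K) (I : Fin n →₀ ℕ) :
    cf (algebraMap (OK K) (MW K n) c) I = if I = 0 then c else 0 := by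
  classical
  change MvPowerSeries.coeff I (algebraMap (OK K) (MvPowerSeries (Fin n) (OK K)) c) = _
  rw [MvPowerSeries.algebraMap_apply, MvPowerSeries.coeff_C]
  split_ifs <;> rfl

lemma GB_algebraMap (c : OK K) (hB : ‖(c : K)‖ ≤ B) :
    GB ρ B (algebraMap (OK K) (MW K n) c) := fun I => by
  classical
  rw [cf_algebraMap]
  split_ifs with h
  · subst h; simpa using hB
  · simpa using (norm_nonneg _).trans hB

lemma GB_one : GB ρ 1 (1 : MW K n) := by
  rw [← map_one (algebraMap (OK K) (MW K n))]
  exact GB_algebraMap _ (by simp)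

lemma GB.pow (hf : GB ρ B f) (hρ : 0 < ρ) (k : ℕ) : GB ρ (B ^ k) (f ^ k) := by
  induction k with
  | zero => simpa using GB_one
  | succ k ih => rw [pow_succ, pow_succ]; exact ih.mul hf hρ

lemma GB.prod {ι : Type*} {s : Finset ι} {f : ι → MW K n} {B : ι → ℝ} (hρ : 0 < ρ)
    (h : ∀ i ∈ s, GB ρ (B i) (f i)) : GB ρ (∏ i ∈ s, B i) (∏ i ∈ s, f i) := by
  classical
  induction s using Finset.induction_on with
  | empty => simpa using GB_one
  | insert a s ha ih =>
    rw [Finset.prod_insert ha, Finset.prod_insert ha]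
    exact (h a (by simp)).mul (ih fun i hi => h i (by simp [hi])) hρ

end

/-- The monomial `y^I`. -/
lemma GB.monomial {ρ B : ℝ} {y : Fin m → MW K n} (hy : ∀ i, GB ρ B (y i)) (hρ : 0 < ρ)
    (I : Fin m →₀ ℕ) : GB ρ (B ^ I.degree) (I.prod fun i k => y i ^ k) := by
  have h1 : B ^ I.degree = ∏ i ∈ I.support, B ^ I i := by
    rw [Finsupp.degree_apply, Finset.prod_pow_eq_pow_sum]
  rw [h1]
  exact GB.prod hρ fun i _ => (hy i).pow hρ _

/-- By shrinking the radius the bound can be made arbitrarily close to `1`. -/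
lemma exists_GB_lt (f : MW K n) {B : ℝ} (hB : 1 < B) :
    ∃ ρ₀ : ℝ, 1 < ρ₀ ∧ ∀ ρ, 1 < ρ → ρ ≤ ρ₀ → GB ρ B f := by
  obtain ⟨ρ₁, hρ₁, B₁, h⟩ := exists_GB f
  obtain ⟨M, hM⟩ := pow_unbounded_of_one_lt B₁ hB
  have hM1 : B₁ ≤ B ^ (M + 1) := hM.le.trans (pow_le_pow_right₀ hB.le (Nat.le_succ _))
  -- Coefficients have norm at most `1`, so the power `M + 1` of `‖c_I‖ ρ₀ ^ |I|` is at most `‖c_I‖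
  -- ρ₁ ^ |I| ≤ B₁ ≤ B ^ (M + 1)`.
  set ρ₀ := ρ₁ ^ (((M + 1 : ℕ) : ℝ)⁻¹) with hρ₀
  have hρ₀1 : 1 < ρ₀ := Real.one_lt_rpow hρ₁ (by positivity)
  refine ⟨ρ₀, hρ₀1, fun ρ h1 h2 => GB.mono_left (ρ := ρ₀) (fun I => ?_) (by linarith) h2⟩
  have e : ρ₀ ^ (M + 1) = ρ₁ := Real.rpow_inv_natCast_pow (by linarith) (Nat.succ_ne_zero M)
  refine le_of_pow_le_pow_left₀ (Nat.succ_ne_zero M) (by linarith) (le_trans ?_ hM1)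
  refine le_trans ?_ (h I)
  rw [mul_pow, ← pow_mul, mul_comm I.degree, pow_mul, e]
  refine mul_le_mul_of_nonneg_right ?_ (by positivity)
  exact pow_le_of_le_one (norm_nonneg _) (norm_OK_le _) (Nat.succ_ne_zero M)

lemma exists_forall_GB_lt {ι : Type*} [Finite ι] (f : ι → MW K n) {B : ℝ} (hB : 1 < B) :
    ∃ ρ₀ : ℝ, 1 < ρ₀ ∧ ∀ ρ, 1 < ρ → ρ ≤ ρ₀ → ∀ i, GB ρ B (f i) := by
  cases nonempty_fintype ι
  choose r hr1 hr2 using fun i => exists_GB_lt (f i) hB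
  by_cases hι : Nonempty ι
  · refine ⟨Finset.univ.inf' Finset.univ_nonempty r, ?_, fun ρ h1 h2 i => hr2 i ρ h1 ?_⟩
    · rw [Finset.lt_inf'_iff]; exact fun i _ => hr1 i
    · exact h2.trans (Finset.inf'_le _ (Finset.mem_univ i))
  · exact ⟨2, one_lt_two, fun _ _ _ i => (hι ⟨i⟩).elim⟩

/-! ### Truncation -/

/-- Coefficients of norm larger than `‖π‖ ^ N` can only occur in bounded degree, because `ρ ^ |I|`
is unbounded. So elements of `W_n` are polynomials modulo every power of `π`, which is what reduces
statements on `W_n` to polynomials. -/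
lemma finite_not_pow_dvd {π : OK K} (hπ : Irreducible π) (f : MW K n) (N : ℕ) :
    {I | ¬ π ^ N ∣ cf f I}.Finite := by
  obtain ⟨ρ, hρ, B, h⟩ := exists_GB f
  have hp := pow_pos (norm_pos_of_irreducible hπ) N
  obtain ⟨D, hD⟩ := pow_unbounded_of_one_lt (B / ‖(π : K)‖ ^ N) hρ
  refine (Finsupp.finite_of_degree_le (σ := Fin n) D).subset fun I hI => ?_
  rw [Set.mem_ofPred_eq, pow_dvd_iff_norm_le hπ, not_le] at hI
  by_contra hlt
  rw [Set.mem_ofPred_eq, not_le] at hlt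
  have h1 : ‖(π : K)‖ ^ N * ρ ^ I.degree ≤ B :=
    (mul_le_mul_of_nonneg_right hI.le (by positivity)).trans (h I)
  rw [div_lt_iff₀ hp] at hD
  have h2 : ρ ^ D ≤ ρ ^ I.degree := pow_le_pow_right₀ hρ.le hlt.le
  nlinarith

/-- The finite set of multi-indices whose coefficient is not divisible by `π ^ N`. -/
def trSet {π : OK K} (hπ : Irreducible π) (N : ℕ) (f : MW K n) : Finset (Fin n →₀ ℕ) :=
  (finite_not_pow_dvd hπ f N).toFinset

lemma mem_trSet {π : OK K} (hπ : Irreducible π) {N : ℕ} {f : MW K n} {I : Fin n →₀ ℕ} :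
    I ∈ trSet hπ N f ↔ ¬ π ^ N ∣ cf f I := by simp [trSet]

/-- The polynomial consisting of the terms of `f` which are not divisible by `π ^ N`. -/
def tr {π : OK K} (hπ : Irreducible π) (N : ℕ) (f : MW K n) : MvPolynomial (Fin n) (OK K) :=
  ∑ I ∈ trSet hπ N f, MvPolynomial.monomial I (cf f I)

open Classical in
lemma coeff_tr {π : OK K} (hπ : Irreducible π) (N : ℕ) (f : MW K n)
    (I : Fin n →₀ ℕ) : (tr hπ N f).coeff I = if π ^ N ∣ cf f I then 0 else cf f I := by
  classical
  rw [tr, MvPolynomial.coeff_sum]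
  simp only [MvPolynomial.coeff_monomial]
  by_cases h : π ^ N ∣ cf f I
  · rw [if_pos h]
    refine Finset.sum_eq_zero fun J hJ => if_neg ?_
    rintro rfl
    exact (mem_trSet hπ).mp hJ h
  · rw [if_neg h, Finset.sum_eq_single I (fun J _ hJ => if_neg hJ)
      (fun h' => (h' ((mem_trSet hπ).mpr h)).elim), if_pos rfl]

/-- The inclusion of polynomials into `W_n`. -/
def ofPoly : MvPolynomial (Fin n) (OK K) →ₐ[OK K] MW K n := MvPolynomial.aeval MW.X

lemma cf_ofPoly (P : MvPolynomial (Fin n) (OK K)) (I : Fin n →₀ ℕ) :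
    cf (ofPoly P) I = P.coeff I := by
  have : (MW K n).val.comp ofPoly = MvPolynomial.coeToMvPowerSeries.algHom (OK K) := by
    refine MvPolynomial.algHom_ext fun i => ?_
    simp [ofPoly]
    rfl
  have h := DFunLike.congr_fun this P
  change MvPowerSeries.coeff I ((MW K n).val (ofPoly P)) = _
  rw [← AlgHom.comp_apply, h]
  simp

lemma pow_dvd_sub_tr {π : OK K} (hπ : Irreducible π) (N : ℕ) (f : MW K n) :
    (algebraMap (OK K) (MW K n) π) ^ N ∣ f - ofPoly (tr hπ N f) := by
  classical
  rw [pow_dvd_iff hπ]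
  intro I
  rw [cf_sub, cf_ofPoly, coeff_tr]
  split_ifs with h
  · simpa using h
  · simp

/-- Convergent sums in `W_n` of families with a common bound. -/
lemma exists_sum_of_dvd [CompleteSpace K] {π : OK K} (hπ : Irreducible π) {ρ B : ℝ}
    (hρ : 1 < ρ) (hB : 0 ≤ B) {ι : Type*} (t : ι → MW K m) (ht : ∀ i, GB ρ B (t i))
    (S : ℕ → Finset ι) (hS : ∀ N, ∀ i ∉ S N, (algebraMap (OK K) (MW K m) π) ^ N ∣ t i) :
    ∃ w : MW K m, GB ρ B w ∧ ∀ N, (algebraMap (OK K) (MW K m) π) ^ N ∣ w - ∑ i ∈ S N, t i := by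
  classical
  have hS' : ∀ N J, ∀ i ∉ S N, ‖(cf (t i) J : K)‖ ≤ ‖(π : K)‖ ^ N := fun N J i hi => by
    rw [← pow_dvd_iff_norm_le hπ]
    exact (pow_dvd_iff hπ _ _).mp (hS N i hi) J
  have hsum : ∀ J, Summable fun i => (cf (t i) J : K) := fun J => by
    refine NonarchimedeanAddGroup.summable_of_tendsto_cofinite_zero ?_
    rw [Metric.tendsto_nhds]
    intro ε hε
    obtain ⟨N, hN⟩ := exists_pow_lt_of_lt_one hε (norm_lt_one_of_irreducible hπ)
    filter_upwards [(S N).finite_toSet.compl_mem_cofinite] with i hi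
    rw [dist_zero_right]
    exact (hS' N J i hi).trans_lt hN
  have hle : ∀ J, ‖∑' i, (cf (t i) J : K)‖ ≤ B / ρ ^ J.degree := fun J =>
    IsUltrametricDist.norm_tsum_le_of_forall_le_of_nonneg (by positivity) fun i => by
      rw [le_div_iff₀ (by positivity)]; exact ht i J
  have hle1 : ∀ J, ‖∑' i, (cf (t i) J : K)‖ ≤ 1 := fun J =>
    IsUltrametricDist.norm_tsum_le_of_forall_le_of_nonneg zero_le_one fun i => norm_OK_le _
  let w : MvPowerSeries (Fin m) (OK K) := fun J => ⟨∑' i, (cf (t i) J : K), mem_OK.mpr (hle1 J)⟩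
  have hw : ∀ J, ‖((MvPowerSeries.coeff J w : OK K) : K)‖ * ρ ^ J.degree ≤ B := fun J => by
    rw [← le_div_iff₀ (by positivity)]; exact hle J
  refine ⟨⟨w, ρ, hρ, _, hw⟩, hw, fun N => ?_⟩
  rw [pow_dvd_iff hπ]
  intro J
  rw [pow_dvd_iff_norm_le hπ, cf_sub, cf_sum]
  have e : ((cf (⟨w, ρ, hρ, _, hw⟩ : MW K m) J - ∑ i ∈ S N, cf (t i) J : OK K) : K)
      = ∑' i, (if i ∈ S N then 0 else (cf (t i) J : K)) := by
    have h1 := (hsum J).sum_add_tsum_compl (s := S N)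
    have h2 : ∑' i, (if i ∈ S N then 0 else (cf (t i) J : K)) =
        ∑' i : ((S N : Set ι)ᶜ : Set _), (cf (t i) J : K) := by
      rw [tsum_subtype ((S N : Set ι)ᶜ) (fun i => (cf (t i) J : K))]
      refine tsum_congr fun i => ?_
      by_cases hi : i ∈ S N <;> simp [Set.indicator, hi]
    rw [h2]
    push_cast
    rw [sub_eq_iff_eq_add, add_comm]
    exact h1.symm
  rw [e]
  refine IsUltrametricDist.norm_tsum_le_of_forall_le_of_nonneg (by positivity) fun i => ?_
  split_ifs with h
  · simp
  · exact hS' N J i h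

/-- Sums `∑ a_I q_I` over the multi-indices, where the coefficients `a_I` are dominated by those of
an element of `W_n` and where the growth of `q_I` is at most geometric. -/
lemma exists_sum [CompleteSpace K] {π : OK K} (hπ : Irreducible π) {ρ B ρ' B' : ℝ} {f : MW K n}
    (hf : GB ρ B f) (hρ' : 1 < ρ') (hB' : 0 ≤ B')
    (a : (Fin n →₀ ℕ) → OK K) (ha : ∀ I, ‖(a I : K)‖ ≤ ‖(cf f I : K)‖)
    (q : (Fin n →₀ ℕ) → MW K m) (hq : ∀ I, GB ρ' (B' * ρ ^ I.degree) (q I)) :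
    ∃ w : MW K m, GB ρ' (B * B') w ∧ ∀ N, (algebraMap (OK K) (MW K m) π) ^ N ∣
      w - ∑ I ∈ trSet hπ N f, a I • q I := by
  refine exists_sum_of_dvd hπ hρ' (mul_nonneg hf.nonneg hB') (fun I => a I • q I)
    (fun I => (hq I).smul _ ?_) _ fun N I hI => ?_
  · have h0 : 0 ≤ B' * ρ ^ I.degree := (hq I).nonneg
    calc _ ≤ ‖(cf f I : K)‖ * (B' * ρ ^ I.degree) := mul_le_mul_of_nonneg_right (ha I) h0
      _ = (‖(cf f I : K)‖ * ρ ^ I.degree) * B' := by ring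
      _ ≤ _ := mul_le_mul_of_nonneg_right (hf I) hB'
  · rw [mem_trSet, not_not, pow_dvd_iff_norm_le hπ] at hI
    obtain ⟨c, hc⟩ := (pow_dvd_iff_norm_le hπ N _).mpr ((ha I).trans hI)
    exact ⟨c • q I, by rw [hc, mul_smul, algebraMap_pow_mul]⟩

end MW

end

/-! ## Homomorphisms out of Monsky-Washnitzer algebras -/

section

variable {K : Type u} [NormedField K] [IsUltrametricDist K] {n m : ℕ}

/-- The ring `E` is `π`-adically separated. -/
def IsSep (π : OK K) (E : Type*) [CommRing E] [Algebra (OK K) E] : Prop :=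
  ∀ x : E, (∀ N : ℕ, (algebraMap (OK K) E π) ^ N ∣ x) → x = 0

namespace MW

section

variable {E : Type*} [CommRing E] [Algebra (OK K) E] {π : OK K}

lemma pow_dvd_eval₂ {j : OK K →+* E} (hj : algebraMap (OK K) E π ∣ j π) (y : Fin n → E) {N : ℕ}
    {P : MvPolynomial (Fin n) (OK K)} (hP : ∀ I, π ^ N ∣ P.coeff I) :
    (algebraMap (OK K) E π) ^ N ∣ MvPolynomial.eval₂ j y P := by
  obtain ⟨Q, rfl⟩ := (MvPolynomial.C_dvd_iff_dvd_coeff _ _).mpr hP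
  rw [MvPolynomial.eval₂_mul, MvPolynomial.eval₂_C, map_pow]
  exact Dvd.dvd.mul_right (pow_dvd_pow_of_dvd hj N) _

/-- The element `e` is the limit of the values `P(y)` over the polynomials `P` approximating `f`. -/
def Lim (π : OK K) (j : OK K →+* E) (y : Fin n → E) (f : MW K n) (e : E) : Prop :=
  ∀ (N : ℕ) (P : MvPolynomial (Fin n) (OK K)), (algebraMap (OK K) (MW K n) π) ^ N ∣ f - ofPoly P →
    (algebraMap (OK K) E π) ^ N ∣ e - MvPolynomial.eval₂ j y P

variable {j : OK K →+* E} {y : Fin n → E}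

/-- Two polynomials that approximate `f` modulo `π ^ N` differ by a polynomial divisible by `π ^ N`.
Therefore a limit may be tested on the truncations alone. The map `j` on constants need not be the
structure map; it suffices that `π` divides `j π`, which admits Frobenius-semilinear homomorphisms.
-/
lemma pow_dvd_eval₂_sub (hπ : Irreducible π) (hj : algebraMap (OK K) E π ∣ j π) {N : ℕ}
    {f : MW K n} {P Q : MvPolynomial (Fin n) (OK K)}
    (hP : (algebraMap (OK K) (MW K n) π) ^ N ∣ f - ofPoly P)
    (hQ : (algebraMap (OK K) (MW K n) π) ^ N ∣ f - ofPoly Q) :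
    (algebraMap (OK K) E π) ^ N ∣ MvPolynomial.eval₂ j y P - MvPolynomial.eval₂ j y Q := by
  rw [← MvPolynomial.eval₂_sub]
  refine pow_dvd_eval₂ hj y fun I => ?_
  have h := dvd_sub hQ hP
  rw [sub_sub_sub_cancel_left, ← map_sub, pow_dvd_iff hπ] at h
  simpa only [cf_ofPoly] using h I

lemma lim_of_tr (hπ : Irreducible π) (hj : algebraMap (OK K) E π ∣ j π) {f : MW K n} {e : E}
    (h : ∀ N, (algebraMap (OK K) E π) ^ N ∣ e - MvPolynomial.eval₂ j y (tr hπ N f)) :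
    Lim π j y f e := fun N P hP => by
  have h1 := pow_dvd_eval₂_sub (y := y) hπ hj (pow_dvd_sub_tr hπ N f) hP
  have := dvd_add (h N) h1
  rwa [sub_add_sub_cancel] at this

lemma Lim.unique (hπ : Irreducible π) (hsep : IsSep π E) {f : MW K n} {e e' : E}
    (h : Lim π j y f e) (h' : Lim π j y f e') : e = e' := by
  rw [← sub_eq_zero]
  refine hsep _ fun N => ?_
  have := dvd_sub (h N _ (pow_dvd_sub_tr hπ N f)) (h' N _ (pow_dvd_sub_tr hπ N f))
  rwa [sub_sub_sub_cancel_right] at this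

lemma Lim.add (hπ : Irreducible π) (hj : algebraMap (OK K) E π ∣ j π) {f g : MW K n} {e e' : E}
    (h : Lim π j y f e) (h' : Lim π j y g e') : Lim π j y (f + g) (e + e') := fun N P hP => by
  have hfg : (algebraMap (OK K) (MW K n) π) ^ N ∣
      f + g - ofPoly (tr hπ N f + tr hπ N g) := by
    rw [map_add, add_sub_add_comm]
    exact dvd_add (pow_dvd_sub_tr hπ N f) (pow_dvd_sub_tr hπ N g)
  have h1 := pow_dvd_eval₂_sub (y := y) hπ hj hfg hP
  have h2 := dvd_add (dvd_add (h N _ (pow_dvd_sub_tr hπ N f)) (h' N _ (pow_dvd_sub_tr hπ N g))) h1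
  convert h2 using 1
  rw [MvPolynomial.eval₂_add]; ring

lemma Lim.mul (hπ : Irreducible π) (hj : algebraMap (OK K) E π ∣ j π) {f g : MW K n} {e e' : E}
    (h : Lim π j y f e) (h' : Lim π j y g e') : Lim π j y (f * g) (e * e') := fun N P hP => by
  have hfg : (algebraMap (OK K) (MW K n) π) ^ N ∣
      f * g - ofPoly (tr hπ N f * tr hπ N g) := by
    rw [map_mul]
    have : f * g - ofPoly (tr hπ N f) * ofPoly (tr hπ N g) =
        (f - ofPoly (tr hπ N f)) * g + ofPoly (tr hπ N f) * (g - ofPoly (tr hπ N g)) := by ring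
    rw [this]
    exact dvd_add ((pow_dvd_sub_tr hπ N f).mul_right _) ((pow_dvd_sub_tr hπ N g).mul_left _)
  have h1 := pow_dvd_eval₂_sub (y := y) hπ hj hfg hP
  have h2 := dvd_add (dvd_add ((h N _ (pow_dvd_sub_tr hπ N f)).mul_right e')
    ((h' N _ (pow_dvd_sub_tr hπ N g)).mul_left (MvPolynomial.eval₂ j y (tr hπ N f)))) h1
  convert h2 using 1
  rw [MvPolynomial.eval₂_mul]; ring

lemma lim_ofPoly (hπ : Irreducible π) (hj : algebraMap (OK K) E π ∣ j π)
    (P : MvPolynomial (Fin n) (OK K)) : Lim π j y (ofPoly P) (MvPolynomial.eval₂ j y P) :=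
  fun N Q hQ => pow_dvd_eval₂_sub (f := ofPoly P) hπ hj (by simp) hQ

/-- A homomorphism on polynomials extends to `W_n` once all the necessary limits exist. -/
theorem exists_ringHom (hπ : Irreducible π) (hsep : IsSep π E)
    (hj : algebraMap (OK K) E π ∣ j π)
    (H : ∀ f : MW K n, ∃ e, ∀ N, (algebraMap (OK K) E π) ^ N ∣
      e - MvPolynomial.eval₂ j y (tr hπ N f)) :
    ∃ ψ : MW K n →+* E, (∀ c, ψ (algebraMap (OK K) _ c) = j c) ∧ ∀ i, ψ (MW.X i) = y i := by
  choose e he using H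
  have hl : ∀ f, Lim π j y f (e f) := fun f => lim_of_tr hπ hj (he f)
  have hP : ∀ P, e (ofPoly P) = MvPolynomial.eval₂ j y P := fun P =>
    (hl _).unique hπ hsep (lim_ofPoly hπ hj P)
  have hc : ∀ c, e (algebraMap (OK K) _ c) = j c := fun c => by
    have := hP (MvPolynomial.C c)
    rwa [MvPolynomial.eval₂_C, ← MvPolynomial.algebraMap_eq, AlgHom.commutes] at this
  refine ⟨{ toFun := e, map_one' := ?_, map_zero' := ?_, map_add' := fun f g => ?_,
            map_mul' := fun f g => ?_ }, hc, fun i => ?_⟩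
  · simpa using hc 1
  · exact (hl _).unique hπ hsep ((hl f).mul hπ hj (hl g))
  · simpa using hc 0
  · exact (hl _).unique hπ hsep ((hl f).add hπ hj (hl g))
  · have := hP (MvPolynomial.X i)
    rw [MvPolynomial.eval₂_X] at this
    rw [← this]
    simp [ofPoly]

/-- A homomorphism under which `π` maps to a multiple of `π` is `π`-adically continuous, and
polynomials are `π`-adically dense in `W_n`; a separated target has unique limits. -/
lemma ringHom_ext (hπ : Irreducible π) (hsep : IsSep π E) {ψ₁ ψ₂ : MW K n →+* E}
    (hj : algebraMap (OK K) E π ∣ ψ₁ (algebraMap (OK K) _ π))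
    (hc : ∀ c, ψ₁ (algebraMap (OK K) _ c) = ψ₂ (algebraMap (OK K) _ c))
    (hX : ∀ i, ψ₁ (MW.X i) = ψ₂ (MW.X i)) : ψ₁ = ψ₂ := by
  have hpoly : ∀ P : MvPolynomial (Fin n) (OK K), ψ₁ (ofPoly P) = ψ₂ (ofPoly P) := by
    intro P
    have : ψ₁.comp (ofPoly : MvPolynomial (Fin n) (OK K) →ₐ[OK K] MW K n).toRingHom =
        ψ₂.comp (ofPoly : MvPolynomial (Fin n) (OK K) →ₐ[OK K] MW K n).toRingHom := by
      refine MvPolynomial.ringHom_ext (fun c => ?_) (fun i => ?_)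
      · simpa [ofPoly] using hc c
      · simpa [ofPoly] using hX i
    exact DFunLike.congr_fun this P
  ext f
  rw [← sub_eq_zero]
  refine hsep _ fun N => ?_
  obtain ⟨g, hg⟩ := pow_dvd_sub_tr hπ N f
  have h1 : f = ofPoly (tr hπ N f) + (algebraMap (OK K) (MW K n) π) ^ N * g := by rw [← hg]; ring
  have h2 : ψ₁ f - ψ₂ f = (ψ₁ (algebraMap (OK K) _ π)) ^ N * (ψ₁ g - ψ₂ g) := by
    rw [h1]
    simp only [map_add, map_mul, map_pow, hpoly, hc]
    ring
  rw [h2]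
  exact (pow_dvd_pow_of_dvd hj N).mul_right _

end

end MW

variable {π : OK K}

/-- An endomorphism of `O` which is local does not increase norms. -/
lemma norm_map_le [IsDiscreteValuationRing (OK K)] (hπ : Irreducible π) (σK : OK K →+* OK K)
    (hσ : π ∣ σK π) (c : OK K) : ‖(σK c : K)‖ ≤ ‖(c : K)‖ := by
  by_cases hc : c = 0
  · subst hc; simp
  obtain ⟨k, v, rfl⟩ := IsDiscreteValuationRing.eq_unit_mul_pow_irreducible hc hπ
  have hv : ‖((v : OK K) : K)‖ = 1 := by
    refine le_antisymm (norm_OK_le _) ?_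
    have h1 : ‖((v : OK K) : K)‖ * ‖((v⁻¹ : (OK K)ˣ) : OK K).1‖ = 1 := by
      have : (v : OK K) * (v⁻¹ : (OK K)ˣ) = 1 := v.mul_inv
      calc _ = ‖(((v : OK K) * (v⁻¹ : (OK K)ˣ) : OK K) : K)‖ := by rw [← norm_mul]; rfl
        _ = 1 := by rw [this]; simp
    have h2 := norm_OK_le ((v⁻¹ : (OK K)ˣ) : OK K)
    nlinarith [norm_nonneg ((v : OK K) : K)]
  have h1 : ‖(σK π : K)‖ ≤ ‖(π : K)‖ := (dvd_iff_norm_le hπ.ne_zero).mp hσ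
  simp only [map_mul, map_pow]
  push_cast
  rw [norm_mul, norm_mul, norm_pow, norm_pow, hv]
  exact mul_le_mul (norm_OK_le _) (pow_le_pow_left₀ (norm_nonneg _) h1 k) (by positivity)
    zero_le_one

namespace DaggerPres

lemma proj_surjective (X : DaggerPres K) : Function.Surjective X.proj :=
  Ideal.Quotient.mk_surjective

lemma proj_eq_zero_iff (X : DaggerPres K) {f : MW K X.n} : X.proj f = 0 ↔ f ∈ X.I :=
  Ideal.Quotient.eq_zero_iff_mem

/-- Sums `∑ c_I y^I` exist in `A^int`. -/
lemma exists_eval [CompleteSpace K] (hπ : Irreducible π) (Y : DaggerPres K) (σK : OK K →+* OK K)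
    (hσ : ∀ c, ‖(σK c : K)‖ ≤ ‖(c : K)‖) (y : Fin n → Y.int) (f : MW K n) :
    ∃ e, ∀ N, (algebraMap (OK K) Y.int π) ^ N ∣
      e - MvPolynomial.eval₂ ((algebraMap (OK K) Y.int).comp σK) y (MW.tr hπ N f) := by
  choose z hz using fun i => Y.proj_surjective (y i)
  obtain ⟨ρ, hρ, B, hf⟩ := f.2
  -- The radius `ρ'` is so small that each lift `z i` has size at most `ρ` there. Then `z ^ I` grows
  -- at most like `ρ ^ |I|`, which the decay of the coefficients of `f` compensates.
  obtain ⟨ρ', hρ', hz'⟩ := MW.exists_forall_GB_lt z hρ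
  have hz1 := hz' ρ' hρ' le_rfl
  obtain ⟨w, -, hw⟩ := MW.exists_sum hπ (f := f) hf hρ' zero_le_one
    (fun I => σK (MW.cf f I)) (fun I => hσ _) (fun I => I.prod fun i k => z i ^ k)
    (fun I => by rw [one_mul]; exact MW.GB.monomial hz1 (by linarith) I)
  refine ⟨Y.proj w, fun N => ?_⟩
  have h1 := map_dvd Y.proj (hw N)
  rw [map_pow, AlgHom.commutes] at h1
  convert h1 using 1
  rw [map_sub, map_sum, MW.tr, MvPolynomial.eval₂_sum]
  congr 1
  refine Finset.sum_congr rfl fun I _ => ?_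
  rw [MvPolynomial.eval₂_monomial, map_smul, Algebra.smul_def, Finsupp.prod, Finsupp.prod, map_prod]
  simp [hz]

/-- Homomorphisms from `W_n` to a separated `A^int` with prescribed values on the variables. -/
theorem exists_ringHom [CompleteSpace K] [IsDiscreteValuationRing (OK K)] (hπ : Irreducible π)
    (Y : DaggerPres K) (hsep : IsSep π Y.int) (σK : OK K →+* OK K) (hσ : π ∣ σK π)
    (y : Fin n → Y.int) :
    ∃ ψ : MW K n →+* Y.int, (∀ c, ψ (algebraMap (OK K) _ c) = algebraMap (OK K) Y.int (σK c)) ∧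
      ∀ i, ψ (MW.X i) = y i :=
  MW.exists_ringHom (j := (algebraMap (OK K) Y.int).comp σK) hπ hsep (map_dvd _ hσ)
    fun f => exists_eval hπ Y σK (norm_map_le hπ σK hσ) y f

end DaggerPres

end

/-! ## Saturated ideals of Monsky-Washnitzer algebras -/

/-- Every ideal of a polynomial ring over a field has a finite set of generators for which
membership is witnessed with a control on the degrees. -/
lemma exists_finset_degree_control {k : Type*} [Field k] {n : ℕ}
    (I : Ideal (MvPolynomial (Fin n) k)) :
    ∃ B : Finset (MvPolynomial (Fin n) k), (∀ b ∈ B, b ∈ I ∧ b ≠ 0) ∧ ∀ h ∈ I,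
      ∃ a : MvPolynomial (Fin n) k → MvPolynomial (Fin n) k, h = ∑ b ∈ B, a b * b ∧
        ∀ b ∈ B, a b = 0 ∨ (a b).totalDegree + b.totalDegree ≤ h.totalDegree := by
  classical
  -- A graded order is essential: the division algorithm bounds the leading monomials of the
  -- products `a b * b`, and for a graded order this bounds their total degrees. The finite set is a
  -- Gröbner basis, obtained from a finite set of generators of the ideal of leading monomials.
  let mo : MonomialOrder (Fin n) := MonomialOrder.degLex
  let D : Set (Fin n →₀ ℕ) := mo.degree '' {f | f ∈ I ∧ f ≠ 0}
  obtain ⟨s', hs', hspan⟩ := (Submodule.fg_span_iff_fg_span_finset_subset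
    (R := MvPolynomial (Fin n) k) ((fun d : Fin n →₀ ℕ => MvPolynomial.monomial d (1 : k)) '' D)).mp
      (IsNoetherian.noetherian _)
  have hch : ∀ x ∈ s', ∃ f, (f ∈ I ∧ f ≠ 0) ∧ MvPolynomial.monomial (mo.degree f) (1 : k) = x := by
    intro x hx
    obtain ⟨_, ⟨f, hf, rfl⟩, h⟩ := hs' hx
    exact ⟨f, hf, h⟩
  choose! F hF1 hF2 using hch
  have key : ∀ h ∈ I, h ≠ 0 → ∃ x ∈ s', mo.degree (F x) ≤ mo.degree h := by
    intro h hI h0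
    have h1 : MvPolynomial.monomial (mo.degree h) (1 : k) ∈
        Ideal.span ((fun d : Fin n →₀ ℕ => MvPolynomial.monomial d (1 : k)) ''
          ((fun x => mo.degree (F x)) '' (s' : Set (MvPolynomial (Fin n) k)))) := by
      have e : ((fun d : Fin n →₀ ℕ => MvPolynomial.monomial d (1 : k)) ''
          ((fun x => mo.degree (F x)) '' (s' : Set (MvPolynomial (Fin n) k)))) = s' := by
        rw [Set.image_image]
        ext x
        constructor
        · rintro ⟨y, hy, rfl⟩
          simpa only [hF2 y hy] using hy
        · intro hx
          exact ⟨x, hx, hF2 x hx⟩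
      rw [e]
      change _ ∈ Submodule.span _ _
      rw [← hspan]
      exact Submodule.subset_span ⟨_, ⟨h, ⟨hI, h0⟩, rfl⟩, rfl⟩
    rw [MvPolynomial.mem_ideal_span_monomial_image] at h1
    obtain ⟨_, ⟨x, hx, rfl⟩, hle⟩ := h1 (mo.degree h) (by
      rw [MvPolynomial.mem_support_iff, MvPolynomial.coeff_monomial, if_pos rfl]
      exact one_ne_zero)
    exact ⟨x, hx, hle⟩
  refine ⟨s'.image F, fun b hb => ?_, fun h hI => ?_⟩
  · obtain ⟨x, hx, rfl⟩ := Finset.mem_image.mp hb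
    exact hF1 x hx
  · have hB : ∀ b ∈ ((s'.image F : Finset _) : Set (MvPolynomial (Fin n) k)),
        IsUnit (mo.leadingCoeff b) := fun b hb => by
      obtain ⟨x, hx, rfl⟩ := Finset.mem_image.mp hb
      exact (MonomialOrder.leadingCoeff_ne_zero_iff.mpr (hF1 x hx).2).isUnit
    obtain ⟨g, r, h1, h2, h3⟩ := mo.div_set hB h
    -- A nonzero remainder would lie in `I`, so its leading monomial would be divisible by one of
    -- the chosen leading monomials, which division rules out.
    have hr : r = 0 := by
      by_contra hr0
      have hrI : r ∈ I := by
        have : r = h - Finsupp.linearCombination _ (fun b : ((s'.image F : Finset _) :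
          Set (MvPolynomial (Fin n) k)) => (b : MvPolynomial (Fin n) k)) g := by rw [h1]; ring
        rw [this]
        refine I.sub_mem hI ?_
        rw [Finsupp.linearCombination_apply]
        refine I.sum_mem fun b _ => I.mul_mem_left _ ?_
        obtain ⟨x, hx, h⟩ := Finset.mem_image.mp b.2
        rw [← h]
        exact (hF1 x hx).1
      obtain ⟨x, hx, hle⟩ := key r hrI hr0
      exact h3 _ (mo.degree_mem_support hr0) (F x) (by simpa using ⟨x, hx, rfl⟩) hle
    refine ⟨fun b => if hb : b ∈ s'.image F then g ⟨b, hb⟩ else 0, ?_, fun b hb => ?_⟩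
    · rw [h1, hr, add_zero, Finsupp.linearCombination_apply, Finsupp.sum_fintype _ _ (by simp),
        ← Finset.sum_coe_sort (s'.image F)]
      refine Finset.sum_congr rfl fun b _ => ?_
      simp
    · beta_reduce
      rw [dif_pos hb]
      by_cases h0 : g ⟨b, hb⟩ = 0
      · exact Or.inl h0
      · right
        have hb0 : b ≠ 0 := by
          obtain ⟨x, hx, rfl⟩ := Finset.mem_image.mp hb
          exact (hF1 x hx).2
        rw [← MvPolynomial.totalDegree_mul_of_isDomain h0 hb0, mul_comm]
        exact MvPolynomial.degLex_totalDegree_monotone (h2 ⟨b, hb⟩)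

section

variable {K : Type u} [NormedField K] [IsUltrametricDist K] {n m : ℕ}

lemma eq_zero_of_forall_pow_dvd {π : OK K} (hπ : Irreducible π) {c : OK K} (h : ∀ N, π ^ N ∣ c) :
    c = 0 := by
  by_contra hc
  have hc' : 0 < ‖(c : K)‖ := norm_pos_iff.mpr fun h => hc (Subtype.ext h)
  obtain ⟨N, hN⟩ := exists_pow_lt_of_lt_one hc' (norm_lt_one_of_irreducible hπ)
  exact absurd ((pow_dvd_iff_norm_le hπ N c).mp (h N)) (not_le.mpr hN)

namespace MW

lemma eq_zero_of_forall_pow_dvd {π : OK K} (hπ : Irreducible π) {f : MW K n}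
    (h : ∀ N, (algebraMap (OK K) (MW K n) π) ^ N ∣ f) : f = 0 :=
  ext_cf fun I => Dagger.eq_zero_of_forall_pow_dvd hπ fun N => (pow_dvd_iff hπ N f).mp (h N) I

/-- Convergent sums in `W_n` indexed by the natural numbers. -/
lemma exists_sum_nat [CompleteSpace K] {π : OK K} (hπ : Irreducible π) {ρ B : ℝ}
    (hρ : 1 < ρ) (hB : 0 ≤ B) (t : ℕ → MW K m) (ht : ∀ k, GB ρ B (π ^ k • t k)) :
    ∃ w : MW K m, GB ρ B w ∧ ∀ N, (algebraMap (OK K) (MW K m) π) ^ N ∣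
      w - ∑ k ∈ Finset.range N, π ^ k • t k := by
  refine exists_sum_of_dvd hπ hρ hB (fun k => π ^ k • t k) ht Finset.range fun N k hk => ?_
  rw [Finset.mem_range, not_lt] at hk
  rw [← algebraMap_pow_mul]
  exact (pow_dvd_pow _ hk).mul_right _

variable [IsDiscreteValuationRing (OK K)] {π : OK K}

lemma residue_eq_zero_iff (hπ : Irreducible π) (c : OK K) :
    IsLocalRing.residue (OK K) c = 0 ↔ π ∣ c := by
  rw [IsLocalRing.residue_eq_zero_iff, hπ.maximalIdeal_eq, Ideal.mem_span_singleton]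

/-- Reduction of an element of `W_n`, a polynomial over the residue field. -/
def redP (hπ : Irreducible π) (f : MW K n) :
    MvPolynomial (Fin n) (IsLocalRing.ResidueField (OK K)) :=
  (tr hπ 1 f).map (IsLocalRing.residue (OK K))

lemma coeff_redP (hπ : Irreducible π) (f : MW K n) (I : Fin n →₀ ℕ) :
    (redP hπ f).coeff I = IsLocalRing.residue (OK K) (cf f I) := by
  classical
  rw [redP, MvPolynomial.coeff_map, coeff_tr]
  split_ifs with h
  · rw [map_zero, eq_comm, residue_eq_zero_iff hπ]
    simpa using h
  · rfl

lemma redP_add (hπ : Irreducible π) (f g : MW K n) :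
    redP hπ (f + g) = redP hπ f + redP hπ g := by
  ext I; simp [coeff_redP]

lemma redP_mul (hπ : Irreducible π) (f g : MW K n) :
    redP hπ (f * g) = redP hπ f * redP hπ g := by
  classical
  ext I
  simp [coeff_redP, MvPolynomial.coeff_mul, cf_mul]

lemma redP_smul (hπ : Irreducible π) (f : MW K n) : redP hπ (π • f) = 0 := by
  ext I
  rw [coeff_redP, cf_smul, MvPolynomial.coeff_zero, residue_eq_zero_iff hπ]
  exact Dvd.intro _ rfl

lemma redP_sum (hπ : Irreducible π) {ι : Type*} (s : Finset ι) (f : ι → MW K n) :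
    redP hπ (∑ i ∈ s, f i) = ∑ i ∈ s, redP hπ (f i) := by
  ext I
  simp [coeff_redP, MvPolynomial.coeff_sum]

lemma exists_eq_smul_of_redP_eq_zero (hπ : Irreducible π) {f : MW K n} (h : redP hπ f = 0) :
    ∃ g, f = π • g := by
  rw [dvd_iff hπ.ne_zero]
  intro I
  rw [← residue_eq_zero_iff hπ, ← coeff_redP hπ, h, MvPolynomial.coeff_zero]

/-- Lifting a polynomial over the residue field, with control of its degree. -/
lemma exists_lift (hπ : Irreducible π) (P : MvPolynomial (Fin n) (IsLocalRing.ResidueField (OK K))) :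
    ∃ f : MW K n, redP hπ f = P ∧ ∀ ρ : ℝ, 1 < ρ → GB ρ (ρ ^ P.totalDegree) f := by
  classical
  choose l hl using IsLocalRing.residue_surjective (R := OK K)
  refine ⟨ofPoly (∑ I ∈ P.support, MvPolynomial.monomial I (l (P.coeff I))), ?_, fun ρ hρ I => ?_⟩
  · ext I
    rw [coeff_redP, cf_ofPoly, MvPolynomial.coeff_sum]
    simp only [MvPolynomial.coeff_monomial]
    rw [Finset.sum_ite_eq']
    split_ifs with h
    · exact hl _
    · rw [map_zero, eq_comm, ← MvPolynomial.notMem_support_iff]; exact h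
  · rw [cf_ofPoly, MvPolynomial.coeff_sum]
    simp only [MvPolynomial.coeff_monomial]
    rw [Finset.sum_ite_eq']
    split_ifs with h
    · refine le_trans (mul_le_of_le_one_left (by positivity) (norm_OK_le _)) ?_
      exact pow_le_pow_right₀ hρ.le (MvPolynomial.le_totalDegree h)
    · simp only [ZeroMemClass.coe_zero, norm_zero, zero_mul]; positivity

/-- A monomial of highest degree in the reduction comes from a coefficient of norm one. This
converts an analytic bound on `f` into a bound on the degree of its reduction. -/
lemma GB_of_redP (hπ : Irreducible π) {f : MW K n} {ρ B : ℝ} (hf : GB ρ B f)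
    (h : redP hπ f ≠ 0) : ρ ^ (redP hπ f).totalDegree ≤ B := by
  obtain ⟨I, hI, hdeg⟩ : ∃ I ∈ (redP hπ f).support, (redP hπ f).totalDegree = I.degree := by
    refine ⟨MonomialOrder.degLex.degree (redP hπ f), MonomialOrder.degree_mem_support h,
      MvPolynomial.degree_degLexDegree.symm⟩
  have h1 : ‖(cf f I : K)‖ = 1 := by
    refine le_antisymm (norm_OK_le _) ?_
    by_contra hlt
    rw [not_le] at hlt
    rw [MvPolynomial.mem_support_iff, coeff_redP, Ne, IsLocalRing.residue_eq_zero_iff] at hI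
    refine hI ?_
    rw [IsLocalRing.mem_maximalIdeal, mem_nonunits_iff]
    intro hu
    obtain ⟨d, hd⟩ := hu.exists_right_inv
    have h2 : ‖(cf f I : K)‖ * ‖(d : K)‖ = 1 := by
      have := congrArg (fun x : OK K => ‖(x : K)‖) hd
      simpa using this
    nlinarith [norm_OK_le d, norm_nonneg (d : K), norm_nonneg (cf f I : K)]
  have h2 := hf I
  rwa [h1, one_mul, ← hdeg] at h2

/-- A saturated ideal `J` is contained in `I` as soon as this holds modulo `π`. -/
theorem le_of_saturated [CompleteSpace K] (hπ : Irreducible π) (I J : Ideal (MW K n)) (hIJ : I ≤ J)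
    (hsat : ∀ f, π • f ∈ J → f ∈ J) (hmod : ∀ f ∈ J, ∃ g ∈ I, ∃ h, f = g + π • h) : J ≤ I := by
  classical
  -- The reduction of `I`. An element of `J` is divided by lifts of a Gröbner basis of `Ibar`, the
  -- remainder is divided by `π`, and this is repeated. The degree control must ensure that the
  -- resulting series of quotients converge in `W_n` and not merely `π`-adically.
  let Ibar : Ideal (MvPolynomial (Fin n) (IsLocalRing.ResidueField (OK K))) :=
    { carrier := {P | ∃ g ∈ I, redP hπ g = P}
      zero_mem' := ⟨0, I.zero_mem, by ext; simp [coeff_redP]⟩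
      add_mem' := by
        rintro _ _ ⟨g, hg, rfl⟩ ⟨g', hg', rfl⟩
        exact ⟨g + g', I.add_mem hg hg', redP_add hπ g g'⟩
      smul_mem' := by
        rintro P _ ⟨g, hg, rfl⟩
        obtain ⟨f, hf, -⟩ := exists_lift hπ P
        exact ⟨f * g, I.mul_mem_left _ hg, by rw [redP_mul, hf, smul_eq_mul]⟩ }
  obtain ⟨G, hG1, hG2⟩ := exists_finset_degree_control Ibar
  choose! F hFI hFred using fun b (hb : b ∈ G) => (hG1 b hb).1
  have hc0 := norm_pos_of_irreducible hπ
  have hc1 := norm_lt_one_of_irreducible hπ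
  -- uniform bounds for the generators
  have hF' : ∀ b, ∃ L E : MW K n, F b = L + π • E ∧
      (b ∈ G → ∀ ρ : ℝ, 1 < ρ → GB ρ (ρ ^ b.totalDegree) L) := by
    intro b
    obtain ⟨L, hL, hLG⟩ := exists_lift hπ b
    by_cases hb : b ∈ G
    · have h0 : redP hπ (F b + (-1 : OK K) • L) = 0 := by
        ext I
        rw [coeff_redP, cf_add, cf_smul, map_add, neg_one_mul, map_neg, ← coeff_redP hπ,
          ← coeff_redP hπ, hFred b hb, hL]
        simp
      obtain ⟨E, hE⟩ := exists_eq_smul_of_redP_eq_zero hπ h0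
      refine ⟨L, E, ?_, fun _ => hLG⟩
      rw [← hE]; simp
    · exact ⟨F b, 0, by simp, fun h => (hb h).elim⟩
  choose L E hLE hL using hF'
  intro f hfJ
  obtain ⟨ρ₁, hρ₁, B, hfB⟩ := f.2
  -- With `E b` of size at most `‖π‖⁻¹`, the correction `π • E b` has size at most `1`, so the
  -- generator `F b` has the same bound `ρ ^ b.totalDegree` as a lift of `b` of the same degree.
  obtain ⟨ρ₂, hρ₂, hE⟩ := exists_forall_GB_lt (fun b : G => E b) (B := ‖(π : K)‖⁻¹)
    ((one_lt_inv₀ hc0).mpr hc1)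
  obtain ⟨ρ, hρ, hρ1, hρ2⟩ : ∃ ρ : ℝ, 1 < ρ ∧ ρ ≤ ρ₁ ∧ ρ ≤ ρ₂ :=
    ⟨min ρ₁ ρ₂, lt_min hρ₁ hρ₂, min_le_left _ _, min_le_right _ _⟩
  replace hfB : GB ρ B f := GB.mono_left hfB (by linarith) hρ1
  have hFG : ∀ b ∈ G, GB ρ (ρ ^ b.totalDegree) (F b) := by
    intro b hb
    rw [hLE b]
    refine (hL b hb ρ hρ).add (GB.mono ((hE ρ hρ hρ2 ⟨b, hb⟩).smul π le_rfl) ?_) (by linarith)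
    rw [mul_inv_cancel₀ hc0.ne']
    exact one_le_pow₀ hρ.le
  -- The quotients have the same bound as `f`, and the new remainder loses only the factor `‖π‖⁻¹`
  -- caused by dividing by `π`. After `k` steps this loss is offset exactly by the factor `π ^ k` in
  -- front of the quotients.
  have step : ∀ (B : ℝ) (f : MW K n), f ∈ J → GB ρ B f →
      ∃ (a : MvPolynomial (Fin n) (IsLocalRing.ResidueField (OK K)) → MW K n) (f' : MW K n),
        (∀ b ∈ G, GB ρ B (a b)) ∧ f = ∑ b ∈ G, a b * F b + π • f' ∧ f' ∈ J ∧
        GB ρ (B / ‖(π : K)‖) f' := by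
    intro B f hfJ hfB
    have hfI : redP hπ f ∈ Ibar := by
      obtain ⟨g, hg, h, rfl⟩ := hmod f hfJ
      exact ⟨g, hg, by rw [redP_add, redP_smul, add_zero]⟩
    obtain ⟨a, ha1, ha2⟩ := hG2 _ hfI
    choose A hA1 hA2 using fun b => exists_lift hπ (a b)
    by_cases h0 : redP hπ f = 0
    · obtain ⟨f', rfl⟩ := exists_eq_smul_of_redP_eq_zero hπ h0
      refine ⟨0, f', fun b _ => ?_, by simp, hsat _ hfJ, hfB.of_smul hπ.ne_zero⟩
      intro I
      simpa using hfB.nonneg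
    · have hd := GB_of_redP hπ hfB h0
      let A' := fun b => if a b = 0 then 0 else A b
      have hA' : ∀ b ∈ G, redP hπ (A' b) = a b ∧ GB ρ B (A' b) ∧ GB ρ B (A' b * F b) := by
        intro b hb
        have hz : GB ρ B (0 : MW K n) := fun I => by simpa using hfB.nonneg
        by_cases hab : a b = 0
        · simp only [A', if_pos hab, zero_mul]
          exact ⟨by ext; simp [coeff_redP, hab], hz, hz⟩
        · simp only [A', if_neg hab]
          have hle := (ha2 b hb).resolve_left hab
          refine ⟨hA1 b, (hA2 b ρ hρ).mono ?_, ((hA2 b ρ hρ).mul (hFG b hb) (by linarith)).mono ?_⟩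
          · exact (pow_le_pow_right₀ hρ.le (by omega)).trans hd
          · rw [← pow_add]
            exact (pow_le_pow_right₀ hρ.le hle).trans hd
      have hsub : GB ρ B (f - ∑ b ∈ G, A' b * F b) :=
        hfB.sub (GB.sum (by linarith) hfB.nonneg fun b hb => (hA' b hb).2.2) (by linarith)
      have hJ : f - ∑ b ∈ G, A' b * F b ∈ J :=
        J.sub_mem hfJ (J.sum_mem fun b hb => J.mul_mem_left _ (hIJ (hFI b hb)))
      have hr : redP hπ (f - ∑ b ∈ G, A' b * F b) = 0 := by
        have h1 : redP hπ f = redP hπ (f - ∑ b ∈ G, A' b * F b) +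
            ∑ b ∈ G, redP hπ (A' b * F b) := by
          rw [← redP_sum, ← redP_add]; congr 1; ring
        have h2 : ∑ b ∈ G, redP hπ (A' b * F b) = ∑ b ∈ G, a b * b :=
          Finset.sum_congr rfl fun b hb => by rw [redP_mul, (hA' b hb).1, hFred b hb]
        rw [h2, ← ha1] at h1
        simpa using h1
      obtain ⟨f', hf'⟩ := exists_eq_smul_of_redP_eq_zero hπ hr
      refine ⟨A', f', fun b hb => (hA' b hb).2.1, by rw [← hf']; ring, ?_, ?_⟩
      · apply hsat; rw [← hf']; exact hJ
      · apply GB.of_smul hπ.ne_zero; rw [← hf']; exact hsub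
  choose! a f' ha hf hfJ' hfB' using step
  -- the sequence of successive quotients
  let s : ℕ → MW K n := fun k => Nat.rec f (fun k g => f' (B / ‖(π : K)‖ ^ k) g) k
  have hs : ∀ k, s k ∈ J ∧ GB ρ (B / ‖(π : K)‖ ^ k) (s k) := by
    intro k
    induction k with
    | zero => exact ⟨hfJ, by rw [pow_zero, div_one]; exact hfB⟩
    | succ k ih =>
      refine ⟨hfJ' _ _ ih.1 ih.2, ?_⟩
      have := hfB' _ _ ih.1 ih.2
      rwa [div_div, ← pow_succ] at this
  let A : MvPolynomial (Fin n) (IsLocalRing.ResidueField (OK K)) → ℕ → MW K n :=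
    fun b k => a (B / ‖(π : K)‖ ^ k) (s k) b
  have hA : ∀ b ∈ G, ∀ k, GB ρ B (π ^ k • A b k) := fun b hb k => by
    refine (ha _ _ (hs k).1 (hs k).2 b hb).smul _ ?_
    push_cast
    rw [norm_pow, mul_div_cancel₀ _ (pow_ne_zero _ hc0.ne')]
  have hsum : ∀ N, f = ∑ b ∈ G, (∑ k ∈ Finset.range N, π ^ k • A b k) * F b + π ^ N • s N := by
    intro N
    induction N with
    | zero => simp [s]
    | succ N ih =>
      have h1 : s N = ∑ b ∈ G, A b N * F b + π • s (N + 1) := hf _ _ (hs N).1 (hs N).2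
      rw [h1, smul_add, Finset.smul_sum, ← mul_smul, ← pow_succ] at ih
      simp_rw [Finset.sum_range_succ, add_mul, Finset.sum_add_distrib, smul_mul_assoc]
      rw [add_assoc]
      exact ih
  have hex : ∀ b, ∃ w : MW K n, b ∈ G → ∀ N, (algebraMap (OK K) (MW K n) π) ^ N ∣
      w - ∑ k ∈ Finset.range N, π ^ k • A b k := by
    intro b
    by_cases hb : b ∈ G
    · obtain ⟨w, -, hw⟩ := exists_sum_nat hπ hρ hfB.nonneg (A b) (hA b hb)
      exact ⟨w, fun _ => hw⟩
    · exact ⟨0, fun h => (hb h).elim⟩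
  choose w hw using hex
  have hfw : f = ∑ b ∈ G, w b * F b := by
    rw [← sub_eq_zero]
    refine eq_zero_of_forall_pow_dvd hπ fun N => ?_
    have h1 : f - ∑ b ∈ G, w b * F b = (algebraMap (OK K) (MW K n) π) ^ N * s N -
        ∑ b ∈ G, (w b - ∑ k ∈ Finset.range N, π ^ k • A b k) * F b := by
      conv_lhs => rw [hsum N]
      rw [algebraMap_pow_mul]
      simp_rw [sub_mul, Finset.sum_sub_distrib]
      ring
    rw [h1]
    exact dvd_sub (Dvd.intro _ rfl) (Finset.dvd_sum fun b hb => (hw b hb N).mul_right _)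
  rw [hfw]
  exact I.sum_mem fun b hb => I.mul_mem_left _ (hFI b hb)

end MW

end

/-! ## Integral elements of the Robba ring -/

section

variable {K : Type u} [NormedField K]

/-- Bounded coefficients in nonnegative degrees give convergence for all `s > 0`, geometric decay in
negative degrees gives it for `s < log ρ`. -/
lemma isRobba_of_bounds {f : ℤ → K} {C B ρ : ℝ} (hρ : 1 < ρ) (h1 : ∀ i, 0 ≤ i → ‖f i‖ ≤ C)
    (h2 : ∀ j : ℕ, ‖f (-j)‖ * ρ ^ j ≤ B) : IsRobba f := by
  have hlog : 0 < Real.log ρ := Real.log_pos hρ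
  refine (isRobba_iff f).mpr ⟨Real.log ρ, hlog, fun s hs hsr => ?_⟩
  set δ := min s (Real.log ρ - s) with hδ
  have hδ0 : 0 < δ := lt_min hs (by linarith)
  have hC : 0 ≤ C := (norm_nonneg _).trans (h1 0 le_rfl)
  refine Summable.of_nonneg_of_le (wt_nonneg s f) (fun i => ?_)
    ((summable_exp_abs hδ0).mul_left (max C B))
  have hM : 0 ≤ max C B := hC.trans (le_max_left _ _)
  rcases le_total 0 i with hi | hi
  · have hi' : (0 : ℝ) ≤ i := by exact_mod_cast hi
    unfold wt
    rw [abs_of_nonneg hi']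
    refine mul_le_mul ((h1 i hi).trans (le_max_left _ _)) ?_ (Real.exp_nonneg _) hM
    exact Real.exp_le_exp.mpr (neg_le_neg (mul_le_mul_of_nonneg_right (min_le_left _ _) hi'))
  · obtain ⟨j, rfl⟩ : ∃ j : ℕ, i = -j := ⟨(-i).toNat, by omega⟩
    have h3 : ρ ^ j = Real.exp (Real.log ρ * j) := by
      rw [mul_comm, Real.exp_nat_mul, Real.exp_log (by linarith)]
    have h4 := (h2 j).trans (le_max_right C B)
    rw [h3] at h4
    have h5 : |((-(j : ℤ) : ℤ) : ℝ)| = j := by push_cast; rw [abs_neg, abs_of_nonneg (by positivity)]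
    rw [h5]
    unfold wt
    have h6 : Real.exp (-(s * ((-(j : ℤ) : ℤ) : ℝ))) =
        Real.exp (Real.log ρ * j) * Real.exp (-((Real.log ρ - s) * j)) := by
      rw [← Real.exp_add]; congr 1; push_cast; ring
    rw [h6, ← mul_assoc]
    refine mul_le_mul h4 ?_ (Real.exp_nonneg _) hM
    exact Real.exp_le_exp.mpr (neg_le_neg (mul_le_mul_of_nonneg_right (min_le_right _ _)
      (by positivity)))

namespace Robba

lemma ext_coeff {f g : Robba K} (h : ∀ i, f.1 i = g.1 i) : f = g := Subtype.ext (funext h)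

@[simp] lemma coeff_add (f g : Robba K) (i : ℤ) : (f + g).1 i = f.1 i + g.1 i := rfl
@[simp] lemma coeff_sub (f g : Robba K) (i : ℤ) : (f - g).1 i = f.1 i - g.1 i := rfl
@[simp] lemma coeff_neg (f : Robba K) (i : ℤ) : (-f).1 i = -f.1 i := rfl
lemma coeff_one (i : ℤ) : (1 : Robba K).1 i = if i = 0 then 1 else 0 := by
  change (Pi.single 0 1 : ℤ → K) i = _
  rw [Pi.single_apply]
lemma coeff_mul (f g : Robba K) (i : ℤ) : (f * g).1 i = ∑' j, f.1 j * g.1 (i - j) := rfl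

/-- The monomial `c T^m`. -/
def mono (m : ℤ) (c : K) : Robba K := ⟨Pi.single m c, isRobba_single m c⟩

lemma coeff_mono (m : ℤ) (c : K) (i : ℤ) : (mono m c).1 i = if i = m then c else 0 :=
  Pi.single_apply m c i

lemma coeff_mono_mul (m : ℤ) (c : K) (f : Robba K) (i : ℤ) :
    (mono m c * f).1 i = c * f.1 (i - m) := conv_single c m f.1 i

lemma mono_mul_mono (m n : ℤ) (c d : K) : mono m c * mono n d = mono (m + n) (c * d) := by
  refine ext_coeff fun i => ?_
  rw [coeff_mono_mul, coeff_mono, coeff_mono]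
  by_cases h : i = m + n
  · rw [if_pos h, if_pos (by omega)]
  · rw [if_neg h, if_neg (by omega), mul_zero]

lemma mono_zero_one : (mono 0 1 : Robba K) = 1 := rfl

@[simp] lemma coeff_sum {ι : Type*} (s : Finset ι) (f : ι → Robba K) (i : ℤ) :
    (∑ j ∈ s, f j).1 i = ∑ j ∈ s, (f j).1 i := by
  classical
  induction s using Finset.induction_on with
  | empty => simp
  | insert a s ha ih => rw [Finset.sum_insert ha, Finset.sum_insert ha, coeff_add, ih]

section

variable [CompleteSpace K]

lemma C_eq_mono (c : K) : C c = mono 0 c := rfl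

lemma coeff_C_mul (c : K) (f : Robba K) (i : ℤ) : (C c * f).1 i = c * f.1 i := by
  rw [C_eq_mono, coeff_mono_mul, sub_zero]

/-- The series without negative powers. -/
def plus (K : Type u) [NormedField K] [CompleteSpace K] : Subring (Robba K) where
  carrier := {f | ∀ i < 0, f.1 i = 0}
  zero_mem' := fun _ _ => rfl
  one_mem' := fun i hi => by rw [coeff_one, if_neg hi.ne]
  add_mem' := fun hf hg i hi => by rw [coeff_add, hf i hi, hg i hi, add_zero]
  neg_mem' := fun hf i hi => by rw [coeff_neg, hf i hi, neg_zero]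
  mul_mem' := fun {f g} hf hg i hi => by
    rw [coeff_mul]
    refine (tsum_congr fun j => ?_).trans tsum_zero
    rcases lt_or_ge j 0 with hj | hj
    · rw [hf j hj, zero_mul]
    · rw [hg (i - j) (by omega), mul_zero]

lemma mem_plus {f : Robba K} : f ∈ plus K ↔ ∀ i < 0, f.1 i = 0 := Iff.rfl

/-- The power series underlying a series (negative powers are dropped). -/
def toPS (f : Robba K) : PowerSeries K := PowerSeries.mk fun n => f.1 n

@[simp] lemma coeff_toPS (f : Robba K) (n : ℕ) : PowerSeries.coeff n (toPS f) = f.1 n := by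
  simp [toPS]

lemma toPS_add (f g : Robba K) : toPS (f + g) = toPS f + toPS g := by
  ext n; simp

lemma toPS_mul {f g : Robba K} (hf : f ∈ plus K) (hg : g ∈ plus K) :
    toPS (f * g) = toPS f * toPS g := by
  ext n
  rw [PowerSeries.coeff_mul, coeff_toPS, coeff_mul,
    tsum_eq_sum (s := (Finset.range (n + 1)).map Nat.castEmbedding)]
  · rw [Finset.sum_map, Finset.Nat.sum_antidiagonal_eq_sum_range_succ_mk]
    refine Finset.sum_congr rfl fun k hk => ?_
    have hk' : k ≤ n := Nat.lt_succ_iff.mp (Finset.mem_range.mp hk)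
    simp only [Nat.castEmbedding_apply, coeff_toPS]
    rw [Nat.cast_sub hk']
  · intro j hj
    rcases lt_or_ge j 0 with h | h
    · rw [hf j h, zero_mul]
    · rw [hg (n - j) ?_, mul_zero]
      by_contra hlt
      refine hj (Finset.mem_map.mpr ⟨j.toNat, Finset.mem_range.mpr (by omega), ?_⟩)
      simp only [Nat.castEmbedding_apply]
      omega

lemma toPS_injOn {f g : Robba K} (hf : f ∈ plus K) (hg : g ∈ plus K) (h : toPS f = toPS g) :
    f = g := by
  refine ext_coeff fun i => ?_
  rcases lt_or_ge i 0 with hi | hi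
  · rw [hf i hi, hg i hi]
  · have := congrArg (PowerSeries.coeff i.toNat) h
    rw [coeff_toPS, coeff_toPS, Int.toNat_of_nonneg hi] at this
    exact this

end

end Robba

end

section

variable {K : Type u} [NormedField K] [IsUltrametricDist K] [CompleteSpace K] {n : ℕ}

namespace Robba

/-- The subring of series with integral coefficients. -/
def Rint (K : Type u) [NormedField K] [IsUltrametricDist K] [CompleteSpace K] :
    Subring (Robba K) where
  carrier := {f | ∀ i, ‖f.1 i‖ ≤ 1}
  zero_mem' := fun i => by simp
  one_mem' := fun i => by rw [coeff_one]; split_ifs <;> simp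
  add_mem' := fun hf hg i => (IsUltrametricDist.norm_add_le_max _ _).trans (max_le (hf i) (hg i))
  neg_mem' := fun {f} hf i => by rw [coeff_neg, norm_neg]; exact hf i
  mul_mem' := fun {f g} hf hg i => by
    rw [coeff_mul]
    refine IsUltrametricDist.norm_tsum_le_of_forall_le_of_nonneg zero_le_one fun j => ?_
    rw [norm_mul]
    exact mul_le_one₀ (hf _) (norm_nonneg _) (hg _)

instance : Algebra (OK K) (Rint K) :=
  ((C.comp (NormedField.valuation (K := K)).valuationSubring.subtype).codRestrict (Rint K) fun c i => by
    change ‖(mono 0 (c : K)).1 i‖ ≤ 1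
    rw [coeff_mono]
    split_ifs
    · exact norm_OK_le c
    · simp).toAlgebra

lemma algebraMap_Rint (c : OK K) : ((algebraMap (OK K) (Rint K) c : Rint K) : Robba K) = C (c : K) :=
  rfl

lemma pow_dvd_Rint_iff {π : OK K} (hπ : Irreducible π) (N : ℕ) (x : Rint K) :
    (algebraMap (OK K) (Rint K) π) ^ N ∣ x ↔ ∀ i, ‖x.1.1 i‖ ≤ ‖(π : K)‖ ^ N := by
  have hπ0 : (π : K) ≠ 0 := norm_pos_iff.mp (norm_pos_of_irreducible hπ)
  have e : ∀ y : Rint K, ((algebraMap (OK K) (Rint K) π) ^ N * y : Rint K).1 =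
      C ((π : K) ^ N) * y.1 := fun y => by
    rw [← map_pow]
    change C _ * y.1 = _
    congr 2
  constructor
  · rintro ⟨y, rfl⟩ i
    rw [e, coeff_C_mul, norm_mul, norm_pow]
    exact mul_le_of_le_one_right (by positivity) (y.2 i)
  · intro h
    refine ⟨⟨C (((π : K) ^ N)⁻¹) * x.1, fun i => ?_⟩, Subtype.ext ?_⟩
    · rw [coeff_C_mul, norm_mul, norm_inv, norm_pow]
      rw [inv_mul_le_iff₀ (pow_pos (norm_pos_of_irreducible hπ) N), mul_one]
      exact h i
    · rw [e]
      refine ext_coeff fun i => ?_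
      rw [coeff_C_mul, coeff_C_mul, mul_inv_cancel_left₀ (pow_ne_zero _ hπ0)]

lemma isSep_Rint {π : OK K} (hπ : Irreducible π) : IsSep π (Rint K) := fun x hx => by
  refine Subtype.ext (ext_coeff fun i => ?_)
  by_contra h0
  obtain ⟨N, hN⟩ := exists_pow_lt_of_lt_one (norm_pos_iff.mpr h0) (norm_lt_one_of_irreducible hπ)
  exact absurd ((pow_dvd_Rint_iff hπ N x).mp (hx N) i) (not_le.mpr hN)

/-- Power series with integral coefficients are elements of the Robba ring. -/
def ofPS : PowerSeries (OK K) →+* Rint K :=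
  have hR : ∀ f : PowerSeries (OK K), IsRobba fun i : ℤ =>
      if 0 ≤ i then ((PowerSeries.coeff i.toNat f : OK K) : K) else 0 := fun f => by
    refine isRobba_of_bounds (C := 1) (B := 1) one_lt_two (fun i hi => ?_) fun j => ?_
    · rw [if_pos hi]; exact norm_OK_le _
    · by_cases hj : j = 0
      · subst hj; simpa using norm_OK_le _
      · rw [if_neg (by omega)]; simp
  let F : PowerSeries (OK K) → Robba K := fun f => ⟨_, hR f⟩
  have hF : ∀ f, F f ∈ plus K := fun f i hi => if_neg (by omega)
  have hc : ∀ f, toPS (F f) = f.map (NormedField.valuation (K := K)).valuationSubring.subtype := fun f => by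
    ext n; simp [F]
  { toFun := fun f => ⟨F f, fun i => by
      change ‖if 0 ≤ i then _ else _‖ ≤ 1
      split_ifs
      · exact norm_OK_le _
      · simp⟩
    map_one' := Subtype.ext (toPS_injOn (hF 1) (one_mem _) (by
      change toPS (F 1) = toPS 1
      rw [hc, map_one]
      ext n
      rw [coeff_toPS, coeff_one, PowerSeries.coeff_one]; simp))
    map_mul' := fun f g => Subtype.ext (toPS_injOn (hF _) (mul_mem (hF f) (hF g)) (by
      change toPS (F (f * g)) = toPS (F f * F g)
      rw [toPS_mul (hF f) (hF g), hc, hc, hc, map_mul]))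
    map_zero' := Subtype.ext (toPS_injOn (hF 0) (zero_mem _) (by
      change toPS (F 0) = toPS 0
      rw [hc, map_zero]; ext n; simp))
    map_add' := fun f g => Subtype.ext (toPS_injOn (hF _) (add_mem (hF f) (hF g)) (by
      change toPS (F (f + g)) = toPS (F f + F g)
      rw [toPS_add, hc, hc, hc, map_add])) }

lemma coeff_ofPS (f : PowerSeries (OK K)) (i : ℤ) : (ofPS f).1.1 i =
    if 0 ≤ i then ((PowerSeries.coeff i.toNat f : OK K) : K) else 0 := rfl

/-- The series with no terms of degree less than `-d`. -/
def Low (d : ℕ) (f : Robba K) : Prop := ∀ i : ℤ, i < -d → f.1 i = 0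

lemma Low.mul {d e : ℕ} {f g : Robba K} (hf : Low d f) (hg : Low e g) : Low (d + e) (f * g) :=
  fun i hi => by
    rw [coeff_mul]
    refine (tsum_congr fun j => ?_).trans tsum_zero
    rcases lt_or_ge j (-d) with hj | hj
    · rw [hf j hj, zero_mul]
    · rw [hg (i - j) (by push_cast at hi; omega), mul_zero]

lemma low_one : Low 0 (1 : Robba K) := fun i hi => by
  rw [coeff_one, if_neg (by push_cast at hi; omega)]

lemma Low.pow {d : ℕ} {f : Robba K} (hf : Low d f) (k : ℕ) : Low (k * d) (f ^ k) := by
  induction k with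
  | zero => simpa using low_one
  | succ k ih => rw [pow_succ, Nat.succ_mul]; exact ih.mul hf

/-- The pole of a monomial is bounded by its degree, so in a sum `∑ c_I y ^ I` the decay of the
`c_I` becomes decay of the coefficients of negative powers of `T`. -/
lemma low_monomial {y : Fin n → Rint K} (hy : ∀ i, Low 1 (y i).1) (I : Fin n →₀ ℕ) :
    Low I.degree (I.prod fun i k => y i ^ k : Rint K).1 := by
  classical
  rw [Finsupp.degree_apply, Finsupp.prod]
  induction I.support using Finset.induction_on with
  | empty => simpa using low_one
  | insert a s ha ih =>
    rw [Finset.prod_insert ha, Finset.sum_insert ha]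
    have := (hy a).pow (I a)
    rw [mul_one] at this
    exact this.mul ih

lemma coeff_algebraMap_mul (c : OK K) (x : Rint K) (i : ℤ) :
    (algebraMap (OK K) (Rint K) c * x).1.1 i = c * x.1.1 i := coeff_C_mul _ _ _

/-- Evaluation of elements of `W_n` at integral series with at most a simple pole. -/
lemma exists_eval {π : OK K} (hπ : Irreducible π) (y : Fin n → Rint K) (hy : ∀ i, Low 1 (y i).1)
    (f : MW K n) : ∃ e : Rint K, ∀ N, (algebraMap (OK K) (Rint K) π) ^ N ∣
      e - MvPolynomial.eval₂ (algebraMap (OK K) (Rint K)) y (MW.tr hπ N f) := by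
  classical
  obtain ⟨ρ, hρ, B, hf⟩ := f.2
  let t (i : ℤ) (I : Fin n →₀ ℕ) : K := MW.cf f I * (I.prod fun j k => y j ^ k : Rint K).1.1 i
  have ht1 : ∀ i I, ‖t i I‖ ≤ ‖(MW.cf f I : K)‖ := fun i I => by
    simp only [t, norm_mul]
    exact mul_le_of_le_one_right (norm_nonneg _) ((I.prod fun j k => y j ^ k : Rint K).2 i)
  have ha3 : ∀ N I, I ∉ MW.trSet hπ N f → ‖(MW.cf f I : K)‖ ≤ ‖(π : K)‖ ^ N := fun N I hI => by
    rwa [MW.mem_trSet, not_not, pow_dvd_iff_norm_le hπ] at hI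
  have hsum : ∀ i, Summable (t i) := fun i => by
    refine NonarchimedeanAddGroup.summable_of_tendsto_cofinite_zero ?_
    rw [Metric.tendsto_nhds]
    intro ε hε
    obtain ⟨N, hN⟩ := exists_pow_lt_of_lt_one hε (norm_lt_one_of_irreducible hπ)
    filter_upwards [(MW.trSet hπ N f).finite_toSet.compl_mem_cofinite] with I hI
    rw [dist_zero_right]
    exact ((ht1 i I).trans (ha3 N I hI)).trans_lt hN
  have hle1 : ∀ i, ‖∑' I, t i I‖ ≤ 1 := fun i =>
    IsUltrametricDist.norm_tsum_le_of_forall_le_of_nonneg zero_le_one fun I =>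
      (ht1 i I).trans (norm_OK_le _)
  have hB : 0 ≤ B := MW.GB.nonneg hf
  -- Only the `I` with `|I| ≥ j` contribute to `T ^ (-j)`, and for these `‖c_I‖ ρ ^ j ≤ ‖c_I‖ ρ ^
  -- |I| ≤ B`. This is where overconvergence places the limit in the Robba ring.
  have hle2 : ∀ j : ℕ, ‖∑' I, t (-j) I‖ * ρ ^ j ≤ B := fun j => by
    rw [← le_div_iff₀ (by positivity)]
    refine IsUltrametricDist.norm_tsum_le_of_forall_le_of_nonneg (by positivity) fun I => ?_
    rcases lt_or_ge I.degree j with h | h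
    · simp only [t]
      rw [low_monomial hy I (-j) (by omega)]
      simp only [mul_zero, norm_zero]
      positivity
    · rw [le_div_iff₀ (by positivity)]
      refine le_trans ?_ (hf I)
      exact mul_le_mul (ht1 _ I) (pow_le_pow_right₀ hρ.le h) (by positivity) (norm_nonneg _)
  refine ⟨⟨⟨fun i => ∑' I, t i I, isRobba_of_bounds hρ (fun i _ => hle1 i) hle2⟩, hle1⟩,
    fun N => ?_⟩
  rw [pow_dvd_Rint_iff hπ]
  intro i
  have e : (MvPolynomial.eval₂ (algebraMap (OK K) (Rint K)) y (MW.tr hπ N f)).1.1 i =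
      ∑ I ∈ MW.trSet hπ N f, t i I := by
    rw [MW.tr, MvPolynomial.eval₂_sum, AddSubmonoidClass.coe_finsetSum, coeff_sum]
    refine Finset.sum_congr rfl fun I _ => ?_
    rw [MvPolynomial.eval₂_monomial, coeff_algebraMap_mul]
  change ‖(∑' I, t i I) - _‖ ≤ _
  rw [e]
  have h1 := (hsum i).sum_add_tsum_compl (s := MW.trSet hπ N f)
  rw [← h1, add_sub_cancel_left]
  exact IsUltrametricDist.norm_tsum_le_of_forall_le_of_nonneg (by positivity) fun I =>
    (ht1 i I).trans (ha3 N I I.2)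

theorem exists_ringHom {π : OK K} (hπ : Irreducible π) (y : Fin n → Rint K)
    (hy : ∀ i, Low 1 (y i).1) :
    ∃ ψ : MW K n →+* Rint K, (∀ c, ψ (algebraMap (OK K) _ c) = algebraMap (OK K) (Rint K) c) ∧
      ∀ i, ψ (MW.X i) = y i :=
  MW.exists_ringHom hπ (isSep_Rint hπ) dvd_rfl (exists_eval hπ y hy)

end Robba

end

/-! ## Embedding dagger algebras into the Robba ring -/

section

variable {K : Type u} [NormedField K] [IsUltrametricDist K] {n : ℕ}

lemma MW.incl_X (i : Fin n) : MW.incl n (MW.X i : MW K n) = MW.X i.castSucc := by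
  refine Subtype.ext ?_
  change MvPowerSeries.rename (R := OK K) (Fin.castSuccEmb (n := n)) (MvPowerSeries.X i) = _
  rw [MvPowerSeries.rename_X]
  rfl

namespace DaggerPres

/-- The presentation `W_{n+1} → (A_f)^int` of a localization. -/
def projLoc (X : DaggerPres K) (f : MW K X.n) : MW K (X.n + 1) →ₐ[OK K] (X.loc f).int :=
  (X.loc f).proj

lemma projLoc_eq_zero_iff (X : DaggerPres K) (f : MW K X.n) {g : MW K (X.n + 1)} :
    X.projLoc f g = 0 ↔ g ∈ X.I.map (MW.incl X.n) ⊔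
      Ideal.span {MW.incl X.n f * MW.X (Fin.last X.n) - 1} := (X.loc f).proj_eq_zero_iff

lemma toLoc_proj (X : DaggerPres K) (f g : MW K X.n) :
    X.toLoc f (X.proj g) = X.projLoc f (MW.incl X.n g) := rfl

/-- The last variable of the localization. -/
def locInv (X : DaggerPres K) (f : MW K X.n) : (X.loc f).int :=
  X.projLoc f (MW.X (Fin.last X.n))

lemma toLoc_mul_locInv (X : DaggerPres K) (f : MW K X.n) :
    X.toLoc f (X.proj f) * X.locInv f = 1 := by
  rw [toLoc_proj, locInv, ← map_mul, ← sub_eq_zero, ← map_one (X.projLoc f), ← map_sub,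
    projLoc_eq_zero_iff]
  exact Ideal.mem_sup_right (Ideal.subset_span rfl)

lemma exists_dvd_sub_aeval {π : OK K} (hπ : Irreducible π) (X : DaggerPres K) (x : X.int) :
    ∃ P : MvPolynomial (Fin X.n) (OK K), algebraMap (OK K) X.int π ∣
      x - MvPolynomial.aeval (fun i => X.proj (MW.X i)) P := by
  obtain ⟨f, rfl⟩ := X.proj_surjective x
  refine ⟨MW.tr hπ 1 f, ?_⟩
  have h := map_dvd X.proj (MW.pow_dvd_sub_tr hπ 1 f)
  rw [pow_one, AlgHom.commutes, map_sub] at h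
  convert h using 2
  rw [MW.ofPoly, ← AlgHom.comp_apply, MvPolynomial.comp_aeval]

section

variable {E : Type*} [CommRing E] [Algebra (OK K) E] {π : OK K}

/-- A homomorphism which is injective modulo `π`. -/
def ModInj (π : OK K) {X : DaggerPres K} (r : X.int →ₐ[OK K] E) : Prop :=
  ∀ x, algebraMap (OK K) E π ∣ r x → algebraMap (OK K) X.int π ∣ x

/-- The kernel of `W_n → E` contains `X.I`, is saturated because `E` has no `π`-torsion, and agrees
with `X.I` modulo `π` by assumption, so `MW.le_of_saturated` applies. -/
theorem ModInj.injective [CompleteSpace K] [IsDiscreteValuationRing (OK K)] (hπ : Irreducible π)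
    (hE : ∀ e : E, algebraMap (OK K) E π * e = 0 → e = 0) {X : DaggerPres K}
    {r : X.int →ₐ[OK K] E} (hr : ModInj π r) : Function.Injective r := by
  rw [injective_iff_map_eq_zero]
  intro x hx
  obtain ⟨f, rfl⟩ := X.proj_surjective x
  rw [proj_eq_zero_iff]
  let J : Ideal (MW K X.n) := RingHom.ker (r.comp X.proj)
  refine MW.le_of_saturated hπ X.I J (fun g hg => ?_) (fun g hg => ?_) (fun g hg => ?_)
    (show f ∈ J from hx)
  · change r (X.proj g) = 0
    rw [X.proj_eq_zero_iff.mpr hg, map_zero]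
  · refine hE _ ?_
    have : r (X.proj (π • g)) = 0 := hg
    rwa [map_smul, map_smul, Algebra.smul_def] at this
  · obtain ⟨y, hy⟩ := hr (X.proj g) (by
      rw [show r (X.proj g) = 0 from hg]; exact dvd_zero _)
    obtain ⟨h, rfl⟩ := X.proj_surjective y
    refine ⟨g - π • h, ?_, h, by abel⟩
    rw [← proj_eq_zero_iff, map_sub, hy, map_smul, Algebra.smul_def, sub_self]

/-- Modulo `π` the localization is the algebraic one: every element is congruent to a polynomial in
the generators, and a power of `f` moves the polynomial into the image of `X.int`. -/
theorem ModInj.loc (hπ : Irreducible π) {X : DaggerPres K} {r : X.int →ₐ[OK K] E}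
    (hr : ModInj π r) {f : MW K X.n} {r' : (X.loc f).int →ₐ[OK K] E}
    (h : ∀ x, r' (X.toLoc f x) = r x) : ModInj π r' := by
  have key : ∀ P : MvPolynomial (Fin (X.n + 1)) (OK K), ∃ (N : ℕ) (y : X.int),
      X.toLoc f (X.proj f) ^ N * MvPolynomial.aeval (fun i => X.projLoc f (MW.X i)) P =
        X.toLoc f y := by
    intro P
    induction P using MvPolynomial.induction_on with
    | C c => exact ⟨0, algebraMap _ _ c, by
        rw [pow_zero, one_mul, MvPolynomial.aeval_C, AlgHom.commutes]⟩
    | add P Q hP hQ =>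
      obtain ⟨N, y, hy⟩ := hP
      obtain ⟨M, z, hz⟩ := hQ
      refine ⟨N + M, X.proj f ^ M * y + X.proj f ^ N * z, ?_⟩
      rw [map_add, map_add, map_mul, map_mul, map_pow, map_pow, ← hy, ← hz]
      ring
    | mul_X P i hP =>
      obtain ⟨N, y, hy⟩ := hP
      induction i using Fin.lastCases with
      | last =>
        refine ⟨N + 1, y, ?_⟩
        rw [map_mul, MvPolynomial.aeval_X, ← hy]
        have := X.toLoc_mul_locInv f
        rw [locInv] at this
        linear_combination (X.toLoc f (X.proj f) ^ N *
          MvPolynomial.aeval (fun i => X.projLoc f (MW.X i)) P) * this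
      | cast i =>
        refine ⟨N, y * X.proj (MW.X i), ?_⟩
        rw [map_mul, map_mul, MvPolynomial.aeval_X, ← hy, toLoc_proj X f (MW.X i), MW.incl_X]
        ring
  intro z hz
  obtain ⟨P, c, hc⟩ := exists_dvd_sub_aeval hπ _ z
  change z - MvPolynomial.aeval (fun i => X.projLoc f (MW.X i)) P = _ at hc
  obtain ⟨N, y, hy⟩ := key P
  have hπr : ∀ w : (X.loc f).int, r' (algebraMap (OK K) _ π * w) = algebraMap (OK K) E π * r' w :=
    fun w => by rw [map_mul, AlgHom.commutes]
  have e1 : X.toLoc f (X.proj f) ^ N * z =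
      X.toLoc f y + algebraMap (OK K) _ π * (X.toLoc f (X.proj f) ^ N * c) := by
    rw [← hy]; linear_combination (X.toLoc f (X.proj f) ^ N) * hc
  have h1 : algebraMap (OK K) X.int π ∣ y := by
    refine hr y ?_
    rw [← h, eq_sub_of_add_eq e1.symm, map_sub, hπr, map_mul]
    exact dvd_sub (hz.mul_left _) (dvd_mul_right _ _)
  have h2 : algebraMap (OK K) (X.loc f).int π ∣ X.toLoc f (X.proj f) ^ N * z := by
    rw [e1]
    refine dvd_add ?_ (dvd_mul_right _ _)
    have := map_dvd (X.toLoc f) h1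
    rwa [AlgHom.commutes] at this
  have h3 : z = X.locInv f ^ N * (X.toLoc f (X.proj f) ^ N * z) := by
    rw [← mul_assoc, ← mul_pow, mul_comm (X.locInv f), toLoc_mul_locInv, one_pow, one_mul]
  rw [h3]
  exact h2.mul_left _

end

/-- Extension of a homomorphism to a localization. -/
theorem exists_loc_ringHom {E : Type*} [CommRing E] [Algebra (OK K) E] {π : OK K}
    (hπ : Irreducible π) (hsep : IsSep π E) {j : OK K →+* E} (hj : algebraMap (OK K) E π ∣ j π)
    {X : DaggerPres K} (r : X.int →+* E) (hr : ∀ c, r (algebraMap _ _ c) = j c) {f : MW K X.n}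
    {v : E} (hv : r (X.proj f) * v = 1)
    (H : ∃ ψ : MW K (X.n + 1) →+* E, (∀ c, ψ (algebraMap (OK K) _ c) = j c) ∧ ∀ i, ψ (MW.X i) =
      Fin.snoc (α := fun _ => E) (fun i => r (X.proj (MW.X i))) v i) :
    ∃ r' : (X.loc f).int →+* E, (∀ c, r' (algebraMap _ _ c) = j c) ∧
      (∀ x, r' (X.toLoc f x) = r x) ∧ r' (X.locInv f) = v := by
  obtain ⟨ψ, hψc, hψX⟩ := H
  have hψ : ∀ g, ψ (MW.incl X.n g) = r (X.proj g) := by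
    intro g
    have : ψ.comp (MW.incl X.n : MW K X.n →ₐ[OK K] MW K (X.n + 1)).toRingHom =
        r.comp X.proj.toRingHom := by
      refine MW.ringHom_ext hπ hsep ?_ (fun c => ?_) fun i => ?_
      · simpa [hψc] using hj
      · simp [hψc, hr]
      · change ψ (MW.incl X.n (MW.X i)) = r (X.proj (MW.X i))
        rw [MW.incl_X, hψX, Fin.snoc_castSucc]
    exact DFunLike.congr_fun this g
  have hker : ∀ g ∈ (X.loc f).I, ψ g = 0 := by
    have : (X.loc f).I ≤ RingHom.ker ψ := by
      refine sup_le (Ideal.map_le_iff_le_comap.mpr fun g hg => ?_)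
        ((Ideal.span_singleton_le_iff_mem _).mpr ?_)
      · change ψ (MW.incl X.n g) = 0
        rw [hψ, X.proj_eq_zero_iff.mpr hg, map_zero]
      · change ψ (_ * _ - 1) = 0
        rw [map_sub, map_mul, map_one, hψ, hψX, Fin.snoc_last, hv, sub_self]
    exact fun g hg => this hg
  let r' : (X.loc f).int →+* E := Ideal.Quotient.lift (X.loc f).I ψ hker
  have hr' : ∀ g, r' (X.projLoc f g) = ψ g := fun g => rfl
  refine ⟨r', fun c => ?_, fun x => ?_, ?_⟩
  · rw [← AlgHom.commutes (X.projLoc f), hr', hψc]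
  · obtain ⟨g, rfl⟩ := X.proj_surjective x
    rw [toLoc_proj, hr', hψ]
  · rw [locInv, hr', hψX, Fin.snoc_last]

/-- Homomorphisms out of a localization are determined by their restriction. -/
theorem loc_ringHom_ext {E : Type*} [CommRing E] [Algebra (OK K) E] {π : OK K}
    (hπ : Irreducible π) (hsep : IsSep π E) {X : DaggerPres K} {f : MW K X.n}
    {r₁ r₂ : (X.loc f).int →+* E} (hj : algebraMap (OK K) E π ∣ r₁ (algebraMap _ _ π))
    (h : ∀ x, r₁ (X.toLoc f x) = r₂ (X.toLoc f x)) : r₁ = r₂ := by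
  have hinv : r₁ (X.locInv f) = r₂ (X.locInv f) := by
    have h1 := congrArg r₁ (X.toLoc_mul_locInv f)
    have h2 := congrArg r₂ (X.toLoc_mul_locInv f)
    rw [map_mul, map_one] at h1 h2
    rw [← h] at h2
    calc _ = r₁ (X.locInv f) * (r₁ (X.toLoc f (X.proj f)) * r₂ (X.locInv f)) := by rw [h2, mul_one]
      _ = _ := by rw [← mul_assoc, mul_comm (r₁ (X.locInv f)), h1, one_mul]
  have hc : ∀ c, r₁ (algebraMap _ _ c) = r₂ (algebraMap _ _ c) := fun c => by
    rw [← AlgHom.commutes (X.toLoc f), h]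
  have : r₁.comp (X.projLoc f).toRingHom = r₂.comp (X.projLoc f).toRingHom := by
    refine MW.ringHom_ext hπ hsep ?_ (fun c => ?_) fun i => ?_
    · change _ ∣ r₁ (X.projLoc f (algebraMap _ _ π))
      rwa [AlgHom.commutes]
    · change r₁ (X.projLoc f (algebraMap _ _ c)) = r₂ (X.projLoc f (algebraMap _ _ c))
      rw [AlgHom.commutes, hc]
    · change r₁ (X.projLoc f (MW.X i)) = r₂ (X.projLoc f (MW.X i))
      induction i using Fin.lastCases with
      | last => exact hinv
      | cast i => rw [← MW.incl_X, ← toLoc_proj, h]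
  ext z
  obtain ⟨g, rfl⟩ := (X.loc f).proj_surjective z
  exact DFunLike.congr_fun this g

section

variable [CompleteSpace K]

open Robba

lemma Rint_eq_zero_of_mul {π : OK K} (hπ : Irreducible π) (e : Rint K)
    (h : algebraMap (OK K) (Rint K) π * e = 0) : e = 0 := by
  refine Subtype.ext (ext_coeff fun i => ?_)
  have := coeff_algebraMap_mul π e i
  rw [h] at this
  exact (mul_eq_zero.mp this.symm).resolve_left (norm_pos_iff.mp (norm_pos_of_irreducible hπ))

/-- Extension of a homomorphism to the Robba ring to a localization. -/
theorem exists_extend_loc {π : OK K} (hπ : Irreducible π) {X : DaggerPres K}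
    (r : X.int →ₐ[OK K] Rint K) (hr : ∀ i, Low 1 (r (X.proj (MW.X i))).1) {f : MW K X.n}
    {v : Rint K} (hv : r (X.proj f) * v = 1) (hv' : Low 1 v.1) :
    ∃ r' : (X.loc f).int →ₐ[OK K] Rint K, (∀ x, r' (X.toLoc f x) = r x) ∧
      r' (X.locInv f) = v ∧ ∀ i, Low 1 (r' ((X.loc f).proj (MW.X i))).1 := by
  have hH := Robba.exists_ringHom (n := X.n + 1) hπ
    (Fin.snoc (α := fun _ => Rint K) (fun i => r (X.proj (MW.X i))) v) (fun i => by
      induction i using Fin.lastCases with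
      | last => rwa [Fin.snoc_last]
      | cast i => rw [Fin.snoc_castSucc]; exact hr i)
  obtain ⟨r', h1, h2, h3⟩ := exists_loc_ringHom hπ (isSep_Rint hπ) dvd_rfl
    (r : X.int →+* Rint K) (fun c => r.commutes c) hv hH
  refine ⟨{ r' with commutes' := h1 }, h2, h3, fun i => ?_⟩
  change Low 1 (r' (X.projLoc f (MW.X i))).1
  change Fin (X.n + 1) at i
  induction i using Fin.lastCases with
  | last => rw [← locInv, h3]; exact hv'
  | cast i =>
    have := h2 (X.proj (MW.X i))
    rw [toLoc_proj, MW.incl_X] at this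
    rw [this]
    exact hr i

lemma isSep_of_injective {π : OK K} (hπ : Irreducible π) {X : DaggerPres K}
    {r : X.int →ₐ[OK K] Rint K} (hr : Function.Injective r) : IsSep π X.int := fun x hx => by
  refine (injective_iff_map_eq_zero r).mp hr x (isSep_Rint hπ _ fun N => ?_)
  have := map_dvd r (hx N)
  rwa [map_pow, AlgHom.commutes] at this

variable [CharZero K] (p : ℕ) [Fact p.Prime]

/-- The map from the dagger algebra to the Robba ring. -/
def toRobba {X : DaggerPres K} (r : X.int →ₐ[OK K] Rint K) : X.gen p →+* Robba K :=
  Robba.extend X p ((Rint K).subtype.comp (r : X.int →+* Rint K))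

lemma toRobba_algebraMap {X : DaggerPres K} (r : X.int →ₐ[OK K] Rint K) (x : X.int) :
    toRobba p r (algebraMap X.int (X.gen p) x) = (r x).1 := by
  rw [toRobba, Robba.extend]
  exact IsLocalization.Away.lift_eq (p : X.int) _ x

lemma exists_pow_mul_eq {X : DaggerPres K} (a : X.gen p) :
    ∃ (k : ℕ) (x : X.int), (p : X.gen p) ^ k * a = algebraMap X.int (X.gen p) x := by
  obtain ⟨k, x, h⟩ := IsLocalization.Away.surj (p : X.int) a
  exact ⟨k, x, by rw [mul_comm, ← h, map_natCast]⟩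

lemma toRobba_injective {X : DaggerPres K} {r : X.int →ₐ[OK K] Rint K}
    (hr : Function.Injective r) : Function.Injective (toRobba p r) := by
  rw [injective_iff_map_eq_zero]
  intro a ha
  obtain ⟨k, x, hx⟩ := exists_pow_mul_eq p a
  have h1 := congrArg (toRobba p r) hx
  rw [toRobba_algebraMap, map_mul, ha, mul_zero] at h1
  have h2 : x = 0 := (injective_iff_map_eq_zero r).mp hr x (Subtype.ext h1.symm)
  rw [h2, map_zero] at hx
  exact ((X.isUnit_p p).pow k).mul_right_eq_zero.mp hx

end

end DaggerPres

end

/-! ## Expansions at the point `u = 0` -/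

section

variable {K : Type u} [NormedField K] [IsUltrametricDist K] [IsDiscreteValuationRing (OK K)]
  {π : OK K}

namespace DaggerPres

variable {X : DaggerPres K}

/-- The special fibre is the quotient of `X.int` by `π`, since `π` generates the maximal ideal. -/
lemma dvd_of_one_tmul_eq_zero (hπ : Irreducible π) (x : X.int)
    (hx : (1 ⊗ₜ x : X.special) = 0) : algebraMap (OK K) X.int π ∣ x := by
  have h1 := TensorProduct.quotTensorEquivQuotSMul_mk_tmul
    (IsLocalRing.maximalIdeal (OK K)) (1 : OK K) x
  have h2 : (Ideal.Quotient.mk (IsLocalRing.maximalIdeal (OK K)) 1 ⊗ₜ[OK K] x :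
    (OK K ⧸ IsLocalRing.maximalIdeal (OK K)) ⊗[OK K] X.int) = 0 := hx
  rw [h2, map_zero, one_smul, eq_comm, Submodule.Quotient.mk_eq_zero, hπ.maximalIdeal_eq,
    Submodule.ideal_span_singleton_smul] at h1
  obtain ⟨y, -, hy⟩ := h1
  exact ⟨y, by rw [← hy, ← Algebra.smul_def]; rfl⟩

lemma exists_one_tmul (s : X.special) : ∃ x : X.int, s = 1 ⊗ₜ x := by
  induction s using TensorProduct.induction_on with
  | zero => exact ⟨0, (tmul_zero _ _).symm⟩
  | tmul c x =>
    obtain ⟨c, rfl⟩ := IsLocalRing.residue_surjective (R := OK K) c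
    refine ⟨c • x, ?_⟩
    rw [← TensorProduct.smul_tmul, Algebra.smul_def, mul_one]
    rfl
  | add a b ha hb =>
    obtain ⟨x, rfl⟩ := ha
    obtain ⟨y, rfl⟩ := hb
    exact ⟨x + y, (tmul_add _ _ _).symm⟩

/-- As the residue field at the point is `k`, every element of the special fibre is a constant plus
a multiple of `u`; the three terms are lifts of this relation. -/
lemma exists_eq_add_mul_add_mul (hπ : Irreducible π) {u : MW K X.n}
    (hu : Function.Surjective
      (algebraMap (IsLocalRing.ResidueField (OK K)) (X.special ⧸ Ideal.span {X.red u})))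
    (x : X.int) : ∃ (c : OK K) (z w : X.int),
      x = algebraMap _ _ c + X.proj u * z + algebraMap _ _ π * w := by
  obtain ⟨c, hc⟩ := hu (Ideal.Quotient.mk _ (1 ⊗ₜ x))
  obtain ⟨c, rfl⟩ := IsLocalRing.residue_surjective c
  have h1 : (1 ⊗ₜ x : X.special) - algebraMap _ _ (IsLocalRing.residue _ c) ∈
      Ideal.span {X.red u} := by
    rw [← Ideal.Quotient.eq_zero_iff_mem, map_sub, ← hc, sub_eq_zero]
    rfl
  obtain ⟨s, hs⟩ := Ideal.mem_span_singleton.mp h1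
  obtain ⟨z, rfl⟩ := exists_one_tmul s
  have h2 : (1 ⊗ₜ (x - algebraMap _ _ c - X.proj u * z) : X.special) = 0 := by
    rw [tmul_sub, tmul_sub]
    rw [red, Algebra.TensorProduct.tmul_mul_tmul, mul_one] at hs
    have h3 : (algebraMap _ X.special (IsLocalRing.residue _ c)) =
        (1 : IsLocalRing.ResidueField (OK K)) ⊗ₜ[OK K] (algebraMap _ X.int c) := by
      rw [Algebra.TensorProduct.algebraMap_apply, Algebra.algebraMap_eq_smul_one (R := OK K) c,
        ← TensorProduct.smul_tmul, Algebra.smul_def, mul_one]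
      rfl
    rw [← hs, h3, sub_self]
  obtain ⟨w, hw⟩ := dvd_of_one_tmul_eq_zero hπ _ h2
  exact ⟨c, z, w, by rw [← hw]; ring⟩

/-- The hypothesis says that the reduction of `x` lies in every power of `(u)`, so it vanishes by
Krull's intersection theorem. -/
lemma dvd_of_forall_mem_pow (hπ : Irreducible π)
    (hX : Algebra.Smooth (IsLocalRing.ResidueField (OK K)) X.special)
    (hconn : ConnectedSpace (PrimeSpectrum X.special)) {u : MW K X.n}
    (hu : (Ideal.span {X.red u}).IsPrime) (x : X.int)
    (hx : ∀ m : ℕ, ∃ y w : X.int, x = X.proj u ^ m * y + algebraMap _ _ π * w) :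
    algebraMap (OK K) X.int π ∣ x := by
  refine dvd_of_one_tmul_eq_zero hπ x (eq_zero_of_forall_mem_span_pow
    (k := IsLocalRing.ResidueField (OK K)) (X.red u) hu _ fun m => ?_)
  obtain ⟨y, w, h⟩ := hx m
  rw [Ideal.span_singleton_pow, Ideal.mem_span_singleton]
  refine ⟨1 ⊗ₜ y, ?_⟩
  have h0 : (1 : IsLocalRing.ResidueField (OK K)) ⊗ₜ[OK K] (algebraMap (OK K) X.int π * w) = 0 := by
    rw [← Algebra.smul_def, ← TensorProduct.smul_tmul, Algebra.smul_def, mul_one]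
    have : algebraMap (OK K) (IsLocalRing.ResidueField (OK K)) π = 0 :=
      (MW.residue_eq_zero_iff hπ π).mpr dvd_rfl
    rw [this, zero_tmul]
  rw [h, tmul_add, h0, add_zero, red, Algebra.TensorProduct.tmul_pow,
    Algebra.TensorProduct.tmul_mul_tmul, one_pow, mul_one]

variable [CompleteSpace K] {u : MW K X.n} {ρ : X.int →ₐ[OK K] PowerSeries (OK K)}

/-- If the expansion of `y` vanishes modulo `π`, so does its constant term; hence `y = u z` modulo
`π`, and the expansion of `z` again vanishes modulo `π`. Iteration places `x` in `(u ^ m, π)` for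
every `m`. -/
lemma dvd_of_dvd_coeff (hπ : Irreducible π)
    (hX : Algebra.Smooth (IsLocalRing.ResidueField (OK K)) X.special)
    (hconn : ConnectedSpace (PrimeSpectrum X.special))
    (hu : (Ideal.span {X.red u}).IsPrime) (hu' : Function.Surjective
      (algebraMap (IsLocalRing.ResidueField (OK K)) (X.special ⧸ Ideal.span {X.red u})))
    (hρ : ρ (X.proj u) = PowerSeries.X) (x : X.int)
    (hx : ∀ i, π ∣ PowerSeries.coeff i (ρ x)) : algebraMap (OK K) X.int π ∣ x := by
  have hπρ : ∀ w i, PowerSeries.coeff i (ρ (algebraMap _ _ π * w)) =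
      π * PowerSeries.coeff i (ρ w) := fun w i => by
    rw [← Algebra.smul_def, map_smul, PowerSeries.coeff_smul, smul_eq_mul]
  have key : ∀ m : ℕ, ∃ y w : X.int, x = X.proj u ^ m * y + algebraMap _ _ π * w ∧
      ∀ i, π ∣ PowerSeries.coeff i (ρ y) := by
    intro m
    induction m with
    | zero => exact ⟨x, 0, by simp, hx⟩
    | succ m ih =>
      obtain ⟨y, w, hxy, hy⟩ := ih
      obtain ⟨c, z, w', h⟩ := exists_eq_add_mul_add_mul hπ hu' y
      have h0 : ∀ i, PowerSeries.coeff i (ρ y) = PowerSeries.coeff i (algebraMap (OK K) _ c) +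
          PowerSeries.coeff i (PowerSeries.X * ρ z) + π * PowerSeries.coeff i (ρ w') := by
        intro i
        rw [h, map_add, map_add, hπρ, map_add, map_mul, hρ, AlgHom.commutes, map_add]
      have hc : π ∣ c := by
        have h1 := hy 0
        rw [h0, PowerSeries.coeff_zero_X_mul, add_zero, PowerSeries.algebraMap_apply,
          PowerSeries.coeff_zero_C] at h1
        exact (dvd_add_left (dvd_mul_right _ _)).mp h1
      obtain ⟨c', rfl⟩ := hc
      refine ⟨z, w + X.proj u ^ m * (algebraMap _ _ c' + w'), ?_, fun i => ?_⟩
      · rw [hxy, h, map_mul]; ring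
      · have h1 := hy (i + 1)
        rw [h0, PowerSeries.coeff_succ_X_mul, PowerSeries.algebraMap_apply, PowerSeries.coeff_C,
          if_neg (Nat.succ_ne_zero i), zero_add] at h1
        exact (dvd_add_left (dvd_mul_right _ _)).mp h1
  exact dvd_of_forall_mem_pow hπ hX hconn hu x fun m => by
    obtain ⟨y, w, h, -⟩ := key m
    exact ⟨y, w, h⟩

/-- The kernel `J` of the constant term contains `X.I` and `u` and is saturated, as `O` is a domain.
Modulo `π` it is no larger than `X.I + (u)`, because the residue field at the point is `k`. So
`MW.le_of_saturated` makes the two ideals equal. -/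
lemma exists_eq_mul_of_coeff_zero (hπ : Irreducible π) (hu' : Function.Surjective
      (algebraMap (IsLocalRing.ResidueField (OK K)) (X.special ⧸ Ideal.span {X.red u})))
    (hρ : ρ (X.proj u) = PowerSeries.X) (x : X.int)
    (hx : PowerSeries.coeff 0 (ρ x) = 0) : ∃ y, x = X.proj u * y := by
  obtain ⟨f, rfl⟩ := X.proj_surjective x
  let J : Ideal (MW K X.n) := RingHom.ker
    ((PowerSeries.constantCoeff (R := OK K)).comp (ρ.comp X.proj).toRingHom)
  have hJ : ∀ f, f ∈ J ↔ PowerSeries.coeff 0 (ρ (X.proj f)) = 0 := fun f => by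
    rw [PowerSeries.coeff_zero_eq_constantCoeff]
    rfl
  have hle : J ≤ X.I ⊔ Ideal.span {u} := by
    refine MW.le_of_saturated hπ _ J (sup_le (fun g hg => ?_)
      ((Ideal.span_singleton_le_iff_mem _).mpr ?_)) (fun g hg => ?_) fun g hg => ?_
    · rw [hJ, X.proj_eq_zero_iff.mpr hg, map_zero, map_zero]
    · rw [hJ, hρ, PowerSeries.coeff_zero_X]
    · rw [hJ, map_smul, map_smul, PowerSeries.coeff_smul] at hg
      rw [hJ]
      exact (mul_eq_zero.mp hg).resolve_left hπ.ne_zero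
    · rw [hJ] at hg
      obtain ⟨c, z, w, h⟩ := exists_eq_add_mul_add_mul hπ hu' (X.proj g)
      rw [h, map_add, map_add, ← Algebra.smul_def, map_smul, PowerSeries.coeff_smul, map_add,
        map_mul, hρ, AlgHom.commutes, map_add, PowerSeries.coeff_zero_X_mul, add_zero,
        PowerSeries.algebraMap_apply, PowerSeries.coeff_zero_C, smul_eq_mul] at hg
      obtain ⟨z, rfl⟩ := X.proj_surjective z
      obtain ⟨w, rfl⟩ := X.proj_surjective w
      -- Vanishing of the constant term of `g` reads `c + π d = 0`; the constant `c` is thus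
      -- absorbed by replacing `w` with `w - d`.
      set d := PowerSeries.coeff 0 (ρ (X.proj w))
      refine ⟨(g - π • (w - algebraMap _ _ d) - u * z) + u * z, ?_, w - algebraMap _ _ d, by ring⟩
      refine add_mem (Ideal.mem_sup_left ?_)
        (Ideal.mem_sup_right (Ideal.mul_mem_right _ _ (Ideal.subset_span rfl)))
      rw [← proj_eq_zero_iff, map_sub, map_sub, h, map_smul, map_sub, AlgHom.commutes, map_mul,
        Algebra.smul_def]
      have hc : algebraMap (OK K) X.int c = - (algebraMap _ _ π * algebraMap _ _ d) := by
        have hg' : c = -(π * d) := eq_neg_of_add_eq_zero_left hg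
        rw [hg', map_neg, map_mul]
      rw [hc]; ring
  obtain ⟨a, ha, b, hb, hab⟩ := Submodule.mem_sup.mp (hle ((hJ f).mpr hx))
  obtain ⟨y, rfl⟩ := Ideal.mem_span_singleton.mp hb
  refine ⟨X.proj y, ?_⟩
  rw [← hab, map_add, X.proj_eq_zero_iff.mpr ha, zero_add, map_mul]

open Robba

/-- The map to the Robba ring given by an expansion. -/
def expand (ρ : X.int →ₐ[OK K] PowerSeries (OK K)) : X.int →ₐ[OK K] Rint K where
  __ := (ofPS (K := K)).comp ρ.toRingHom
  commutes' c := by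
    refine Subtype.ext (ext_coeff fun i => ?_)
    change (ofPS (ρ (algebraMap _ _ c))).1.1 i = (C (c : K)).1 i
    rw [AlgHom.commutes, coeff_ofPS, C_eq_mono, coeff_mono, PowerSeries.algebraMap_apply,
      PowerSeries.coeff_C]
    by_cases h : i = 0
    · subst h; simp
    · rw [if_neg h]
      split_ifs <;> first | rfl | omega

lemma expand_apply (x : X.int) : expand ρ x = ofPS (ρ x) := rfl

lemma modInj_expand (hπ : Irreducible π)
    (h : ∀ x, (∀ i, π ∣ PowerSeries.coeff i (ρ x)) → algebraMap (OK K) X.int π ∣ x) :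
    ModInj π (expand ρ) := fun x hx => h x fun i => by
  have h1 := (pow_dvd_Rint_iff hπ 1 (expand ρ x)).mp (by rwa [pow_one]) (i : ℤ)
  rw [pow_one, expand_apply, coeff_ofPS, if_pos (by positivity), Int.toNat_natCast] at h1
  exact (dvd_iff_norm_le hπ.ne_zero).mpr h1

end DaggerPres

end

/-! ## Decomposition of elements of the punctured dagger algebra -/

section

variable {K : Type u} [NormedField K] [IsUltrametricDist K] [CompleteSpace K]
  {π : OK K} {n : ℕ}

lemma eq_of_forall_norm_sub_le (hπ : Irreducible π) {a b : K}
    (h : ∀ N : ℕ, ‖a - b‖ ≤ ‖(π : K)‖ ^ N) : a = b := by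
  by_contra hab
  obtain ⟨N, hN⟩ := exists_pow_lt_of_lt_one (norm_pos_iff.mpr (sub_ne_zero.mpr hab))
    (norm_lt_one_of_irreducible hπ)
  exact absurd (h N) (not_le.mpr hN)

namespace MW

/-- The monomial `x^I`. -/
def xpow (I : Fin n →₀ ℕ) : MW K n := ofPoly (MvPolynomial.monomial I 1)

lemma xpow_add (I J : Fin n →₀ ℕ) : (xpow (I + J) : MW K n) = xpow I * xpow J := by
  rw [xpow, xpow, xpow, ← map_mul, MvPolynomial.monomial_mul, one_mul]

lemma xpow_zero : (xpow 0 : MW K n) = 1 := by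
  rw [xpow, MvPolynomial.monomial_zero', map_one, map_one]

lemma xpow_single (i : Fin n) : (xpow (Finsupp.single i 1) : MW K n) = X i := by
  rw [xpow, ofPoly]
  exact MvPolynomial.aeval_X _ _

lemma GB_xpow {ρ : ℝ} (hρ : 0 ≤ ρ) (I : Fin n →₀ ℕ) : GB ρ (ρ ^ I.degree) (xpow I : MW K n) := by
  classical
  intro J
  rw [xpow, cf_ofPoly, MvPolynomial.coeff_monomial]
  split_ifs with h
  · subst h; simp
  · simpa using pow_nonneg hρ _

lemma pow_dvd_sub_sum_xpow (hπ : Irreducible π) (N : ℕ) (f : MW K n) :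
    (algebraMap (OK K) (MW K n) π) ^ N ∣ f - ∑ I ∈ trSet hπ N f, cf f I • xpow I := by
  convert pow_dvd_sub_tr hπ N f using 2
  rw [tr, map_sum]
  refine Finset.sum_congr rfl fun I _ => ?_
  rw [xpow, ← map_smul, MvPolynomial.smul_monomial, smul_eq_mul, mul_one]

/-- The inverse is the geometric series. At a radius where `w` has size at most `‖π‖⁻¹`, all powers
of `π • w` are bounded by `1`, so the series converges in `W_n`. -/
lemma isUnit_one_add_smul (hπ : Irreducible π) (w : MW K n) : IsUnit (1 + π • w) := by
  have hb : 1 < ‖(π : K)‖⁻¹ := by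
    rw [one_lt_inv₀ (norm_pos_of_irreducible hπ)]; exact norm_lt_one_of_irreducible hπ
  obtain ⟨ρ, hρ, h⟩ := exists_GB_lt w hb
  have hw := h ρ hρ le_rfl
  have hw' : GB ρ 1 (π • (-w)) := hw.neg.smul _ (by
    rw [mul_inv_cancel₀ (norm_pos_of_irreducible hπ).ne'])
  obtain ⟨s, -, hs⟩ := exists_sum_nat hπ hρ zero_le_one (fun k => (-w) ^ k) (fun k => by
    rw [← smul_pow]
    simpa using hw'.pow (by linarith) k)
  refine IsUnit.of_mul_eq_one s ?_
  rw [← sub_eq_zero]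
  refine eq_zero_of_forall_pow_dvd hπ fun N => ?_
  have h1 : (1 + π • w) * ∑ k ∈ Finset.range N, π ^ k • (-w) ^ k = 1 - (π • (-w)) ^ N := by
    rw [← mul_neg_geom_sum, smul_neg, sub_neg_eq_add]
    simp only [← smul_neg, smul_pow]
  have h2 : (1 + π • w) * s - 1 = (1 + π • w) * (s - ∑ k ∈ Finset.range N, π ^ k • (-w) ^ k) -
      (π • (-w)) ^ N := by rw [mul_sub, h1]; ring
  rw [h2]
  refine dvd_sub ((hs N).mul_left _) ?_
  rw [smul_pow, ← algebraMap_pow_mul]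
  exact dvd_mul_right _ _

end MW

namespace Robba

/-- The monomial `T^m`. -/
def Tpow (K : Type u) [NormedField K] [IsUltrametricDist K] [CompleteSpace K] (m : ℤ) : Rint K :=
  ⟨mono m 1, fun i => by rw [coeff_mono]; split_ifs <;> simp⟩

lemma Tpow_mul (m k : ℤ) : Tpow K m * Tpow K k = Tpow K (m + k) :=
  Subtype.ext (by change mono m 1 * mono k 1 = mono (m + k) 1; rw [mono_mul_mono, one_mul])

lemma Tpow_zero : Tpow K 0 = 1 := rfl

lemma Tpow_pow (m : ℤ) (k : ℕ) : Tpow K m ^ k = Tpow K (k * m) := by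
  induction k with
  | zero => rw [pow_zero, Nat.cast_zero, zero_mul, Tpow_zero]
  | succ k ih => rw [pow_succ, ih, Tpow_mul]; congr 1; push_cast; ring

lemma coeff_Tpow_mul (m : ℤ) (f : Rint K) (i : ℤ) : (Tpow K m * f).1.1 i = f.1.1 (i - m) := by
  change (mono m 1 * f.1).1 i = _
  rw [coeff_mono_mul, one_mul]

lemma norm_coeff_sub_le (hπ : Irreducible π) {N : ℕ} {x y : Rint K}
    (h : (algebraMap (OK K) (Rint K) π) ^ N ∣ x - y) (i : ℤ) :
    ‖x.1.1 i - y.1.1 i‖ ≤ ‖(π : K)‖ ^ N := (pow_dvd_Rint_iff hπ N _).mp h i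

end Robba

namespace DaggerPres

open Robba

section

variable {Y : DaggerPres K} (r : Y.int →ₐ[OK K] Rint K) {w : MW K Y.n}

lemma map_pow_dvd {E E' : Type*} [CommRing E] [Algebra (OK K) E] [CommRing E'] [Algebra (OK K) E']
    (r : E →ₐ[OK K] E') {N : ℕ} {x : E} (h : (algebraMap (OK K) E π) ^ N ∣ x) :
    (algebraMap (OK K) E' π) ^ N ∣ r x := by
  have := map_dvd r h
  rwa [map_pow, AlgHom.commutes] at this

/-- Division by the parameter, with control of the growth of the coefficients. -/
lemma exists_div (hπ : Irreducible π) (hw : r (Y.proj w) = Tpow K 1)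
    (hdiv : ∀ i, ∃ (c : OK K) (q : MW K Y.n),
      Y.proj (MW.X i) = algebraMap _ _ c + Y.proj w * Y.proj q) {b : ℝ} (hb : 1 < b) :
    ∃ ρ₀ : ℝ, 1 < ρ₀ ∧ ∀ ρ, 1 < ρ → ρ ≤ ρ₀ → ∀ B f, MW.GB ρ B f → ∃ q : MW K Y.n,
      MW.GB ρ (B * b) q ∧ ∀ i, 0 ≤ i → (r (Y.proj q)).1.1 i = (r (Y.proj f)).1.1 (i + 1) := by
  choose c q hcq using hdiv
  obtain ⟨ρ₀, hρ₀, hq⟩ := MW.exists_forall_GB_lt q hb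
  refine ⟨ρ₀, hρ₀, fun ρ hρ hρρ₀ B f hf => ?_⟩
  have hρ0 : 0 < ρ := by linarith
  -- If `x^I = c + w q` and `x^J = c' + w q'`, then `x^(I+J) = c c' + w (c q' + x^J q)`. Both terms
  -- of the new quotient respect the bound, so a monomial of any degree costs only a single factor
  -- `b`.
  have mon : ∀ I : Fin Y.n →₀ ℕ, ∃ (c : OK K) (q : MW K Y.n), MW.GB ρ (b * ρ ^ I.degree) q ∧
      Y.proj (MW.xpow I) = algebraMap _ _ c + Y.proj w * Y.proj q := by
    have hadd : ∀ I J : Fin Y.n →₀ ℕ,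
        (∃ (c : OK K) (q : MW K Y.n), MW.GB ρ (b * ρ ^ I.degree) q ∧
          Y.proj (MW.xpow I) = algebraMap _ _ c + Y.proj w * Y.proj q) →
        (∃ (c : OK K) (q : MW K Y.n), MW.GB ρ (b * ρ ^ J.degree) q ∧
          Y.proj (MW.xpow J) = algebraMap _ _ c + Y.proj w * Y.proj q) →
        ∃ (c : OK K) (q : MW K Y.n), MW.GB ρ (b * ρ ^ (I + J).degree) q ∧
          Y.proj (MW.xpow (I + J)) = algebraMap _ _ c + Y.proj w * Y.proj q := by
      rintro I J ⟨c, q, hq, e⟩ ⟨c', q', hq', e'⟩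
      refine ⟨c * c', c • q' + MW.xpow J * q, ?_, ?_⟩
      · rw [map_add]
        refine MW.GB.add ((hq'.smul_le c).mono ?_)
          (((MW.GB_xpow hρ0.le J).mul hq hρ0).mono (le_of_eq (by rw [pow_add]; ring))) hρ0.le
        have : (1 : ℝ) ≤ ρ ^ I.degree := one_le_pow₀ hρ.le
        rw [pow_add]
        nlinarith [mul_nonneg (by linarith : 0 ≤ b) (pow_nonneg hρ0.le J.degree)]
      · rw [MW.xpow_add, map_mul, map_add, map_mul, map_mul, map_smul, e', e, Algebra.smul_def]
        ring
    intro I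
    induction I using Finsupp.induction_linear with
    | zero =>
      refine ⟨1, 0, fun I => ?_, by rw [MW.xpow_zero, map_one, map_one, map_zero]; ring⟩
      rw [MW.cf_zero]
      simp only [ZeroMemClass.coe_zero, norm_zero, zero_mul]
      positivity
    | add I J hI hJ => exact hadd I J hI hJ
    | single i k =>
      induction k with
      | zero =>
        refine ⟨1, 0, fun I => ?_, by
          rw [Finsupp.single_zero, MW.xpow_zero, map_one, map_one, map_zero]; ring⟩
        rw [MW.cf_zero]
        simp only [ZeroMemClass.coe_zero, norm_zero, zero_mul]
        positivity
      | succ k ih =>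
        rw [Finsupp.single_add]
        refine hadd _ _ ih ⟨c i, q i, (hq ρ hρ hρρ₀ i).mono ?_, by rw [MW.xpow_single, hcq]⟩
        rw [Finsupp.degree_single, pow_one]
        nlinarith
  choose c q hq e using mon
  obtain ⟨s, hs, hsN⟩ := MW.exists_sum hπ hf hρ (by linarith : (0 : ℝ) ≤ b) (MW.cf f)
    (fun I => le_rfl) q hq
  -- Modulo each `π ^ N` the expansion of `f` minus `T` times that of `s` is a constant, which does
  -- not affect the coefficients of degree `i + 1 ≥ 1`.
  refine ⟨s, hs, fun i hi => eq_of_forall_norm_sub_le hπ fun N => ?_⟩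
  have h1 := map_pow_dvd (r.comp Y.proj) (hsN N)
  have h2 := map_pow_dvd (r.comp Y.proj) (MW.pow_dvd_sub_sum_xpow hπ N f)
  have h3 := dvd_sub h2 (h1.mul_left (Tpow K 1))
  have h4 := (pow_dvd_Rint_iff hπ N _).mp h3 (i + 1)
  have e5 : ((r.comp Y.proj) (f - ∑ I ∈ MW.trSet hπ N f, MW.cf f I • MW.xpow I) - Tpow K 1 *
      (r.comp Y.proj) (s - ∑ I ∈ MW.trSet hπ N f, MW.cf f I • q I)) =
      r (Y.proj f) - Tpow K 1 * r (Y.proj s) -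
        algebraMap (OK K) (Rint K) (∑ I ∈ MW.trSet hπ N f, MW.cf f I * c I) := by
    simp only [map_sub, AlgHom.comp_apply, map_sum, mul_sub, map_smul, e, map_add, map_mul,
      AlgHom.commutes, hw, smul_add, Finset.sum_add_distrib, Finset.mul_sum, mul_smul_comm]
    simp only [Algebra.smul_def]
    ring
  rw [e5] at h4
  have e6 : (r (Y.proj f) - Tpow K 1 * r (Y.proj s) -
        algebraMap (OK K) (Rint K) (∑ I ∈ MW.trSet hπ N f, MW.cf f I * c I)).1.1 (i + 1) =
      (r (Y.proj f)).1.1 (i + 1) - (r (Y.proj s)).1.1 i := by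
    change (r (Y.proj f)).1.1 (i + 1) - (Tpow K 1 * r (Y.proj s)).1.1 (i + 1) -
      (mono 0 _).1 (i + 1) = _
    rw [coeff_Tpow_mul, coeff_mono, if_neg (by omega), sub_zero, add_sub_cancel_right]
  rw [e6] at h4
  rwa [norm_sub_rev]

/-- The radius is chosen once for all `k`: each division costs the factor `b` and none of them
shrinks the radius. This uniformity allows dividing by unboundedly high powers of the parameter
within one convergent series. -/
lemma exists_div_pow (hπ : Irreducible π) (hw : r (Y.proj w) = Tpow K 1)
    (hdiv : ∀ i, ∃ (c : OK K) (q : MW K Y.n),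
      Y.proj (MW.X i) = algebraMap _ _ c + Y.proj w * Y.proj q) {b : ℝ} (hb : 1 < b) :
    ∃ ρ₀ : ℝ, 1 < ρ₀ ∧ ∀ ρ, 1 < ρ → ρ ≤ ρ₀ → ∀ B f, MW.GB ρ B f → ∀ k : ℕ, ∃ q : MW K Y.n,
      MW.GB ρ (B * b ^ k) q ∧
        ∀ i, 0 ≤ i → (r (Y.proj q)).1.1 i = (r (Y.proj f)).1.1 (i + k) := by
  obtain ⟨ρ₀, hρ₀, h⟩ := exists_div r hπ hw hdiv hb
  refine ⟨ρ₀, hρ₀, fun ρ hρ hρρ₀ B f hf k => ?_⟩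
  induction k with
  | zero => exact ⟨f, by simpa using hf, fun i _ => by simp⟩
  | succ k ih =>
    obtain ⟨q, hq, e⟩ := ih
    obtain ⟨q', hq', e'⟩ := h ρ hρ hρρ₀ _ q hq
    refine ⟨q', hq'.mono (le_of_eq (by ring)), fun i hi => ?_⟩
    rw [e' i hi, e (i + 1) (by omega)]
    push_cast; ring_nf

variable (r' : (Y.loc w).int →ₐ[OK K] Rint K)

/-- The part of nonnegative degree of an element of the localization at the parameter. -/
theorem exists_nonneg_part (hπ : Irreducible π) (hw : r (Y.proj w) = Tpow K 1)
    (hdiv : ∀ i, ∃ (c : OK K) (q : MW K Y.n),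
      Y.proj (MW.X i) = algebraMap _ _ c + Y.proj w * Y.proj q)
    (hr : ∀ x, r' (Y.toLoc w x) = r x) (hr' : r' (Y.locInv w) = Tpow K (-1))
    (z : (Y.loc w).int) : ∃ y : Y.int, ∀ i, 0 ≤ i → (r y).1.1 i = (r' z).1.1 i := by
  obtain ⟨F, rfl⟩ := (Y.loc w).proj_surjective z
  change ∃ y : Y.int, ∀ i, 0 ≤ i → (r y).1.1 i = (r' (Y.projLoc w F)).1.1 i
  change MW K (Y.n + 1) at F
  obtain ⟨ρ, hρ, B, hF⟩ := MW.exists_GB F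
  -- The cost `b` of a division is taken to be the radius `ρ` of `F`. Dividing by `w ^ k` then costs
  -- `ρ ^ k`, which is precisely the weight of the `k`-th power of the last variable, the inverse of
  -- the parameter.
  obtain ⟨ρ₀, hρ₀, h⟩ := exists_div_pow r hπ hw hdiv hρ
  set ρ₁ := min ρ ρ₀ with hρ₁
  have h1 : 1 < ρ₁ := lt_min hρ hρ₀
  have mon : ∀ I : Fin (Y.n + 1) →₀ ℕ, ∃ q : MW K Y.n, MW.GB ρ₁ (1 * ρ ^ I.degree) q ∧
      ∀ i, 0 ≤ i → (r (Y.proj q)).1.1 i = (r' (Y.projLoc w (MW.xpow I))).1.1 i := by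
    intro I
    obtain ⟨J, k, hdeg, hI⟩ : ∃ (J : Fin Y.n →₀ ℕ) (k : ℕ), I.degree = J.degree + k ∧
        (MW.xpow I : MW K (Y.n + 1)) =
          MW.incl Y.n (MW.xpow J) * MW.X (Fin.last Y.n) ^ k := by
      induction I using Finsupp.induction_linear with
      | zero => exact ⟨0, 0, by simp, by simp [MW.xpow_zero]⟩
      | add I I' hI hI' =>
        obtain ⟨J, k, hd, h⟩ := hI
        obtain ⟨J', k', hd', h'⟩ := hI'
        exact ⟨J + J', k + k', by rw [map_add, map_add, hd, hd']; ring, by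
          rw [MW.xpow_add, MW.xpow_add, h, h', map_mul]; ring⟩
      | single i m =>
        have hs : ∀ {l : ℕ} (i : Fin l) (m : ℕ),
            (MW.xpow (Finsupp.single i m) : MW K l) = MW.X i ^ m := fun i m => by
          induction m with
          | zero => rw [Finsupp.single_zero, MW.xpow_zero, pow_zero]
          | succ m ih => rw [Finsupp.single_add, MW.xpow_add, ih, MW.xpow_single, pow_succ]
        rw [hs]
        induction i using Fin.lastCases with
        | last => exact ⟨0, m, by simp [Finsupp.degree_single], by simp [MW.xpow_zero]⟩
        | cast i => exact ⟨Finsupp.single i m, 0, by simp [Finsupp.degree_single], by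
            rw [hs, map_pow, MW.incl_X, pow_zero, mul_one]⟩
    obtain ⟨q, hq, e⟩ := h ρ₁ h1 (min_le_right _ _) _ _
      (MW.GB_xpow (K := K) (by linarith : (0 : ℝ) ≤ ρ₁) J) k
    refine ⟨q, hq.mono ?_, fun i hi => ?_⟩
    · rw [one_mul, hdeg, pow_add]
      gcongr
      exact min_le_left _ _
    · rw [e i hi, hI, map_mul, ← toLoc_proj, map_mul, hr, map_pow, map_pow, ← locInv, hr',
        Tpow_pow, mul_comm (r _), coeff_Tpow_mul]
      ring_nf
  choose q hq e using mon
  obtain ⟨s, -, hs⟩ := MW.exists_sum hπ hF h1 zero_le_one (MW.cf F) (fun I => le_rfl) q hq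
  refine ⟨Y.proj s, fun i hi => eq_of_forall_norm_sub_le hπ fun N => ?_⟩
  have h2 := norm_coeff_sub_le hπ (by simpa using map_pow_dvd (r.comp Y.proj) (hs N)) i
  have h3 := norm_coeff_sub_le hπ (by
    simpa using map_pow_dvd (r'.comp (Y.projLoc w)) (MW.pow_dvd_sub_sum_xpow hπ N F)) i
  have h4 : (∑ I ∈ MW.trSet hπ N F, MW.cf F I • r (Y.proj (q I))).1.1 i =
      (∑ I ∈ MW.trSet hπ N F, MW.cf F I • r' (Y.projLoc w (MW.xpow I))).1.1 i := by
    simp only [AddSubmonoidClass.coe_finsetSum, coeff_sum, Algebra.smul_def, coeff_algebraMap_mul,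
      e _ i hi]
  rw [h4] at h2
  rw [← sub_sub_sub_cancel_right _ _
    ((∑ I ∈ MW.trSet hπ N F, MW.cf F I • r' (Y.projLoc w (MW.xpow I))).1.1 i), sub_eq_add_neg]
  exact (IsUltrametricDist.norm_add_le_max _ _).trans (max_le h2 (by rwa [norm_neg]))

/-- Series in `1/T` with geometric decay come from the localization at the parameter. -/
theorem exists_of_nonpos (hπ : Irreducible π) (hr' : r' (Y.locInv w) = Tpow K (-1))
    (f : Robba K) {ρ : ℝ} (hρ : 1 < ρ) (hf : ∀ m : ℕ, ‖f.1 (-m)‖ * ρ ^ m ≤ 1)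
    (hf' : ∀ i, 0 < i → f.1 i = 0) : ∃ z, (r' z).1 = f := by
  have hle : ∀ m : ℕ, ‖f.1 (-m)‖ ≤ 1 := fun m => by
    refine le_trans ?_ (hf m)
    exact le_mul_of_one_le_right (norm_nonneg _) (one_le_pow₀ hρ.le)
  -- The preimage is the series `∑ f_{-m} x ^ m` in the last variable, which maps to `T⁻¹`.
  -- Geometric decay of its coefficients is exactly the condition defining `W_{n+1}`.
  let c (m : ℕ) : OK K := ⟨f.1 (-m), hle m⟩
  have hfin : ∀ N, {m : ℕ | ¬ π ^ N ∣ c m}.Finite := fun N => by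
    obtain ⟨M, hM⟩ := exists_pow_lt_of_lt_one (pow_pos (norm_pos_of_irreducible hπ) N)
      (inv_lt_one_of_one_lt₀ hρ)
    refine (Set.finite_lt_nat M).subset fun m hm => ?_
    by_contra hlt
    refine hm ((pow_dvd_iff_norm_le hπ N _).mpr ?_)
    have h1 : ‖f.1 (-m)‖ ≤ (ρ⁻¹) ^ m := by
      rw [inv_pow, ← one_div, le_div_iff₀ (by positivity)]; exact hf m
    exact h1.trans ((pow_le_pow_of_le_one (by positivity) (inv_le_one_of_one_le₀ hρ.le)
      (not_lt.mp hlt)).trans hM.le)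
  obtain ⟨s, -, hs⟩ := MW.exists_sum_of_dvd (m := Y.n + 1) hπ hρ zero_le_one
    (fun m : ℕ => c m • MW.xpow (Finsupp.single (Fin.last Y.n) m)) (fun m => by
      refine (MW.GB_xpow (by linarith) _).smul _ ?_
      rw [Finsupp.degree_single]; exact hf m) (fun N => (hfin N).toFinset) (fun N m hm => by
      rw [Set.Finite.mem_toFinset, Set.mem_ofPred_eq, not_not] at hm
      rw [Algebra.smul_def, ← map_pow]
      exact (map_dvd _ hm).mul_right _)
  refine ⟨Y.projLoc w s, ext_coeff fun i => eq_of_forall_norm_sub_le hπ fun N => ?_⟩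
  have h1 := norm_coeff_sub_le hπ (by simpa using map_pow_dvd (r'.comp (Y.projLoc w)) (hs N)) i
  have hx : ∀ m, r' (Y.projLoc w (MW.xpow (Finsupp.single (Fin.last Y.n) m))) = Tpow K (-m) := by
    intro m
    induction m with
    | zero => simp [MW.xpow_zero, Tpow_zero]
    | succ m ih =>
      rw [Finsupp.single_add, MW.xpow_add, MW.xpow_single, map_mul, map_mul, ih, ← locInv, hr',
        Tpow_mul]
      push_cast
      ring_nf
  have h2 : (∑ m ∈ (hfin N).toFinset,
      c m • r' (Y.projLoc w (MW.xpow (Finsupp.single (Fin.last Y.n) m)))).1.1 i =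
      ∑ m ∈ (hfin N).toFinset, if i = -m then f.1 (-m) else 0 := by
    rw [AddSubmonoidClass.coe_finsetSum, coeff_sum]
    refine Finset.sum_congr rfl fun m _ => ?_
    rw [hx, Algebra.smul_def, coeff_algebraMap_mul]
    change f.1 (-m) * (mono (-m) 1).1 i = _
    rw [coeff_mono]; simp
  rw [h2] at h1
  have h3 : ‖(∑ m ∈ (hfin N).toFinset, if i = -m then f.1 (-m) else 0) - f.1 i‖ ≤
      ‖(π : K)‖ ^ N := by
    rcases lt_or_ge 0 i with hi | hi
    · rw [hf' i hi, Finset.sum_eq_zero fun m _ => if_neg (by omega)]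
      simp
    · obtain ⟨k, rfl⟩ : ∃ k : ℕ, i = -k := ⟨(-i).toNat, by omega⟩
      simp only [neg_inj, Nat.cast_inj, Finset.sum_ite_eq]
      split_ifs with hk
      · simp
      · rw [Set.Finite.mem_toFinset, Set.mem_ofPred_eq, not_not] at hk
        rw [zero_sub, norm_neg]
        exact (pow_dvd_iff_norm_le hπ N _).mp hk
  rw [← sub_add_sub_cancel]
  exact (IsUltrametricDist.norm_add_le_max _ _).trans (max_le h1 h3)

end

end DaggerPres

end

/-! ## Extension of Frobenius lifts to localizations -/

section

variable {K : Type u} [NormedField K] [IsUltrametricDist K] [CompleteSpace K]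
  [IsDiscreteValuationRing (OK K)] {π : OK K}

lemma dvd_natCast (hπ : Irreducible π) {p : ℕ} (hp : ‖(p : K)‖ < 1) : π ∣ (p : OK K) := by
  rw [← Ideal.mem_span_singleton, ← hπ.maximalIdeal_eq, IsLocalRing.mem_maximalIdeal]
  intro h
  obtain ⟨v, hv⟩ := h.exists_right_inv
  have h1 : ‖(((p : OK K) * v : OK K) : K)‖ = 1 := by rw [hv]; simp
  have h2 : ‖(((p : OK K) * v : OK K) : K)‖ = ‖(p : K)‖ * ‖(v : K)‖ := by rw [← norm_mul]; rfl
  have := norm_OK_le v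
  nlinarith [norm_nonneg (p : K), norm_nonneg (v : K)]

lemma dvd_map_of_frobenius (hπ : Irreducible π) {p : ℕ} (hp : p ≠ 0) {σK : OK K →+* OK K}
    (hσK : ∀ c, σK c - c ^ p ∈ IsLocalRing.maximalIdeal (OK K)) : π ∣ σK π := by
  have h := hσK π
  rw [hπ.maximalIdeal_eq, Ideal.mem_span_singleton] at h
  exact (dvd_sub_left (dvd_pow_self π hp)).mp h

namespace DaggerPres

lemma isUnit_one_add_mul (hπ : Irreducible π) {X : DaggerPres K} (x : X.int) :
    IsUnit (1 + algebraMap (OK K) X.int π * x) := by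
  obtain ⟨w, rfl⟩ := X.proj_surjective x
  have := (MW.isUnit_one_add_smul hπ w).map X.proj
  rwa [map_add, map_one, map_smul, Algebra.smul_def] at this

lemma mem_map_maximalIdeal (hπ : Irreducible π) {X : DaggerPres K} {x : X.int} :
    x ∈ (IsLocalRing.maximalIdeal (OK K)).map (algebraMap (OK K) X.int) ↔
      algebraMap (OK K) X.int π ∣ x := by
  rw [hπ.maximalIdeal_eq, Ideal.map_span, Set.image_singleton, Ideal.mem_span_singleton]

lemma exists_loc_hom (hπ : Irreducible π) {X Z : DaggerPres K} (hsep : IsSep π Z.int)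
    {σK : OK K →+* OK K} (hσ : π ∣ σK π) (ψ : X.int →+* Z.int)
    (hψ : ∀ c, ψ (algebraMap _ _ c) = algebraMap _ _ (σK c)) {f : MW K X.n}
    (hf : IsUnit (ψ (X.proj f))) : ∃ ψ' : (X.loc f).int →+* Z.int,
      (∀ c, ψ' (algebraMap _ _ c) = algebraMap _ _ (σK c)) ∧ ∀ x, ψ' (X.toLoc f x) = ψ x := by
  obtain ⟨v, hv⟩ := hf.exists_right_inv
  obtain ⟨ψ', h1, h2, -⟩ := exists_loc_ringHom (j := (algebraMap (OK K) Z.int).comp σK) hπ hsep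
    (map_dvd _ hσ) ψ hψ hv (exists_ringHom hπ Z hsep σK hσ _)
  exact ⟨ψ', h1, h2⟩

lemma isUnit_toLoc (X : DaggerPres K) (f : MW K X.n) : IsUnit (X.toLoc f (X.proj f)) :=
  IsUnit.of_mul_eq_one _ (X.toLoc_mul_locInv f)

/-- As `σ f` is congruent to `f ^ p` modulo `π` and elements `1 + π x` are units, `σ f` is
invertible in the localization and `σ` extends. Modulo `π` both the extension and the `p`-power map
are homomorphisms on the localization; they agree on the image of `X.int` and hence everywhere. -/
theorem IsFrobeniusLift.exists_loc (hπ : Irreducible π) {p : ℕ} [hp0 : Fact p.Prime]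
    (hp : ‖(p : K)‖ < 1) {σK : OK K →+* OK K}
    (hσK : ∀ c, σK c - c ^ p ∈ IsLocalRing.maximalIdeal (OK K)) {X : DaggerPres K}
    {σ : X.int →+* X.int} (hσ : X.IsFrobeniusLift p σK σ) (f : MW K X.n)
    (hsep : IsSep π (X.loc f).int) : ∃ σ' : (X.loc f).int →+* (X.loc f).int,
      (X.loc f).IsFrobeniusLift p σK σ' ∧ ∀ x, σ' (X.toLoc f x) = X.toLoc f (σ x) := by
  have hππ := dvd_map_of_frobenius hπ hp0.out.ne_zero hσK
  obtain ⟨w, hw⟩ := (mem_map_maximalIdeal hπ).mp (hσ.lifts_frobenius (X.proj f))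
  obtain ⟨t, ht⟩ := X.isUnit_toLoc f
  have hunit : IsUnit (((X.toLoc f).toRingHom.comp σ) (X.proj f)) := by
    have e : ((X.toLoc f).toRingHom.comp σ) (X.proj f) = (t ^ p : (X.loc f).intˣ) *
        (1 + algebraMap _ _ π * ((t ^ p)⁻¹ : (X.loc f).intˣ) * X.toLoc f w) := by
      change X.toLoc f (σ (X.proj f)) = _
      rw [eq_add_of_sub_eq hw, map_add, map_pow, map_mul, AlgHom.commutes, ← ht, mul_add, mul_one,
        mul_right_comm, mul_comm _ ((((t ^ p)⁻¹ : (X.loc f).intˣ)) : (X.loc f).int),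
        Units.mul_inv_cancel_left, Units.val_pow_eq_pow_val, add_comm]
    rw [e, mul_assoc]
    exact (Units.isUnit _).mul (isUnit_one_add_mul hπ _)
  obtain ⟨σ', h1, h2⟩ := exists_loc_hom hπ hsep hππ ((X.toLoc f).toRingHom.comp σ) (fun c => by
    change X.toLoc f (σ _) = _
    rw [hσ.extends_base, AlgHom.commutes]) hunit
  refine ⟨σ', ⟨h1, fun x => ?_⟩, h2⟩
  rw [mem_map_maximalIdeal hπ, ← Ideal.mem_span_singleton]
  set I : Ideal (X.loc f).int := Ideal.span {algebraMap _ _ π} with hI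
  have hπ0 : algebraMap (OK K) ((X.loc f).int ⧸ I) π = 0 :=
    Ideal.Quotient.eq_zero_iff_mem.mpr (Ideal.subset_span rfl)
  have hp1 : (p : (X.loc f).int ⧸ I) = 0 := by
    obtain ⟨c, hc⟩ := dvd_natCast hπ hp
    have := congrArg (algebraMap (OK K) ((X.loc f).int ⧸ I)) hc
    rwa [map_natCast, map_mul, hπ0, zero_mul] at this
  have hsep' : IsSep π ((X.loc f).int ⧸ I) := fun x hx => by
    have := hx 1
    rwa [pow_one, hπ0, zero_dvd_iff] at this
  -- In the zero ring there is no characteristic `p` and no `frobenius`, but the congruence is then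
  -- trivial.
  by_cases htriv : Nontrivial ((X.loc f).int ⧸ I)
  · have : CharP ((X.loc f).int ⧸ I) p := (CharP.charP_iff_prime_eq_zero hp0.out).mpr hp1
    have key : (Ideal.Quotient.mk I).comp σ' =
        (frobenius ((X.loc f).int ⧸ I) p).comp (Ideal.Quotient.mk I) := by
      refine loc_ringHom_ext hπ hsep' ?_ fun x => ?_
      · rw [hπ0, zero_dvd_iff, RingHom.comp_apply, h1, Ideal.Quotient.eq_zero_iff_mem,
          Ideal.mem_span_singleton]
        exact map_dvd _ hππ
      · rw [RingHom.comp_apply, RingHom.comp_apply, frobenius_def, ← map_pow,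
          Ideal.Quotient.mk_eq_mk_iff_sub_mem, h2, ← map_pow, Ideal.mem_span_singleton]
        change _ ∣ X.toLoc f (σ x) - _
        rw [← map_sub]
        have := map_dvd (X.toLoc f) ((mem_map_maximalIdeal hπ).mp (hσ.lifts_frobenius x))
        rwa [AlgHom.commutes] at this
    have := DFunLike.congr_fun key x
    rwa [RingHom.comp_apply, RingHom.comp_apply, frobenius_def, ← map_pow,
      Ideal.Quotient.mk_eq_mk_iff_sub_mem] at this
  · rw [not_nontrivial_iff_subsingleton] at htriv
    exact Ideal.Quotient.eq_zero_iff_mem.mp (Subsingleton.elim _ _)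

end DaggerPres

end

/-! ## Differentials and the derivation `T d/dT` -/

section

variable {K : Type u} [NormedField K] [IsUltrametricDist K]

namespace Robba

variable [CompleteSpace K]

lemma coeff_deriv (f : Robba K) (i : ℤ) :
    (deriv f).1 i = ((i + 1 : ℤ) : K) * f.1 (i + 1) := rfl

/-- The derivation `T d/dT` of the Robba ring. -/
def theta : Robba K →+ Robba K := (AddMonoidHom.mulLeft (mono 1 1)).comp deriv

lemma coeff_theta (f : Robba K) (i : ℤ) : (theta f).1 i = (i : K) * f.1 i := by
  change (mono 1 1 * deriv f).1 i = _
  rw [coeff_mono_mul, coeff_deriv, one_mul, sub_add_cancel]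

lemma deriv_eq (f : Robba K) : deriv f = mono (-1) 1 * theta f := by
  refine ext_coeff fun i => ?_
  rw [coeff_mono_mul, coeff_theta, coeff_deriv, one_mul, sub_neg_eq_add]

lemma theta_mul (f g : Robba K) : theta (f * g) = f * theta g + g * theta f := by
  obtain ⟨r, hr, H⟩ := exists_common f.2 g.2
  obtain ⟨r₁, hr₁, H₁⟩ := exists_common (theta f).2 g.2
  obtain ⟨r₂, hr₂, H₂⟩ := exists_common f.2 (theta g).2
  refine ext_coeff fun i => ?_
  rw [coeff_theta, coeff_add, mul_comm g, coeff_mul, coeff_mul, coeff_mul,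
    ← Summable.tsum_add, ← tsum_mul_left]
  · refine tsum_congr fun j => ?_
    rw [coeff_theta, coeff_theta]
    push_cast
    ring
  · have h := H₂ (r₂ / 2) (by linarith) (by linarith)
    exact (summable_norm_term h.1 h.2 i).of_norm
  · have h := H₁ (r₁ / 2) (by linarith) (by linarith)
    exact (summable_norm_term h.1 h.2 i).of_norm

lemma theta_mono (m : ℤ) (c : K) : theta (mono m c) = mono m (m * c) := by
  refine ext_coeff fun i => ?_
  rw [coeff_theta, coeff_mono, coeff_mono]
  by_cases h : i = m
  · subst h; simp
  · simp [h]

lemma theta_C (c : K) : theta (C c) = 0 := by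
  rw [C_eq_mono, theta_mono]
  refine ext_coeff fun i => ?_
  simp [coeff_mono]

lemma theta_C_mul (c : K) (f : Robba K) : theta (C c * f) = C c * theta f := by
  rw [theta_mul, theta_C, mul_zero, add_zero]

lemma theta_one : theta (1 : Robba K) = 0 := by
  rw [← map_one C, theta_C]

lemma theta_natCast_mul (n : ℕ) (f : Robba K) : theta ((n : Robba K) * f) = n * theta f := by
  rw [← map_natCast C, theta_C_mul]

lemma theta_mem_plus {f : Robba K} (hf : f ∈ plus K) : theta f ∈ plus K := fun i hi => by
  rw [coeff_theta, hf i hi, mul_zero]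

/-- `T d/dT` multiplies the coefficient of `T ^ i` by `i`, which is nonzero for `i < 0` in
characteristic zero. -/
lemma mem_plus_of_theta [CharZero K] {f : Robba K} (hf : theta f ∈ plus K) : f ∈ plus K :=
  fun i hi => by
    have := hf i hi
    rw [coeff_theta] at this
    exact (mul_eq_zero.mp this).resolve_left (Int.cast_ne_zero.mpr hi.ne)

lemma theta_mem_Rint {f : Robba K} (hf : f ∈ Rint K) : theta f ∈ Rint K := fun i => by
  rw [coeff_theta, norm_mul]
  exact mul_le_one₀ (IsUltrametricDist.norm_intCast_le_one K i) (norm_nonneg _) (hf i)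

/-- The derivation `T d/dT` on integral series. -/
def thetaInt : Rint K →+ Rint K where
  toFun f := ⟨theta f.1, theta_mem_Rint f.2⟩
  map_zero' := Subtype.ext (map_zero theta)
  map_add' f g := Subtype.ext (map_add theta f.1 g.1)

lemma coe_thetaInt (f : Rint K) : (thetaInt f).1 = theta f.1 := rfl

lemma thetaInt_mul (f g : Rint K) : thetaInt (f * g) = f * thetaInt g + g * thetaInt f :=
  Subtype.ext (theta_mul f.1 g.1)

lemma thetaInt_algebraMap (c : OK K) : thetaInt (algebraMap (OK K) (Rint K) c) = 0 :=
  Subtype.ext (theta_C _)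

end Robba

namespace MW

variable {n : ℕ}

lemma pderiv_mul (i : Fin n) (f g : MW K n) :
    pderiv i (f * g) = f * pderiv i g + g * pderiv i f :=
  Subtype.ext (by
    have := (MvPowerSeries.pderiv (OK K) i).leibniz f.1 g.1
    simp only [smul_eq_mul] at this
    exact this)

lemma pderiv_algebraMap (i : Fin n) (c : OK K) : pderiv i (algebraMap (OK K) (MW K n) c) = 0 :=
  Subtype.ext ((MvPowerSeries.pderiv (OK K) i).map_algebraMap c)

lemma pderiv_one (i : Fin n) : pderiv i (1 : MW K n) = 0 := by
  simpa using pderiv_algebraMap i (1 : OK K)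

lemma pderiv_X (i j : Fin n) : pderiv i (X j : MW K n) = if i = j then 1 else 0 := by
  refine Subtype.ext ?_
  change MvPowerSeries.pderiv (OK K) i (MvPowerSeries.X j) = _
  split_ifs with h
  · subst h; rw [MvPowerSeries.pderiv_X_self]; rfl
  · rw [MvPowerSeries.pderiv_X_of_ne (Ne.symm h)]; rfl

/-- A derivation on `W_n` with values in a separated ring vanishes once it vanishes on the
variables. -/
theorem derivation_eq_zero {E : Type*} [CommRing E] [Algebra (OK K) E] {π : OK K}
    (hπ : Irreducible π) (hsep : IsSep π E) (ψ : MW K n →+* E)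
    (hψ : algebraMap (OK K) E π ∣ ψ (algebraMap (OK K) _ π)) (D : MW K n →+ E)
    (hD : ∀ f g, D (f * g) = ψ f * D g + ψ g * D f) (hc : ∀ c, D (algebraMap (OK K) _ c) = 0)
    (hX : ∀ i, D (X i) = 0) (f : MW K n) : D f = 0 := by
  have hpoly : ∀ P : MvPolynomial (Fin n) (OK K), D (ofPoly P) = 0 := by
    intro P
    induction P using MvPolynomial.induction_on with
    | C c =>
      have : (ofPoly (MvPolynomial.C c) : MW K n) = algebraMap (OK K) _ c := by
        rw [← MvPolynomial.algebraMap_eq, AlgHom.commutes]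
      rw [this, hc]
    | add P Q hP hQ => rw [map_add, map_add, hP, hQ, add_zero]
    | mul_X P i hP =>
      have : (ofPoly (MvPolynomial.X i) : MW K n) = X i := MvPolynomial.aeval_X _ _
      rw [map_mul, hD, hP, this, hX, mul_zero, mul_zero, add_zero]
  refine hsep _ fun N => ?_
  obtain ⟨g, hg⟩ := pow_dvd_sub_tr hπ N f
  have hcN : D (algebraMap (OK K) (MW K n) π ^ N) = 0 := by rw [← map_pow, hc]
  rw [eq_add_of_sub_eq hg, map_add, hpoly, add_zero, hD, hcN, mul_zero, add_zero, map_pow]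
  exact (pow_dvd_pow_of_dvd hψ N).mul_right _

lemma isSep {π : OK K} (hπ : Irreducible π) : IsSep π (MW K n) := fun _ hx =>
  eq_zero_of_forall_pow_dvd hπ hx

lemma pderiv_castSucc_incl {π : OK K} (hπ : Irreducible π) (i : Fin n) (f : MW K n) :
    pderiv i.castSucc (incl n f) = incl n (pderiv i f) := by
  rw [← sub_eq_zero]
  refine derivation_eq_zero hπ (isSep hπ) (incl n : MW K n →ₐ[OK K] MW K (n + 1)).toRingHom ?_
    ((pderiv (K := K) i.castSucc).toAddMonoidHom.comp (incl n : MW K n →ₐ[OK K] MW K (n + 1)).toAddMonoidHom -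
      (incl n : MW K n →ₐ[OK K] MW K (n + 1)).toAddMonoidHom.comp (pderiv (K := K) i).toAddMonoidHom) ?_ ?_ ?_ f
  · change _ ∣ incl n (algebraMap (OK K) (MW K n) π)
    rw [AlgHom.commutes]
  · intro f g
    change pderiv i.castSucc (incl n (f * g)) - incl n (pderiv i (f * g)) =
      incl n f * (pderiv i.castSucc (incl n g) - incl n (pderiv i g)) +
      incl n g * (pderiv i.castSucc (incl n f) - incl n (pderiv i f))
    rw [map_mul, pderiv_mul, pderiv_mul, map_add, map_mul, map_mul]
    ring
  · intro c
    change pderiv i.castSucc (incl n (algebraMap (OK K) (MW K n) c)) -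
      incl n (pderiv i (algebraMap (OK K) (MW K n) c)) = 0
    rw [AlgHom.commutes, pderiv_algebraMap, pderiv_algebraMap, map_zero, sub_zero]
  · intro j
    change pderiv i.castSucc (incl n (X j : MW K n)) - incl n (pderiv i (X j : MW K n)) = 0
    rw [incl_X, pderiv_X, pderiv_X]
    by_cases h : i = j
    · simp [h]
    · rw [if_neg h, if_neg (by simpa using h), map_zero, sub_zero]

lemma pderiv_last_incl {π : OK K} (hπ : Irreducible π) (f : MW K n) :
    pderiv (Fin.last n) (incl n f) = 0 := by
  refine derivation_eq_zero hπ (isSep hπ) (incl n : MW K n →ₐ[OK K] MW K (n + 1)).toRingHom ?_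
    ((pderiv (K := K) (Fin.last n)).toAddMonoidHom.comp
      (incl n : MW K n →ₐ[OK K] MW K (n + 1)).toAddMonoidHom) ?_ ?_ ?_ f
  · change _ ∣ incl n (algebraMap (OK K) (MW K n) π)
    rw [AlgHom.commutes]
  · intro f g
    change pderiv _ (incl n (f * g)) = incl n f * pderiv _ (incl n g) + incl n g * pderiv _ (incl n f)
    rw [map_mul, pderiv_mul]
  · intro c
    change pderiv _ (incl n (algebraMap (OK K) (MW K n) c)) = 0
    rw [AlgHom.commutes, pderiv_algebraMap]
  · intro j
    change pderiv _ (incl n (X j : MW K n)) = 0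
    rw [incl_X, pderiv_X, if_neg (Fin.castSucc_lt_last j).ne']

end MW

end

namespace DaggerPres

section

variable {K : Type u} [NormedField K] [IsUltrametricDist K] (X : DaggerPres K) (p : ℕ)

lemma dInt_proj (f : MW K X.n) :
    X.dInt p (X.proj f) = X.omegaMk p fun i => X.el p (MW.pderiv i f) := rfl

lemma d_algebraMap (x : X.int) : X.d p (algebraMap X.int (X.gen p) x) = X.dInt p x :=
  IsLocalizedModule.lift_apply (Submonoid.powers (p : OK K))
    (IsScalarTower.toAlgHom (OK K) X.int (X.gen p)).toLinearMap (X.dInt p)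
    (X.isUnit_end_powers p) x

lemma d_el (f : MW K X.n) :
    X.d p (X.el p f) = X.omegaMk p fun i => X.el p (MW.pderiv i f) := by
  rw [el, d_algebraMap, dInt_proj]

lemma omegaMk_surjective : Function.Surjective (X.omegaMk p) := Submodule.mkQ_surjective _

lemma d_el_X (i : Fin X.n) : X.d p (X.el p (MW.X i)) = X.omegaMk p (Pi.single i 1) := by
  rw [d_el]
  congr 1
  funext j
  rw [MW.pderiv_X, Pi.single_apply]
  split_ifs
  · simp [el]
  · simp [el]

lemma omegaMk_eq_sum (w : Fin X.n → X.gen p) :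
    X.omegaMk p w = ∑ i, w i • X.d p (X.el p (MW.X i)) := by
  simp_rw [d_el_X, ← map_smul, ← map_sum]
  congr 1
  funext j
  simp [Finset.sum_apply, Pi.single_apply]

lemma d_natCast_pow_mul (k : ℕ) (a : X.gen p) :
    X.d p ((p : X.gen p) ^ k * a) = (p : X.gen p) ^ k • X.d p a := by
  have h1 : (p : X.gen p) ^ k * a = ((p : OK K) ^ k) • a := by
    rw [Algebra.smul_def, map_pow, map_natCast]
  have h2 : (p : X.gen p) ^ k • X.d p a = ((p : OK K) ^ k) • X.d p a := by
    rw [← algebraMap_smul (X.gen p) ((p : OK K) ^ k) (X.d p a), map_pow, map_natCast]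
  rw [h1, map_smul, h2]

lemma d_one : X.d p 1 = 0 := by
  have : (1 : X.gen p) = X.el p 1 := by rw [el, map_one, map_one]
  rw [this, d_el, ← map_zero (X.omegaMk p)]
  congr 1
  funext i
  rw [MW.pderiv_one, el, map_zero, map_zero]
  rfl

variable (v : X.gen p)

lemma logMk_surjective : Function.Surjective (X.logMk p v) := Submodule.mkQ_surjective _

lemma smul_dlog : v • X.dlog p v = X.logD p v v := by
  change v • X.logMk p v (0, 1) = X.logMk p v (X.d p v, 0)
  rw [← map_smul, eq_comm, ← sub_eq_zero, ← map_sub]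
  refine (Submodule.Quotient.mk_eq_zero _).mpr (Submodule.subset_span ?_)
  simp

lemma logMk_eq (ω : X.Omega p) (b : X.gen p) :
    X.logMk p v (ω, b) = X.logMk p v (ω, 0) + b • X.dlog p v := by
  rw [dlog, ← map_smul, ← map_add]
  simp

lemma logMk_omegaMk (w : Fin X.n → X.gen p) :
    X.logMk p v (X.omegaMk p w, 0) = ∑ i, w i • X.logD p v (X.el p (MW.X i)) := by
  change (X.logMk p v).comp (LinearMap.inl _ _ _) (X.omegaMk p w) = _
  rw [omegaMk_eq_sum, map_sum]
  simp_rw [map_smul]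
  rfl

lemma span_logD_one : Submodule.span (X.gen p) (Set.range (X.logD p 1)) = ⊤ := by
  rw [eq_top_iff]
  rintro x -
  obtain ⟨⟨ω, b⟩, rfl⟩ := X.logMk_surjective p 1 x
  obtain ⟨w, rfl⟩ := X.omegaMk_surjective p ω
  have h1 : X.dlog p 1 = X.logD p 1 1 := by rw [← smul_dlog, one_smul]
  rw [logMk_eq, logMk_omegaMk, h1]
  exact add_mem (sum_mem fun i _ => Submodule.smul_mem _ _ (Submodule.subset_span ⟨_, rfl⟩))
    (Submodule.smul_mem _ _ (Submodule.subset_span ⟨_, rfl⟩))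

end

section

variable {K : Type u} [NormedField K] [IsUltrametricDist K] [CompleteSpace K] [CharZero K]
  (p : ℕ) [Fact p.Prime] {π : OK K}

open Robba

/-- The chain rule for homomorphisms to the Robba ring. -/
lemma theta_chain (hπ : Irreducible π) {n : ℕ} (ψ : MW K n →+* Rint K) {τ : OK K → OK K}
    (hψ : ∀ c, ψ (algebraMap _ _ c) = algebraMap _ _ (τ c)) (hτ : π ∣ τ π) (f : MW K n) :
    thetaInt (ψ f) = ∑ i, ψ (MW.pderiv i f) * thetaInt (ψ (MW.X i)) := by
  let S : MW K n →+ Rint K := ∑ i, (AddMonoidHom.mulRight (thetaInt (ψ (MW.X i)))).comp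
    (ψ.toAddMonoidHom.comp (MW.pderiv (K := K) i).toAddMonoidHom)
  have hS : ∀ f, S f = ∑ i, ψ (MW.pderiv i f) * thetaInt (ψ (MW.X i)) := fun f => by
    simp only [S, AddMonoidHom.finsetSum_apply]
    rfl
  rw [← hS, ← sub_eq_zero]
  refine MW.derivation_eq_zero hπ (isSep_Rint hπ) ψ ?_
    (thetaInt.comp ψ.toAddMonoidHom - S) ?_ ?_ ?_ f
  · rw [hψ]; exact map_dvd _ hτ
  · intro f g
    change thetaInt (ψ (f * g)) - S (f * g) =
      ψ f * (thetaInt (ψ g) - S g) + ψ g * (thetaInt (ψ f) - S f)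
    rw [map_mul, thetaInt_mul, hS, hS, hS, mul_sub, mul_sub, Finset.mul_sum, Finset.mul_sum]
    simp_rw [MW.pderiv_mul, map_add, map_mul, add_mul]
    rw [Finset.sum_add_distrib]
    simp_rw [mul_assoc]
    ring
  · intro c
    change thetaInt (ψ _) - S _ = 0
    rw [hψ, thetaInt_algebraMap, hS]
    simp_rw [MW.pderiv_algebraMap, map_zero, zero_mul]
    simp
  · intro j
    change thetaInt (ψ _) - S _ = 0
    rw [hS]
    simp_rw [MW.pderiv_X]
    rw [Finset.sum_eq_single j]
    · simp
    · intro i _ hi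
      rw [if_neg hi, map_zero, zero_mul]
    · simp

/-- A homomorphism `A → B` induces a map on differentials, if `B` embeds into the Robba ring. -/
theorem exists_logOmega_hom (hπ : Irreducible π) {X : DaggerPres K} {B : Type*} [CommRing B]
    {jB : B →+* Robba K} (hjB : Function.Injective jB) {dB : B →+ B}
    (hdB : ∀ b, jB (dB b) = theta (jB b)) (J : X.gen p →+* B) (ψ : X.int →+* Rint K)
    {τ : OK K → OK K} (hψ : ∀ c, ψ (algebraMap _ _ c) = algebraMap _ _ (τ c)) (hτ : π ∣ τ π)
    (hJ : ∀ x, jB (J (algebraMap X.int (X.gen p) x)) = (ψ x).1) {v : X.gen p} {c : B}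
    (hc : J v * c = dB (J v)) :
    ∃ t : X.LogOmega p v →ₛₗ[J] B, (∀ a, t (X.logD p v a) = dB (J a)) ∧ t (X.dlog p v) = c := by
  -- The symbol `dx_i` is sent to `dB (J x_i)`. The chain rule, checked after the embedding in the
  -- Robba ring, shows that `df` goes to `dB (J f)`, so the relations for `f ∈ X.I` go to zero. The
  -- value `c` on `dlog v` can be any solution of `J v * c = dB (J v)`.
  let s₀ : (Fin X.n → X.gen p) →ₛₗ[J] B :=
    { toFun := fun w => ∑ i, J (w i) * dB (J (X.el p (MW.X i)))
      map_add' := fun w w' => by simp [add_mul, Finset.sum_add_distrib]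
      map_smul' := fun a w => by simp [Finset.mul_sum, mul_assoc] }
  have hs₀ : ∀ f : MW K X.n, s₀ (fun i => X.el p (MW.pderiv i f)) = dB (J (X.el p f)) := by
    intro f
    refine hjB ?_
    have h1 := theta_chain hπ (ψ.comp X.proj.toRingHom) (τ := τ) (fun c => by
      change ψ (X.proj _) = _
      rw [AlgHom.commutes, hψ]) hτ f
    have h2 : ∀ g, jB (J (X.el p g)) = (ψ (X.proj g)).1 := fun g => hJ _
    change jB (∑ i, J (X.el p (MW.pderiv i f)) * dB (J (X.el p (MW.X i)))) = _
    rw [map_sum, hdB, h2]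
    simp_rw [map_mul, hdB, h2]
    have h3 := congrArg Subtype.val h1
    rw [coe_thetaInt, AddSubmonoidClass.coe_finsetSum] at h3
    exact h3.symm
  let s : X.Omega p →ₛₗ[J] B := (X.omegaRel p).liftQ s₀ (by
    rw [omegaRel, Submodule.span_le]
    rintro _ ⟨f, hf, rfl⟩
    change s₀ _ = 0
    rw [hs₀, el, X.proj_eq_zero_iff.mpr hf, map_zero, map_zero, map_zero])
  have hs : ∀ a, s (X.d p a) = dB (J a) := by
    intro a
    obtain ⟨k, x, hx⟩ := exists_pow_mul_eq p a
    obtain ⟨f, rfl⟩ := X.proj_surjective x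
    have h1 : s (X.d p ((p : X.gen p) ^ k * a)) = dB (J ((p : X.gen p) ^ k * a)) := by
      rw [hx, ← el, d_el]
      exact hs₀ f
    rw [d_natCast_pow_mul, map_smulₛₗ, map_mul, map_pow, map_natCast, smul_eq_mul] at h1
    refine hjB ((((Robba.isUnit_natCast (K := K) (Fact.out : p.Prime).ne_zero).pow k)).mul_right_inj.mp ?_)
    have h2 := congrArg jB h1
    rw [hdB, map_mul, map_mul, map_pow, map_natCast, ← Nat.cast_pow, theta_natCast_mul] at h2
    rw [← Nat.cast_pow, h2, hdB]
  let t₀ : (X.Omega p × X.gen p) →ₛₗ[J] B :=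
    { toFun := fun x => s x.1 + J x.2 * c
      map_add' := fun x y => by
        simp only [Prod.fst_add, Prod.snd_add, map_add, add_mul]; ring
      map_smul' := fun a x => by
        simp only [Prod.smul_fst, Prod.smul_snd, smul_eq_mul, map_smulₛₗ, map_mul]; ring }
  let t : X.LogOmega p v →ₛₗ[J] B := (X.logRel p v).liftQ t₀ (by
    rw [logRel, Submodule.span_le, Set.singleton_subset_iff]
    change s (X.d p v) + J (-v) * c = 0
    rw [hs, map_neg, neg_mul, hc, add_neg_cancel])
  refine ⟨t, fun a => ?_, ?_⟩
  · change s (X.d p a) + J 0 * c = _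
    rw [hs, map_zero, zero_mul, add_zero]
  · change s 0 + J 1 * c = _
    rw [map_zero, map_one, zero_add, one_mul]

end

end DaggerPres

/-! ## Generators of the module of differentials -/

namespace DaggerPres

section

variable {K : Type u} [NormedField K] [IsUltrametricDist K] (X : DaggerPres K) (p : ℕ)

lemma el_mul (f g : MW K X.n) : X.el p (f * g) = X.el p f * X.el p g := by
  rw [el, map_mul, map_mul]; rfl

lemma el_add (f g : MW K X.n) : X.el p (f + g) = X.el p f + X.el p g := by
  rw [el, map_add, map_add]; rfl

/-- The map from `W_n` to the dagger algebra, as a ring homomorphism. -/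
def elHom : MW K X.n →+* X.gen p := (algebraMap X.int (X.gen p)).comp X.proj.toRingHom

lemma elHom_apply (f : MW K X.n) : X.elHom p f = X.el p f := rfl

lemma d_el_mul (f g : MW K X.n) :
    X.d p (X.el p (f * g)) = X.el p f • X.d p (X.el p g) + X.el p g • X.d p (X.el p f) := by
  rw [d_el, d_el, d_el, ← map_smul, ← map_smul, ← map_add]
  congr 1
  funext i
  rw [MW.pderiv_mul, el_add, el_mul, el_mul]
  rfl

lemma d_el_algebraMap (c : OK K) : X.d p (X.el p (algebraMap _ _ c)) = 0 := by
  rw [d_el, ← map_zero (X.omegaMk p)]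
  congr 1
  funext i
  rw [MW.pderiv_algebraMap, el, map_zero, map_zero]
  rfl

lemma d_el_eq_sum (f : MW K X.n) :
    X.d p (X.el p f) = ∑ i, X.el p (MW.pderiv i f) • X.d p (X.el p (MW.X i)) := by
  rw [d_el, omegaMk_eq_sum]

lemma span_d_eq_top {u : X.gen p}
    (h : ∀ i, X.d p (X.el p (MW.X i)) ∈ Submodule.span (X.gen p) {X.d p u}) :
    Submodule.span (X.gen p) {X.d p u} = ⊤ := by
  rw [eq_top_iff]
  rintro ω -
  obtain ⟨w, rfl⟩ := X.omegaMk_surjective p ω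
  rw [omegaMk_eq_sum]
  exact sum_mem fun i _ => Submodule.smul_mem _ _ (h i)

lemma genMap_algebraMap {Y : DaggerPres K} (φ : X.int →+* Y.int) (x : X.int) :
    genMap p φ (algebraMap X.int (X.gen p) x) = algebraMap Y.int (Y.gen p) (φ x) :=
  IsLocalization.map_eq _ _

/-- The element of the localized dagger algebra defined by an element of `W_{n+1}`. -/
def elLoc (f : MW K X.n) (g : MW K (X.n + 1)) : (X.loc f).gen p := (X.loc f).el p g

lemma genMap_toLoc_el (f g : MW K X.n) :
    genMap p (X.toLoc f : X.int →+* (X.loc f).int) (X.el p g) = X.elLoc p f (MW.incl X.n g) :=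
  genMap_algebraMap X p _ _

lemma d_elLoc_incl {π : OK K} (hπ : Irreducible π) (f g : MW K X.n) :
    (X.loc f).d p (X.elLoc p f (MW.incl X.n g)) = ∑ i,
      X.elLoc p f (MW.incl X.n (MW.pderiv i g)) •
        (X.loc f).d p (X.elLoc p f (MW.X i.castSucc)) := by
  have h := (X.loc f).d_el_eq_sum p (show MW K (X.loc f).n from MW.incl X.n g)
  refine h.trans ((Fin.sum_univ_castSucc (n := X.n) (fun i =>
    X.elLoc p f (MW.pderiv i (MW.incl X.n g)) •
      (X.loc f).d p (X.elLoc p f (MW.X i)))).trans ?_)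
  rw [MW.pderiv_last_incl hπ]
  have h0 : X.elLoc p f 0 = 0 := map_zero ((X.loc f).elHom p)
  rw [h0, zero_smul, add_zero]
  refine Finset.sum_congr rfl fun i _ => ?_
  rw [MW.pderiv_castSucc_incl hπ]

/-- The map on differentials induced by a localization. -/
lemma exists_locOmega {π : OK K} (hπ : Irreducible π) (f : MW K X.n) :
    ∃ t : X.Omega p →ₛₗ[genMap p (X.toLoc f : X.int →+* (X.loc f).int)] (X.loc f).Omega p,
      ∀ g, t (X.d p (X.el p g)) = (X.loc f).d p (X.elLoc p f (MW.incl X.n g)) := by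
  let φ := genMap p (X.toLoc f : X.int →+* (X.loc f).int)
  let s₀ : (Fin X.n → X.gen p) →ₛₗ[φ] (X.loc f).Omega p :=
    { toFun := fun w => ∑ i, φ (w i) • (X.loc f).d p (X.elLoc p f (MW.X i.castSucc))
      map_add' := fun w w' => by simp [add_smul, Finset.sum_add_distrib]
      map_smul' := fun a w => by simp [Finset.smul_sum, mul_smul] }
  have hs₀ : ∀ g : MW K X.n, s₀ (fun i => X.el p (MW.pderiv i g)) =
      (X.loc f).d p (X.elLoc p f (MW.incl X.n g)) := fun g => by
    rw [d_elLoc_incl X p hπ]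
    change ∑ i, φ (X.el p (MW.pderiv i g)) • _ = _
    refine Finset.sum_congr rfl fun i _ => ?_
    rw [genMap_toLoc_el]
  refine ⟨(X.omegaRel p).liftQ s₀ ?_, fun g => ?_⟩
  · rw [omegaRel, Submodule.span_le]
    rintro _ ⟨g, hg, rfl⟩
    change s₀ _ = 0
    have h0 : X.elLoc p f (MW.incl X.n g) = 0 := by
      rw [← genMap_toLoc_el, el, X.proj_eq_zero_iff.mpr hg, map_zero, map_zero]
    rw [hs₀, h0, map_zero]
  · rw [d_el]
    exact hs₀ g

lemma elLoc_mul_X_last (f : MW K X.n) :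
    X.elLoc p f (MW.incl X.n f) * X.elLoc p f (MW.X (Fin.last X.n)) = 1 := by
  have := congrArg (algebraMap (X.loc f).int ((X.loc f).gen p)) (X.toLoc_mul_locInv f)
  rwa [map_mul, map_one] at this

/-- Inverting `f` makes each old `dx_i` a multiple of `du`. For the new variable `x`, the relation
`f x = 1` gives `dx = -x ^ 2 df`, and `df` is a combination of the `dx_i`. -/
lemma span_d_loc {π : OK K} (hπ : Irreducible π) (f u : MW K X.n)
    (h : ∀ i, X.el p f • X.d p (X.el p (MW.X i)) ∈
      Submodule.span (X.gen p) {X.d p (X.el p u)}) :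
    Submodule.span ((X.loc f).gen p) {(X.loc f).d p (X.elLoc p f (MW.incl X.n u))} = ⊤ := by
  obtain ⟨t, ht⟩ := X.exists_locOmega p hπ f
  set S := Submodule.span ((X.loc f).gen p) {(X.loc f).d p (X.elLoc p f (MW.incl X.n u))}
  have hS : ∀ i : Fin X.n, (X.loc f).d p (X.elLoc p f (MW.X i.castSucc)) ∈ S := by
    intro i
    obtain ⟨a, ha⟩ := Submodule.mem_span_singleton.mp (h i)
    have h1 := congrArg t ha
    rw [map_smulₛₗ, map_smulₛₗ, ht, ht, genMap_toLoc_el, MW.incl_X] at h1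
    have h2 := congrArg (fun ω => X.elLoc p f (MW.X (Fin.last X.n)) • ω) h1
    simp only [smul_smul] at h2
    rw [mul_comm _ (X.elLoc p f (MW.incl X.n f)), elLoc_mul_X_last, one_smul] at h2
    rw [← h2]
    exact Submodule.smul_mem _ _ (Submodule.mem_span_singleton_self _)
  have hf : (X.loc f).d p (X.elLoc p f (MW.incl X.n f)) ∈ S := by
    rw [d_elLoc_incl X p hπ]
    exact sum_mem fun i _ => Submodule.smul_mem _ _ (hS i)
  refine span_d_eq_top _ p fun i => ?_
  change Fin (X.n + 1) at i
  change (X.loc f).d p (X.elLoc p f (MW.X i)) ∈ S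
  induction i using Fin.lastCases with
  | cast i => exact hS i
  | last =>
    have h1 : (X.loc f).d p (X.elLoc p f (MW.incl X.n f * MW.X (Fin.last X.n))) = 0 := by
      have e : X.elLoc p f (MW.incl X.n f * MW.X (Fin.last X.n)) = 1 := by
        rw [← elLoc_mul_X_last X p f]; exact (X.loc f).el_mul p _ _
      rw [e, d_one]
    have h2 := (X.loc f).d_el_mul p (show MW K (X.loc f).n from MW.incl X.n f)
      (show MW K (X.loc f).n from MW.X (Fin.last X.n))
    change (X.loc f).d p (X.elLoc p f (MW.incl X.n f * MW.X (Fin.last X.n))) =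
      X.elLoc p f (MW.incl X.n f) • (X.loc f).d p (X.elLoc p f (MW.X (Fin.last X.n))) +
      X.elLoc p f (MW.X (Fin.last X.n)) • (X.loc f).d p (X.elLoc p f (MW.incl X.n f)) at h2
    have h3 := congrArg (fun ω => X.elLoc p f (MW.X (Fin.last X.n)) • ω)
      (eq_neg_of_add_eq_zero_left (h1.symm.trans h2).symm)
    simp only [smul_smul] at h3
    rw [mul_comm _ (X.elLoc p f (MW.incl X.n f)), elLoc_mul_X_last, one_smul] at h3
    rw [h3]
    exact Submodule.smul_mem _ _ (neg_mem (Submodule.smul_mem _ _ hf))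

lemma logMk_smul_d (v a b : X.gen p) : X.logMk p v (a • X.d p b, 0) = a • X.logD p v b := by
  have := (X.logMk p v).map_smul a (X.d p b, 0)
  rwa [Prod.smul_mk, smul_zero] at this

/-- Differentiating `x_j = c_j + u y_j` yields `∑_k (δ_jk - u ∂y_j/∂x_k) dx_k = y_j du`. Multiplying
by the adjugate of this matrix shows that its determinant times each `dx_i` is a multiple of `du`.
-/
lemma det_smul_d_mem (u : MW K X.n) (y : Fin X.n → MW K X.n) (c : Fin X.n → OK K)
    (h : ∀ i, X.proj (MW.X i) = algebraMap _ _ (c i) + X.proj u * X.proj (y i)) (i : Fin X.n) :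
    X.el p (Matrix.det (1 - Matrix.of fun j k => u * MW.pderiv k (y j))) •
      X.d p (X.el p (MW.X i)) ∈ Submodule.span (X.gen p) {X.d p (X.el p u)} := by
  set M : Matrix (Fin X.n) (Fin X.n) (MW K X.n) := 1 - Matrix.of fun j k => u * MW.pderiv k (y j)
  set S := Submodule.span (X.gen p) {X.d p (X.el p u)}
  have h1 : ∀ j, ∑ k, X.el p (M j k) • X.d p (X.el p (MW.X k)) ∈ S := by
    intro j
    have e1 : X.el p (MW.X j) = X.el p (algebraMap _ _ (c j)) + X.el p (u * y j) := by
      rw [el, h, map_add, ← map_mul, ← AlgHom.commutes X.proj]; rfl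
    have e2 : ∀ k, X.el p (M j k) =
        (if j = k then 1 else 0) - X.el p u * X.el p (MW.pderiv k (y j)) := fun k => by
      rw [← el_mul, ← elHom_apply, ← elHom_apply]
      simp only [M, Matrix.sub_apply, Matrix.of_apply, map_sub, Matrix.one_apply]
      split_ifs <;> simp
    have e3 : ∑ k, X.el p (M j k) • X.d p (X.el p (MW.X k)) =
        X.d p (X.el p (MW.X j)) - X.el p u • X.d p (X.el p (y j)) := by
      simp_rw [e2, sub_smul, Finset.sum_sub_distrib, mul_smul]
      rw [← Finset.smul_sum, ← d_el_eq_sum]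
      simp
    rw [e3, e1, map_add, d_el_algebraMap, zero_add, d_el_mul, add_sub_cancel_left]
    exact Submodule.smul_mem _ _ (Submodule.mem_span_singleton_self _)
  have h2 : X.el p M.det • X.d p (X.el p (MW.X i)) =
      ∑ j, X.el p (M.adjugate i j) • ∑ k, X.el p (M j k) • X.d p (X.el p (MW.X k)) := by
    simp_rw [Finset.smul_sum, smul_smul]
    rw [Finset.sum_comm]
    simp_rw [← Finset.sum_smul, ← elHom_apply, ← map_mul, ← map_sum]
    have h3 : ∀ k, ∑ j, M.adjugate i j * M j k = if i = k then M.det else 0 := fun k => by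
      rw [← Matrix.mul_apply, Matrix.adjugate_mul, Matrix.smul_apply, Matrix.one_apply]
      simp
    simp_rw [h3]
    rw [Finset.sum_eq_single i]
    · simp
    · intro k _ hk
      rw [if_neg hk.symm, map_zero, zero_smul]
    · simp
  rw [h2]
  exact sum_mem fun j _ => Submodule.smul_mem _ _ (h1 j)

end

section

variable {K : Type u} [NormedField K] [IsUltrametricDist K] [CompleteSpace K] [CharZero K]
  (p : ℕ) [Fact p.Prime] {π : OK K}

open Robba

/-- A trivialization of the module of logarithmic differentials, under which the differential
corresponds to `T d/dT`. -/
structure Frame (X : DaggerPres K) (v : X.gen p) (j : X.gen p →+* Robba K) where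
  /-- The coefficient of a differential form. -/
  coef : X.LogOmega p v ≃ₗ[X.gen p] X.gen p
  j_coef_logD : ∀ a, j (coef (X.logD p v a)) = theta (j a)

variable {p}

/-- A generator of the differentials whose image in the Robba ring is `1` has no annihilator,
because `j` is injective; so the differentials are free of rank one on it. -/
lemma exists_frame_of_span {X : DaggerPres K} {v : X.gen p} {j : X.gen p →+* Robba K}
    (hj : Function.Injective j) (η : X.LogOmega p v) (hη : Submodule.span (X.gen p) {η} = ⊤)
    (t : X.LogOmega p v →ₛₗ[j] Robba K) (ht : ∀ a, t (X.logD p v a) = theta (j a))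
    (htη : t η = 1) : Nonempty (Frame p X v j) := by
  let e : X.gen p →ₗ[X.gen p] X.LogOmega p v := LinearMap.toSpanSingleton _ _ η
  have hte : ∀ a, t (e a) = j a := fun a => by
    change t (a • η) = _
    rw [map_smulₛₗ, htη, smul_eq_mul, mul_one]
  have he : Function.Bijective e := by
    refine ⟨(injective_iff_map_eq_zero e).mpr fun a ha => hj ?_, fun ω => ?_⟩
    · rw [← hte, ha, map_zero, map_zero]
    · have : ω ∈ Submodule.span (X.gen p) {η} := hη ▸ Submodule.mem_top
      exact Submodule.mem_span_singleton.mp this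
  let E := LinearEquiv.ofBijective e he
  have hE : ∀ ω, j (E.symm ω) = t ω := fun ω => by
    rw [← hte]
    change t (E (E.symm ω)) = _
    rw [LinearEquiv.apply_symm_apply]
  exact ⟨⟨E.symm, fun a => by rw [hE, ht]⟩⟩

lemma theta_Tpow (m : ℤ) : theta (Tpow K m).1 = mono m (m : K) := by
  change theta (mono m 1) = _
  rw [theta_mono, mul_one]

/-- Differentials with a logarithmic pole at the origin are free on `dlog u`. -/
theorem exists_frame_log (hπ : Irreducible π) {X : DaggerPres K} {r : X.int →ₐ[OK K] Rint K}
    (hr : Function.Injective r) {u : MW K X.n} (hu : r (X.proj u) = Tpow K 1)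
    (hspan : Submodule.span (X.gen p) {X.d p (X.el p u)} = ⊤) :
    Nonempty (Frame p X (X.el p u) (toRobba p r)) := by
  have hu' : toRobba p r (X.el p u) = (Tpow K 1).1 := by rw [el, toRobba_algebraMap, hu]
  obtain ⟨t, ht, htd⟩ := exists_logOmega_hom p hπ (X := X) (jB := RingHom.id (Robba K))
    Function.injective_id (dB := theta) (fun _ => rfl) (toRobba p r) (r : X.int →+* Rint K)
    (τ := id) (fun c => r.commutes c) dvd_rfl (fun x => toRobba_algebraMap p r x)
    (v := X.el p u) (c := 1) (by
      rw [hu', theta_Tpow, mul_one, Int.cast_one]; rfl)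
  refine exists_frame_of_span (toRobba_injective p hr) (X.dlog p (X.el p u)) ?_ t ht htd
  rw [eq_top_iff]
  rintro x -
  obtain ⟨⟨ω, b⟩, rfl⟩ := X.logMk_surjective p _ x
  rw [logMk_eq]
  refine add_mem ?_ (Submodule.smul_mem _ _ (Submodule.mem_span_singleton_self _))
  have : ω ∈ Submodule.span (X.gen p) {X.d p (X.el p u)} := hspan ▸ Submodule.mem_top
  obtain ⟨a, rfl⟩ := Submodule.mem_span_singleton.mp this
  have e : X.logMk p (X.el p u) (a • X.d p (X.el p u), 0) =
      a • X.logD p (X.el p u) (X.el p u) := logMk_smul_d _ _ _ _ _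
  rw [e, ← smul_dlog]
  exact Submodule.smul_mem _ _ (Submodule.smul_mem _ _ (Submodule.mem_span_singleton_self _))

/-- Differentials away from the origin are free on `u⁻¹ du`. -/
theorem exists_frame_one (hπ : Irreducible π) {X : DaggerPres K} {r : X.int →ₐ[OK K] Rint K}
    (hr : Function.Injective r) {u : MW K X.n} (hu : r (X.proj u) = Tpow K 1)
    {w : X.gen p} (hw : X.el p u * w = 1)
    (hspan : Submodule.span (X.gen p) {X.d p (X.el p u)} = ⊤) :
    Nonempty (Frame p X 1 (toRobba p r)) := by
  have hu' : toRobba p r (X.el p u) = (Tpow K 1).1 := by rw [el, toRobba_algebraMap, hu]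
  obtain ⟨t, ht, htd⟩ := exists_logOmega_hom p hπ (X := X) (jB := RingHom.id (Robba K))
    Function.injective_id (dB := theta) (fun _ => rfl) (toRobba p r) (r : X.int →+* Rint K)
    (τ := id) (fun c => r.commutes c) dvd_rfl (fun x => toRobba_algebraMap p r x)
    (v := 1) (c := 0) (by rw [mul_zero, map_one, theta_one])
  have hdlog : X.dlog p 1 = 0 := by
    rw [← one_smul (X.gen p) (X.dlog p 1), smul_dlog]
    change X.logMk p 1 (X.d p 1, 0) = 0
    rw [d_one]
    exact map_zero _
  have hη : w • X.logD p 1 (X.el p u) ∈ Submodule.span (X.gen p) {w • X.logD p 1 (X.el p u)} :=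
    Submodule.mem_span_singleton_self _
  refine exists_frame_of_span (toRobba_injective p hr) (w • X.logD p 1 (X.el p u)) ?_ t ht ?_
  · rw [eq_top_iff]
    rintro x -
    obtain ⟨⟨ω, b⟩, rfl⟩ := X.logMk_surjective p _ x
    rw [logMk_eq, hdlog, smul_zero, add_zero]
    have : ω ∈ Submodule.span (X.gen p) {X.d p (X.el p u)} := hspan ▸ Submodule.mem_top
    obtain ⟨a, rfl⟩ := Submodule.mem_span_singleton.mp this
    have e : X.logMk p 1 (a • X.d p (X.el p u), 0) =
        (a * X.el p u) • (w • X.logD p 1 (X.el p u)) := by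
      rw [smul_smul, mul_assoc, hw, mul_one]
      exact logMk_smul_d _ _ _ _ _
    rw [e]
    exact Submodule.smul_mem _ _ hη
  · have h1 : theta (Tpow K 1).1 = (Tpow K 1).1 := by
      rw [theta_Tpow, Int.cast_one]; rfl
    rw [map_smulₛₗ, ht, hu', h1, ← hu', smul_eq_mul, mul_comm, ← map_mul, hw, map_one]

end

end DaggerPres

/-! ## Series converging on a circle -/

section

variable {K : Type u} [NormedField K] [IsUltrametricDist K]

lemma tendsto_prod_wt {s : ℝ} {f g : ℤ → K} (hf : Tendsto (wt s f) cofinite (𝓝 0))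
    (hg : Tendsto (wt s g) cofinite (𝓝 0)) :
    Tendsto (fun x : ℤ × ℤ => wt s f x.1 * wt s g x.2) cofinite (𝓝 0) :=
  tendsto_mul_cofinite_nhds_zero hf hg

lemma norm_conv_le {s C : ℝ} {f g : ℤ → K} {n : ℤ} (hC : 0 ≤ C)
    (h : ∀ i, wt s f i * wt s g (n - i) ≤ C) : wt s (conv f g) n ≤ C := by
  have h1 : ‖conv f g n‖ ≤ C * Real.exp (s * n) := by
    refine IsUltrametricDist.norm_tsum_le_of_forall_le_of_nonneg (by positivity) fun i => ?_
    rw [wt_term s f g n i]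
    exact mul_le_mul_of_nonneg_right (h i) (Real.exp_nonneg _)
  unfold wt
  calc _ ≤ C * Real.exp (s * n) * Real.exp (-(s * n)) :=
        mul_le_mul_of_nonneg_right h1 (Real.exp_nonneg _)
    _ = C := by rw [mul_assoc, ← Real.exp_add, add_neg_cancel, Real.exp_zero, mul_one]

lemma tendsto_wt_conv {s : ℝ} {f g : ℤ → K} (hf : Tendsto (wt s f) cofinite (𝓝 0))
    (hg : Tendsto (wt s g) cofinite (𝓝 0)) : Tendsto (wt s (conv f g)) cofinite (𝓝 0) := by
  rw [Metric.tendsto_nhds]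
  intro δ hδ
  have h := (tendsto_prod_wt hf hg).eventually (gt_mem_nhds (half_pos hδ))
  have hfin : {x : ℤ × ℤ | ¬ wt s f x.1 * wt s g x.2 < δ / 2}.Finite := h
  have hfin' := (hfin.image fun x => x.1 + x.2).compl_mem_cofinite
  filter_upwards [hfin'] with n hn
  rw [Real.dist_eq, sub_zero, abs_of_nonneg (wt_nonneg _ _ _)]
  refine lt_of_le_of_lt (norm_conv_le (half_pos hδ).le fun i => ?_) (half_lt_self hδ)
  by_contra hlt
  refine hn ⟨(i, n - i), fun h => hlt h.le, ?_⟩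
  simp

lemma wt_add_le (s : ℝ) (f g : ℤ → K) (i : ℤ) : wt s (f + g) i ≤ max (wt s f i) (wt s g i) := by
  unfold wt
  rw [← max_mul_of_nonneg _ _ (Real.exp_nonneg _)]
  exact mul_le_mul_of_nonneg_right (IsUltrametricDist.norm_add_le_max _ _) (Real.exp_nonneg _)

lemma wt_neg (s : ℝ) (f : ℤ → K) : wt s (-f) = wt s f := by
  funext i; simp [wt]

lemma wt_single (s : ℝ) (m : ℤ) (c : K) (i : ℤ) :
    wt s (Pi.single m c) i = if i = m then ‖c‖ * Real.exp (-(s * m)) else 0 := by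
  unfold wt
  rw [Pi.single_apply]
  split_ifs with h
  · subst h; rfl
  · simp

lemma tendsto_wt_single (s : ℝ) (m : ℤ) (c : K) :
    Tendsto (wt s (Pi.single m c)) cofinite (𝓝 0) := by
  refine tendsto_nhds_of_eventually_eq ?_
  filter_upwards [(Set.finite_singleton m).compl_mem_cofinite] with i hi
  rw [wt_single, if_neg (show i ≠ m from hi)]

/-- The group of bidirectional series converging on the circle of radius `e^{-s}`. -/
def circSubgroup (s : ℝ) (K : Type u) [NormedField K] [IsUltrametricDist K] : AddSubgroup (ℤ → K) where
  carrier := {f | Tendsto (wt s f) cofinite (𝓝 0)}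
  add_mem' := fun {f g} hf hg => by
    have h0 : Tendsto (fun i => max (wt s f i) (wt s g i)) cofinite (𝓝 0) := by
      simpa using Tendsto.max hf hg
    exact squeeze_zero (wt_nonneg s _) (wt_add_le s f g) h0
  zero_mem' := by
    have : wt s (0 : ℤ → K) = fun _ => 0 := by funext i; simp [wt]
    rw [Set.mem_ofPred_eq, this]; exact tendsto_const_nhds
  neg_mem' := fun {f} hf => by rw [Set.mem_ofPred_eq, wt_neg]; exact hf

/-- Bidirectional series converging on the circle of radius `e^{-s}`. -/
def Circ (s : ℝ) (K : Type u) [NormedField K] [IsUltrametricDist K] : Type u := circSubgroup s K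

variable {s : ℝ}

instance : AddCommGroup (Circ s K) := inferInstanceAs (AddCommGroup (circSubgroup s K))

variable [CompleteSpace K]

lemma summable_conv {f g : ℤ → K} (hf : Tendsto (wt s f) cofinite (𝓝 0))
    (hg : Tendsto (wt s g) cofinite (𝓝 0)) (n : ℤ) : Summable fun i => f i * g (n - i) := by
  refine NonarchimedeanAddGroup.summable_of_tendsto_cofinite_zero ?_
  rw [tendsto_zero_iff_norm_tendsto_zero]
  have h : Function.Injective fun i : ℤ => (i, n - i) := fun i j h => congrArg Prod.fst h
  have h1 := ((tendsto_prod_wt hf hg).comp h.tendsto_cofinite).mul_const (Real.exp (s * n))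
  rw [zero_mul] at h1
  exact h1.congr fun i => (wt_term s f g n i).symm

lemma conv_add_of_tendsto {f g h : ℤ → K} (hf : Tendsto (wt s f) cofinite (𝓝 0))
    (hg : Tendsto (wt s g) cofinite (𝓝 0)) (hh : Tendsto (wt s h) cofinite (𝓝 0)) :
    conv f (g + h) = conv f g + conv f h := by
  funext n
  simp only [conv, Pi.add_apply]
  rw [← (summable_conv hf hg n).tsum_add (summable_conv hf hh n)]
  simp only [mul_add]

lemma conv_assoc_of_tendsto {f g h : ℤ → K} (hf : Tendsto (wt s f) cofinite (𝓝 0))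
    (hg : Tendsto (wt s g) cofinite (𝓝 0)) (hh : Tendsto (wt s h) cofinite (𝓝 0)) :
    conv (conv f g) h = conv f (conv g h) := by
  funext n
  have key : Summable (fun x : ℤ × ℤ => f x.2 * g (x.1 - x.2) * h (n - x.1)) := by
    refine NonarchimedeanAddGroup.summable_of_tendsto_cofinite_zero ?_
    rw [tendsto_zero_iff_norm_tendsto_zero]
    obtain ⟨C, hC⟩ := bdd_of_tendsto hh
    have h1 := ((tendsto_prod_wt hf hg).comp shear.injective.tendsto_cofinite).mul_const
      (C * Real.exp (s * n))
    rw [zero_mul] at h1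
    refine squeeze_zero (fun _ => norm_nonneg _) (fun x => ?_) h1
    have e : ‖f x.2 * g (x.1 - x.2) * h (n - x.1)‖ =
        wt s f x.2 * wt s g (x.1 - x.2) * (wt s h (n - x.1) * Real.exp (s * n)) := by
      rw [norm_mul, wt_term s f g x.1 x.2]
      have e3 : ‖h (n - x.1)‖ * Real.exp (s * x.1) = wt s h (n - x.1) * Real.exp (s * n) := by
        unfold wt
        rw [mul_assoc, ← Real.exp_add]; congr 2; push_cast; ring
      rw [← e3]; ring
    rw [e]
    exact mul_le_mul_of_nonneg_left
      (mul_le_mul_of_nonneg_right (hC _) (Real.exp_nonneg _))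
      (mul_nonneg (wt_nonneg _ _ _) (wt_nonneg _ _ _))
  have lhs : conv (conv f g) h n = ∑' j, ∑' i, f i * g (j - i) * h (n - j) := by
    unfold conv
    exact tsum_congr fun j => tsum_mul_right.symm
  have rhs : conv f (conv g h) n = ∑' i, ∑' j, f i * g (j - i) * h (n - j) := by
    unfold conv
    refine tsum_congr fun i => ?_
    rw [← tsum_mul_left, ← (Equiv.subRight i).tsum_eq]
    refine tsum_congr fun j => ?_
    simp only [Equiv.subRight_apply]
    rw [show n - i - (j - i) = n - j by ring, mul_assoc]
  rw [lhs, rhs]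
  exact Summable.tsum_comm (f := fun i j => f i * g (j - i) * h (n - j))
    ((Equiv.prodComm ℤ ℤ).summable_iff.mp key)

namespace Circ

instance : Mul (Circ s K) := ⟨fun f g => ⟨conv f.1 g.1, tendsto_wt_conv f.2 g.2⟩⟩

instance : One (Circ s K) := ⟨⟨Pi.single 0 1, tendsto_wt_single s 0 1⟩⟩

instance : CommRing (Circ s K) where
  __ := (inferInstance : AddCommGroup (Circ s K))
  mul := (· * ·)
  one := 1
  mul_assoc f g h := Subtype.ext (conv_assoc_of_tendsto f.2 g.2 h.2)
  mul_comm f g := Subtype.ext (conv_comm f.1 g.1)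
  one_mul f := Subtype.ext (by funext n; exact (conv_single 1 0 f.1 n).trans (by simp))
  mul_one f := Subtype.ext ((conv_comm _ _).trans
    (by funext n; exact (conv_single 1 0 f.1 n).trans (by simp)))
  left_distrib f g h := Subtype.ext (conv_add_of_tendsto f.2 g.2 h.2)
  right_distrib f g h := Subtype.ext (by
    change conv (f.1 + g.1) h.1 = conv f.1 h.1 + conv g.1 h.1
    rw [conv_comm, conv_add_of_tendsto h.2 f.2 g.2, conv_comm h.1, conv_comm h.1])
  zero_mul f := Subtype.ext (by
    funext n; change conv 0 f.1 n = 0; simp [conv])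
  mul_zero f := Subtype.ext (by
    funext n; change conv f.1 0 n = 0; simp [conv])

lemma bddAbove (f : Circ s K) : BddAbove (Set.range (wt s f.1)) := by
  obtain ⟨C, hC⟩ := bdd_of_tendsto f.2
  exact ⟨C, by rintro _ ⟨i, rfl⟩; exact hC i⟩

/-- The supremum norm on the circle. -/
def groupNorm (s : ℝ) (K : Type u) [NormedField K] [IsUltrametricDist K] :
    AddGroupNorm (Circ s K) where
  toFun f := ⨆ i, wt s f.1 i
  map_zero' := by
    have : wt s (0 : ℤ → K) = fun _ => 0 := by funext i; simp [wt]
    change ⨆ i, wt s (0 : ℤ → K) i = 0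
    simp [this]
  add_le' f g := by
    have h0 : ∀ h : Circ s K, BddAbove (Set.range (wt s h.1)) := fun h => by
      obtain ⟨C, hC⟩ := bdd_of_tendsto h.2
      exact ⟨C, by rintro _ ⟨i, rfl⟩; exact hC i⟩
    refine ciSup_le fun i => (wt_add_le s f.1 g.1 i).trans (max_le ?_ ?_)
    · exact (le_ciSup (h0 f) i).trans
        (le_add_of_nonneg_right (Real.iSup_nonneg fun j => wt_nonneg s g.1 j))
    · exact (le_ciSup (h0 g) i).trans
        (le_add_of_nonneg_left (Real.iSup_nonneg fun j => wt_nonneg s f.1 j))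
  neg' f := by
    change ⨆ i, wt s (-f.1) i = _
    rw [wt_neg]
  eq_zero_of_map_eq_zero' f hf := by
    obtain ⟨C, hC⟩ := bdd_of_tendsto f.2
    refine Subtype.ext (funext fun i => ?_)
    have h1 : wt s f.1 i ≤ 0 := (le_ciSup (f := wt s f.1)
      ⟨C, by rintro _ ⟨i, rfl⟩; exact hC i⟩ i).trans hf.le
    have h2 := le_antisymm h1 (wt_nonneg s f.1 i)
    exact norm_eq_zero.mp ((mul_eq_zero.mp h2).resolve_right (Real.exp_ne_zero _))

instance : NormedAddCommGroup (Circ s K) := (groupNorm s K).toNormedAddCommGroup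

lemma wt_le_norm (f : Circ s K) (i : ℤ) : wt s f.1 i ≤ ‖f‖ := le_ciSup (bddAbove f) i

lemma norm_le_of {f : Circ s K} {C : ℝ} (h : ∀ i, wt s f.1 i ≤ C) : ‖f‖ ≤ C := ciSup_le h

instance : NormedCommRing (Circ s K) where
  __ := (inferInstance : NormedAddCommGroup (Circ s K))
  __ := (inferInstance : CommRing (Circ s K))
  norm_mul_le f g := norm_le_of fun n => norm_conv_le (by positivity) fun i =>
    mul_le_mul (wt_le_norm f i) (wt_le_norm g _) (wt_nonneg _ _ _) (norm_nonneg _)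

instance : IsUltrametricDist (Circ s K) :=
  IsUltrametricDist.isUltrametricDist_of_forall_norm_add_le_max_norm fun f g =>
    norm_le_of fun i => (wt_add_le s f.1 g.1 i).trans
      (max_le_max (wt_le_norm f i) (wt_le_norm g i))

lemma norm_coeff_le (f : Circ s K) (i : ℤ) : ‖f.1 i‖ ≤ ‖f‖ * Real.exp (s * i) := by
  have h := wt_le_norm f i
  unfold wt at h
  calc ‖f.1 i‖ = ‖f.1 i‖ * Real.exp (-(s * i)) * Real.exp (s * i) := by
        rw [mul_assoc, ← Real.exp_add, neg_add_cancel, Real.exp_zero, mul_one]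
    _ ≤ _ := mul_le_mul_of_nonneg_right h (Real.exp_nonneg _)

lemma coeff_sub (f g : Circ s K) (i : ℤ) : (f - g).1 i = f.1 i - g.1 i := rfl

instance : CompleteSpace (Circ s K) := by
  refine Metric.complete_of_cauchySeq_tendsto fun u hu => ?_
  have hc : ∀ i, CauchySeq fun k => (u k).1 i := fun i => by
    rw [Metric.cauchySeq_iff] at hu ⊢
    intro ε hε
    obtain ⟨N, hN⟩ := hu (ε / Real.exp (s * i)) (by positivity)
    refine ⟨N, fun m hm k hk => ?_⟩
    have h1 := hN m hm k hk
    rw [dist_eq_norm, lt_div_iff₀ (Real.exp_pos _)] at h1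
    rw [dist_eq_norm, ← coeff_sub]
    exact (norm_coeff_le _ i).trans_lt h1
  choose g hg using fun i => cauchySeq_tendsto_of_complete (hc i)
  have hdiff : ∀ ε > 0, ∃ N, ∀ k ≥ N, ∀ i, wt s ((u k).1 - g) i ≤ ε := by
    intro ε hε
    obtain ⟨N, hN⟩ := Metric.cauchySeq_iff.mp hu ε hε
    refine ⟨N, fun k hk i => ?_⟩
    have hlim : Tendsto (fun m => wt s ((u k).1 - (u m).1) i) atTop
        (𝓝 (wt s ((u k).1 - g) i)) := by
      unfold wt
      simp only [Pi.sub_apply]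
      exact ((tendsto_const_nhds.sub (hg i)).norm).mul_const _
    refine le_of_tendsto hlim (eventually_atTop.mpr ⟨N, fun m hm => ?_⟩)
    have h1 := hN k hk m hm
    rw [dist_eq_norm] at h1
    exact (wt_le_norm (u k - u m) i).trans h1.le
  have hg0 : Tendsto (wt s g) cofinite (𝓝 0) := by
    rw [Metric.tendsto_nhds]
    intro ε hε
    obtain ⟨N, hN⟩ := hdiff (ε / 2) (half_pos hε)
    filter_upwards [(u N).2.eventually (gt_mem_nhds (half_pos hε))] with i hi
    rw [Real.dist_eq, sub_zero, abs_of_nonneg (wt_nonneg _ _ _)]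
    have h1 := wt_add_le s (-((u N).1 - g)) (u N).1 i
    rw [wt_neg, neg_sub, sub_add_cancel] at h1
    exact h1.trans_lt (max_lt ((hN N le_rfl i).trans_lt (half_lt_self hε))
      (hi.trans (half_lt_self hε)))
  let G : Circ s K := ⟨g, hg0⟩
  refine ⟨G, Metric.tendsto_atTop.mpr fun ε hε => ?_⟩
  obtain ⟨N, hN⟩ := hdiff (ε / 2) (half_pos hε)
  refine ⟨N, fun k hk => ?_⟩
  rw [dist_eq_norm]
  exact (norm_le_of fun i => hN k hk i).trans_lt (half_lt_self hε)

/-- The monomial `c T^m`. -/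
def mono (s : ℝ) (m : ℤ) (c : K) : Circ s K := ⟨Pi.single m c, tendsto_wt_single s m c⟩

lemma coeff_mono (m : ℤ) (c : K) (i : ℤ) : (mono s m c).1 i = if i = m then c else 0 :=
  Pi.single_apply m c i

lemma coeff_mono_mul (m : ℤ) (c : K) (f : Circ s K) (i : ℤ) :
    (mono s m c * f).1 i = c * f.1 (i - m) := conv_single c m f.1 i

lemma coeff_mul (f g : Circ s K) (i : ℤ) : (f * g).1 i = ∑' j, f.1 j * g.1 (i - j) := rfl

lemma mono_mul_mono (m k : ℤ) (c d : K) : mono s m c * mono s k d = mono s (m + k) (c * d) := by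
  refine Subtype.ext (funext fun i => ?_)
  rw [coeff_mono_mul, coeff_mono, coeff_mono]
  by_cases h : i = m + k
  · rw [if_pos h, if_pos (by omega)]
  · rw [if_neg h, if_neg (by omega), mul_zero]

lemma mono_zero_one : mono s 0 (1 : K) = 1 := rfl

lemma wt_mono_mul (m : ℤ) (c : K) (f : Circ s K) (i : ℤ) :
    wt s (mono s m c * f).1 i = ‖c‖ * Real.exp (-(s * m)) * wt s f.1 (i - m) := by
  unfold wt
  rw [coeff_mono_mul, norm_mul]
  have : Real.exp (-(s * i)) = Real.exp (-(s * m)) * Real.exp (-(s * (i - m : ℤ))) := by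
    rw [← Real.exp_add]; congr 1; push_cast; ring
  rw [this]; ring

/-- For a radius whose powers are not values of `K`, every nonzero series on the circle has a
unique dominating term. -/
lemma exists_eq_mono_mul (hs : ∀ i j : ℤ, ∀ a b : K, a ≠ 0 → b ≠ 0 →
      ‖a‖ * Real.exp (-(s * i)) = ‖b‖ * Real.exp (-(s * j)) → i = j)
    (f : Circ s K) (hf : f ≠ 0) : ∃ (m : ℤ) (c : K) (ε : Circ s K), c ≠ 0 ∧ ‖ε‖ < 1 ∧
      f = mono s m c * (1 + ε) := by
  obtain ⟨i₀, hi₀⟩ : ∃ i, f.1 i ≠ 0 := by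
    by_contra h
    push Not at h
    exact hf (Subtype.ext (funext h))
  have hpos : 0 < wt s f.1 i₀ := mul_pos (norm_pos_iff.mpr hi₀) (Real.exp_pos _)
  have hfin : {i | ¬ wt s f.1 i < wt s f.1 i₀}.Finite := f.2.eventually (gt_mem_nhds hpos)
  obtain ⟨m, hm, hmax⟩ := hfin.toFinset.exists_max_image (wt s f.1)
    ⟨i₀, by simp⟩
  have hm0 : wt s f.1 i₀ ≤ wt s f.1 m := hmax i₀ (by simp)
  have hmax' : ∀ i, wt s f.1 i ≤ wt s f.1 m := fun i => by
    by_cases hi : wt s f.1 i < wt s f.1 i₀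
    · exact hi.le.trans hm0
    · exact hmax i (by simpa using hi)
  have hc : f.1 m ≠ 0 := fun h => by
    have : wt s f.1 m = 0 := by unfold wt; rw [h, norm_zero, zero_mul]
    linarith
  -- By the assumption on the radius two nonzero terms with different exponents never have the same
  -- weight, so the maximum is attained only at `m`.
  have hstrict : ∀ i, i ≠ m → wt s f.1 i < wt s f.1 m := fun i hi => by
    refine lt_of_le_of_ne (hmax' i) fun h => ?_
    by_cases h0 : f.1 i = 0
    · have : wt s f.1 i = 0 := by unfold wt; rw [h0, norm_zero, zero_mul]
      linarith
    · exact hi (hs i m _ _ h0 hc h)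
  set g := mono s (-m) (f.1 m)⁻¹ * f with hg
  have hinv : mono s m (f.1 m) * mono s (-m) (f.1 m)⁻¹ = 1 := by
    rw [mono_mul_mono, add_neg_cancel, mul_inv_cancel₀ hc, mono_zero_one]
  have hM : 0 < wt s f.1 m := hpos.trans_le hm0
  have hgw : ∀ i, wt s g.1 i = wt s f.1 (i + m) / wt s f.1 m := fun i => by
    rw [hg, wt_mono_mul, sub_neg_eq_add]
    conv_rhs => rw [wt, wt]
    unfold wt
    rw [norm_inv, div_eq_mul_inv _ (‖f.1 m‖ * _), mul_inv, ← Real.exp_neg, mul_comm]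
    congr 3
    push_cast; ring
  have hε : ∀ i, wt s (g - 1).1 i < 1 := fun i => by
    by_cases hi : i = 0
    · have : (g - 1).1 i = 0 := by
        subst hi
        rw [coeff_sub, hg, coeff_mono_mul, ← mono_zero_one, coeff_mono, zero_sub, neg_neg,
          inv_mul_cancel₀ hc, if_pos rfl, sub_self]
      unfold wt
      rw [this, norm_zero, zero_mul]
      exact one_pos
    · have : wt s (g - 1).1 i = wt s g.1 i := by
        unfold wt
        rw [coeff_sub, ← mono_zero_one, coeff_mono, if_neg hi, sub_zero]
      rw [this, hgw, div_lt_one hM]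
      exact hstrict _ (by omega)
  -- Every weight is below `1`, and only finitely many reach `1 / 2`, so the supremum is below `1`
  -- too.
  have hε' : ‖g - 1‖ < 1 := by
    have hfin : {i | ¬ wt s (g - 1).1 i < 1 / 2}.Finite :=
      (g - 1).2.eventually (gt_mem_nhds (by norm_num))
    by_cases hne : hfin.toFinset.Nonempty
    · obtain ⟨j, hj, hjmax⟩ := hfin.toFinset.exists_max_image (wt s (g - 1).1) hne
      refine lt_of_le_of_lt (norm_le_of fun i => ?_) (max_lt (hε j) one_half_lt_one)
      by_cases hi : wt s (g - 1).1 i < 1 / 2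
      · exact hi.le.trans (le_max_right _ _)
      · exact (hjmax i (by simpa using hi)).trans (le_max_left _ _)
    · refine lt_of_le_of_lt (norm_le_of fun i => ?_) one_half_lt_one
      by_contra hlt
      refine hne ⟨i, ?_⟩
      rw [Set.Finite.mem_toFinset]
      exact fun h => hlt h.le
  refine ⟨m, f.1 m, g - 1, hc, hε', ?_⟩
  rw [add_sub_cancel, hg, ← mul_assoc, hinv, one_mul]

end Circ

end

/-! ## Factorization of matrices over a circle -/

section

/-- The invertible matrices with entries in a subring, and whose inverses have entries there. -/
def matUnits {R : Type*} [CommRing R] (ι : Type*) [Fintype ι] [DecidableEq ι] (S : Subring R) :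
    Subgroup (Matrix ι ι R)ˣ where
  carrier := {U | (∀ i j, U.1 i j ∈ S) ∧ ∀ i j, (U⁻¹).1 i j ∈ S}
  mul_mem' := by
    rintro U V ⟨hU, hU'⟩ ⟨hV, hV'⟩
    refine ⟨fun i j => ?_, fun i j => ?_⟩
    · exact S.sum_mem fun k _ => S.mul_mem (hU i k) (hV k j)
    · rw [mul_inv_rev]
      exact S.sum_mem fun k _ => S.mul_mem (hV' i k) (hU' k j)
  one_mem' := by
    have h : ∀ i j, (1 : Matrix ι ι R) i j ∈ S := fun i j => by
      rw [Matrix.one_apply]; split_ifs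
      exacts [S.one_mem, S.zero_mem]
    exact ⟨h, by rw [inv_one]; exact h⟩
  inv_mem' := by
    rintro U ⟨hU, hU'⟩
    exact ⟨hU', by rw [inv_inv]; exact hU⟩

/-- Additive splittings give multiplicative ones near the identity. -/
theorem exists_units_mul_of_norm_lt {𝔸 : Type*} [NormedRing 𝔸] [CompleteSpace 𝔸]
    [IsUltrametricDist 𝔸] (S T : Subring 𝔸) (hS : IsClosed (S : Set 𝔸))
    (hT : IsClosed (T : Set 𝔸)) (P : 𝔸 →+ 𝔸) (hP : ∀ a, ‖P a‖ ≤ ‖a‖) (hPT : ∀ a, P a ∈ T)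
    (hPS : ∀ a, a - P a ∈ S) (ε : 𝔸) (hε : ‖ε‖ < 1) :
    ∃ (x : Sˣ) (y : Tˣ), 1 + ε = (x : S) * (y : T) := by
  -- A fixed point `w = -P (ε + ε w)` lies in `T`, and `(1 + ε) (1 + w) = 1 + ((ε + ε w) - P (ε + ε
  -- w))` lies in `1 + S`. Both `w` and the term from `S` have norm below `1`, and closed subrings
  -- are complete, so both factors are invertible in their subrings.
  have hf : ContractingWith ‖ε‖₊ (fun w : 𝔸 => -P (ε + ε * w)) := by
    refine ⟨hε, LipschitzWith.of_dist_le_mul fun a b => ?_⟩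
    rw [dist_eq_norm, dist_eq_norm]
    have e : -P (ε + ε * a) - -P (ε + ε * b) = -P (ε * (a - b)) := by
      rw [← sub_eq_zero, mul_sub]
      simp only [map_add, map_sub]
      abel
    rw [e, norm_neg]
    exact (hP _).trans (norm_mul_le _ _)
  set w := hf.fixedPoint with hw
  have hfix : -P (ε + ε * w) = w := hf.fixedPoint_isFixedPt
  have hεw : ‖ε + ε * w‖ ≤ max ‖ε‖ (‖ε‖ * ‖w‖) :=
    (IsUltrametricDist.norm_add_le_max _ _).trans (max_le_max le_rfl (norm_mul_le _ _))
  have hw1 : ‖w‖ < 1 := by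
    have h1 : ‖w‖ ≤ max ‖ε‖ (‖ε‖ * ‖w‖) := by
      conv_lhs => rw [← hfix, norm_neg]
      exact (hP _).trans hεw
    rcases le_max_iff.mp h1 with h2 | h2
    · exact h2.trans_lt hε
    · by_contra h3
      nlinarith [norm_nonneg ε]
  have hεw' : ‖ε + ε * w‖ < 1 :=
    hεw.trans_lt (max_lt hε (by nlinarith [norm_nonneg ε, norm_nonneg w]))
  have hx1 : ‖(ε + ε * w) - P (ε + ε * w)‖ < 1 := by
    rw [sub_eq_add_neg]
    refine (IsUltrametricDist.norm_add_le_max _ _).trans_lt (max_lt hεw' ?_)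
    rw [norm_neg]
    exact (hP _).trans_lt hεw'
  have key : (1 + ε) * (1 + w) = 1 + ((ε + ε * w) - P (ε + ε * w)) := by
    rw [sub_eq_add_neg, hfix]
    noncomm_ring
  have hwT : w ∈ T := by rw [← hfix]; exact T.neg_mem (hPT _)
  have : CompleteSpace S := hS.completeSpace_coe
  have : CompleteSpace T := hT.completeSpace_coe
  let x : Sˣ := Units.oneSub (-⟨_, hPS (ε + ε * w)⟩ : S) (by rw [norm_neg]; exact hx1)
  let y : Tˣ := Units.oneSub (-⟨w, hwT⟩ : T) (by rw [norm_neg]; exact hw1)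
  have hy : ((y : T) : 𝔸) = 1 + w := by
    change (1 : 𝔸) - -w = _
    rw [sub_neg_eq_add]
  have hxx : ((x : S) : 𝔸) = 1 + ((ε + ε * w) - P (ε + ε * w)) := by
    change (1 : 𝔸) - -_ = _
    rw [sub_neg_eq_add]
  refine ⟨x, y⁻¹, ?_⟩
  rw [hxx, ← key, ← hy, mul_assoc, ← Subring.coe_mul, Units.mul_inv, Subring.coe_one, mul_one]

variable {ι : Type*} [Fintype ι] [DecidableEq ι]

attribute [local instance] Matrix.normedAddCommGroup

/-- The supremum norm on matrices over an ultrametric ring. -/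
@[reducible] def matNormedRing {R : Type*} [NormedCommRing R] [IsUltrametricDist R] :
    NormedRing (Matrix ι ι R) where
  __ := (Matrix.normedAddCommGroup : NormedAddCommGroup (Matrix ι ι R))
  __ := (inferInstance : Ring (Matrix ι ι R))
  norm_mul_le f g := by
    refine (Matrix.norm_le_iff (by positivity)).mpr fun i j => ?_
    rw [Matrix.mul_apply]
    refine IsUltrametricDist.norm_sum_le_of_forall_le_of_nonneg (by positivity) fun k _ => ?_
    exact (norm_mul_le _ _).trans (mul_le_mul (Matrix.norm_entry_le_entrywise_sup_norm f)
      (Matrix.norm_entry_le_entrywise_sup_norm g) (norm_nonneg _) (norm_nonneg _))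

attribute [local instance] matNormedRing

lemma matIsUltrametricDist {R : Type*} [NormedCommRing R] [IsUltrametricDist R] :
    IsUltrametricDist (Matrix ι ι R) :=
  IsUltrametricDist.isUltrametricDist_of_forall_norm_add_le_max_norm fun f g =>
    (Matrix.norm_le_iff (le_max_of_le_left (norm_nonneg _))).mpr fun i j =>
      (IsUltrametricDist.norm_add_le_max (f i j) (g i j)).trans
        (max_le_max (Matrix.norm_entry_le_entrywise_sup_norm f)
          (Matrix.norm_entry_le_entrywise_sup_norm g))

attribute [local instance] matIsUltrametricDist

lemma exists_pivot {R : Type*} [CommRing R] (hR : IsField R) (M : Matrix ι ι R) :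
    ∃ (L L' : List (Matrix.TransvectionStruct ι R)) (D : ι → R),
      M = (L.map Matrix.TransvectionStruct.toMatrix).prod * Matrix.diagonal D *
        (L'.map Matrix.TransvectionStruct.toMatrix).prod := by
  let _ := hR.toField
  exact Matrix.Pivot.exists_list_transvec_mul_diagonal_mul_list_transvec M

lemma diagonal_mul_transvection {R : Type*} [CommRing R] (D E : ι → R)
    (hDE : ∀ i, D i * E i = 1) (i j : ι) (c : R) :
    Matrix.diagonal D * Matrix.transvection i j c =
      Matrix.transvection i j (D i * c * E j) * Matrix.diagonal D := by
  rw [Matrix.transvection, Matrix.transvection, mul_add, add_mul, mul_one, one_mul]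
  congr 1
  ext k l
  rw [Matrix.diagonal_mul, Matrix.mul_diagonal, Matrix.single_apply, Matrix.single_apply]
  by_cases h : i = k ∧ j = l
  · obtain ⟨rfl, rfl⟩ := h
    rw [if_pos ⟨rfl, rfl⟩, if_pos ⟨rfl, rfl⟩, mul_assoc, mul_comm (E j), hDE, mul_one]
  · rw [if_neg h, if_neg h, mul_zero, zero_mul]

/-- Over a field, an invertible matrix lies in `H * diagonal` for every monoid `H` that contains
all transvections. -/
lemma exists_mul_diagonal {R : Type*} [CommRing R] (hR : IsField R) (H : Submonoid (Matrix ι ι R))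
    (hH : ∀ i j c, i ≠ j → Matrix.transvection i j c ∈ H) (M : (Matrix ι ι R)ˣ) :
    ∃ h ∈ H, ∃ D : ι → R, (∀ i, D i ≠ 0) ∧ M.1 = h * Matrix.diagonal D := by
  obtain ⟨L, L', D, hM⟩ := exists_pivot hR M.1
  let _ := hR.toField
  have hlist : ∀ L : List (Matrix.TransvectionStruct ι R),
      (L.map Matrix.TransvectionStruct.toMatrix).prod ∈ H := fun L =>
    Submonoid.list_prod_mem _ fun x hx => by
      obtain ⟨t, _, rfl⟩ := List.mem_map.mp hx
      exact hH _ _ _ t.hij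
  have hD : ∀ i, D i ≠ 0 := by
    have h1 : IsUnit M.1.det := (Matrix.isUnit_iff_isUnit_det _).mp M.isUnit
    have hdet : ∀ L : List (Matrix.TransvectionStruct ι R),
      (L.map Matrix.TransvectionStruct.toMatrix).prod.det = 1 := fun L =>
        Matrix.TransvectionStruct.det_toMatrix_prod L
    rw [hM, Matrix.det_mul, Matrix.det_mul, hdet, hdet, one_mul, mul_one,
      Matrix.det_diagonal] at h1
    intro i
    have : Nontrivial R := ⟨hR.exists_pair_ne⟩
    exact ((IsUnit.prod_univ_iff).mp h1 i).ne_zero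
  choose E hE using fun i => hR.mul_inv_cancel (hD i)
  -- A diagonal matrix moves to the right past a transvection at the price of rescaling its
  -- off-diagonal entry, so the transvections gather on the left.
  have hconj : ∀ L : List (Matrix.TransvectionStruct ι R), ∃ h ∈ H,
      Matrix.diagonal D * (L.map Matrix.TransvectionStruct.toMatrix).prod =
        h * Matrix.diagonal D := by
    intro L
    induction L with
    | nil => exact ⟨1, H.one_mem, by simp⟩
    | cons t L ih =>
      obtain ⟨h, hh, e⟩ := ih
      refine ⟨_, H.mul_mem (hH t.i t.j (D t.i * t.c * E t.j) t.hij) hh, ?_⟩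
      rw [List.map_cons, List.prod_cons, ← mul_assoc, Matrix.TransvectionStruct.toMatrix,
        diagonal_mul_transvection D E hE, mul_assoc (Matrix.transvection _ _ _), e,
        ← mul_assoc (Matrix.transvection _ _ _) h]
  obtain ⟨h, hh, e⟩ := hconj L'
  exact ⟨_, H.mul_mem (hlist L) hh, D, hD, by rw [hM, mul_assoc, e, mul_assoc]⟩

/-- The matrices that can be approximated multiplicatively by elements of a group of units. -/
def approxMonoid {𝔸 : Type*} [NormedRing 𝔸] (G : Subgroup 𝔸ˣ) : Submonoid 𝔸 where
  carrier := {h | ∀ δ > 0, ∃ g ∈ G, ‖(g⁻¹ : 𝔸ˣ).1 * h - 1‖ < δ}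
  one_mem' δ hδ := ⟨1, G.one_mem, by simpa using hδ⟩
  mul_mem' := by
    intro h₁ h₂ H₁ H₂ δ hδ
    -- The approximation of `h₂` is chosen first: the error made for `h₁` is conjugated by `g₂`,
    -- which costs at most the factor `C`, so `h₁` has to be approximated with an accuracy that
    -- depends on `g₂`.
    obtain ⟨g₂, hg₂, e₂⟩ := H₂ (min 1 (δ / 3)) (by positivity)
    set C := ‖(g₂⁻¹ : 𝔸ˣ).1‖ * ‖g₂.1‖ with hC
    have hC0 : 0 ≤ C := by positivity
    obtain ⟨g₁, hg₁, e₁⟩ := H₁ (δ / (3 * (C + 1))) (by positivity)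
    refine ⟨g₁ * g₂, G.mul_mem hg₁ hg₂, ?_⟩
    set a := (g₁⁻¹ : 𝔸ˣ).1 * h₁ - 1 with ha
    set b := (g₂⁻¹ : 𝔸ˣ).1 * h₂ - 1 with hb
    have e : (((g₁ * g₂)⁻¹ : 𝔸ˣ)).1 * (h₁ * h₂) - 1 =
        ((g₂⁻¹ : 𝔸ˣ).1 * a * g₂.1) + ((g₂⁻¹ : 𝔸ˣ).1 * a * g₂.1) * b + b := by
      have h2 : g₂.1 * b = h₂ - g₂.1 := by
        rw [hb, mul_sub, ← mul_assoc, Units.mul_inv, one_mul, mul_one]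
      have h3 : (g₂⁻¹ : 𝔸ˣ).1 * g₂.1 = 1 := Units.inv_mul _
      rw [mul_assoc _ g₂.1 b, h2, mul_inv_rev, Units.val_mul, ha]
      have h4 : b = (g₂⁻¹ : 𝔸ˣ).1 * h₂ - 1 := hb
      conv_rhs => rw [h4]
      noncomm_ring
    have hx : ‖(g₂⁻¹ : 𝔸ˣ).1 * a * g₂.1‖ ≤ δ / 3 := by
      calc _ ≤ ‖(g₂⁻¹ : 𝔸ˣ).1‖ * ‖a‖ * ‖g₂.1‖ :=
            (norm_mul_le _ _).trans (mul_le_mul_of_nonneg_right (norm_mul_le _ _) (norm_nonneg _))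
        _ = C * ‖a‖ := by rw [hC]; ring
        _ ≤ (C + 1) * (δ / (3 * (C + 1))) :=
            mul_le_mul (by linarith) e₁.le (norm_nonneg _) (by positivity)
        _ = δ / 3 := by field_simp
    rw [e]
    have hb1 : ‖b‖ < 1 := e₂.trans_le (min_le_left _ _)
    have hb2 : ‖b‖ < δ / 3 := e₂.trans_le (min_le_right _ _)
    have hxb : ‖(g₂⁻¹ : 𝔸ˣ).1 * a * g₂.1 * b‖ ≤ δ / 3 := (norm_mul_le _ _).trans (by
      nlinarith [norm_nonneg b, norm_nonneg ((g₂⁻¹ : 𝔸ˣ).1 * a * g₂.1)])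
    linarith [norm_add₃_le (a := (g₂⁻¹ : 𝔸ˣ).1 * a * g₂.1) (b := (g₂⁻¹ : 𝔸ˣ).1 * a * g₂.1 * b)
      (c := b)]

lemma mem_approxMonoid {𝔸 : Type*} [NormedRing 𝔸] {G : Subgroup 𝔸ˣ} {g : 𝔸ˣ} (hg : g ∈ G) :
    g.1 ∈ approxMonoid G := fun δ hδ => ⟨g, hg, by simpa using hδ⟩

namespace Circ

variable {K : Type u} [NormedField K] [IsUltrametricDist K] [CompleteSpace K] {s : ℝ}

/-- The part of a series with exponents in a given set. -/
def restrict (A : Set ℤ) : Circ s K →+ Circ s K where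
  toFun f := ⟨A.indicator f.1, by
    refine squeeze_zero (wt_nonneg s _) (fun i => ?_) f.2
    unfold wt
    exact mul_le_mul_of_nonneg_right (norm_indicator_le_norm_self _ _) (Real.exp_nonneg _)⟩
  map_zero' := Subtype.ext (Set.indicator_zero' _)
  map_add' f g := Subtype.ext (Set.indicator_add _ _ _)

lemma coeff_restrict (A : Set ℤ) (f : Circ s K) (i : ℤ) :
    (restrict A f).1 i = A.indicator f.1 i := rfl

lemma norm_restrict_le (A : Set ℤ) (f : Circ s K) : ‖restrict A f‖ ≤ ‖f‖ :=
  norm_le_of fun i => by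
    refine le_trans ?_ (wt_le_norm f i)
    unfold wt
    exact mul_le_mul_of_nonneg_right (norm_indicator_le_norm_self _ _) (Real.exp_nonneg _)

lemma mul_coeff_eq_zero {f g : Circ s K} {i : ℤ} (h : ∀ j, f.1 j = 0 ∨ g.1 (i - j) = 0) :
    (f * g).1 i = 0 := by
  rw [coeff_mul]
  refine (tsum_congr fun j => ?_).trans tsum_zero
  exact mul_eq_zero.mpr (h j)

/-- The series without negative powers. -/
def pos (s : ℝ) (K : Type u) [NormedField K] [IsUltrametricDist K] [CompleteSpace K] :
    Subring (Circ s K) where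
  carrier := {f | ∀ i < 0, f.1 i = 0}
  mul_mem' {f g} hf hg i hi := mul_coeff_eq_zero fun j => by
    by_cases hj : j < 0
    · exact Or.inl (hf j hj)
    · exact Or.inr (hg _ (by omega))
  one_mem' i hi := by
    rw [← mono_zero_one, coeff_mono, if_neg hi.ne]
  add_mem' {f g} hf hg i hi := by
    change f.1 i + g.1 i = 0
    rw [hf i hi, hg i hi, add_zero]
  zero_mem' i hi := rfl
  neg_mem' {f} hf i hi := by
    change -f.1 i = 0
    rw [hf i hi, neg_zero]

/-- The series without positive powers. -/
def nonpos (s : ℝ) (K : Type u) [NormedField K] [IsUltrametricDist K] [CompleteSpace K] :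
    Subring (Circ s K) where
  carrier := {f | ∀ i > 0, f.1 i = 0}
  mul_mem' {f g} hf hg i hi := mul_coeff_eq_zero fun j => by
    by_cases hj : 0 < j
    · exact Or.inl (hf j hj)
    · exact Or.inr (hg _ (by omega))
  one_mem' i hi := by
    rw [← mono_zero_one, coeff_mono, if_neg hi.ne']
  add_mem' {f g} hf hg i hi := by
    change f.1 i + g.1 i = 0
    rw [hf i hi, hg i hi, add_zero]
  zero_mem' i hi := rfl
  neg_mem' {f} hf i hi := by
    change -f.1 i = 0
    rw [hf i hi, neg_zero]

/-- The series with finitely many positive powers. -/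
def mero (s : ℝ) (K : Type u) [NormedField K] [IsUltrametricDist K] [CompleteSpace K] :
    Subring (Circ s K) where
  carrier := {f | ∃ N : ℤ, ∀ i > N, f.1 i = 0}
  mul_mem' := by
    rintro f g ⟨N, hf⟩ ⟨N', hg⟩
    exact ⟨N + N', fun i hi => mul_coeff_eq_zero fun j => by
      by_cases hj : N < j
      · exact Or.inl (hf j hj)
      · exact Or.inr (hg _ (by omega))⟩
  one_mem' := ⟨0, (nonpos s K).one_mem⟩
  add_mem' := by
    rintro f g ⟨N, hf⟩ ⟨N', hg⟩
    refine ⟨max N N', fun i hi => ?_⟩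
    change f.1 i + g.1 i = 0
    rw [hf i (by omega), hg i (by omega), add_zero]
  zero_mem' := ⟨0, fun i hi => rfl⟩
  neg_mem' := by
    rintro f ⟨N, hf⟩
    refine ⟨N, fun i hi => ?_⟩
    change -f.1 i = 0
    rw [hf i hi, neg_zero]

lemma nonpos_le_mero : nonpos s K ≤ mero s K := fun _ hf => ⟨0, hf⟩

lemma continuous_coeff (i : ℤ) : Continuous fun f : Circ s K => f.1 i := by
  refine (LipschitzWith.of_dist_le_mul (K := ⟨Real.exp (s * i), Real.exp_nonneg _⟩)
    fun f g => ?_).continuous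
  rw [dist_eq_norm, dist_eq_norm, ← coeff_sub, mul_comm]
  exact norm_coeff_le _ i

lemma isClosed_pos : IsClosed (pos s K : Set (Circ s K)) := by
  have : (pos s K : Set (Circ s K)) = ⋂ i : ℤ, ⋂ _ : i < 0, {f | f.1 i = 0} := by
    ext f; simp only [Set.mem_iInter]; rfl
  rw [this]
  exact isClosed_iInter fun i => isClosed_iInter fun _ =>
    isClosed_eq (continuous_coeff i) continuous_const

lemma isClosed_nonpos : IsClosed (nonpos s K : Set (Circ s K)) := by
  have : (nonpos s K : Set (Circ s K)) = ⋂ i : ℤ, ⋂ _ : 0 < i, {f | f.1 i = 0} := by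
    ext f; simp only [Set.mem_iInter]; rfl
  rw [this]
  exact isClosed_iInter fun i => isClosed_iInter fun _ =>
    isClosed_eq (continuous_coeff i) continuous_const

lemma exists_mero_norm_sub_lt (f : Circ s K) {δ : ℝ} (hδ : 0 < δ) :
    ∃ g ∈ mero s K, ‖f - g‖ < δ := by
  have hfin : {i | ¬ wt s f.1 i < δ / 2}.Finite := f.2.eventually (gt_mem_nhds (half_pos hδ))
  obtain ⟨N, hN⟩ := hfin.bddAbove
  refine ⟨restrict {i | i ≤ N} f, ⟨N, fun i hi => ?_⟩, ?_⟩
  · rw [coeff_restrict]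
    exact Set.indicator_of_notMem (by simpa using hi) _
  · refine lt_of_le_of_lt (norm_le_of fun i => ?_) (half_lt_self hδ)
    unfold wt
    rw [coeff_sub, coeff_restrict]
    by_cases hi : i ≤ N
    · rw [Set.indicator_of_mem (by simpa using hi), sub_self, norm_zero, zero_mul]
      exact (half_pos hδ).le
    · rw [Set.indicator_of_notMem (by simpa using hi), sub_zero]
      by_contra h
      exact hi (hN (show i ∈ {i | ¬ wt s f.1 i < δ / 2} from fun h' => h h'.le))

lemma mono_mem_mero (m : ℤ) (c : K) : mono s m c ∈ mero s K :=
  ⟨m, fun i hi => by rw [coeff_mono, if_neg hi.ne']⟩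

lemma mono_mul_mono_inv (m : ℤ) {c : K} (hc : c ≠ 0) : mono s m c * mono s (-m) c⁻¹ = 1 := by
  rw [mono_mul_mono, add_neg_cancel, mul_inv_cancel₀ hc, mono_zero_one]

lemma isField (hs : ∀ i j : ℤ, ∀ a b : K, a ≠ 0 → b ≠ 0 →
      ‖a‖ * Real.exp (-(s * i)) = ‖b‖ * Real.exp (-(s * j)) → i = j) : IsField (Circ s K) where
  exists_pair_ne := ⟨0, 1, fun h => by
    have := congrArg (fun f : Circ s K => f.1 0) h
    rw [← mono_zero_one] at this
    simp only [coeff_mono, if_true] at this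
    exact zero_ne_one (this : (0 : K) = 1)⟩
  mul_comm := mul_comm
  mul_inv_cancel := fun {f} hf => by
    obtain ⟨m, c, ε, hc, hε, rfl⟩ := exists_eq_mono_mul hs f hf
    let y : (Circ s K)ˣ := Units.oneSub (-ε) (by rwa [norm_neg])
    have hy : y.1 = 1 + ε := sub_neg_eq_add _ _
    refine ⟨mono s (-m) c⁻¹ * (y⁻¹).1, ?_⟩
    rw [← hy, mul_mul_mul_comm, mono_mul_mono_inv m hc, Units.mul_inv, mul_one]

/-- The matrices with entries in a subring. -/
def _root_.Dagger.matSubring {R : Type*} [CommRing R] (ι : Type*) [Fintype ι] [DecidableEq ι]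
    (S : Subring R) : Subring (Matrix ι ι R) where
  carrier := {U | ∀ i j, U i j ∈ S}
  mul_mem' hU hV i j := S.sum_mem fun k _ => S.mul_mem (hU i k) (hV k j)
  one_mem' i j := by
    rw [Matrix.one_apply]; split_ifs
    exacts [S.one_mem, S.zero_mem]
  add_mem' hU hV i j := S.add_mem (hU i j) (hV i j)
  zero_mem' _ _ := S.zero_mem
  neg_mem' hU i j := S.neg_mem (hU i j)

lemma _root_.Dagger.map_mem_matUnits {R : Type*} [CommRing R] {S S' : Subring R} (h : S ≤ S')
    (x : (matSubring ι S)ˣ) : Units.map (matSubring ι S).subtype.toMonoidHom x ∈ matUnits ι S' :=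
  ⟨fun i j => h (x.1.2 i j), fun i j => h (x⁻¹.1.2 i j)⟩

/-- Every invertible matrix over a circle of irrational radius is the product of an invertible
matrix whose entries have finitely many positive powers and an invertible matrix of series without
negative powers. -/
theorem exists_birkhoff (hs : ∀ i j : ℤ, ∀ a b : K, a ≠ 0 → b ≠ 0 →
      ‖a‖ * Real.exp (-(s * i)) = ‖b‖ * Real.exp (-(s * j)) → i = j)
    (U : (Matrix ι ι (Circ s K))ˣ) :
    ∃ W ∈ matUnits ι (mero s K), ∃ V ∈ matUnits ι (pos s K), U = W * V := by
  set G := matUnits ι (mero s K) with hG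
  -- A transvection is approximated by cutting off the high positive powers of its entry.
  have htrans : ∀ i j (c : Circ s K), i ≠ j → Matrix.transvection i j c ∈ approxMonoid G := by
    intro i j c hij δ hδ
    obtain ⟨g, hg, hcg⟩ := exists_mero_norm_sub_lt c hδ
    have hmem : ∀ c ∈ mero s K, ∀ k l, Matrix.transvection i j c k l ∈ mero s K := by
      intro c hc k l
      rw [Matrix.transvection, Matrix.add_apply, Matrix.one_apply, Matrix.single_apply]
      split_ifs <;>
      simp [hc, Subring.add_mem]
    let t : (Matrix ι ι (Circ s K))ˣ := ⟨Matrix.transvection i j g, Matrix.transvection i j (-g),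
      by rw [Matrix.transvection_mul_transvection_same _ _ hij]; simp,
      by rw [Matrix.transvection_mul_transvection_same _ _ hij]; simp⟩
    refine ⟨t, ⟨hmem g hg, hmem (-g) (Subring.neg_mem _ hg)⟩, ?_⟩
    change ‖Matrix.transvection i j (-g) * Matrix.transvection i j c - 1‖ < δ
    rw [Matrix.transvection_mul_transvection_same _ _ hij, Matrix.transvection, add_sub_cancel_left]
    refine (Matrix.norm_lt_iff hδ).mpr fun k l => ?_
    rw [Matrix.single_apply]
    split_ifs
    · rw [neg_add_eq_sub]; exact hcg
    · rw [norm_zero]; exact hδ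
  -- At this radius the circle is a field, so `U` is a product of transvections and a diagonal
  -- matrix. Every diagonal entry is a monomial times `1 + ε` with `‖ε‖ < 1`. Approximating the
  -- transvections and keeping the monomials exactly gives `U = g (1 + small)` with `g` in `G`, and
  -- the small factor splits by the truncation at degree `0`.
  obtain ⟨h, hh, D, hD, hU⟩ := exists_mul_diagonal (isField hs) _ htrans U
  choose m c ε hc hε hDε using fun i => exists_eq_mono_mul hs (D i) (hD i)
  let D₀ : (Matrix ι ι (Circ s K))ˣ := ⟨Matrix.diagonal fun i => mono s (m i) (c i),
    Matrix.diagonal fun i => mono s (-m i) (c i)⁻¹,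
    by simp [Matrix.diagonal_mul_diagonal, mono_mul_mono_inv _ (hc _)],
    by simp [Matrix.diagonal_mul_diagonal, mul_comm, mono_mul_mono_inv _ (hc _)]⟩
  have hD₀ : D₀ ∈ G := by
    have hmem : ∀ (m : ι → ℤ) (c : ι → K) i j,
        (Matrix.diagonal fun i => mono s (m i) (c i)) i j ∈ mero s K := fun m c i j => by
      rw [Matrix.diagonal_apply]
      split_ifs
      exacts [mono_mem_mero _ _, Subring.zero_mem _]
    exact ⟨hmem m c, hmem (fun i => -m i) fun i => (c i)⁻¹⟩
  obtain ⟨g, hg, hgh⟩ := (approxMonoid G).mul_mem hh (mem_approxMonoid hD₀) 1 one_pos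
  set e := (g⁻¹ : (Matrix ι ι (Circ s K))ˣ).1 * (h * D₀.1) - 1 with he
  have hE : ‖(Matrix.diagonal ε : Matrix ι ι (Circ s K))‖ < 1 :=
    (Matrix.norm_lt_iff one_pos).mpr fun i j => by
      rw [Matrix.diagonal_apply]
      split_ifs
      · exact hε i
      · rw [norm_zero]; exact one_pos
  have hUe : U.1 = g.1 * (1 + (e + e * Matrix.diagonal ε + Matrix.diagonal ε)) := by
    have h1 : Matrix.diagonal D = D₀.1 * (1 + Matrix.diagonal ε) := by
      change _ = Matrix.diagonal _ * _
      rw [← Matrix.diagonal_one, Matrix.diagonal_add, Matrix.diagonal_mul_diagonal]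
      exact congrArg _ (funext hDε)
    have h2 : g.1 * (1 + e) = h * D₀.1 := by
      rw [he, add_sub_cancel, ← mul_assoc, Units.mul_inv, one_mul]
    rw [hU, h1, ← mul_assoc, ← h2, mul_assoc]
    congr 1
    noncomm_ring
  have hsmall : ‖e + e * Matrix.diagonal ε + Matrix.diagonal ε‖ < 1 := by
    refine (IsUltrametricDist.norm_add_le_max _ _).trans_lt (max_lt ?_ hE)
    refine (IsUltrametricDist.norm_add_le_max _ _).trans_lt (max_lt hgh ?_)
    refine (norm_mul_le _ _).trans_lt ?_
    nlinarith [norm_nonneg e, norm_nonneg (Matrix.diagonal ε : Matrix ι ι (Circ s K))]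
  have hcont : ∀ i j, Continuous fun A : Matrix ι ι (Circ s K) => A i j := fun i j =>
    (continuous_apply j).comp (continuous_apply i)
  have hclosed : ∀ S : Subring (Circ s K), IsClosed (S : Set (Circ s K)) →
      IsClosed (matSubring ι S : Set (Matrix ι ι (Circ s K))) := by
    intro S hS
    have : (matSubring ι S : Set (Matrix ι ι (Circ s K))) = ⋂ i, ⋂ j, {A | A i j ∈ S} := by
      ext f; simp only [Set.mem_iInter]; rfl
    rw [this]
    exact isClosed_iInter fun i => isClosed_iInter fun j => hS.preimage (hcont i j)
  obtain ⟨x, y, hxy⟩ := @exists_units_mul_of_norm_lt (Matrix ι ι (Circ s K)) matNormedRing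
    (inferInstanceAs (CompleteSpace (ι → ι → Circ s K))) matIsUltrametricDist (matSubring ι (nonpos s K))
    (matSubring ι (pos s K)) (hclosed _ isClosed_nonpos) (hclosed _ isClosed_pos)
    (AddMonoidHom.mapMatrix (restrict {i | 0 ≤ i}))
    (fun a => (Matrix.norm_le_iff (norm_nonneg _)).mpr fun i j =>
      (norm_restrict_le _ _).trans (Matrix.norm_entry_le_entrywise_sup_norm a))
    (fun a i j k hk => by
      change (restrict _ (a i j)).1 k = 0
      rw [coeff_restrict]
      exact Set.indicator_of_notMem (by simpa using hk) _)
    (fun a i j k hk => by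
      change (a i j).1 k - (restrict _ (a i j)).1 k = 0
      rw [coeff_restrict, Set.indicator_of_mem (by simpa using hk.le), sub_self])
    _ hsmall
  refine ⟨g * Units.map (matSubring ι (nonpos s K)).subtype.toMonoidHom x,
    G.mul_mem hg (map_mem_matUnits nonpos_le_mero x),
    Units.map (matSubring ι (pos s K)).subtype.toMonoidHom y, map_mem_matUnits le_rfl y,
    Units.ext ?_⟩
  rw [hUe, hxy, Units.val_mul, Units.val_mul, mul_assoc]
  rfl

end Circ

end

/-! ## Factorization of matrices over the Robba ring -/

section

variable {K : Type u} [NormedField K] [IsUltrametricDist K]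

lemma exists_norm_eq_zpow [IsDiscreteValuationRing (OK K)] {π : OK K} (hπ : Irreducible π) {a : K}
    (ha : a ≠ 0) : ∃ m : ℤ, ‖a‖ = ‖(π : K)‖ ^ m := by
  have hu : ∀ w : (OK K)ˣ, ‖((w : OK K) : K)‖ = 1 := fun w => by
    have h1 : ∀ x : OK K, ‖(x : K)‖ ≤ 1 := fun x => x.2
    have h2 : ‖((w : OK K) : K)‖ * ‖((w⁻¹ : (OK K)ˣ) : OK K).1‖ = 1 := by
      rw [← norm_mul]
      have : ((w : OK K) : K) * ((w⁻¹ : (OK K)ˣ) : OK K).1 = 1 := by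
        exact congrArg (fun x : OK K => (x : K)) w.mul_inv
      rw [this, norm_one]
    refine le_antisymm (h1 _) ?_
    nlinarith [h1 w, h1 ((w⁻¹ : (OK K)ˣ) : OK K), norm_nonneg ((w : OK K) : K)]
  have hint : ∀ b : OK K, b ≠ 0 → ∃ m : ℕ, ‖(b : K)‖ = ‖(π : K)‖ ^ m := fun b hb => by
    obtain ⟨m, w, rfl⟩ := IsDiscreteValuationRing.eq_unit_mul_pow_irreducible hb hπ
    refine ⟨m, ?_⟩
    push_cast
    rw [norm_mul, hu, one_mul, norm_pow]
  rcases le_total ‖a‖ 1 with h | h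
  · obtain ⟨m, hm⟩ := hint ⟨a, h⟩ (fun h0 => ha (congrArg Subtype.val h0))
    exact ⟨m, by rw [zpow_natCast]; exact hm⟩
  · have h' : ‖a⁻¹‖ ≤ 1 := by rw [norm_inv]; exact inv_le_one_of_one_le₀ h
    obtain ⟨m, hm⟩ := hint ⟨a⁻¹, h'⟩ (fun h0 => ha (inv_eq_zero.mp (congrArg Subtype.val h0)))
    refine ⟨-m, ?_⟩
    rw [zpow_neg, zpow_natCast, ← hm]
    simp

/-- There are arbitrarily small radii whose powers are not values of `K`. -/
lemma exists_irrational_radius [IsDiscreteValuationRing (OK K)] {r : ℝ} (hr : 0 < r) :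
    ∃ s : ℝ, 0 < s ∧ s < r ∧ ∀ i j : ℤ, ∀ a b : K, a ≠ 0 → b ≠ 0 →
      ‖a‖ * Real.exp (-(s * i)) = ‖b‖ * Real.exp (-(s * j)) → i = j := by
  obtain ⟨π, hπ⟩ := IsDiscreteValuationRing.exists_irreducible (OK K)
  have hπ0 : (π : K) ≠ 0 := fun h => hπ.ne_zero (Subtype.ext h)
  have hpos : 0 < ‖(π : K)‖ := norm_pos_iff.mpr hπ0
  set l := |Real.log ‖(π : K)‖| + 1 with hl
  have hl0 : 0 < l := by positivity
  by_cases hlog : Real.log ‖(π : K)‖ = 0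
  · refine ⟨r / 2, by linarith, by linarith, fun i j a b ha hb h => ?_⟩
    have h1 : ∀ c : K, c ≠ 0 → ‖c‖ = 1 := fun c hc => by
      obtain ⟨m, hm⟩ := exists_norm_eq_zpow hπ hc
      have : ‖(π : K)‖ = 1 := by rw [← Real.exp_log hpos, hlog, Real.exp_zero]
      rw [hm, this, one_zpow]
    rw [h1 a ha, h1 b hb, one_mul, one_mul, Real.exp_eq_exp, neg_inj] at h
    exact_mod_cast mul_left_cancel₀ (by linarith : r / 2 ≠ 0) h
  -- The nonzero norms of `K` are powers of `‖π‖`. With `s` an irrational multiple of `|log ‖π‖|`,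
  -- equal weights for `i ≠ j` would make this multiple rational.
  · obtain ⟨x, hx, hx0, hx1⟩ := exists_irrational_btwn
      (show (0 : ℝ) < r / |Real.log ‖(π : K)‖| from div_pos hr (abs_pos.mpr hlog))
    refine ⟨x * |Real.log ‖(π : K)‖|, mul_pos hx0 (abs_pos.mpr hlog),
      (lt_div_iff₀ (abs_pos.mpr hlog)).mp hx1, fun i j a b ha hb h => ?_⟩
    obtain ⟨m, hm⟩ := exists_norm_eq_zpow hπ ha
    obtain ⟨k, hk⟩ := exists_norm_eq_zpow hπ hb
    have h2 := congrArg Real.log h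
    rw [Real.log_mul (norm_ne_zero_iff.mpr ha) (Real.exp_ne_zero _), Real.log_exp,
      Real.log_mul (norm_ne_zero_iff.mpr hb) (Real.exp_ne_zero _), Real.log_exp, hm, hk,
      Real.log_zpow, Real.log_zpow] at h2
    by_contra hij
    have hij' : ((i - j : ℤ) : ℝ) ≠ 0 := by exact_mod_cast sub_ne_zero.mpr hij
    rcases abs_choice (Real.log ‖(π : K)‖) with h3 | h3
    · rw [h3] at h2
      have h4 : x * ((i - j : ℤ) : ℝ) = ((m - k : ℤ) : ℝ) :=
        mul_right_cancel₀ hlog (by push_cast; linarith)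
      exact (hx.mul_intCast (sub_ne_zero.mpr hij)).ne_int _ h4
    · rw [h3] at h2
      have h4 : x * ((i - j : ℤ) : ℝ) = ((k - m : ℤ) : ℝ) :=
        mul_right_cancel₀ hlog (by push_cast; linarith)
      exact (hx.mul_intCast (sub_ne_zero.mpr hij)).ne_int _ h4

variable [CompleteSpace K]

namespace Robba

/-- The elements of the Robba ring with finitely many positive powers. -/
def mero (K : Type u) [NormedField K] [CompleteSpace K] : Subring (Robba K) where
  carrier := {f | ∃ N : ℤ, ∀ i > N, f.1 i = 0}
  mul_mem' := by
    rintro f g ⟨N, hf⟩ ⟨N', hg⟩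
    refine ⟨N + N', fun i hi => ?_⟩
    rw [coeff_mul]
    refine (tsum_congr fun j => ?_).trans tsum_zero
    by_cases hj : N < j
    · rw [hf j hj, zero_mul]
    · rw [hg _ (by omega), mul_zero]
  one_mem' := ⟨0, fun i hi => by rw [coeff_one, if_neg hi.ne']⟩
  add_mem' := by
    rintro f g ⟨N, hf⟩ ⟨N', hg⟩
    refine ⟨max N N', fun i hi => ?_⟩
    rw [coeff_add, hf i (by omega), hg i (by omega), add_zero]
  zero_mem' := ⟨0, fun i hi => rfl⟩
  neg_mem' := by
    rintro f ⟨N, hf⟩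
    exact ⟨N, fun i hi => by rw [coeff_neg, hf i hi, neg_zero]⟩

/-- The elements of the Robba ring that converge on the circle of radius `e^{-s}`. -/
def atRadius (K : Type u) [NormedField K] [IsUltrametricDist K] [CompleteSpace K] (s : ℝ) :
    Subring (Robba K) where
  carrier := {f | Tendsto (wt s f.1) cofinite (𝓝 0)}
  mul_mem' hf hg := tendsto_wt_conv hf hg
  one_mem' := tendsto_wt_single s 0 1
  add_mem' := (circSubgroup s K).add_mem
  zero_mem' := (circSubgroup s K).zero_mem
  neg_mem' := (circSubgroup s K).neg_mem

/-- Restriction to a circle. -/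
def toCirc (s : ℝ) : atRadius K s →+* Circ s K where
  toFun f := ⟨f.1.1, f.2⟩
  map_one' := rfl
  map_mul' _ _ := rfl
  map_zero' := rfl
  map_add' _ _ := rfl

lemma toCirc_injective (s : ℝ) : Function.Injective (toCirc (K := K) s) := fun _ _ h =>
  Subtype.ext (Subtype.ext (congrArg (fun x : Circ s K => x.1) h))

/-- With finitely many positive powers, convergence on the circle of radius `e^{-s}` implies
convergence on all circles of larger radius `e^{-t}`, `0 < t ≤ s`. So a factor found on a single
circle already belongs to the Robba ring. -/
lemma exists_toCirc_eq {s : ℝ} (hs : 0 < s) {f : Circ s K} (hf : f ∈ Circ.mero s K) :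
    ∃ g : atRadius K s, toCirc s g = f ∧ g.1 ∈ mero K := by
  obtain ⟨N, hN⟩ := hf
  have hR : IsRobba f.1 := by
    refine ⟨s, hs, fun t ht hts => ?_⟩
    have h1 := f.2.const_mul (Real.exp ((s - t) * N))
    rw [mul_zero] at h1
    refine squeeze_zero (wt_nonneg t _) (fun i => ?_) h1
    by_cases hi : N < i
    · rw [wt, hN i hi, norm_zero, zero_mul]
      exact mul_nonneg (Real.exp_nonneg _) (wt_nonneg _ _ _)
    · have e : wt t f.1 i = Real.exp ((s - t) * i) * wt s f.1 i := by
        unfold wt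
        rw [mul_left_comm, ← Real.exp_add]; congr 2; ring
      rw [e]
      refine mul_le_mul_of_nonneg_right (Real.exp_le_exp.mpr ?_) (wt_nonneg _ _ _)
      have : (i : ℝ) ≤ N := by exact_mod_cast not_lt.mp hi
      exact mul_le_mul_of_nonneg_left this (by linarith)
  exact ⟨⟨⟨f.1, hR⟩, f.2⟩, rfl, N, hN⟩

variable {ι : Type*} [Fintype ι] [DecidableEq ι]

lemma _root_.Dagger.exists_units_lift {R S : Type*} [CommRing R] [CommRing S] {f : R →+* S}
    (hf : Function.Injective f) (U : (Matrix ι ι S)ˣ) (T : Subring S) (hU : U ∈ matUnits ι T)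
    (H : ∀ x ∈ T, ∃ y, f y = x) :
    ∃ V : (Matrix ι ι R)ˣ, Units.map f.mapMatrix.toMonoidHom V = U := by
  choose A hA using fun i j => H _ (hU.1 i j)
  choose B hB using fun i j => H _ (hU.2 i j)
  have hA' : f.mapMatrix (Matrix.of A) = U.1 := by ext i j; exact hA i j
  have hB' : f.mapMatrix (Matrix.of B) = (U⁻¹).1 := by ext i j; exact hB i j
  have hinj : Function.Injective (f.mapMatrix : Matrix ι ι R →+* Matrix ι ι S) :=
    Matrix.map_injective hf
  refine ⟨⟨Matrix.of A, Matrix.of B, hinj ?_, hinj ?_⟩, Units.ext hA'⟩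
  · rw [map_mul, map_one, hA', hB', Units.mul_inv]
  · rw [map_mul, map_one, hA', hB', Units.inv_mul]

/-- Every invertible matrix over the Robba ring is the product of an invertible matrix whose
entries have finitely many positive powers and an invertible matrix of series without negative
powers. -/
theorem exists_birkhoff [IsDiscreteValuationRing (OK K)] (U : (Matrix ι ι (Robba K))ˣ) :
    ∃ W ∈ matUnits ι (mero K), ∃ V ∈ matUnits ι (plus K), U = W * V := by
  have hrad : ∃ r : ℝ, 0 < r ∧ ∀ s, 0 < s → s ≤ r → ∀ i j,
      U.1 i j ∈ atRadius K s ∧ (U⁻¹).1 i j ∈ atRadius K s := by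
    choose a ha ha' using fun i j => (U.1 i j).2
    choose b hb hb' using fun i j => ((U⁻¹).1 i j).2
    have hev : ∀ᶠ s in 𝓝[>] (0 : ℝ), ∀ i j, s ≤ a i j ∧ s ≤ b i j := by
      rw [Filter.eventually_all]; intro i
      rw [Filter.eventually_all]; intro j
      exact ((gt_mem_nhds (ha i j)).filter_mono nhdsWithin_le_nhds |>.mono fun _ h => h.le).and
        ((gt_mem_nhds (hb i j)).filter_mono nhdsWithin_le_nhds |>.mono fun _ h => h.le)
    obtain ⟨r, hr, hr0⟩ := (hev.and self_mem_nhdsWithin).exists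
    exact ⟨r, hr0, fun s hs hsr i j => ⟨ha' i j s hs (hsr.trans (hr i j).1),
      hb' i j s hs (hsr.trans (hr i j).2)⟩⟩
  obtain ⟨r, hr, hU⟩ := hrad
  obtain ⟨s, hs, hsr, hirr⟩ := exists_irrational_radius (K := K) hr
  have hinj := toCirc_injective (K := K) s
  obtain ⟨U₀, hU₀⟩ := exists_units_lift (f := (atRadius K s).subtype) Subtype.val_injective U
    (atRadius K s) ⟨fun i j => (hU s hs hsr.le i j).1, fun i j => (hU s hs hsr.le i j).2⟩
    fun x hx => ⟨⟨x, hx⟩, rfl⟩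
  -- The factorization is made on one circle only. The factor `W` lifts to the Robba ring by
  -- `exists_toCirc_eq`, and then `V` lifts as well, being `W⁻¹ U`.
  obtain ⟨W, hW, V, hV, hUWV⟩ := Circ.exists_birkhoff hirr
    (Units.map (toCirc (K := K) s).mapMatrix.toMonoidHom U₀)
  obtain ⟨W₀, hW₀⟩ := exists_units_lift hinj W _ hW fun x hx => by
    obtain ⟨g, hg, _⟩ := exists_toCirc_eq hs hx
    exact ⟨g, hg⟩
  have hmem : ∀ x : atRadius K s, toCirc s x ∈ Circ.mero s K → x.1 ∈ mero K := fun x hx => hx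
  have hmem' : ∀ x : atRadius K s, toCirc s x ∈ Circ.pos s K → x.1 ∈ plus K := fun x hx =>
    mem_plus.mpr hx
  have hV₀ : V = Units.map (toCirc (K := K) s).mapMatrix.toMonoidHom (W₀⁻¹ * U₀) := by
    rw [map_mul, map_inv, hW₀, hUWV, inv_mul_cancel_left]
  refine ⟨Units.map (atRadius K s).subtype.mapMatrix.toMonoidHom W₀, ⟨fun i j => ?_, fun i j => ?_⟩,
    Units.map (atRadius K s).subtype.mapMatrix.toMonoidHom (W₀⁻¹ * U₀), ⟨fun i j => ?_,
    fun i j => ?_⟩, ?_⟩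
  · refine hmem (W₀.1 i j) ?_
    rw [← hW₀] at hW
    exact hW.1 i j
  · refine hmem ((W₀⁻¹).1 i j) ?_
    rw [← hW₀] at hW
    exact hW.2 i j
  · refine hmem' ((W₀⁻¹ * U₀).1 i j) ?_
    rw [hV₀] at hV
    exact hV.1 i j
  · refine hmem' (((W₀⁻¹ * U₀)⁻¹).1 i j) ?_
    rw [hV₀] at hV
    exact hV.2 i j
  · rw [← map_mul, mul_inv_cancel_left, hU₀]

end Robba

end

/-! ## Unipotent differential systems over the Robba ring -/

section

/-- Matrices vanishing below the `k`-th superdiagonal. -/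
def UT {R : Type*} [CommRing R] {n : ℕ} (k : ℕ) (A : Matrix (Fin n) (Fin n) R) : Prop :=
  ∀ i j : Fin n, (j : ℕ) < i + k → A i j = 0

variable {R : Type*} [CommRing R] {n : ℕ}

lemma UT.mul {k l : ℕ} {A B : Matrix (Fin n) (Fin n) R} (hA : UT k A) (hB : UT l B) :
    UT (k + l) (A * B) := fun i j h => by
  rw [Matrix.mul_apply]
  refine Finset.sum_eq_zero fun m _ => ?_
  by_cases hm : (m : ℕ) < i + k
  · rw [hA i m hm, zero_mul]
  · rw [hB m j (by omega), mul_zero]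

lemma UT.add {k : ℕ} {A B : Matrix (Fin n) (Fin n) R} (hA : UT k A) (hB : UT k B) :
    UT k (A + B) := fun i j h => by rw [Matrix.add_apply, hA i j h, hB i j h, add_zero]

lemma UT.neg {k : ℕ} {A : Matrix (Fin n) (Fin n) R} (hA : UT k A) : UT k (-A) :=
  fun i j h => by rw [Matrix.neg_apply, hA i j h, neg_zero]

lemma UT.sub {k : ℕ} {A B : Matrix (Fin n) (Fin n) R} (hA : UT k A) (hB : UT k B) :
    UT k (A - B) := by rw [sub_eq_add_neg]; exact hA.add hB.neg

lemma UT.mono {k l : ℕ} (hkl : l ≤ k) {A : Matrix (Fin n) (Fin n) R} (hA : UT k A) : UT l A :=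
  fun i j h => hA i j (by omega)

lemma UT.eq_zero {k : ℕ} (hk : n ≤ k) {A : Matrix (Fin n) (Fin n) R} (hA : UT k A) : A = 0 := by
  ext i j
  exact hA i j (by omega)

lemma UT.map {S : Type*} [CommRing S] {k : ℕ} {A : Matrix (Fin n) (Fin n) R} (hA : UT k A)
    {f : R → S} (hf : f 0 = 0) : UT k (A.map f) := fun i j h => by
  rw [Matrix.map_apply, hA i j h, hf]

lemma UT.smul {k : ℕ} {A : Matrix (Fin n) (Fin n) R} (hA : UT k A) (c : R) : UT k (c • A) :=
  fun i j h => by rw [Matrix.smul_apply, hA i j h, smul_zero]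

lemma UT.isUnit_one_add {A : Matrix (Fin n) (Fin n) R} (hA : UT 1 A) : IsUnit (1 + A) := by
  have h : ∀ k, UT k (A ^ k) := fun k => by
    induction k with
    | zero =>
      intro i j h
      rw [pow_zero, Matrix.one_apply_ne]
      rintro rfl; omega
    | succ k ih => rw [pow_succ]; exact ih.mul hA
  exact IsNilpotent.isUnit_one_add ⟨n, (h n).eq_zero le_rfl⟩

end

section

variable {K : Type u} [NormedField K] [IsUltrametricDist K]

/-- By Bézout `1 = a m + b p`; if `m` also had norm below `1`, the ultrametric inequality would give
`‖1‖ < 1`. -/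
lemma norm_natCast_eq_one {p : ℕ} (hp' : p.Prime) (hp : ‖(p : K)‖ < 1) {m : ℕ} (hm : ¬ p ∣ m) :
    ‖(m : K)‖ = 1 := by
  refine le_antisymm (IsUltrametricDist.norm_natCast_le_one K m) ?_
  by_contra hlt
  push Not at hlt
  have hco : IsCoprime (m : ℤ) (p : ℤ) :=
    Nat.isCoprime_iff_coprime.mpr ((Nat.Prime.coprime_iff_not_dvd hp').mpr hm).symm
  obtain ⟨a, b, hab⟩ := hco
  have h1 : (a : K) * m + b * p = 1 := by exact_mod_cast congrArg (Int.cast : ℤ → K) hab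
  have h2 : ‖(a : K) * m + b * p‖ < 1 := by
    refine (IsUltrametricDist.norm_add_le_max _ _).trans_lt (max_lt ?_ ?_)
    · rw [norm_mul]
      nlinarith [IsUltrametricDist.norm_intCast_le_one K a, norm_nonneg (a : K),
        norm_nonneg (m : K)]
    · rw [norm_mul]
      nlinarith [IsUltrametricDist.norm_intCast_le_one K b, norm_nonneg (b : K),
        norm_nonneg (p : K)]
  rw [h1, norm_one] at h2
  exact lt_irrefl _ h2

/-- The inverses of the integers grow subexponentially. -/
lemma exists_exp_le_norm_natCast [CharZero K] {p : ℕ} (hp' : p.Prime) (hp : ‖(p : K)‖ < 1) {δ : ℝ}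
    (hδ : 0 < δ) :
    ∃ C : ℝ, 0 ≤ C ∧ ∀ m : ℕ, m ≠ 0 → Real.exp (-(δ * m)) ≤ C * ‖(m : K)‖ := by
  have hp0 : 0 < ‖(p : K)‖ := norm_pos_iff.mpr (Nat.cast_ne_zero.mpr hp'.ne_zero)
  -- The norm of `m` is `‖p‖ ^ v`, with `v` the `p`-adic valuation, while `m ≥ p ^ v ≥ 2 ^ v`. So
  -- the claim compares a linear function of `v` with the exponential `δ 2 ^ v`; the constant `D`
  -- takes care of small `v`.
  obtain ⟨D, hD⟩ : ∃ D : ℝ, ∀ v : ℕ, v * (-Real.log ‖(p : K)‖) ≤ δ * 2 ^ v + D := by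
    have h1 : Tendsto (fun v : ℕ => ((v : ℝ) ^ 1 / 2 ^ v) * (-Real.log ‖(p : K)‖)) atTop
        (𝓝 (0 * _)) := (tendsto_pow_const_div_const_pow_of_one_lt 1 one_lt_two).mul_const _
    rw [zero_mul] at h1
    obtain ⟨N, hN⟩ := eventually_atTop.mp (h1.eventually (gt_mem_nhds hδ))
    refine ⟨N * |Real.log ‖(p : K)‖|, fun v => ?_⟩
    by_cases hv : N ≤ v
    · have h2 := hN v hv
      rw [pow_one, div_mul_eq_mul_div, div_lt_iff₀ (by positivity)] at h2
      have : 0 ≤ N * |Real.log ‖(p : K)‖| := by positivity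
      linarith
    · have h3 : (v : ℝ) ≤ N := by exact_mod_cast (not_le.mp hv).le
      have h4 : (v : ℝ) * (-Real.log ‖(p : K)‖) ≤ v * |Real.log ‖(p : K)‖| :=
        mul_le_mul_of_nonneg_left (neg_le_abs _) (Nat.cast_nonneg _)
      have h5 := mul_le_mul_of_nonneg_right h3 (abs_nonneg (Real.log ‖(p : K)‖))
      have : 0 ≤ δ * 2 ^ v := by positivity
      linarith
  refine ⟨Real.exp D, (Real.exp_pos _).le, fun m hm => ?_⟩
  obtain ⟨v, m', hm', rfl⟩ := Nat.exists_eq_pow_mul_and_not_dvd hm p hp'.ne_one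
  have h6 : ‖((p ^ v * m' : ℕ) : K)‖ = Real.exp (v * Real.log ‖(p : K)‖) := by
    push_cast
    rw [norm_mul, norm_pow, norm_natCast_eq_one hp' hp hm', mul_one, Real.exp_nat_mul,
      Real.exp_log hp0]
  rw [h6, ← Real.exp_add, Real.exp_le_exp]
  have h7 : (2 : ℝ) ^ v ≤ ((p ^ v * m' : ℕ) : ℝ) := by
    have : 2 ^ v ≤ p ^ v * m' := (Nat.pow_le_pow_left hp'.two_le v).trans
      (Nat.le_mul_of_pos_right _ (Nat.pos_of_ne_zero fun h => hm' (h ▸ dvd_zero p)))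
    exact_mod_cast this
  have h8 := mul_le_mul_of_nonneg_left h7 hδ.le
  linarith [hD v]

namespace Robba

variable [CompleteSpace K] [CharZero K] {p : ℕ}

/-- The negative part of a series is `θ` of something. -/
lemma exists_eq_sub_theta (hp' : p.Prime) (hp : ‖(p : K)‖ < 1) (f : Robba K) :
    ∃ m ∈ plus K, ∃ g, f = m - theta g := by
  obtain ⟨r, hr, hf⟩ := f.2
  -- Dividing the coefficient of `T ^ (-m)` by `m` costs at most a constant times `e^{r m / 2}`, so
  -- the antiderivative converges for `0 < s ≤ r / 2`.
  obtain ⟨C, hC0, hC⟩ := exists_exp_le_norm_natCast (K := K) hp' hp (half_pos hr)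
  let g₀ : ℤ → K := fun i => if i < 0 then -((i : K)⁻¹ * f.1 i) else 0
  have hg₀ : IsRobba g₀ := by
    refine ⟨r / 2, half_pos hr, fun s hs hsr => ?_⟩
    have h1 := (hf r hr le_rfl).const_mul C
    rw [mul_zero] at h1
    refine squeeze_zero (wt_nonneg _ _) (fun i => ?_) h1
    by_cases hi : i < 0
    · obtain ⟨m, rfl⟩ : ∃ m : ℕ, i = -m := ⟨i.natAbs, by omega⟩
      have hm : m ≠ 0 := by omega
      have hmK : 0 < ‖(m : K)‖ := norm_pos_iff.mpr (Nat.cast_ne_zero.mpr hm)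
      have h2 := hC m hm
      have e : wt s g₀ (-m) = ‖(m : K)‖⁻¹ * (‖f.1 (-m)‖ * Real.exp (s * m)) := by
        simp only [wt, g₀, if_pos hi]
        push_cast
        rw [norm_neg, norm_mul, norm_inv, norm_neg, mul_assoc]
        congr 3; ring
      have e' : wt r f.1 (-m) = ‖f.1 (-m)‖ * Real.exp (r * m) := by
        unfold wt
        congr 2; push_cast; ring
      rw [e, e', inv_mul_le_iff₀ hmK]
      have h3 : Real.exp (s * m) ≤ Real.exp (r * m) * Real.exp (-(r / 2 * m)) := by
        rw [← Real.exp_add, Real.exp_le_exp]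
        have := mul_le_mul_of_nonneg_right hsr (Nat.cast_nonneg (α := ℝ) m)
        linarith
      calc ‖f.1 (-m)‖ * Real.exp (s * m)
          ≤ ‖f.1 (-m)‖ * (Real.exp (r * m) * (C * ‖(m : K)‖)) :=
            mul_le_mul_of_nonneg_left (h3.trans (mul_le_mul_of_nonneg_left h2
              (Real.exp_nonneg _))) (norm_nonneg _)
        _ = _ := by ring
    · have : wt s g₀ i = 0 := by simp only [wt, g₀, if_neg hi, norm_zero, zero_mul]
      rw [this]
      exact mul_nonneg hC0 (wt_nonneg _ _ _)
  refine ⟨f + theta ⟨g₀, hg₀⟩, mem_plus.mpr fun i hi => ?_, ⟨g₀, hg₀⟩, by ring⟩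
  rw [coeff_add, coeff_theta]
  simp only [g₀, if_pos hi]
  rw [mul_neg, mul_inv_cancel_left₀ (by exact_mod_cast hi.ne), add_neg_cancel]

variable {ι : Type*} [Fintype ι] {n : ℕ}

lemma map_theta_mul (A B : Matrix ι ι (Robba K)) :
    (A * B).map theta = A.map theta * B + A * B.map theta := by
  refine Matrix.ext fun i j => ?_
  rw [Matrix.map_apply, Matrix.mul_apply, map_sum, Matrix.add_apply, Matrix.mul_apply,
    Matrix.mul_apply, ← Finset.sum_add_distrib]
  refine Finset.sum_congr rfl fun k _ => ?_
  rw [theta_mul, Matrix.map_apply, Matrix.map_apply]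
  ring

lemma map_theta_add (A B : Matrix ι ι (Robba K)) :
    (A + B).map theta = A.map theta + B.map theta := by
  refine Matrix.ext fun i j => ?_
  simp

lemma map_theta_one [DecidableEq ι] : (1 : Matrix ι ι (Robba K)).map theta = 0 := by
  refine Matrix.ext fun i j => ?_
  rw [Matrix.map_apply, Matrix.one_apply]
  split_ifs
  · exact theta_one
  · exact map_zero _

lemma map_theta_inv [DecidableEq ι] (U : (Matrix ι ι (Robba K))ˣ) :
    (U⁻¹).1.map theta = -((U⁻¹).1 * U.1.map theta * (U⁻¹).1) := by
  have h := map_theta_mul U.1 (U⁻¹).1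
  rw [Units.mul_inv, map_theta_one] at h
  have h2 : (U⁻¹).1 * (U.1 * (U⁻¹).1.map theta) = (U⁻¹).1.map theta := by
    rw [← mul_assoc, Units.inv_mul, one_mul]
  rw [← h2, eq_neg_of_add_eq_zero_right h.symm, mul_neg, mul_assoc]

/-- A unipotent system over the Robba ring is isomorphic to one with coefficients in `plus`. -/
theorem exists_gauge (hp' : p.Prime) (hp : ‖(p : K)‖ < 1)
    {N : Matrix (Fin n) (Fin n) (Robba K)} (hN : UT 1 N) :
    ∃ (G : (Matrix (Fin n) (Fin n) (Robba K))ˣ) (N' : Matrix (Fin n) (Fin n) (Robba K)),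
      UT 1 N' ∧ (∀ i j, N' i j ∈ plus K) ∧ G.1.map theta + N * G.1 = G.1 * N' := by
  -- The splitting is chosen to be zero for `f = 0`, so that applying it to each entry preserves
  -- strict triangularity.
  have hsplit : ∀ f : Robba K, ∃ m g, m ∈ plus K ∧ f = m - theta g ∧ (f = 0 → m = 0 ∧ g = 0) := by
    intro f
    by_cases h : f = 0
    · exact ⟨0, 0, Subring.zero_mem _, by rw [map_zero, sub_zero, h], fun _ => ⟨rfl, rfl⟩⟩
    · obtain ⟨m, hm, g, hg⟩ := exists_eq_sub_theta hp' hp f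
      exact ⟨m, g, hm, hg, fun h' => absurd h' h⟩
  choose m g hm hg h0 using hsplit
  -- Successive approximation along the superdiagonals. With the error written as `E = m(E) - θ
  -- g(E)`, adding `g(E)` to `G` and `m(E)` to `N'` cancels it to first order. What remains are
  -- products of a strictly triangular matrix with `g(E)` or `m(E)`, which vanish on one more
  -- diagonal.
  have key : ∀ d : ℕ, ∃ G N' : Matrix (Fin n) (Fin n) (Robba K), UT 1 G ∧ UT 1 N' ∧
      (∀ i j, N' i j ∈ plus K) ∧ UT (d + 1) (G.map theta + N * (1 + G) - (1 + G) * N') := by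
    intro d
    induction d with
    | zero =>
      refine ⟨0, 0, fun _ _ _ => rfl, fun _ _ _ => rfl, fun _ _ => Subring.zero_mem _, ?_⟩
      have : (0 : Matrix (Fin n) (Fin n) (Robba K)).map theta = 0 := Matrix.ext fun i j => by simp
      simpa only [this, add_zero, mul_one, mul_zero, sub_zero, zero_add] using hN
    | succ d ih =>
      obtain ⟨G, N', hG, hN', hplus, hE⟩ := ih
      set E := G.map theta + N * (1 + G) - (1 + G) * N' with hEdef
      have hD : UT (d + 1) (E.map g) := hE.map (h0 0 rfl).2
      have hM : UT (d + 1) (E.map m) := hE.map (h0 0 rfl).1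
      have hEe : E = E.map m - (E.map g).map theta := by
        exact Matrix.ext fun i j => hg (E i j)
      refine ⟨G + E.map g, N' + E.map m, hG.add (hD.mono (by omega)),
        hN'.add (hM.mono (by omega)), fun i j => Subring.add_mem _ (hplus i j) (hm _), ?_⟩
      have e : (G + E.map g).map theta + N * (1 + (G + E.map g)) -
          (1 + (G + E.map g)) * (N' + E.map m) =
          N * E.map g - G * E.map m - E.map g * N' - E.map g * E.map m := by
        have h1 : (E.map g).map theta = E.map m - E := by rw [eq_sub_iff_add_eq, add_comm]; exact (eq_sub_iff_add_eq.mp hEe)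
        rw [map_theta_add, h1]
        conv_lhs => enter [1, 1, 2, 2]; rw [hEdef]
        noncomm_ring
      rw [e]
      refine UT.sub (UT.sub (UT.sub ?_ ?_) ?_) ?_
      · exact (hN.mul hD).mono (by omega)
      · exact (hG.mul hM).mono (by omega)
      · exact (hD.mul hN').mono (by omega)
      · exact (hD.mul hM).mono (by omega)
  obtain ⟨G, N', hG, hN', hplus, hE⟩ := key n
  obtain ⟨U, hU⟩ := hG.isUnit_one_add
  refine ⟨U, N', hN', hplus, ?_⟩
  rw [hU, map_theta_add, map_theta_one, zero_add]
  exact sub_eq_zero.mp (hE.eq_zero (by omega))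

/-- Solutions of unipotent systems with coefficients in `plus` lie in `plus`. -/
theorem mem_plus_of_system {A B H : Matrix (Fin n) (Fin n) (Robba K)} (hA : UT 1 A) (hB : UT 1 B)
    (hA' : ∀ i j, A i j ∈ plus K) (hB' : ∀ i j, B i j ∈ plus K)
    (h : H.map theta = A * H + H * B) (i j : Fin n) : H i j ∈ plus K := by
  -- By strict triangularity the entry `(i, j)` of `A H + H B` involves only the entries of `H`
  -- further down in column `j` and further left in row `i`; for these `n - i + j` is smaller.
  have key : ∀ (d : ℕ) (i j : Fin n), n - i + j = d → H i j ∈ plus K := by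
    intro d
    induction d using Nat.strong_induction_on with
    | _ d ih =>
      intro i j hd
      refine mem_plus_of_theta ?_
      have h1 := congrFun (congrFun h i) j
      rw [Matrix.map_apply, Matrix.add_apply, Matrix.mul_apply, Matrix.mul_apply] at h1
      rw [h1]
      refine Subring.add_mem _ (Subring.sum_mem _ fun k _ => ?_) (Subring.sum_mem _ fun k _ => ?_)
      · by_cases hk : (k : ℕ) < i + 1
        · rw [hA i k hk, zero_mul]; exact Subring.zero_mem _
        · exact Subring.mul_mem _ (hA' i k) (ih _ (by omega) k j rfl)
      · by_cases hk : (j : ℕ) < k + 1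
        · rw [hB k j hk, mul_zero]; exact Subring.zero_mem _
        · exact Subring.mul_mem _ (ih _ (by omega) i k rfl) (hB' k j)
  exact key _ i j rfl

end Robba

end

/-! ## Semilinear substitutions in series on the open unit disc -/

section

variable {K : Type u} [NormedField K] [IsUltrametricDist K] [CompleteSpace K]

namespace Robba

/-- The power series `∑ c_n T^n` as an element of the Robba ring. -/
lemma exists_toPS_eq {g : PowerSeries K}
    (hg : ∀ s : ℝ, 0 < s → ∃ C : ℝ, ∀ n : ℕ, ‖PowerSeries.coeff n g‖ ≤ C * Real.exp (s * n)) :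
    ∃ f : plus K, toPS f.1 = g := by
  let f : ℤ → K := fun i => if 0 ≤ i then PowerSeries.coeff i.toNat g else 0
  have hf : IsRobba f := by
    refine ⟨1, one_pos, fun s hs _ => ?_⟩
    obtain ⟨C, hC⟩ := hg (s / 2) (half_pos hs)
    have h1 := ((summable_exp_abs (half_pos hs)).tendsto_cofinite_zero).const_mul |C|
    rw [mul_zero] at h1
    refine squeeze_zero (wt_nonneg s f) (fun i => ?_) h1
    unfold wt
    by_cases hi : 0 ≤ i
    · obtain ⟨n, rfl⟩ := Int.eq_ofNat_of_zero_le hi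
      have h2 := hC n
      simp only [f, if_pos hi]
      have h3 : Real.exp (-(s / 2 * |((n : ℤ) : ℝ)|)) =
          Real.exp (s / 2 * n) * Real.exp (-(s * (n : ℤ))) := by
        rw [← Real.exp_add, abs_of_nonneg (by positivity)]
        congr 1; push_cast; ring
      rw [h3, ← mul_assoc]
      refine mul_le_mul_of_nonneg_right ?_ (Real.exp_nonneg _)
      exact h2.trans (mul_le_mul_of_nonneg_right (le_abs_self C) (Real.exp_nonneg _))
    · simp only [f, if_neg hi, norm_zero, zero_mul]
      positivity
  refine ⟨⟨⟨f, hf⟩, mem_plus.mpr fun i hi => if_neg (by omega)⟩, ?_⟩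
  ext n
  rw [coeff_toPS]
  simp [f]

lemma exists_norm_coeff_le {f : Robba K} {s : ℝ} (hs : 0 < s) :
    ∃ C : ℝ, ∀ n : ℕ, ‖f.1 n‖ ≤ C * Real.exp (s * n) := by
  obtain ⟨r, hr, hf⟩ := f.2
  obtain ⟨C, hC⟩ := bdd_of_tendsto (hf (min r s) (lt_min hr hs) (min_le_left _ _))
  refine ⟨C, fun n => ?_⟩
  have h1 := hC n
  unfold wt at h1
  rw [Real.exp_neg, ← div_eq_mul_inv, div_le_iff₀ (Real.exp_pos _)] at h1
  have hC0 : 0 ≤ C := (wt_nonneg _ _ _).trans (hC 0)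
  refine h1.trans (mul_le_mul_of_nonneg_left (Real.exp_le_exp.mpr ?_) hC0)
  exact mul_le_mul_of_nonneg_right (min_le_right _ _) (by positivity)

lemma toPS_one : toPS (1 : Robba K) = 1 := by
  ext n
  rw [coeff_toPS, coeff_one, PowerSeries.coeff_one]
  simp

lemma toPS_C (c : K) : toPS (C c : Robba K) = PowerSeries.C c := by
  ext n
  rw [coeff_toPS, C_eq_mono, coeff_mono, PowerSeries.coeff_C]
  simp

lemma toPS_T : toPS (mono 1 1 : Robba K) = PowerSeries.X := by
  ext n
  rw [coeff_toPS, coeff_mono, PowerSeries.coeff_X]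
  norm_cast

lemma toPS_theta (f : Robba K) :
    toPS (theta f) = PowerSeries.X * PowerSeries.derivative K (toPS f) := by
  ext n
  rw [coeff_toPS, coeff_theta]
  cases n with
  | zero => simp
  | succ n =>
    rw [PowerSeries.coeff_succ_X_mul, PowerSeries.coeff_derivative, coeff_toPS]
    push_cast
    ring

lemma C_mem_plus (c : K) : C c ∈ plus K := mem_plus.mpr fun i hi => by
  rw [C_eq_mono, coeff_mono, if_neg hi.ne]

lemma T_mem_plus : (mono 1 1 : Robba K) ∈ plus K := mem_plus.mpr fun i hi => by
  rw [coeff_mono, if_neg (by omega)]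

/-- An endomorphism of the power series ring that does not increase coefficients acts on the
series converging on the open unit disc. -/
lemma exists_plusHom (E : PowerSeries K →+* PowerSeries K)
    (hE : ∀ g (n : ℕ) (B : ℝ), (∀ i ≤ n, ‖PowerSeries.coeff i g‖ ≤ B) →
      ‖PowerSeries.coeff n (E g)‖ ≤ B) :
    ∃ σ : plus K →+* plus K, ∀ f, toPS (σ f).1 = E (toPS f.1) := by
  have h : ∀ f : plus K, ∃ g : plus K, toPS g.1 = E (toPS f.1) := fun f =>
    exists_toPS_eq fun s hs => by
      obtain ⟨B, hB⟩ := exists_norm_coeff_le (f := f.1) hs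
      refine ⟨|B|, fun n => hE _ n _ fun i hi => ?_⟩
      rw [coeff_toPS]
      refine (hB i).trans (mul_le_mul (le_abs_self B) (Real.exp_le_exp.mpr ?_)
        (Real.exp_nonneg _) (abs_nonneg _))
      exact mul_le_mul_of_nonneg_left (by exact_mod_cast hi) hs.le
  choose σ hσ using h
  refine ⟨⟨⟨⟨σ, ?_⟩, fun f g => ?_⟩, ?_, fun f g => ?_⟩, hσ⟩ <;>
    refine Subtype.ext (toPS_injOn (σ _).2 (Subtype.prop _) ?_)
  · rw [hσ]; exact (congrArg E toPS_one).trans ((map_one E).trans toPS_one.symm)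
  · rw [hσ]
    exact (congrArg E (toPS_mul f.2 g.2)).trans ((map_mul E _ _).trans
      ((congrArg₂ (· * ·) (hσ f) (hσ g)).symm.trans (toPS_mul (σ f).2 (σ g).2).symm))
  · have h0 : toPS (0 : Robba K) = 0 := by ext n; simp
    rw [hσ]
    exact (congrArg E h0).trans ((map_zero E).trans h0.symm)
  · rw [hσ]
    exact (congrArg E (toPS_add f.1 g.1)).trans ((map_add E _ _).trans
      ((congrArg₂ (· + ·) (hσ f) (hσ g)).symm.trans (toPS_add (σ f).1 (σ g).1).symm))

/-- The semilinear substitution `∑ c_n T^n ↦ ∑ τ(c_n) S^n`. -/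
theorem exists_substHom (τ : K →+* K) (hτ : ∀ c, ‖τ c‖ ≤ ‖c‖) (S : Robba K) (hS : S ∈ plus K)
    (hS0 : S.1 0 = 0) (hS1 : ∀ i, ‖S.1 i‖ ≤ 1) :
    ∃ σ : plus K →+* plus K, (∀ c, σ ⟨C c, C_mem_plus c⟩ = ⟨C (τ c), C_mem_plus _⟩) ∧
      σ ⟨mono 1 1, T_mem_plus⟩ = ⟨S, hS⟩ ∧
      ∀ κ ∈ plus K, theta S = κ * S → ∀ f, theta (σ f).1 =
        κ * (σ ⟨theta f.1, theta_mem_plus f.2⟩).1 := by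
  have hsub : PowerSeries.HasSubst (toPS S) := PowerSeries.HasSubst.of_constantCoeff_zero' (by
    rw [← PowerSeries.coeff_zero_eq_constantCoeff_apply, coeff_toPS]; exact hS0)
  have hX : PowerSeries.X ∣ toPS S := PowerSeries.X_dvd_iff.mpr (by
    rw [← PowerSeries.coeff_zero_eq_constantCoeff_apply, coeff_toPS]; exact hS0)
  let E : PowerSeries K →+* PowerSeries K :=
    (PowerSeries.substAlgHom (R := K) hsub).toRingHom.comp (PowerSeries.map τ)
  have hEe : ∀ g, E g = PowerSeries.subst (toPS S) (PowerSeries.map τ g) := fun g =>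
    congrFun (PowerSeries.coe_substAlgHom hsub) _
  have hpow : ∀ d n : ℕ, ‖PowerSeries.coeff n (toPS S ^ d)‖ ≤ 1 := by
    intro d
    induction d with
    | zero =>
      intro n
      rw [pow_zero, PowerSeries.coeff_one]
      split_ifs <;> simp
    | succ d ih =>
      intro n
      rw [pow_succ, PowerSeries.coeff_mul]
      refine IsUltrametricDist.norm_sum_le_of_forall_le_of_nonneg zero_le_one fun x _ => ?_
      rw [norm_mul, coeff_toPS]
      exact mul_le_one₀ (ih _) (norm_nonneg _) (hS1 _)
  -- The series `S ^ d` starts in degree at least `d` and has coefficients of norm at most `1`. So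
  -- the `n`-th coefficient after substitution depends only on the first `n` coefficients and is
  -- bounded by them.
  obtain ⟨σ, hσ⟩ := exists_plusHom E fun g n B hB => by
    have hB0 : 0 ≤ B := (norm_nonneg _).trans (hB 0 (Nat.zero_le _))
    rw [hEe, PowerSeries.coeff_subst' hsub, finsum_eq_sum_of_support_subset
      (s := Finset.range (n + 1))]
    · refine IsUltrametricDist.norm_sum_le_of_forall_le_of_nonneg hB0 fun d hd => ?_
      rw [PowerSeries.coeff_map, smul_eq_mul, norm_mul]
      have h1 := (hτ (PowerSeries.coeff d g)).trans
        (hB d (Nat.lt_succ_iff.mp (Finset.mem_range.mp hd)))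
      calc _ ≤ B * 1 := mul_le_mul h1 (hpow d n) (norm_nonneg _) hB0
        _ = B := mul_one B
    · intro d hd
      by_contra hlt
      refine hd ?_
      have : PowerSeries.coeff n (toPS S ^ d) = 0 :=
        PowerSeries.X_pow_dvd_iff.mp (pow_dvd_pow_of_dvd hX d) n (by
          simpa using hlt)
      change _ • _ = (0 : K)
      rw [this, smul_zero]
  refine ⟨σ, fun c => ?_, ?_, fun κ hκ hS' f => ?_⟩
  · refine Subtype.ext (toPS_injOn (σ _).2 (C_mem_plus _) ?_)
    rw [hσ, toPS_C, toPS_C, hEe, PowerSeries.map_C, PowerSeries.subst_C]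
    rfl
  · refine Subtype.ext (toPS_injOn (σ _).2 hS ?_)
    rw [hσ, toPS_T, hEe, PowerSeries.map_X, PowerSeries.subst_X hsub]
  -- The chain rule: `θ(f(S)) = (T S') f'(S)`, where `T S' = κ S` and `S f'(S)` is the substitution
  -- applied to `T f'`. Applying `τ` to coefficients commutes with `d/dT` because it fixes the
  -- integers.
  · have hσθ := (σ ⟨theta f.1, theta_mem_plus f.2⟩).2
    refine toPS_injOn (theta_mem_plus (σ f).2) (Subring.mul_mem _ hκ hσθ) ?_
    have hder : ∀ g : PowerSeries K, PowerSeries.derivative K (PowerSeries.map τ g) =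
        PowerSeries.map τ (PowerSeries.derivative K g) := fun g => by
      ext n
      rw [PowerSeries.coeff_derivative, PowerSeries.coeff_map, PowerSeries.coeff_map,
        PowerSeries.coeff_derivative, map_mul, map_add, map_natCast, map_one]
    have h1 : PowerSeries.X * PowerSeries.derivative K (toPS S) = toPS κ * toPS S := by
      rw [← toPS_theta, hS', toPS_mul hκ hS]
    have h2 : E (PowerSeries.X) = toPS S := by
      rw [hEe, PowerSeries.map_X, PowerSeries.subst_X hsub]
    rw [toPS_theta, hσ, toPS_mul hκ hσθ, hσ, toPS_theta, map_mul, h2, hEe, hEe,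
      PowerSeries.derivative_subst hsub, hder, mul_left_comm, h1]
    ring

/-- A homomorphism to series is determined by the image of a parameter. -/
lemma comp_eq_of_param {τ : K →+* K} {S : Robba K} (hS : S ∈ plus K) (hS0 : S.1 0 = 0)
    {σ : plus K →+* plus K} (hσC : ∀ c, σ ⟨C c, C_mem_plus c⟩ = ⟨C (τ c), C_mem_plus _⟩)
    (hσT : σ ⟨mono 1 1, T_mem_plus⟩ = ⟨S, hS⟩) {Y : Type*} [CommRing Y] (r : Y →+* Robba K)
    (hr : ∀ y, r y ∈ plus K) (s : Y →+* Y) {w : Y} (hw : r w = mono 1 1) (hsw : r (s w) = S)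
    (hdec : ∀ y, ∃ (k y₁ : Y) (c : K), r k = C c ∧ r (s k) = C (τ c) ∧ y = k + w * y₁) (y : Y) :
    r (s y) = (σ ⟨r y, hr y⟩).1 := by
  -- Both sides agree on the constant part `k` and on `w`, so their difference at `k + w y₁` is `S`
  -- times their difference at `y₁`. As `S` has no constant term, the difference vanishes to every
  -- order.
  have key : ∀ (m : ℕ) (y : Y) (i : ℤ), i < m → (r (s y) - (σ ⟨r y, hr y⟩).1).1 i = 0 := by
    intro m
    induction m with
    | zero =>
      intro y i hi
      rw [coeff_sub, mem_plus.mp (hr _) i hi, mem_plus.mp (σ _).2 i hi, sub_zero]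
    | succ m ih =>
      intro y i hi
      obtain ⟨k, y₁, c, hk, hsk, rfl⟩ := hdec y
      have e1 : (⟨r (k + w * y₁), hr _⟩ : plus K) =
          ⟨C c, C_mem_plus c⟩ + ⟨mono 1 1, T_mem_plus⟩ * ⟨r y₁, hr y₁⟩ := Subtype.ext (by
        change r (k + w * y₁) = C c + mono 1 1 * r y₁
        rw [map_add, map_mul, hk, hw])
      have e : r (s (k + w * y₁)) - (σ ⟨r (k + w * y₁), hr _⟩).1 =
          S * (r (s y₁) - (σ ⟨r y₁, hr y₁⟩).1) := by
        rw [e1, map_add σ, map_mul σ, hσC, hσT, map_add, map_mul, map_add, map_mul, hsk, hsw]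
        push_cast
        ring
      rw [e, coeff_mul]
      refine (tsum_congr fun j => ?_).trans tsum_zero
      rcases lt_trichotomy j 0 with hj | hj | hj
      · rw [mem_plus.mp hS j hj, zero_mul]
      · rw [hj, hS0, zero_mul]
      · rw [ih y₁ (i - j) (by push_cast at hi; omega), mul_zero]
  refine ext_coeff fun i => ?_
  have := key (i.toNat + 1) y i (by omega)
  rwa [coeff_sub, sub_eq_zero] at this

/-- An invertible matrix over `Z` in the image of invertible matrices over a subring. -/
lemma _root_.Dagger.exists_units_descend {Y Z : Type*} [CommRing Y] [CommRing Z] {f : Y →+* Z}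
    (hf : Function.Injective f) {ι : Type*} [Fintype ι] [DecidableEq ι] (U : (Matrix ι ι Z)ˣ)
    (h : ∀ i j, ∃ y, f y = U.1 i j) (h' : ∀ i j, ∃ y, f y = (U⁻¹).1 i j) :
    ∃ V : (Matrix ι ι Y)ˣ, V.1.map f = U.1 := by
  obtain ⟨V, hV⟩ := exists_units_lift hf U f.range ⟨fun i j => h i j, fun i j => h' i j⟩
    fun x hx => hx
  exact ⟨V, congrArg Units.val hV⟩

variable [CharZero K] [IsDiscreteValuationRing (OK K)] {p n : ℕ}

/-- Change of bases for a horizontal map: `φ` maps the system `b` to the system `a`, the bases are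
changed by `v` and `w`, and `ψ = w⁻¹ φ v` maps `d` to `c`. In `exists_extension` it is used for the
Frobenius matrix, once to pass to the new basis and once more to pass to triangular form. -/
lemma intertwine {ι : Type*} [Fintype ι] [DecidableEq ι] {φ ψ a b c d v : Matrix ι ι (Robba K)}
    {w : (Matrix ι ι (Robba K))ˣ} (hφ : φ.map theta + a * φ = φ * b)
    (hw : w.1 * c = w.1.map theta + a * w.1) (hv : v * d = v.map theta + b * v)
    (hψ : w.1 * ψ = φ * v) : ψ.map theta + c * ψ = ψ * d := by
  have h1 := map_theta_mul w.1 ψ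
  rw [hψ, map_theta_mul] at h1
  have h2 : w.1 * (ψ.map theta + c * ψ) = w.1 * (ψ * d) := by
    calc _ = w.1 * ψ.map theta + (w.1 * c) * ψ := by noncomm_ring
      _ = (w.1.map theta * ψ + w.1 * ψ.map theta) + a * (w.1 * ψ) := by rw [hw]; noncomm_ring
      _ = (φ.map theta + a * φ) * v + φ * v.map theta := by rw [← h1, hψ]; noncomm_ring
      _ = φ * (v * d) := by rw [hφ, hv]; noncomm_ring
      _ = _ := by rw [← mul_assoc, ← hψ, mul_assoc]
  exact w.isUnit.mul_left_cancel h2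

/-- Extension over the puncture of a unipotent module with Frobenius structure, in terms of
matrices. -/
theorem exists_extension (hp' : p.Prime) (hp : ‖(p : K)‖ < 1) {Y Z : Type*} [CommRing Y]
    [CommRing Z] {jY : Y →+* Robba K} {jZ : Z →+* Robba K} {i : Y →+* Z} (hji : ∀ y, jZ (i y) = jY y)
    (hjY : ∀ y, jY y ∈ plus K) (hjY' : Function.Injective jY)
    (hjZ : Function.Injective jZ)
    (hmero : ∀ f ∈ mero K, ∃ z, jZ z = f)
    (hplus : ∀ z, jZ z ∈ plus K → ∃ y, i y = z) {D : Z →+ Z} (hD : ∀ z, jZ (D z) = theta (jZ z))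
    {σ : Z →+* Z} {κ : Z} {σT : plus K →+* plus K}
    (hDσ : ∀ z, D (σ z) = κ * σ (D z))
    (hσ : ∀ y, jZ (σ (i y)) = (σT ⟨jY y, hjY y⟩).1) (hκ : jZ κ ∈ plus K)
    (hθ : ∀ f, theta (σT f).1 = jZ κ * (σT ⟨theta f.1, theta_mem_plus f.2⟩).1)
    (A : Matrix (Fin n) (Fin n) Z) (Φ : (Matrix (Fin n) (Fin n) Z)ˣ)
    (hΦ : Φ.1.map D + A * Φ.1 = κ • (Φ.1 * A.map σ))
    (U : (Matrix (Fin n) (Fin n) (Robba K))ˣ) {N : Matrix (Fin n) (Fin n) (Robba K)} (hN : UT 1 N)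
    (hU : U.1.map theta + A.map jZ * U.1 = U.1 * N) :
    ∃ (W : (Matrix (Fin n) (Fin n) Z)ˣ) (ν : Matrix (Fin n) (Fin n) Y)
      (Ψ : (Matrix (Fin n) (Fin n) Y)ˣ),
      W.1.map D + A * W.1 = W.1 * ν.map i ∧ Φ.1 * W.1.map σ = W.1 * Ψ.1.map i ∧
        (Ψ.1.map i).map D + ν.map i * Ψ.1.map i = κ • (Ψ.1.map i * (ν.map i).map σ) := by
  obtain ⟨G, N', hN', hN'p, hG⟩ := exists_gauge hp' hp hN
  have hUG : (U * G).1 * N' = (U * G).1.map theta + A.map jZ * (U * G).1 := by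
    rw [Units.val_mul, mul_assoc, ← hG, map_theta_mul, mul_add, ← mul_assoc U.1 N, ← hU]
    noncomm_ring
  -- `U * G` brings the connection into the triangular form `N'` without negative powers. Its left
  -- factor is defined over `Z` and serves as the change of basis; its right factor only has to
  -- preserve the absence of negative powers.
  obtain ⟨W', hW', V, hV, hUW⟩ := exists_birkhoff (U * G)
  obtain ⟨W, hW⟩ := exists_units_lift hjZ W' _ hW' hmero
  have hWv : W.1.map jZ = W'.1 := congrArg Units.val hW
  have hDm : ∀ M : Matrix (Fin n) (Fin n) Z, (M.map D).map jZ = (M.map jZ).map theta := fun M =>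
    Matrix.ext fun i j => hD _
  -- the connection matrix in the new basis
  set νZ := (W⁻¹).1 * (W.1.map D + A * W.1) with hνZ
  have hWν : W.1 * νZ = W.1.map D + A * W.1 := by
    rw [hνZ, ← mul_assoc, Units.mul_inv, one_mul]
  have hwν : W'.1 * νZ.map jZ = W'.1.map theta + A.map jZ * W'.1 := by
    have := congrArg (fun M => M.map jZ) hWν
    simp only [Matrix.map_mul, Matrix.map_add _ (map_add jZ)] at this
    rwa [hDm, hWv] at this
  have hVν : V.1 * N' = V.1.map theta + νZ.map jZ * V.1 := by
    refine W'.isUnit.mul_left_cancel ?_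
    rw [hUW, Units.val_mul, map_theta_mul] at hUG
    rw [← mul_assoc, hUG, mul_add, ← mul_assoc W'.1 (νZ.map jZ), hwν]
    noncomm_ring
  -- The connection matrix in the new basis is obtained from `N'` through `V`, and neither of these
  -- nor `V⁻¹` has negative powers.
  have hνp : ∀ i j, (νZ.map jZ) i j ∈ plus K := by
    have e : νZ.map jZ = (V.1 * N' - V.1.map theta) * (V⁻¹).1 := by
      rw [hVν, add_sub_cancel_left, mul_assoc, Units.mul_inv, mul_one]
    intro i j
    rw [e]
    refine Subring.sum_mem _ fun k _ => Subring.mul_mem _ (Subring.sub_mem _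
      (Subring.sum_mem _ fun l _ => Subring.mul_mem _ (hV.1 i l) (hN'p l k))
      (theta_mem_plus (hV.1 i k))) (hV.2 k j)
  choose ν hν using fun k l => hplus _ (hνp k l)
  have hν' : (Matrix.of ν).map i = νZ := Matrix.ext hν
  -- the Frobenius matrix in the new basis
  set Ψ : (Matrix (Fin n) (Fin n) Z)ˣ := W⁻¹ * Φ * Units.map σ.mapMatrix.toMonoidHom W with hΨ
  have hσW : (Units.map σ.mapMatrix.toMonoidHom W).1 = W.1.map σ := rfl
  have hWΨ : W.1 * Ψ.1 = Φ.1 * W.1.map σ := by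
    rw [hΨ, Units.val_mul, Units.val_mul, hσW, mul_assoc, ← mul_assoc W.1, Units.mul_inv, one_mul]
  set k := jZ κ with hk
  have h1 : (Φ.1.map jZ).map theta + A.map jZ * Φ.1.map jZ =
      Φ.1.map jZ * (k • (A.map σ).map jZ) := by
    have := congrArg (fun M => M.map jZ) hΦ
    simp only [Matrix.map_mul, Matrix.map_add _ (map_add jZ)] at this
    rw [hDm] at this
    rw [this, Matrix.mul_smul, ← Matrix.map_mul]
    exact Matrix.ext fun i j => map_mul jZ _ _
  have hθσ : ∀ M : Matrix (Fin n) (Fin n) Z, ((M.map σ).map jZ).map theta =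
      k • ((M.map D).map σ).map jZ := fun M => Matrix.ext fun i j => by
    change theta (jZ (σ (M i j))) = k * jZ (σ (D (M i j)))
    rw [← hD, hDσ, map_mul]
  have h2 : (W.1.map σ).map jZ * (k • (νZ.map σ).map jZ) =
      ((W.1.map σ).map jZ).map theta + (k • (A.map σ).map jZ) * (W.1.map σ).map jZ := by
    have := congrArg (fun M => (M.map σ).map jZ) hWν
    simp only [Matrix.map_mul, Matrix.map_add _ (map_add jZ), Matrix.map_add _ (map_add σ)] at this
    rw [Matrix.mul_smul, this, hθσ, smul_add, Matrix.smul_mul]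
  have h3 : W'.1 * Ψ.1.map jZ = Φ.1.map jZ * (W.1.map σ).map jZ := by
    have := congrArg (fun M => M.map jZ) hWΨ
    simp only [Matrix.map_mul] at this
    rwa [hWv] at this
  have hψ := intertwine h1 hwν h2 h3
  -- Frobenius acts on `Z` and, as the substitution `σT`, on series without negative powers, but not
  -- on the whole Robba ring as used here. So the relation between `V`, `N'` and the new connection
  -- matrix is moved to `plus K` before `σT` is applied to it.
  obtain ⟨V₀, hV₀⟩ := exists_units_lift (f := (plus K).subtype) Subtype.val_injective V _ hV
    fun x hx => ⟨⟨x, hx⟩, rfl⟩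
  set s : plus K →+* Robba K := (plus K).subtype.comp σT with hs
  set Vσ := Units.map s.mapMatrix.toMonoidHom V₀ with hVσ
  let N₀ : Matrix (Fin n) (Fin n) (plus K) := Matrix.of fun i j => ⟨N' i j, hN'p i j⟩
  let ν₀ : Matrix (Fin n) (Fin n) (plus K) := Matrix.of fun i j => ⟨(νZ.map jZ) i j, hνp i j⟩
  let θV₀ : Matrix (Fin n) (Fin n) (plus K) := Matrix.of fun i j =>
    ⟨theta (V₀.1 i j).1, theta_mem_plus (V₀.1 i j).2⟩
  have hV₀v : V₀.1.map (plus K).subtype = V.1 := congrArg Units.val hV₀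
  have h4 : V₀.1 * N₀ = θV₀ + ν₀ * V₀.1 := by
    refine Matrix.map_injective (f := (plus K).subtype) Subtype.val_injective ?_
    simp only [Matrix.map_mul, Matrix.map_add _ (map_add (plus K).subtype)]
    rw [hV₀v]
    have e : θV₀.map (plus K).subtype = V.1.map theta := by rw [← hV₀v]; rfl
    rw [e]
    exact hVν
  have h5 : Vσ.1 * (k • N₀.map s) = Vσ.1.map theta + (k • (νZ.map σ).map jZ) * Vσ.1 := by
    have := congrArg (fun M => M.map s) h4
    simp only [Matrix.map_mul, Matrix.map_add _ (map_add s)] at this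
    have e1 : Vσ.1.map theta = k • θV₀.map s := Matrix.ext fun a b => hθ (V₀.1 a b)
    have e2 : ν₀.map s = (νZ.map σ).map jZ := Matrix.ext fun a b => by
      change (σT ⟨jZ (νZ a b), _⟩).1 = jZ (σ (νZ a b))
      have e : (⟨jZ (νZ a b), hνp a b⟩ : plus K) = ⟨jY (ν a b), hjY _⟩ := Subtype.ext (by
        change jZ _ = jY _
        rw [← hji, hν])
      exact (congrArg (fun x => (σT x).1) e).trans ((hσ (ν a b)).symm.trans (by rw [hν]))
    rw [e1, ← e2, Matrix.mul_smul, Matrix.smul_mul, ← smul_add]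
    exact congrArg (k • ·) this
  -- The Frobenius matrix between triangular bases, `V⁻¹ Ψ V^σ`. It satisfies `θ H = -N' H + H (κ
  -- N'^σ)`, and its inverse satisfies the analogous equation with the two systems exchanged, so
  -- both have entries in `plus K`.
  set H : (Matrix (Fin n) (Fin n) (Robba K))ˣ :=
    V⁻¹ * Units.map jZ.mapMatrix.toMonoidHom Ψ * Vσ with hH
  have hjΨ : (Units.map jZ.mapMatrix.toMonoidHom Ψ).1 = Ψ.1.map jZ := rfl
  have h6 : V.1 * H.1 = Ψ.1.map jZ * Vσ.1 := by
    rw [hH, Units.val_mul, Units.val_mul, hjΨ, mul_assoc, ← mul_assoc V.1, Units.mul_inv, one_mul]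
  have hHθ := intertwine hψ hVν h5 h6
  have hNσ : UT 1 (k • N₀.map s) := by
    refine UT.smul (UT.map (fun a b h => Subtype.ext (hN' a b h)) (map_zero s)) k
  have hNσp : ∀ a b, (k • N₀.map s) a b ∈ plus K := fun a b =>
    Subring.mul_mem _ hκ (σT (N₀ a b)).2
  have hVσp : Vσ ∈ matUnits (Fin n) (plus K) :=
    ⟨fun a b => (σT (V₀.1 a b)).2, fun a b => (σT ((V₀⁻¹).1 a b)).2⟩
  have hHp : H ∈ matUnits (Fin n) (plus K) := by
    refine ⟨mem_plus_of_system hN'.neg hNσ (fun a b => Subring.neg_mem _ (hN'p a b)) hNσp ?_,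
      mem_plus_of_system hNσ.neg hN' (fun a b => Subring.neg_mem _ (hNσp a b)) hN'p ?_⟩
    · rw [← hHθ]; noncomm_ring
    · rw [map_theta_inv, eq_sub_of_add_eq hHθ, mul_sub, sub_mul, ← mul_assoc, Units.inv_mul,
        one_mul, ← mul_assoc, mul_assoc _ H.1, Units.mul_inv, mul_one]
      noncomm_ring
  have hΨp : Units.map jZ.mapMatrix.toMonoidHom Ψ ∈ matUnits (Fin n) (plus K) := by
    have e : Units.map jZ.mapMatrix.toMonoidHom Ψ = V * H * Vσ⁻¹ := by rw [hH]; group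
    rw [e]
    exact Subgroup.mul_mem _ (Subgroup.mul_mem _ hV hHp) (Subgroup.inv_mem _ hVσp)
  have hi : Function.Injective i := fun a b hab => hjY' (by rw [← hji, hab, hji])
  obtain ⟨Ψ', hΨ'⟩ := exists_units_descend hi Ψ (fun a b => hplus _ (hΨp.1 a b))
    fun a b => hplus _ (hΨp.2 a b)
  refine ⟨W, Matrix.of ν, Ψ', ?_, ?_, ?_⟩
  · rw [hν', hWν]
  · rw [hΨ', hWΨ]
  · rw [hν', hΨ']
    refine Matrix.map_injective hjZ ?_
    have e1 : (Ψ.1.map D + νZ * Ψ.1).map jZ =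
        (Ψ.1.map jZ).map theta + νZ.map jZ * Ψ.1.map jZ := by
      rw [← hDm, ← Matrix.map_mul]
      exact Matrix.map_add jZ (map_add jZ) _ _
    have e2 : (κ • (Ψ.1 * νZ.map σ)).map jZ = Ψ.1.map jZ * (k • (νZ.map σ).map jZ) := by
      rw [Matrix.mul_smul, ← Matrix.map_mul]
      exact Matrix.ext fun a b => map_mul jZ _ _
    exact e1.trans (hψ.trans e2.symm)

end Robba

end

/-! ## Connections in coordinates -/

section

variable {A B : Type*} [CommRing A] [CommRing B] {φ : A →+* B} {ι : Type*} [Fintype ι]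
  [DecidableEq ι]

lemma isBaseChangeAlong_of_basis {M P : Type*} [AddCommGroup M] [Module A M] [AddCommGroup P]
    [Module B P] {j : M →ₛₗ[φ] P} (b : Module.Basis ι A M) (b' : Module.Basis ι B P)
    (h : ∀ i, j (b i) = b' i) : IsBaseChangeAlong φ j := by
  unfold IsBaseChangeAlong
  let _ : Algebra A B := φ.toAlgebra
  let _ : Module A P := Module.compHom P φ
  have : IsScalarTower A B P := IsScalarTower.of_algebraMap_smul fun _ _ => rfl
  let e : B ⊗[A] M ≃ₗ[B] P := (b.baseChange B).equiv b' (Equiv.refl ι)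
  let f : M →ₗ[A] P :=
    { toFun := j, map_add' := map_add j, map_smul' := fun a m => j.map_smulₛₗ a m }
  have he : (e.toLinearMap.restrictScalars A).comp (TensorProduct.mk A B M 1) = f := by
    refine b.ext fun i => ?_
    change e (1 ⊗ₜ b i) = j (b i)
    rw [h, ← Module.Basis.baseChange_apply, Module.Basis.equiv_apply]
    rfl
  exact IsBaseChange.of_equiv e fun x => LinearMap.congr_fun he x

lemma exists_basis_of_isBaseChangeAlong {M P : Type*} [AddCommGroup M] [Module A M]
    [AddCommGroup P] [Module B P] {j : M →ₛₗ[φ] P} (hj : IsBaseChangeAlong φ j)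
    (b : Module.Basis ι A M) : ∃ b' : Module.Basis ι B P, ∀ i, j (b i) = b' i := by
  unfold IsBaseChangeAlong at hj
  let _ : Algebra A B := φ.toAlgebra
  let _ : Module A P := Module.compHom P φ
  have : IsScalarTower A B P := IsScalarTower.of_algebraMap_smul fun _ _ => rfl
  refine ⟨(b.baseChange B).map hj.equiv, fun i => ?_⟩
  rw [Module.Basis.map_apply, Module.Basis.baseChange_apply, IsBaseChange.equiv_tmul, one_smul]
  rfl

/-- The coordinates of an element of a free module, transported along a homomorphism. -/
def coords (φ : A →+* B) {M : Type*} [AddCommGroup M] [Module A M] (b : Module.Basis ι A M) :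
    M →ₛₗ[φ] (ι → B) where
  toFun m i := φ (b.equivFun m i)
  map_add' m m' := funext fun i => by
    rw [map_add, Pi.add_apply, map_add]; rfl
  map_smul' a m := funext fun i => by
    rw [map_smul, Pi.smul_apply, smul_eq_mul, map_mul]; rfl

lemma coords_basis {M : Type*} [AddCommGroup M] [Module A M] (b : Module.Basis ι A M) (k : ι) :
    coords φ b (b k) = Pi.single k 1 := funext fun i => by
  change φ (b.equivFun (b k) i) = _
  rw [Module.Basis.equivFun_self, Pi.single_apply]
  split_ifs with h1 h2 h3
  · exact map_one φ
  · exact absurd h1.symm h2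
  · exact absurd h3.symm h1
  · exact map_zero φ

/-- Two semilinear maps that agree on a basis are equal. -/
lemma semilinear_ext {M P : Type*} [AddCommGroup M] [Module A M] [AddCommGroup P] [Module B P]
    (b : Module.Basis ι A M) {f g : M →ₛₗ[φ] P} (h : ∀ k, f (b k) = g (b k)) (m : M) :
    f m = g m :=
  congrFun (congrArg DFunLike.coe (b.ext (f₁ := f) (f₂ := g) h)) m

/-- The image of an element of `M ⊗ Ω` in coordinates. -/
def tcoords {M Ω : Type*} [AddCommGroup M] [Module A M] [AddCommGroup Ω] [Module A Ω]
    (c : M →ₛₗ[φ] (ι → B)) (t : Ω →ₛₗ[φ] B) : M ⊗[A] Ω →ₛₗ[φ] (ι → B) :=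
  (TensorProduct.rid B (ι → B)).toLinearMap.comp (TensorProduct.map c t)

lemma tcoords_tmul {M Ω : Type*} [AddCommGroup M] [Module A M] [AddCommGroup Ω] [Module A Ω]
    (c : M →ₛₗ[φ] (ι → B)) (t : Ω →ₛₗ[φ] B) (m : M) (ω : Ω) :
    tcoords c t (m ⊗ₜ ω) = t ω • c m := by
  change TensorProduct.rid B (ι → B) (TensorProduct.map c t (m ⊗ₜ ω)) = _
  rw [TensorProduct.map_tmul, TensorProduct.rid_tmul]

variable {M Ω : Type*} [AddCommGroup M] [Module A M] [AddCommGroup Ω] [Module A Ω]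

/-- The matrix of a connection. -/
def connMatrix {d : A →+ Ω} (D : Connection d M) (b : Module.Basis ι A M) (t : Ω →ₛₗ[φ] B) :
    Matrix ι ι B := Matrix.of fun i k => tcoords (coords φ b) t (D.nabla (b k)) i

lemma connMatrix_mulVec_single {d : A →+ Ω} (D : Connection d M) (b : Module.Basis ι A M)
    (t : Ω →ₛₗ[φ] B) (k : ι) :
    (connMatrix D b t).mulVec (Pi.single k 1) = tcoords (coords φ b) t (D.nabla (b k)) := by
  rw [Matrix.mulVec_single_one]; rfl

/-- A connection in coordinates. -/
lemma tcoords_nabla {d : A →+ Ω} (D : Connection d M) (b : Module.Basis ι A M) (t : Ω →ₛₗ[φ] B)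
    {δ : B →+ B} (ht : ∀ a, t (d a) = δ (φ a)) (m : M) :
    tcoords (coords φ b) t (D.nabla m) = (fun i => δ (coords φ b m i)) +
      (connMatrix D b t).mulVec (coords φ b m) := by
  have hsmul : ∀ (a : A) (k : ι), tcoords (coords φ b) t (D.nabla (a • b k)) =
      (fun i => δ (coords φ b (a • b k) i)) +
        (connMatrix D b t).mulVec (coords φ b (a • b k)) := by
    intro a k
    rw [D.leibniz, map_add, LinearMap.map_smulₛₗ, tcoords_tmul, ht, LinearMap.map_smulₛₗ,
      coords_basis, Matrix.mulVec_smul, connMatrix_mulVec_single, add_comm]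
    congr 1
    funext i
    simp only [Pi.smul_apply, Pi.single_apply, smul_eq_mul]
    split_ifs
    · rw [mul_one, mul_one]
    · rw [mul_zero, mul_zero, map_zero]
  have hsum : ∀ (s : Finset ι) (x : ι → A), tcoords (coords φ b) t
      (D.nabla (∑ k ∈ s, x k • b k)) = (fun i => δ (coords φ b (∑ k ∈ s, x k • b k) i)) +
        (connMatrix D b t).mulVec (coords φ b (∑ k ∈ s, x k • b k)) := by
    intro s x
    induction s using Finset.induction_on with
    | empty =>
      simp only [Finset.sum_empty, map_zero, Matrix.mulVec_zero, add_zero]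
      funext i
      simp
    | insert k s hk ih =>
      rw [Finset.sum_insert hk, map_add, map_add, hsmul, ih, map_add, Matrix.mulVec_add]
      funext i
      simp only [Pi.add_apply, map_add]
      ring
  have := hsum Finset.univ (b.equivFun m)
  rwa [b.sum_equivFun] at this

lemma mulVec_derivation {δ : B →+ B} (hδ : ∀ x y, δ (x * y) = x * δ y + y * δ x)
    (W : Matrix ι ι B) (x : ι → B) :
    (fun i => δ (W.mulVec x i)) = (W.map δ).mulVec x + W.mulVec (fun i => δ (x i)) := by
  funext i
  simp only [Matrix.mulVec, dotProduct, map_sum, Pi.add_apply, Matrix.map_apply]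
  rw [← Finset.sum_add_distrib]
  refine Finset.sum_congr rfl fun k _ => ?_
  rw [hδ]
  ring

lemma mulVec_map {C : Type*} [CommRing C] (f : B →+* C) (W : Matrix ι ι B) (x : ι → B) :
    (fun i => f (W.mulVec x i)) = (W.map f).mulVec fun i => f (x i) := by
  funext i
  simp [Matrix.mulVec, dotProduct]

/-- The matrix of a Frobenius structure. -/
def frobMatrix {σ : A →+* A} (F : M →ₛₗ[σ] M) (φ : A →+* B) (b : Module.Basis ι A M) :
    Matrix ι ι B := Matrix.of fun i k => coords φ b (F (b k)) i

lemma coords_frob {σ : A →+* A} (F : M →ₛₗ[σ] M) (b : Module.Basis ι A M) {σ' : B →+* B}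
    (hσ : ∀ a, φ (σ a) = σ' (φ a)) (m : M) :
    coords φ b (F m) = (frobMatrix F φ b).mulVec fun i => σ' (coords φ b m i) := by
  have h : ∀ (s : Finset ι) (x : ι → A), coords φ b (F (∑ k ∈ s, x k • b k)) =
      (frobMatrix F φ b).mulVec fun i => σ' (coords φ b (∑ k ∈ s, x k • b k) i) := by
    intro s x
    induction s using Finset.induction_on with
    | empty =>
      simp only [Finset.sum_empty, map_zero]
      funext i
      simp [Matrix.mulVec, dotProduct]
    | insert k s hk ih =>
      rw [Finset.sum_insert hk, map_add, map_add, map_add, ih]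
      have e : (fun i => σ' ((coords φ b (x k • b k) + coords φ b (∑ k ∈ s, x k • b k)) i)) =
          σ' (φ (x k)) • Pi.single k 1 + fun i => σ' (coords φ b (∑ k ∈ s, x k • b k) i) := by
        funext i
        rw [Pi.add_apply, map_add, LinearMap.map_smulₛₗ, coords_basis]
        simp only [Pi.smul_apply, Pi.add_apply, smul_eq_mul, map_mul, Pi.single_apply]
        split_ifs <;> simp
      rw [e, Matrix.mulVec_add, Matrix.mulVec_smul, LinearMap.map_smulₛₗ, LinearMap.map_smulₛₗ, hσ,
        Matrix.mulVec_single_one]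
      rfl
  have := h Finset.univ (b.equivFun m)
  rwa [b.sum_equivFun] at this

/-- The compatibility of a connection with a Frobenius structure, in terms of matrices. -/
lemma frobMatrix_horizontal {d : A →+ Ω} (D : Connection d M) (b : Module.Basis ι A M)
    (t : Ω →ₛₗ[φ] B) {δ : B →+ B} (ht : ∀ a, t (d a) = δ (φ a)) {σ : A →+* A} (F : M →ₛₗ[σ] M)
    {σ' : B →+* B} (hσ : ∀ a, φ (σ a) = σ' (φ a)) {dσ : Ω →ₛₗ[σ] Ω} {κ : B}
    (hdσ : ∀ ω, t (dσ ω) = κ * σ' (t ω))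
    (hF : ∀ m, D.nabla (F m) = TensorProduct.map F dσ (D.nabla m)) :
    (frobMatrix F φ b).map δ + connMatrix D b t * frobMatrix F φ b =
      κ • (frobMatrix F φ b * (connMatrix D b t).map σ') := by
  have h1 : ∀ z, tcoords (coords φ b) t (TensorProduct.map F dσ z) =
      κ • (frobMatrix F φ b).mulVec fun i => σ' (tcoords (coords φ b) t z i) := by
    intro z
    induction z using TensorProduct.induction_on with
    | zero =>
      rw [map_zero, map_zero]
      funext i
      simp [Matrix.mulVec, dotProduct]
    | tmul m ω =>
      rw [TensorProduct.map_tmul, tcoords_tmul, tcoords_tmul, hdσ, coords_frob F b hσ, mul_smul,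
        ← Matrix.mulVec_smul]
      congr 2
      funext i
      simp
    | add x y hx hy =>
      rw [map_add, map_add, map_add, hx, hy, ← smul_add, ← Matrix.mulVec_add]
      congr 2
      funext i
      simp
  refine Matrix.ext_of_mulVec_single fun k => ?_
  have h2 := congrArg (tcoords (coords φ b) t) (hF (b k))
  rw [h1, tcoords_nabla D b t ht, ← connMatrix_mulVec_single] at h2
  have h3 : coords φ b (F (b k)) = (frobMatrix F φ b).mulVec (Pi.single k 1) := by
    rw [Matrix.mulVec_single_one]; rfl
  have h4 : (fun i => σ' ((connMatrix D b t).mulVec (Pi.single k 1) i)) =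
      ((connMatrix D b t).map σ').mulVec (Pi.single k 1) := by
    rw [Matrix.mulVec_single_one, Matrix.mulVec_single_one]; rfl
  rw [h4, h3] at h2
  rw [Matrix.add_mulVec, Matrix.smul_mulVec, ← Matrix.mulVec_mulVec, ← Matrix.mulVec_mulVec, ← h2]
  congr 1
  rw [Matrix.mulVec_single_one, Matrix.mulVec_single_one]; rfl

end

/-! ## Log-modules given by matrices -/

section

variable {A B : Type*} [CommRing A] [CommRing B] {φ : A →+* B} {ι : Type*} [Fintype ι]
  [DecidableEq ι]

lemma exists_basis_mulVec (W : (Matrix ι ι B)ˣ) : ∃ b : Module.Basis ι B (ι → B),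
    ∀ i, b i = W.1.mulVec (Pi.single i 1) := by
  let e : (ι → B) ≃ₗ[B] (ι → B) := LinearEquiv.ofLinearMap W.1.mulVecLin (W⁻¹).1.mulVecLin
    (by rw [← Matrix.mulVecLin_mul, Units.mul_inv, Matrix.mulVecLin_one])
    (by rw [← Matrix.mulVecLin_mul, Units.inv_mul, Matrix.mulVecLin_one])
  refine ⟨(Pi.basisFun B ι).map e, fun i => ?_⟩
  rw [Module.Basis.map_apply, Pi.basisFun_apply]
  rfl

lemma units_mulVec_inv (W : (Matrix ι ι B)ˣ) (x : ι → B) :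
    W.1.mulVec ((W⁻¹).1.mulVec x) = x := by
  rw [Matrix.mulVec_mulVec, Units.mul_inv, Matrix.one_mulVec]

lemma units_inv_mulVec (W : (Matrix ι ι B)ˣ) (x : ι → B) :
    (W⁻¹).1.mulVec (W.1.mulVec x) = x := by
  rw [Matrix.mulVec_mulVec, Units.inv_mul, Matrix.one_mulVec]

/-- Multiplication by a matrix, composed with a ring endomorphism. -/
def matFrob (σ : B →+* B) (Φ : Matrix ι ι B) : (ι → B) →ₛₗ[σ] (ι → B) where
  toFun x := Φ.mulVec fun i => σ (x i)
  map_add' x y := by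
    rw [← Matrix.mulVec_add]
    congr 1; funext i; exact map_add σ _ _
  map_smul' a x := by
    rw [← Matrix.mulVec_smul]
    congr 1; funext i; exact map_mul σ _ _

lemma matFrob_single (σ : B →+* B) (Φ : Matrix ι ι B) (k : ι) :
    matFrob σ Φ (Pi.single k 1) = Φ.mulVec (Pi.single k 1) := by
  change Φ.mulVec (fun i => σ ((Pi.single k 1 : ι → B) i)) = _
  congr 1; funext i
  rw [Pi.single_apply]
  split_ifs
  · exact map_one σ
  · exact map_zero σ

/-- The connection with given matrix. -/
def matConn {Ω : Type*} [AddCommGroup Ω] [Module B Ω] {d : B →+ Ω}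
    (hd : ∀ x y, d (x * y) = x • d y + y • d x) (coef : Ω ≃ₗ[B] B) (A : Matrix ι ι B) : Connection d (ι → B) where
  nabla :=
    { toFun := fun x => ((fun i => coef (d (x i))) + A.mulVec x) ⊗ₜ coef.symm 1
      map_zero' := by
        rw [Matrix.mulVec_zero, add_zero]
        have : (fun i => coef (d ((0 : ι → B) i))) = 0 := funext fun i => by simp
        rw [this, TensorProduct.zero_tmul]
      map_add' := fun x y => by
        rw [← TensorProduct.add_tmul, Matrix.mulVec_add]
        congr 1
        funext i
        simp only [Pi.add_apply, map_add]
        ring }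
  leibniz a x := by
    have e1 : a • ((fun i => coef (d (x i))) + A.mulVec x) + coef (d a) • x =
        (fun i => coef (d ((a • x) i))) + A.mulVec (a • x) := by
      rw [Matrix.mulVec_smul]
      funext i
      simp only [Pi.add_apply, Pi.smul_apply, smul_eq_mul, hd, map_add, map_smul]
      ring
    have e2 : x ⊗ₜ[B] d a = (coef (d a) • x) ⊗ₜ[B] coef.symm 1 := by
      rw [TensorProduct.smul_tmul, ← map_smul, smul_eq_mul, mul_one, coef.symm_apply_apply]
    change ((fun i => coef (d ((a • x) i))) + A.mulVec (a • x)) ⊗ₜ[B] coef.symm 1 =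
      a • (((fun i => coef (d (x i))) + A.mulVec x) ⊗ₜ[B] coef.symm 1) + x ⊗ₜ[B] d a
    rw [e2, ← e1, TensorProduct.add_tmul, TensorProduct.smul_tmul']

lemma nabla_matConn {Ω : Type*} [AddCommGroup Ω] [Module B Ω] {d : B →+ Ω}
    (hd : ∀ x y, d (x * y) = x • d y + y • d x) (coef : Ω ≃ₗ[B] B) (A : Matrix ι ι B) (x : ι → B) :
    (matConn hd coef A).nabla x = ((fun i => coef (d (x i))) + A.mulVec x) ⊗ₜ coef.symm 1 := rfl

lemma coords_basisFun (x : ι → B) : coords (RingHom.id B) (Pi.basisFun B ι) x = x := rfl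

lemma connMatrix_matConn {Ω : Type*} [AddCommGroup Ω] [Module B Ω] {d : B →+ Ω}
    (hd : ∀ x y, d (x * y) = x • d y + y • d x) (coef : Ω ≃ₗ[B] B) (A : Matrix ι ι B) :
    connMatrix (matConn hd coef A) (Pi.basisFun B ι) coef.toLinearMap = A := by
  refine Matrix.ext_of_mulVec_single fun k => ?_
  have hd1 : d 1 = 0 := by
    have := hd 1 1
    rw [mul_one, one_smul] at this
    exact left_eq_add.mp this
  rw [connMatrix_mulVec_single, Pi.basisFun_apply, nabla_matConn, tcoords_tmul, coords_basisFun]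
  have h0 : (fun i => coef (d ((Pi.single k 1 : ι → B) i))) = 0 := funext fun i => by
    rw [Pi.single_apply]
    split_ifs
    · rw [hd1, map_zero]; rfl
    · rw [map_zero, map_zero]; rfl
  rw [h0, zero_add]
  change coef (coef.symm 1) • _ = _
  rw [coef.apply_symm_apply, one_smul]

lemma frobMatrix_matFrob (σ : B →+* B) (Φ : Matrix ι ι B) :
    frobMatrix (matFrob σ Φ) (RingHom.id B) (Pi.basisFun B ι) = Φ := by
  refine Matrix.ext fun i k => ?_
  change matFrob σ Φ (Pi.basisFun B ι k) i = _
  rw [Pi.basisFun_apply, matFrob_single, Matrix.mulVec_single_one]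
  rfl

/-- The exterior square of a cyclic module vanishes. -/
lemma wedge_eq_zero {Ω : Type*} [AddCommGroup Ω] [Module B Ω] (coef : Ω ≃ₗ[B] B) (x y : Ω) :
    wedge B Ω x y = 0 := by
  have h : ∀ z, z = coef z • coef.symm 1 := fun z => by
    rw [← map_smul, smul_eq_mul, mul_one, coef.symm_apply_apply]
  rw [h x, h y, map_smul, map_smul, LinearMap.smul_apply]
  have : wedge B Ω (coef.symm 1) (coef.symm 1) = 0 :=
    (exteriorPower.ιMulti B 2 (M := Ω)).map_eq_zero_of_eq ![coef.symm 1, coef.symm 1]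
      (i := 0) (j := 1) rfl (by decide)
  rw [this, smul_zero, smul_zero]

/-- Elements of `M ⊗ Ω` in coordinates, for `Ω` free of rank one. -/
lemma eq_tmul_of_coords {M Ω : Type*} [AddCommGroup M] [Module B M] [AddCommGroup Ω] [Module B Ω]
    (b : Module.Basis ι B M) (coef : Ω ≃ₗ[B] B) (z : M ⊗[B] Ω) :
    z = b.equivFun.symm (tcoords (coords (RingHom.id B) b) coef.toLinearMap z) ⊗ₜ coef.symm 1 := by
  induction z using TensorProduct.induction_on with
  | zero => rw [map_zero, map_zero, TensorProduct.zero_tmul]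
  | tmul m ω =>
    have h1 : coords (RingHom.id B) b m = b.equivFun m := rfl
    rw [tcoords_tmul, map_smul, h1, b.equivFun.symm_apply_apply, TensorProduct.smul_tmul,
      ← map_smul, smul_eq_mul, mul_one]
    exact congrArg (m ⊗ₜ ·) (coef.symm_apply_apply ω).symm
  | add x y hx hy => rw [map_add, map_add, TensorProduct.add_tmul, ← hx, ← hy]

lemma tcoords_comp {M Ω : Type*} [AddCommGroup M] [Module A M] [AddCommGroup Ω] [Module A Ω]
    (b : Module.Basis ι A M) (coef : Ω ≃ₗ[A] A) (t : Ω →ₛₗ[φ] B) (z : M ⊗[A] Ω) :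
    tcoords (coords φ b) t z = t (coef.symm 1) •
      fun i => φ (tcoords (coords (RingHom.id A) b) coef.toLinearMap z i) := by
  conv_lhs => rw [eq_tmul_of_coords b coef z]
  rw [tcoords_tmul]
  congr 1
  funext i
  change φ (b.equivFun (b.equivFun.symm _) i) = _
  rw [b.equivFun.apply_symm_apply]

lemma semilinear_eq_mul {Ω : Type*} [AddCommGroup Ω] [Module A Ω] (coef : Ω ≃ₗ[A] A)
    (t : Ω →ₛₗ[φ] B) (ω : Ω) : t ω = t (coef.symm 1) * φ (coef ω) := by
  conv_lhs => rw [← coef.symm_apply_apply ω, ← mul_one (coef ω), ← smul_eq_mul, map_smul,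
    LinearMap.map_smulₛₗ]
  rw [smul_eq_mul, mul_comm]

lemma connMatrix_comp {M Ω : Type*} [AddCommGroup M] [Module A M] [AddCommGroup Ω] [Module A Ω]
    {d : A →+ Ω} (D : Connection d M) (b : Module.Basis ι A M) (coef : Ω ≃ₗ[A] A)
    (t : Ω →ₛₗ[φ] B) : connMatrix D b t =
      t (coef.symm 1) • (connMatrix D b coef.toLinearMap).map φ :=
  Matrix.ext fun i k => congrFun (tcoords_comp b coef t (D.nabla (b k))) i

lemma frobMatrix_comp {M : Type*} [AddCommGroup M] [Module A M] {σ : A →+* A} (F : M →ₛₗ[σ] M)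
    (b : Module.Basis ι A M) :
    frobMatrix F φ b = (frobMatrix F (RingHom.id A) b).map φ := rfl

end

section

variable {K : Type u} [NormedField K] [IsUltrametricDist K] {p q n : ℕ}

/-- The log-module with given matrices of Frobenius and connection. -/
theorem exists_logSigmaNabla {X : DaggerPres K} {σ : X.gen p →+* X.gen p} {w : X.gen p}
    {h : (X.gen p)ˣ} (coef : X.LogOmega p w ≃ₗ[X.gen p] X.gen p)
    (hd : ∀ x y, X.logD p w (x * y) = x • X.logD p w y + y • X.logD p w x)
    (t : X.LogOmega p w →ₛₗ[σ] X.gen p) (ht : ∀ a, t (X.logD p w a) = coef (X.logD p w (σ a)))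
    (htd : t (X.dlog p w) = coef ((q : X.gen p) • X.dlog p w + (h⁻¹).1 • X.logD p w h.1))
    (A : Matrix (Fin n) (Fin n) (X.gen p)) (Φ : (Matrix (Fin n) (Fin n) (X.gen p))ˣ)
    (hΦ : Φ.1.map (fun x => coef (X.logD p w x)) + A * Φ.1 =
      t (coef.symm 1) • (Φ.1 * A.map σ)) :
    ∃ (N : LogSigmaNabla.{u, u} X p q σ w h) (b : Module.Basis (Fin n) (X.gen p) N.M),
      connMatrix N.D b coef.toLinearMap = A ∧ frobMatrix N.F (RingHom.id _) b = Φ.1 := by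
  obtain ⟨b', hb'⟩ := exists_basis_mulVec Φ
  refine ⟨{ M := Fin n → X.gen p
            F := matFrob σ Φ.1
            isBaseChange_F := isBaseChangeAlong_of_basis (Pi.basisFun (X.gen p) (Fin n)) b'
              fun i => by rw [Pi.basisFun_apply, matFrob_single, hb']
            D := matConn hd coef A
            -- Zero maps are admissible: the differentials are free of rank one, so every exterior
            -- product of two forms vanishes.
            integrable := ⟨0, 0, fun a ω => ?_, fun a => rfl, rfl, fun m ω => ?_, fun m => rfl⟩
            horizontal := ⟨(coef.symm.toLinearMap : _ →ₗ[X.gen p] _).comp t, fun a => ?_, ?_,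
              fun m => ?_⟩ },
    Pi.basisFun _ _, connMatrix_matConn hd coef A, frobMatrix_matFrob σ Φ.1⟩
  · rw [wedge_eq_zero coef]; simp
  · have h0 : (wedge (X.gen p) (X.LogOmega p w)).flip ω = 0 :=
      LinearMap.ext fun x => wedge_eq_zero coef x ω
    rw [h0, LinearMap.lTensor_zero]; simp
  · change coef.symm (t _) = _
    rw [ht, coef.symm_apply_apply]
  · change coef.symm (t _) = _
    rw [htd, coef.symm_apply_apply]
  · rw [nabla_matConn, nabla_matConn, TensorProduct.map_tmul]
    have e1 : ((coef.symm.toLinearMap : _ →ₗ[X.gen p] _).comp t) (coef.symm 1) =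
        t (coef.symm 1) • coef.symm 1 := by
      change coef.symm (t _) = _
      rw [← map_smul, smul_eq_mul, mul_one]
    let δ : X.gen p →+ X.gen p := coef.toLinearMap.toAddMonoidHom.comp (X.logD p w)
    have hδ : ∀ x y, δ (x * y) = x * δ y + y * δ x := fun x y => by
      change coef _ = x * coef _ + y * coef _
      rw [hd, map_add, map_smul, map_smul]; rfl
    rw [e1, ← TensorProduct.smul_tmul]
    congr 1
    have h1 := mulVec_derivation hδ Φ.1 (fun i => σ (m i))
    have h2 : (fun i => δ (σ (m i))) = t (coef.symm 1) • fun i => σ (δ (m i)) :=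
      funext fun i => by
      change coef _ = _
      rw [← ht, semilinear_eq_mul coef]
      rfl
    have h3 : matFrob σ Φ.1 m = Φ.1.mulVec fun i => σ (m i) := rfl
    have h4 : matFrob σ Φ.1 ((fun i => coef (X.logD p w (m i))) + A.mulVec m) =
        Φ.1.mulVec (fun i => σ (δ (m i))) + (Φ.1 * A.map σ).mulVec fun i => σ (m i) := by
      rw [map_add, ← Matrix.mulVec_mulVec, ← mulVec_map]
      rfl
    have h5 := congrArg (fun M => M.mulVec fun i => σ (m i)) hΦ
    simp only [Matrix.add_mulVec, ← Matrix.mulVec_mulVec, Matrix.smul_mulVec] at h5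
    rw [h3, h4, smul_add, ← Matrix.mulVec_mulVec, ← h5]
    change (fun i => δ (Φ.1.mulVec (fun i => σ (m i)) i)) + _ = _
    rw [h1, h2, Matrix.mulVec_smul]
    change (Φ.1.map fun x => coef (X.logD p w x)).mulVec _ + _ + _ = _
    abel

/-- A criterion for pullbacks in terms of matrices. -/
theorem isPullback_of_matrix {X Z : DaggerPres K} {φ : X.gen p →+* Z.gen p}
    {σX : X.gen p →+* X.gen p} {σZ : Z.gen p →+* Z.gen p} {uX : X.gen p} {uZ : Z.gen p}
    {hX : (X.gen p)ˣ} {hZ : (Z.gen p)ˣ} (M : LogSigmaNabla.{u, v} X p q σX uX hX)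
    (P : LogSigmaNabla.{u, u} Z p q σZ uZ hZ) (b : Module.Basis (Fin n) (X.gen p) M.M)
    (b' : Module.Basis (Fin n) (Z.gen p) P.M) (coef : Z.LogOmega p uZ ≃ₗ[Z.gen p] Z.gen p)
    (hd : ∀ x y, Z.logD p uZ (x * y) = x • Z.logD p uZ y + y • Z.logD p uZ x)
    (t : X.LogOmega p uX →ₛₗ[φ] Z.gen p)
    (ht : ∀ a, t (X.logD p uX a) = coef (Z.logD p uZ (φ a))) (hσ : ∀ a, φ (σX a) = σZ (φ a))
    (W : (Matrix (Fin n) (Fin n) (Z.gen p))ˣ)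
    (hA : W.1.map (fun x => coef (Z.logD p uZ x)) + connMatrix M.D b t * W.1 =
      W.1 * connMatrix P.D b' coef.toLinearMap)
    (hΦ : frobMatrix M.F φ b * W.1.map σZ = W.1 * frobMatrix P.F (RingHom.id _) b') :
    IsPullback φ M P := by
  -- The columns of `W` are the coordinates of the basis `b'` in the base-changed basis `b`, so
  -- coordinates of vectors are transformed by `W⁻¹`.
  let j : M.M →ₛₗ[φ] P.M := (b'.equivFun.symm.toLinearMap.comp
    ((W⁻¹).1.mulVecLin : _ →ₗ[Z.gen p] _)).comp (coords φ b)
  have hj : ∀ m, j m = b'.equivFun.symm ((W⁻¹).1.mulVec (coords φ b m)) := fun m => rfl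
  have hcj : ∀ m, coords (RingHom.id _) b' (j m) = (W⁻¹).1.mulVec (coords φ b m) := fun m =>
    b'.equivFun.apply_symm_apply _
  have hcj' : ∀ m, coords φ b m = W.1.mulVec (coords (RingHom.id _) b' (j m)) := fun m => by
    rw [hcj, units_mulVec_inv]
  let δ : Z.gen p →+ Z.gen p := coef.toLinearMap.toAddMonoidHom.comp (Z.logD p uZ)
  have hδ : ∀ x y, δ (x * y) = x * δ y + y * δ x := fun x y => by
    change coef _ = x * coef _ + y * coef _
    rw [hd, map_add, map_smul, map_smul]; rfl
  have hinj : ∀ x y : P.M, coords (RingHom.id _) b' x = coords (RingHom.id _) b' y → x = y :=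
    fun x y h => b'.equivFun.injective h
  obtain ⟨b₁, hb₁⟩ := exists_basis_mulVec W⁻¹
  refine ⟨(coef.symm.toLinearMap : _ →ₗ[Z.gen p] _).comp t, j, fun a => ?_,
    isBaseChangeAlong_of_basis b (b₁.map b'.equivFun.symm) fun i => ?_, fun m => ?_, fun m => ?_⟩
  · change coef.symm (t _) = _
    rw [ht, coef.symm_apply_apply]
  · rw [hj, Module.Basis.map_apply, hb₁, coords_basis]
  · refine hinj _ _ ?_
    rw [hcj, coords_frob M.F b hσ, coords_frob (φ := RingHom.id _) P.F b' (σ' := σZ) (fun a => rfl), hcj', mulVec_map,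
      Matrix.mulVec_mulVec _ _ (W.1.map σZ), hΦ, ← Matrix.mulVec_mulVec, units_inv_mulVec]
  · have key : ∀ z, TensorProduct.map j ((coef.symm.toLinearMap : _ →ₗ[Z.gen p] _).comp t) z =
        b'.equivFun.symm ((W⁻¹).1.mulVec (tcoords (coords φ b) t z)) ⊗ₜ coef.symm 1 := by
      intro z
      induction z using TensorProduct.induction_on with
      | zero => rw [map_zero, map_zero, Matrix.mulVec_zero, map_zero, TensorProduct.zero_tmul]
      | tmul m ω =>
        have e : ((coef.symm.toLinearMap : _ →ₗ[Z.gen p] _).comp t) ω =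
            t ω • coef.symm 1 := by
          change coef.symm (t _) = _
          rw [← map_smul, smul_eq_mul, mul_one]
        rw [TensorProduct.map_tmul, e, ← TensorProduct.smul_tmul, tcoords_tmul,
          Matrix.mulVec_smul, map_smul, hj]
      | add x y hx hy =>
        rw [map_add, hx, hy, map_add, Matrix.mulVec_add, map_add, TensorProduct.add_tmul]
    rw [key, eq_tmul_of_coords b' coef (P.D.nabla (j m))]
    congr 2
    rw [tcoords_nabla P.D b' coef.toLinearMap (δ := δ) (fun a => rfl),
      tcoords_nabla M.D b t (δ := δ) ht, hcj' m, mulVec_derivation hδ, Matrix.mulVec_mulVec,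
      add_right_comm, ← Matrix.add_mulVec]
    have hA' : W.1.map δ + connMatrix M.D b t * W.1 =
      W.1 * connMatrix P.D b' coef.toLinearMap := hA
    rw [hA', ← Matrix.mulVec_mulVec, Matrix.mulVec_add, units_inv_mulVec, units_inv_mulVec,
      add_comm]

end

/-! ### Unipotent modules in matrix form. -/

section

variable {A B : Type*} [CommRing A] [CommRing B] {φ : A →+* B} {ι : Type*} [Fintype ι]
  [DecidableEq ι] {M Ω : Type*} [AddCommGroup M] [Module A M] [AddCommGroup Ω] [Module A Ω]

lemma connMatrix_map {C : Type*} [CommRing C] {j : B →+* C} {φ' : A →+* C}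
    (hj : ∀ a, φ' a = j (φ a)) {d : A →+ Ω} (D : Connection d M) (b : Module.Basis ι A M)
    (t : Ω →ₛₗ[φ] B) (t' : Ω →ₛₗ[φ'] C) (ht : ∀ ω, t' ω = j (t ω)) :
    (connMatrix D b t).map j = connMatrix D b t' := by
  have key : ∀ z : M ⊗[A] Ω, tcoords (coords φ' b) t' z = fun i => j (tcoords (coords φ b) t z i) := by
    intro z
    induction z with
    | zero => funext i; simp
    | tmul m ω =>
      funext i
      simp [tcoords_tmul, ht, coords, hj]
    | add x y hx hy => funext i; simp [hx, hy]
  refine Matrix.ext fun i k => ?_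
  have h1 := congrFun (connMatrix_mulVec_single D b t k) i
  have h2 := congrFun (connMatrix_mulVec_single D b t' k) i
  rw [key] at h2
  rw [Matrix.mulVec_single_one] at h1 h2
  rw [Matrix.map_apply]
  exact (congrArg j h1).trans h2.symm

end

section

variable {K : Type u} [NormedField K] [IsUltrametricDist K] [CompleteSpace K] [CharZero K]
  [IsDiscreteValuationRing (OK K)] {p q n : ℕ}

open Robba

instance : Nontrivial (Robba K) :=
  ⟨0, 1, fun h => by simpa [Robba.coeff_one] using congrArg (fun f : Robba K => f.1 0) h⟩

/-- A unipotent basis over the Robba ring gives a gauge transformation to a strictly upper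
triangular connection matrix. -/
theorem IsUnipotentAlong.exists_gauge {X : DaggerPres K} {σ : X.gen p →+* X.gen p}
    {M : LogSigmaNabla.{u, v} X p q σ 1 1} {ρ : X.gen p →+* Robba K} (hM : IsUnipotentAlong M ρ)
    (b : Module.Basis (Fin n) (X.gen p) M.M) (t : X.LogOmega p 1 →ₛₗ[ρ] Robba K)
    (ht : ∀ a, t (X.logD p 1 a) = theta (ρ a)) :
    ∃ (U : (Matrix (Fin n) (Fin n) (Robba K))ˣ) (N : Matrix (Fin n) (Fin n) (Robba K)),
      UT 1 N ∧ U.1.map theta + connMatrix M.D b t * U.1 = U.1 * N := by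
  obtain ⟨P, _, _, D, τ, j, hτ, hj, hD, n', b₀, hb₀⟩ := hM
  obtain ⟨e, he⟩ := exists_basis_of_isBaseChangeAlong hj b
  obtain rfl : n = n' := Fin.equiv_iff_eq.mp ⟨e.indexEquiv b₀⟩
  -- Forms over the Robba ring are written in the basis `dT`; multiplication by `T` passes to the
  -- basis `dT / T`, in which the derivation is `theta`.
  let t' : Robba K →ₗ[Robba K] Robba K := LinearMap.mulLeft (Robba K) (mono 1 1)
  have ht' : ∀ f, t' (deriv f) = theta f := fun f => by
    change mono 1 1 * deriv f = _
    rw [Robba.deriv_eq, ← mul_assoc, mono_mul_mono]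
    norm_num [mono_zero_one]
  -- The two maps on differentials agree on exact forms, and exact forms generate.
  have htτ : ∀ ω, t' (τ ω) = t ω := fun ω => by
    have hω : ω ∈ Submodule.span (X.gen p) (Set.range (X.logD p 1)) := by
      rw [DaggerPres.span_logD_one]; trivial
    induction hω using Submodule.span_induction with
    | mem x h =>
      obtain ⟨a, rfl⟩ := h
      rw [hτ, ht', ht]
    | zero => simp
    | add x y _ _ hx hy => rw [map_add, map_add, map_add, hx, hy]
    | smul a x _ hx => rw [LinearMap.map_smulₛₗ τ, LinearMap.map_smulₛₗ t, LinearMap.map_smul t', hx]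
  -- `V` expresses the image of the basis `b` in the unipotent basis `b₀`; the gauge transformation
  -- sought is its inverse.
  let V : Matrix (Fin n) (Fin n) (Robba K) := b₀.toMatrix e
  let V' : (Matrix (Fin n) (Fin n) (Robba K))ˣ :=
    ⟨V, e.toMatrix b₀, b₀.toMatrix_mul_toMatrix_flip e, e.toMatrix_mul_toMatrix_flip b₀⟩
  let N := connMatrix D b₀ t'
  have hc : ∀ m, coords (RingHom.id _) b₀ (j m) = V.mulVec (coords ρ b m) := by
    let f : M.M →ₛₗ[ρ] (Fin n → Robba K) :=
      { toFun := fun m => coords (RingHom.id _) b₀ (j m)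
        map_add' := fun x y => by rw [map_add, map_add]
        map_smul' := fun a x => by rw [map_smulₛₗ, map_smulₛₗ]; rfl }
    let g : M.M →ₛₗ[ρ] (Fin n → Robba K) :=
      { toFun := fun m => V.mulVec (coords ρ b m)
        map_add' := fun x y => by rw [map_add, Matrix.mulVec_add]
        map_smul' := fun a x => by rw [map_smulₛₗ, Matrix.mulVec_smul] }
    refine fun m => semilinear_ext b (f := f) (g := g) (fun k => ?_) m
    change coords (RingHom.id _) b₀ (j (b k)) = V.mulVec (coords ρ b (b k))
    rw [coords_basis, he, Matrix.mulVec_single_one]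
    rfl
  have hz : ∀ z : M.M ⊗[X.gen p] X.LogOmega p 1,
      tcoords (coords (RingHom.id _) b₀) t' (TensorProduct.map j τ z) =
        V.mulVec (tcoords (coords ρ b) t z) := by
    intro z
    induction z with
    | zero => simp
    | tmul m ω =>
      rw [TensorProduct.map_tmul, tcoords_tmul, tcoords_tmul, hc, htτ, Matrix.mulVec_smul]
    | add x y hx hy => rw [map_add, map_add, map_add, hx, hy, Matrix.mulVec_add]
  have hV : V.map theta + N * V = V * connMatrix M.D b t := by
    refine Matrix.ext fun i k => ?_
    have h1 := hz (M.D.nabla (b k))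
    rw [← hD, tcoords_nabla D b₀ t' (δ := theta) ht', ← connMatrix_mulVec_single, hc, coords_basis,
      Matrix.mulVec_mulVec, Matrix.mulVec_mulVec, Matrix.mulVec_single_one,
      Matrix.mulVec_single_one, Matrix.mulVec_single_one] at h1
    exact congrFun h1 i
  have hN : UT 1 N := by
    intro i k hik
    have h1 := congrFun (connMatrix_mulVec_single D b₀ t' k) i
    rw [Matrix.mulVec_single_one] at h1
    refine Eq.trans h1 ?_
    have : ∀ x ∈ Submodule.span (Robba K) {x | ∃ l < k, ∃ ω : Robba K, x = b₀ l ⊗ₜ[Robba K] ω},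
        tcoords (coords (RingHom.id _) b₀) t' x i = 0 := by
      intro x hx
      induction hx using Submodule.span_induction with
      | mem x h =>
        obtain ⟨l, hl, ω, rfl⟩ := h
        rw [tcoords_tmul, coords_basis, Pi.smul_apply, Pi.single_apply, if_neg, smul_zero]
        rintro rfl
        exact absurd hl (by rw [Fin.lt_def]; omega)
      | zero => simp
      | add x y _ _ hx hy => rw [map_add, Pi.add_apply, hx, hy, add_zero]
      | smul a x _ hx => rw [map_smulₛₗ, Pi.smul_apply, hx, smul_zero]
    exact this _ (hb₀ k)
  refine ⟨V'⁻¹, N, hN, ?_⟩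
  rw [map_theta_inv]
  have e1 : V'.1.map theta = V'.1 * connMatrix M.D b t - N * V'.1 := eq_sub_of_add_eq hV
  rw [e1, mul_sub, sub_mul, ← mul_assoc, Units.inv_mul, one_mul, mul_assoc _ (N * V'.1),
    mul_assoc N, Units.mul_inv, mul_one]
  abel

end

/-! ### Compatibility of Frobenius with maps of dagger algebras. -/

section

variable {K : Type u} [NormedField K] [IsUltrametricDist K]

namespace DaggerPres

lemma comm_pow {A B : Type*} [CommRing A] [CommRing B] {φ : A →+* B} {s : A →+* A} {s' : B →+* B}
    (h : ∀ x, φ (s x) = s' (φ x)) (a : ℕ) (x : A) : φ ((s ^ a) x) = (s' ^ a) (φ x) := by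
  induction a generalizing x with
  | zero => rfl
  | succ a ih =>
    rw [pow_succ, pow_succ, RingHom.mul_def, RingHom.mul_def, RingHom.comp_apply,
      RingHom.comp_apply, ih, h]

variable {X Y : DaggerPres K} (p : ℕ)

lemma genMap_ext {B : Type*} [CommRing B] {f g : X.gen p →+* B}
    (h : ∀ x, f (algebraMap X.int (X.gen p) x) = g (algebraMap X.int (X.gen p) x)) (x : X.gen p) :
    f x = g x :=
  RingHom.congr_fun (IsLocalization.ringHom_ext (Submonoid.powers (p : X.int)) (RingHom.ext h)) x

lemma frob_algebraMap (a : ℕ) (s : X.int →+* X.int) (x : X.int) :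
    X.frob p a s (algebraMap X.int (X.gen p) x) = algebraMap X.int (X.gen p) ((s ^ a) x) :=
  genMap_algebraMap ..

lemma genMap_frob {φ : X.int →+* Y.int} {s : X.int →+* X.int} {s' : Y.int →+* Y.int}
    (h : ∀ x, φ (s x) = s' (φ x)) (a : ℕ) (x : X.gen p) :
    genMap p φ (X.frob p a s x) = Y.frob p a s' (genMap p φ x) := by
  refine genMap_ext p (f := (genMap p φ).comp (X.frob p a s))
    (g := (Y.frob p a s').comp (genMap p φ)) (fun y => ?_) x
  rw [RingHom.comp_apply, RingHom.comp_apply, frob_algebraMap, genMap_algebraMap,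
    genMap_algebraMap, frob_algebraMap, comm_pow h]

end DaggerPres

end

/-! ### Extension of endomorphisms of `O` to `K`. -/

section

variable {K : Type u} [NormedField K] [IsUltrametricDist K] [CompleteSpace K] [CharZero K]
  [IsDiscreteValuationRing (OK K)] {π : OK K}

/-- An endomorphism of the valuation ring extends to an isometry
of the field. -/
lemma exists_fieldHom (hπ : Irreducible π) {p : ℕ} (hp0 : p ≠ 0) (hp : ‖(p : K)‖ < 1)
    (τ₀ : OK K →+* OK K) :
    ∃ τ : K →+* K, (∀ c : OK K, τ c = τ₀ c) ∧ ∀ c, ‖τ c‖ = ‖c‖ := by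
  have hunit : ∀ v : (OK K)ˣ, ‖((v : OK K) : K)‖ = 1 := fun v => by
    have h1 : ((v : OK K) : K) * ((v⁻¹ : (OK K)ˣ) : OK K) = 1 := by
      exact_mod_cast congrArg (Subtype.val) v.mul_inv
    have h2 := congrArg norm h1
    rw [norm_mul, norm_one] at h2
    have h3 : ‖((v : OK K) : K)‖ ≤ 1 := (v : OK K).2
    have h4 : ‖(((v⁻¹ : (OK K)ˣ) : OK K) : K)‖ ≤ 1 := ((v⁻¹ : (OK K)ˣ) : OK K).2
    nlinarith [norm_nonneg ((v : OK K) : K)]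
  have hp' : (p : OK K) ≠ 0 := fun h => by
    have := congrArg (Subtype.val) h
    exact Nat.cast_ne_zero.mpr hp0 (by exact_mod_cast this : (p : K) = 0)
  -- Write `p = v π ^ e` with `v` a unit and `e > 0`. The endomorphism fixes `p` and preserves
  -- units, so `‖τ₀ π‖ ^ e = ‖p‖ = ‖π‖ ^ e`.
  have hn : ‖((τ₀ π : OK K) : K)‖ = ‖(π : K)‖ := by
    obtain ⟨e, v, hv⟩ := IsDiscreteValuationRing.eq_unit_mul_pow_irreducible hp' hπ
    have he : e ≠ 0 := by
      rintro rfl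
      have h1 := congrArg (fun x : OK K => ‖(x : K)‖) hv
      simp only [pow_zero, mul_one, hunit] at h1
      have h2 : ‖(p : K)‖ = 1 := by simpa using h1
      linarith
    have h1 := congrArg (fun x : OK K => ‖(x : K)‖) hv
    have h2 := congrArg (fun x : OK K => ‖(τ₀ x : K)‖) hv
    have h3 : ‖((τ₀ (v : OK K) : OK K) : K)‖ = 1 := hunit (Units.map τ₀.toMonoidHom v)
    simp only [map_mul, map_pow, map_natCast] at h2
    push_cast at h1 h2
    rw [norm_mul, norm_pow, hunit, one_mul] at h1
    rw [norm_mul, norm_pow, h3, one_mul, h1] at h2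
    exact (pow_left_inj₀ (norm_nonneg _) (norm_nonneg _) he).mp h2.symm
  have hnorm : ∀ c : OK K, ‖((τ₀ c : OK K) : K)‖ = ‖(c : K)‖ := fun c => by
    by_cases hc : c = 0
    · rw [hc, map_zero]
    · obtain ⟨e, v, rfl⟩ := IsDiscreteValuationRing.eq_unit_mul_pow_irreducible hc hπ
      have h3 : ‖((τ₀ (v : OK K) : OK K) : K)‖ = 1 := hunit (Units.map τ₀.toMonoidHom v)
      rw [map_mul, map_pow]
      push_cast
      rw [norm_mul, norm_mul, norm_pow, norm_pow, h3, hunit, hn]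
  have hinj : Function.Injective τ₀ := (injective_iff_map_eq_zero _).mpr fun c hc => by
    have := hnorm c
    rw [hc] at this
    have h2 : (c : K) = 0 := norm_eq_zero.mp (this.symm.trans (by simp))
    exact Subtype.ext h2
  refine ⟨IsFractionRing.map hinj, fun c => ?_, fun c => ?_⟩
  · exact IsLocalization.map_eq _ c
  · obtain ⟨a, b, hb, rfl⟩ := IsFractionRing.div_surjective (OK K) c
    have e : ∀ a : OK K, (IsFractionRing.map hinj : K →+* K) (algebraMap (OK K) K a) = τ₀ a :=
      fun a => IsLocalization.map_eq _ a
    rw [map_div₀, norm_div, norm_div, e, e, hnorm, hnorm]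
    rfl

end

/-! ### Expansions without negative terms. -/

section

variable {K : Type u} [NormedField K] [IsUltrametricDist K] [CompleteSpace K] {π : OK K}

open Robba

namespace DaggerPres

/-- If the generators have expansions without negative terms, so do all elements. -/
lemma mem_plus_of_generators (hπ : Irreducible π) {Y : DaggerPres K} (r : Y.int →ₐ[OK K] Rint K)
    (hr : ∀ i, (r (Y.proj (MW.X i))).1 ∈ plus K) (y : Y.int) : (r y).1 ∈ plus K := by
  have hpoly : ∀ P : MvPolynomial (Fin Y.n) (OK K),
      (r (MvPolynomial.aeval (fun i => Y.proj (MW.X i)) P)).1 ∈ plus K := by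
    intro P
    induction P using MvPolynomial.induction_on with
    | C c =>
      rw [MvPolynomial.aeval_C, AlgHom.commutes, algebraMap_Rint]
      exact C_mem_plus _
    | add P Q hP hQ =>
      rw [map_add, map_add]
      exact add_mem hP hQ
    | mul_X P i hP =>
      rw [map_mul, map_mul, MvPolynomial.aeval_X]
      exact mul_mem hP (hr i)
  -- An element is a polynomial in the generators plus `π z`, so its negative coefficients are `π`
  -- times those of `z`. Iteration makes them divisible by all powers of `π`.
  have key : ∀ (N : ℕ) (y : Y.int) (i : ℤ), i < 0 → ‖(r y).1.1 i‖ ≤ ‖(π : K)‖ ^ N := by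
    intro N
    induction N with
    | zero =>
      intro y i _
      rw [pow_zero]
      exact (r y).2 i
    | succ N ih =>
      intro y i hi
      obtain ⟨P, z, hz⟩ := exists_dvd_sub_aeval hπ Y y
      rw [sub_eq_iff_eq_add] at hz
      have h1 : (r y).1.1 i = (π : K) * (r z).1.1 i := by
        rw [hz, map_add, map_mul, AlgHom.commutes]
        change (_ + _ : Robba K).1 i = _
        rw [coeff_add, mem_plus.mp (hpoly P) i hi, add_zero]
        exact coeff_algebraMap_mul _ _ _
      rw [h1, norm_mul, pow_succ']
      exact mul_le_mul_of_nonneg_left (ih z i hi) (norm_nonneg _)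
  refine mem_plus.mpr fun i hi => eq_of_forall_norm_sub_le hπ fun N => ?_
  rw [sub_zero]
  exact key N y i hi

end DaggerPres

end

/-! ### Derivations and Frobenius in terms of a frame. -/

section

variable {K : Type u} [NormedField K] [IsUltrametricDist K] [CompleteSpace K] [CharZero K]
  {p : ℕ} [Fact p.Prime] {π : OK K}

open Robba

namespace DaggerPres

namespace Frame

variable {X : DaggerPres K} {v : X.gen p} {j : X.gen p →+* Robba K}

/-- The derivation of the ring of functions defined by a frame. -/
def der (c : Frame p X v j) : X.gen p →+ X.gen p := c.coef.toLinearMap.toAddMonoidHom.comp (X.logD p v)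

lemma der_apply (c : Frame p X v j) (a : X.gen p) : c.der a = c.coef (X.logD p v a) := rfl

lemma j_der (c : Frame p X v j) (a : X.gen p) : j (c.der a) = theta (j a) := c.j_coef_logD a

lemma logD_mul (c : Frame p X v j) (hj : Function.Injective j) (x y : X.gen p) :
    X.logD p v (x * y) = x • X.logD p v y + y • X.logD p v x := by
  refine c.coef.injective (hj ?_)
  rw [c.j_coef_logD, map_mul, theta_mul, map_add, map_smul, map_smul, map_add, smul_eq_mul,
    smul_eq_mul, map_mul, map_mul, c.j_coef_logD, c.j_coef_logD]

lemma logD_pow (c : Frame p X v j) (hj : Function.Injective j) (m : ℕ) :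
    X.logD p v (v ^ m) = ((m : X.gen p) * v ^ m) • X.dlog p v := by
  induction m with
  | zero =>
    refine c.coef.injective (hj ?_)
    rw [c.j_coef_logD, pow_zero, map_one, theta_one, Nat.cast_zero, zero_mul, zero_smul, map_zero,
      map_zero]
  | succ m ih =>
    rw [pow_succ, c.logD_mul hj, ih, ← smul_dlog, smul_smul, smul_smul, ← add_smul]
    congr 1
    push_cast
    ring

end Frame

/-- The action of a Frobenius lift on logarithmic differentials. -/
theorem exists_dsigma (hπ : Irreducible π) {X : DaggerPres K} {r : X.int →ₐ[OK K] Rint K}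
    (hr : Function.Injective r) {v : X.gen p} (c : Frame p X v (toRobba p r)) {a q : ℕ}
    {σK : OK K →+* OK K} (hσK : π ∣ σK π) {s : X.int →+* X.int}
    (hs : ∀ x, s (algebraMap _ _ x) = algebraMap _ _ (σK x)) {h : (X.gen p)ˣ}
    (hv : X.frob p a s v = h * v ^ q) :
    ∃ t : X.LogOmega p v →ₛₗ[X.frob p a s] X.gen p,
      (∀ x, t (X.logD p v x) = c.coef (X.logD p v (X.frob p a s x))) ∧
      t (X.dlog p v) = c.coef ((q : X.gen p) • X.dlog p v + (h⁻¹).1 • X.logD p v h.1) := by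
  have hj := toRobba_injective p hr
  have hdvd : π ∣ (σK ^ a) π := by
    clear hv
    induction a with
    | zero => exact dvd_rfl
    | succ a ih =>
      rw [pow_succ', RingHom.mul_def, RingHom.comp_apply]
      exact hσK.trans (map_dvd σK ih)
  refine exists_logOmega_hom p hπ hj c.j_der (X.frob p a s)
    ((r : X.int →+* Rint K).comp (s ^ a)) (τ := ⇑(σK ^ a)) (fun x => ?_) hdvd (fun x => ?_) ?_
  · have := comm_pow (φ := algebraMap (OK K) X.int) (s := σK) (s' := s) (fun y => (hs y).symm) a x
    rw [RingHom.comp_apply, ← this]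
    exact r.commutes _
  · rw [frob_algebraMap, toRobba_algebraMap]; rfl
  -- The prescribed value of `dσ (dlog v)` is consistent with `v dlog v = dv`, because `d (h v ^ q)
  -- = h v ^ q (q dlog v + h⁻¹ dh)`.
  · rw [hv, c.der_apply, c.logD_mul hj, c.logD_pow hj, ← smul_eq_mul, ← map_smul]
    congr 1
    rw [smul_add, smul_smul, smul_smul, smul_smul]
    congr 2
    · ring
    · rw [mul_right_comm, Units.mul_inv, one_mul]

end DaggerPres

end

/-! ### Affine curves with a parameter at a rational point. -/

section

variable {K : Type u} [NormedField K] [IsUltrametricDist K] [CompleteSpace K] {π : OK K}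

open Robba

namespace DaggerPres

/-- An embedding of an affine curve and of the complement of a point into rings of series, for
which `w` is the parameter at the point. -/
structure IsParam (π : OK K) {Y : DaggerPres K} (w : MW K Y.n) (r : Y.int →ₐ[OK K] Rint K)
    (r' : (Y.loc w).int →ₐ[OK K] Rint K) : Prop where
  irreducible : Irreducible π
  inj : Function.Injective r
  inj' : Function.Injective r'
  toLoc : ∀ x, r' (Y.toLoc w x) = r x
  param : r (Y.proj w) = Tpow K 1
  locInv : r' (Y.locInv w) = Tpow K (-1)
  div : ∀ i, ∃ (c : OK K) (y : MW K Y.n),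
    Y.proj (MW.X i) = algebraMap _ _ c + Y.proj w * Y.proj y
  nonneg : ∀ y, (r y).1 ∈ plus K

namespace IsParam

variable {Y : DaggerPres K} {w : MW K Y.n} {r : Y.int →ₐ[OK K] Rint K}
  {r' : (Y.loc w).int →ₐ[OK K] Rint K}

/-- The part of `z` of nonnegative degree is the expansion of an element of `Y.int`. If `z` has no
negative terms, this part is everything, and injectivity of `r'` identifies the two elements. -/
lemma exists_toLoc_eq (H : IsParam π w r r') {z : (Y.loc w).int} (hz : (r' z).1 ∈ plus K) :
    ∃ y, Y.toLoc w y = z := by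
  obtain ⟨y, hy⟩ := exists_nonneg_part r r' H.irreducible H.param H.div H.toLoc H.locInv z
  refine ⟨y, H.inj' (Subtype.ext (ext_coeff fun i => ?_))⟩
  rw [H.toLoc]
  rcases lt_or_ge i 0 with hi | hi
  · rw [mem_plus.mp (H.nonneg y) i hi, mem_plus.mp hz i hi]
  · exact hy i hi

/-- Division by the parameter. -/
lemma exists_eq_add_mul (H : IsParam π w r r') (y : Y.int) :
    ∃ (c : OK K) (y₁ : Y.int), y = algebraMap _ _ c + Y.proj w * y₁ := by
  let c : OK K := ⟨(r y).1.1 0, (r y).2 0⟩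
  -- With `c` the constant term of `y`, the quotient `(y - c) / w` exists in the punctured algebra
  -- and has no negative powers, so it comes from `Y.int`.
  have h1 : r' (Y.locInv w * Y.toLoc w (y - algebraMap _ _ c)) =
      Tpow K (-1) * (r y - algebraMap _ _ c) := by
    rw [map_mul, H.locInv, H.toLoc, map_sub, AlgHom.commutes]
  obtain ⟨y₁, hy₁⟩ := H.exists_toLoc_eq (z := Y.locInv w * Y.toLoc w (y - algebraMap _ _ c)) (by
    refine mem_plus.mpr fun i hi => ?_
    rw [h1, coeff_Tpow_mul]
    change (_ - _ : Robba K).1 _ = 0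
    rw [coeff_sub, algebraMap_Rint, C_eq_mono, coeff_mono]
    rcases eq_or_ne i (-1) with rfl | hi'
    · exact sub_self _
    · rw [if_neg (by omega), sub_zero]
      exact mem_plus.mp (H.nonneg y) _ (by omega))
  refine ⟨c, y₁, H.inj ?_⟩
  have h2 : r y₁ = Tpow K (-1) * (r y - algebraMap _ _ c) := by rw [← H.toLoc, hy₁, h1]
  rw [map_add, map_mul, h2, H.param, AlgHom.commutes, ← mul_assoc, Tpow_mul]
  change r y = _ + Tpow K 0 * _
  rw [Tpow_zero, one_mul, add_sub_cancel]

variable [CharZero K] (p : ℕ) [Fact p.Prime]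

lemma toRobba_comp (H : IsParam π w r r') (y : Y.gen p) :
    toRobba p r' (genMap p (Y.toLoc w : Y.int →+* (Y.loc w).int) y) = toRobba p r y := by
  refine genMap_ext p (f := (toRobba p r').comp (genMap p (Y.toLoc w : Y.int →+* (Y.loc w).int)))
    (g := toRobba p r) (fun x => ?_) y
  rw [RingHom.comp_apply, genMap_algebraMap, toRobba_algebraMap, toRobba_algebraMap]
  exact congrArg Subtype.val (H.toLoc x)

lemma coeff_natCast_pow_mul (k : ℕ) (f : Robba K) (i : ℤ) :
    ((p : Robba K) ^ k * f).1 i = (p : K) ^ k * f.1 i := by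
  rw [← map_natCast (C (K := K)), ← map_pow, coeff_C_mul]

lemma natCast_pow_ne_zero (k : ℕ) : (p : K) ^ k ≠ 0 :=
  pow_ne_zero _ (Nat.cast_ne_zero.mpr (Fact.out : p.Prime).ne_zero)

lemma natCast_pow_mul_mem_plus {k : ℕ} {f : Robba K} :
    (p : Robba K) ^ k * f ∈ plus K ↔ f ∈ plus K := by
  simp only [mem_plus, coeff_natCast_pow_mul, mul_eq_zero, natCast_pow_ne_zero, false_or]

lemma toRobba_mem_plus (H : IsParam π w r r') (y : Y.gen p) : toRobba p r y ∈ plus K := by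
  obtain ⟨k, x, hx⟩ := exists_pow_mul_eq p y
  rw [← natCast_pow_mul_mem_plus p (k := k), ← map_natCast (toRobba p r), ← map_pow, ← map_mul, hx,
    toRobba_algebraMap]
  exact H.nonneg x

lemma isUnit_natCast_pow (X : DaggerPres K) (k : ℕ) : IsUnit ((p : X.gen p) ^ k) :=
  (X.isUnit_p p).pow k

lemma exists_eq_of_mem_plus (H : IsParam π w r r') (z : (Y.loc w).gen p)
    (hz : toRobba p r' z ∈ plus K) :
    ∃ y, genMap p (Y.toLoc w : Y.int →+* (Y.loc w).int) y = z := by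
  obtain ⟨k, x, hx⟩ := exists_pow_mul_eq p z
  obtain ⟨y, hy⟩ := H.exists_toLoc_eq (z := x) (by
    rw [← toRobba_algebraMap p, ← hx, map_mul, map_pow, map_natCast]
    exact (natCast_pow_mul_mem_plus p).mpr hz)
  obtain ⟨v, hv⟩ := isUnit_natCast_pow p Y k
  refine ⟨(v⁻¹).1 * algebraMap _ _ y, ((isUnit_natCast_pow p (Y.loc w) k).mul_right_inj).mp ?_⟩
  have h1 : genMap p (Y.toLoc w : Y.int →+* (Y.loc w).int) v.1 = (p : (Y.loc w).gen p) ^ k := by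
    rw [hv, map_pow, map_natCast]
  rw [map_mul, genMap_algebraMap, ← h1, ← mul_assoc, ← map_mul, Units.mul_inv, map_one, one_mul,
    h1, hx]
  exact congrArg _ hy

/-- A factor `T ^ (-m)` removes the positive powers and a factor `p ^ k` makes the geometric bound
equal to `1`, so `exists_of_nonpos` applies. Both factors are invertible in the punctured dagger
algebra. -/
lemma exists_eq_of_mem_mero (H : IsParam π w r r') (hp : ‖(p : K)‖ < 1) (f : Robba K)
    (hf : f ∈ mero K) : ∃ z, toRobba p r' z = f := by
  obtain ⟨N, hN⟩ := hf
  let m := N.toNat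
  let g : Robba K := mono (-m) 1 * f
  have hg : ∀ i, g.1 i = f.1 (i + m) := fun i => by
    rw [coeff_mono_mul, one_mul, sub_neg_eq_add]
  have hgpos : ∀ i, 0 < i → g.1 i = 0 := fun i hi => by
    rw [hg]
    exact hN _ (by omega)
  obtain ⟨s, hs, hgs⟩ := g.2
  obtain ⟨B, hB⟩ := bdd_of_tendsto (hgs s hs le_rfl)
  obtain ⟨k, hk⟩ := exists_pow_lt_of_lt_one (show 0 < (max B 1)⁻¹ by positivity) hp
  have hB1 : 0 < max B 1 := by positivity
  obtain ⟨z, hz⟩ := exists_of_nonpos r' H.irreducible H.locInv ((p : Robba K) ^ k * g)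
    (ρ := Real.exp s) (Real.one_lt_exp_iff.mpr hs) (fun j => by
      have h1 := (hB (-j)).trans (le_max_left B 1)
      have h2 : wt s g.1 (-j) = ‖g.1 (-j)‖ * Real.exp s ^ j := by
        unfold wt
        rw [← Real.exp_nat_mul]
        congr 2
        push_cast
        ring
      rw [coeff_natCast_pow_mul, norm_mul, norm_pow, mul_assoc, ← h2]
      calc _ ≤ (max B 1)⁻¹ * max B 1 :=
            mul_le_mul hk.le h1 (wt_nonneg _ _ _) (by positivity)
        _ = 1 := inv_mul_cancel₀ hB1.ne') (fun i hi => by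
      rw [coeff_natCast_pow_mul, hgpos i hi, mul_zero])
  obtain ⟨v, hv⟩ := isUnit_natCast_pow p (Y.loc w) k
  refine ⟨algebraMap _ _ (Y.toLoc w (Y.proj w) ^ m) * ((v⁻¹).1 * algebraMap _ _ z), ?_⟩
  have h3 : toRobba p r' ((v⁻¹).1 * algebraMap _ _ z) = g := by
    have h4 : IsUnit ((p : Robba K) ^ k) := (isUnit_natCast (Fact.out : p.Prime).ne_zero).pow k
    refine (h4.mul_right_inj).mp ?_
    rw [← hz, ← map_natCast (toRobba p r'), ← map_pow, ← hv, ← map_mul, ← mul_assoc, Units.mul_inv,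
      one_mul, toRobba_algebraMap]
  rw [map_mul, h3, toRobba_algebraMap, map_pow, H.toLoc, H.param, Tpow_pow]
  refine ext_coeff fun i => ?_
  change (mono _ 1 * g).1 i = _
  rw [coeff_mono_mul, one_mul, hg, mul_one, sub_add_cancel]

/-- Division by the parameter, after inverting `p`. -/
lemma exists_gen_eq_add_mul (H : IsParam π w r r') {σK : OK K →+* OK K} {s : Y.int →+* Y.int}
    (hs : ∀ x, s (algebraMap _ _ x) = algebraMap _ _ (σK x)) (a : ℕ) {τ : K →+* K}
    (hτ : ∀ c : OK K, τ c = (σK ^ a) c) (y : Y.gen p) :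
    ∃ (k y₁ : Y.gen p) (c : K), toRobba p r k = C c ∧ toRobba p r (Y.frob p a s k) = C (τ c) ∧
      y = k + Y.el p w * y₁ := by
  obtain ⟨m, x, hx⟩ := exists_pow_mul_eq p y
  obtain ⟨c, y₁, rfl⟩ := H.exists_eq_add_mul x
  obtain ⟨v, hv⟩ := isUnit_natCast_pow p Y m
  have h4 : IsUnit ((p : Robba K) ^ m) := (isUnit_natCast (Fact.out : p.Prime).ne_zero).pow m
  have hC : ∀ c : K, (p : Robba K) ^ m * C (c / (p : K) ^ m) = C c := fun c => by
    rw [← map_natCast (C (K := K)), ← map_pow, ← map_mul,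
      mul_div_cancel₀ _ (natCast_pow_ne_zero p m)]
  have hτp : τ ((p : K) ^ m) = (p : K) ^ m := by rw [map_pow, map_natCast]
  have hs' : (s ^ a) (algebraMap (OK K) Y.int c) = algebraMap (OK K) Y.int ((σK ^ a) c) :=
    (comm_pow (φ := algebraMap (OK K) Y.int) (s := σK) (s' := s) (fun y => (hs y).symm) a c).symm
  have hk : (p : Y.gen p) ^ m * ((v⁻¹).1 * algebraMap Y.int _ (algebraMap (OK K) Y.int c)) =
      algebraMap Y.int _ (algebraMap (OK K) Y.int c) := by
    rw [← hv, ← mul_assoc, Units.mul_inv, one_mul]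
  refine ⟨(v⁻¹).1 * algebraMap Y.int _ (algebraMap (OK K) Y.int c), (v⁻¹).1 * algebraMap _ _ y₁,
    c / (p : K) ^ m, (h4.mul_right_inj).mp ?_, (h4.mul_right_inj).mp ?_,
    ((isUnit_natCast_pow p Y m).mul_right_inj).mp ?_⟩
  · rw [hC, ← map_natCast (toRobba p r), ← map_pow, ← map_mul, hk, toRobba_algebraMap,
      AlgHom.commutes, algebraMap_Rint]
  · have e : ∀ k : Y.gen p, (p : Robba K) ^ m * toRobba p r (Y.frob p a s k) =
        toRobba p r (Y.frob p a s ((p : Y.gen p) ^ m * k)) := fun k => by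
      rw [map_mul, map_mul, map_pow, map_natCast, map_pow, map_natCast]
    rw [e, hk, frob_algebraMap, hs', toRobba_algebraMap, AlgHom.commutes, algebraMap_Rint,
      map_div₀, hτp, hC, hτ]
  · rw [hx, mul_add, hk, map_add, map_mul, ← hv]
    congr 1
    rw [mul_left_comm, ← mul_assoc v.1, Units.mul_inv, one_mul]
    rfl

end IsParam

end DaggerPres

end

section

variable {A : Type*} [CommRing A] {σ : A →+* A} {ι : Type*} [Fintype ι] [DecidableEq ι]
  {M : Type*} [AddCommGroup M] [Module A M]

/-- The linearization of `F` is an isomorphism, so `F` takes a basis to a basis, and its matrix is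
the matrix of a change of basis. -/
lemma exists_units_frobMatrix {F : M →ₛₗ[σ] M} (hF : IsBaseChangeAlong σ F)
    (b : Module.Basis ι A M) : ∃ Φ : (Matrix ι ι A)ˣ, Φ.1 = frobMatrix F (RingHom.id A) b := by
  obtain ⟨e, he⟩ := exists_basis_of_isBaseChangeAlong hF b
  refine ⟨⟨b.toMatrix e, e.toMatrix b, b.toMatrix_mul_toMatrix_flip e,
    e.toMatrix_mul_toMatrix_flip b⟩, Matrix.ext fun i k => ?_⟩
  have h1 := congrFun (coords_frob (φ := RingHom.id A) (σ' := σ) F b (fun _ => rfl) (b k)) i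
  have h2 : (fun i => σ (coords (RingHom.id A) b (b k) i)) = Pi.single k 1 := by
    rw [coords_basis]
    funext l
    by_cases hl : l = k
    · rw [hl, Pi.single_eq_same, map_one]
    · rw [Pi.single_eq_of_ne hl, map_zero]
  rw [h2, Matrix.mulVec_single_one, he] at h1
  exact h1

end

/-! ### Extension of the module across the point. -/

section

variable {K : Type u} [NormedField K] [IsUltrametricDist K] [CompleteSpace K] [CharZero K]
  [IsDiscreteValuationRing (OK K)] {p : ℕ} [Fact p.Prime] {π : OK K}

open Robba

namespace DaggerPres

lemma map_matrix_injective {A B : Type*} [CommRing A] [CommRing B] {f : A →+* B}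
    (hf : Function.Injective f) {m n : ℕ} {M N : Matrix (Fin m) (Fin n) A}
    (h : M.map f = N.map f) : M = N :=
  Matrix.ext fun i j => hf (congrFun (congrFun h i) j)

/-- Differentials are acted on by an endomorphism through the image of the frame. -/
lemma Frame.der_endo {X : DaggerPres K} {v : X.gen p} {j : X.gen p →+* Robba K} (c : Frame p X v j)
    {σ : X.gen p →+* X.gen p} (t : X.LogOmega p v →ₛₗ[σ] X.gen p)
    (ht : ∀ a, t (X.logD p v a) = c.coef (X.logD p v (σ a))) (a : X.gen p) :
    c.der (σ a) = t (c.coef.symm 1) * σ (c.der a) := by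
  rw [c.der_apply, ← ht]
  exact semilinear_eq_mul c.coef t _

set_option maxHeartbeats 400000 in
/-- A module with connection and Frobenius structure that is unipotent around the point where the
parameter `w` vanishes extends to a logarithmic module. -/
theorem IsParam.exists_logExtension {Y : DaggerPres K} {w : MW K Y.n} {r : Y.int →ₐ[OK K] Rint K}
    {r' : (Y.loc w).int →ₐ[OK K] Rint K} (H : IsParam π w r r') (hp : ‖(p : K)‖ < 1)
    (hspan : Submodule.span (Y.gen p) {Y.d p (Y.el p w)} = ⊤)
    {σK : OK K →+* OK K} (hσK : π ∣ σK π) {a q : ℕ} (hq : 0 < q)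
    {s : Y.int →+* Y.int} (hs : ∀ x, s (algebraMap _ _ x) = algebraMap _ _ (σK x))
    {s' : (Y.loc w).int →+* (Y.loc w).int}
    (hs' : ∀ x, s' (algebraMap _ _ x) = algebraMap _ _ (σK x))
    (hss' : ∀ y, s' (Y.toLoc w y) = Y.toLoc w (s y))
    {h : (Y.gen p)ˣ} (hh : Y.frob p a s (Y.el p w) = h * Y.el p w ^ q)
    {X : DaggerPres K} (φ : X.int →ₐ[OK K] (Y.loc w).int) {σ : X.int →+* X.int}
    (hφ : ∀ x, φ (σ x) = s' (φ x))
    (M : LogSigmaNabla.{u, v} X p q (X.frob p a σ) 1 1) [Module.Free (X.gen p) M.M]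
    (hM : IsUnipotentAlong M ((toRobba p r').comp (genMap p (φ : X.int →+* (Y.loc w).int)))) :
    ∃ (N : LogSigmaNabla.{u, u} Y p q (Y.frob p a s) (Y.el p w) h)
      (P : LogSigmaNabla.{u, u} (Y.loc w) p q ((Y.loc w).frob p a s') 1 1),
      IsPullback (genMap p (φ : X.int →+* (Y.loc w).int)) M P ∧
      IsPullback (genMap p (Y.toLoc w : Y.int →+* (Y.loc w).int)) N P := by
  have hπ := H.irreducible
  have hjY := toRobba_injective p H.inj
  have hjZ := toRobba_injective p H.inj'
  set i := genMap p (Y.toLoc w : Y.int →+* (Y.loc w).int) with hi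
  have hji : ∀ y, toRobba p r' (i y) = toRobba p r y := H.toRobba_comp p
  have hiinj : Function.Injective i := fun x y hxy => hjY (by rw [← hji, ← hji, hxy])
  have hjw : toRobba p r (Y.el p w) = (Tpow K 1).1 := by rw [el, toRobba_algebraMap, H.param]
  have hiw : i (Y.el p w) = Y.elLoc p w (MW.incl Y.n w) := Y.genMap_toLoc_el p w w
  obtain ⟨cY⟩ := exists_frame_log hπ H.inj H.param hspan
  have hspanZ : Submodule.span ((Y.loc w).gen p)
      {(Y.loc w).d p (Y.elLoc p w (MW.incl Y.n w))} = ⊤ :=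
    Y.span_d_loc p hπ w w fun k => hspan ▸ Submodule.mem_top
  obtain ⟨cZ⟩ : Nonempty (Frame p (Y.loc w) 1 (toRobba p r')) :=
    exists_frame_one hπ H.inj' (u := MW.incl Y.n w) (by
      have h1 := H.toLoc (Y.proj w)
      rw [toLoc_proj, H.param] at h1
      exact h1) (Y.elLoc_mul_X_last p w) hspanZ
  obtain ⟨tY, htY, htYd⟩ := exists_dsigma hπ H.inj cY hσK hs hh
  obtain ⟨tZ, htZ, htZd⟩ := exists_dsigma (a := a) (q := q) (h := 1) hπ H.inj' cZ hσK hs' (by simp)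
  have hiσ : ∀ y, i (Y.frob p a s y) = (Y.loc w).frob p a s' (i y) :=
    genMap_frob p (φ := (Y.toLoc w : Y.int →+* (Y.loc w).int)) (fun y => (hss' y).symm) a
  have hiδ : ∀ y, i (cY.der y) = cZ.der (i y) := fun y => hjZ (by
    rw [hji, cY.j_der, cZ.j_der, hji])
  set κ := tZ (cZ.coef.symm 1) with hκ
  have hDσ : ∀ z, cZ.der (((Y.loc w).frob p a s') z) = κ * ((Y.loc w).frob p a s') (cZ.der z) := cZ.der_endo tZ htZ
  have hT : theta (Tpow K 1).1 = (Tpow K 1).1 := by rw [theta_Tpow, Int.cast_one]; rfl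
  have hdw : cY.der (Y.el p w) = Y.el p w := hjY (by rw [cY.j_der, hjw, hT])
  have hiw' : IsUnit (i (Y.el p w)) := by
    rw [hiw]
    exact IsUnit.of_mul_eq_one _ (Y.elLoc_mul_X_last p w)
  -- The factor by which Frobenius acts on the frame is determined by its effect on `w`, since the
  -- derivation fixes `w` and `σ w` is a unit after the puncture. So the factors for the two frames
  -- agree, and `κ` has no negative powers.
  have hκi : i (tY (cY.coef.symm 1)) = κ := by
    refine ((hiw'.map ((Y.loc w).frob p a s')).mul_left_inj).mp ?_
    have h1 := congrArg i (cY.der_endo tY htY (Y.el p w))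
    rw [hdw, map_mul, hiδ, hiσ, hDσ, ← hiδ, hdw] at h1
    exact h1.symm
  have hκY : toRobba p r' κ = toRobba p r (tY (cY.coef.symm 1)) := by rw [← hκi, hji]
  obtain ⟨τ, hτ, hτn⟩ := exists_fieldHom hπ (Fact.out : p.Prime).ne_zero hp (σK ^ a)
  set S := toRobba p r ((Y.frob p a s) (Y.el p w)) with hS
  have hSp : S ∈ plus K := H.toRobba_mem_plus p _
  -- The expansion of `σ w` is that of `h` times `T ^ q` with `q > 0`. Substitution of `S` for `T`
  -- therefore makes sense.
  have hS0 : S.1 0 = 0 := by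
    have h1 : (Tpow K 1).1 ^ q = mono q 1 := by
      have := congrArg Subtype.val (Tpow_pow (K := K) 1 q)
      rw [mul_one] at this
      exact this
    rw [hS, hh, map_mul, map_pow, hjw, h1, mul_comm, coeff_mono_mul, one_mul]
    exact mem_plus.mp (H.toRobba_mem_plus p _) _ (by omega)
  have hS1 : ∀ k, ‖S.1 k‖ ≤ 1 := fun k => by
    rw [hS, el, frob_algebraMap, toRobba_algebraMap]
    exact (r _).2 k
  have hθS : theta S = toRobba p r' κ * S := by
    have h1 := congrArg (toRobba p r) (cY.der_endo tY htY (Y.el p w))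
    rwa [hdw, cY.j_der, map_mul, ← hκY] at h1
  have hκp : toRobba p r' κ ∈ plus K := hκY ▸ H.toRobba_mem_plus p _
  obtain ⟨σT, hσC, hσT, hθ⟩ := exists_substHom τ (fun c => (hτn c).le) S hSp hS0 hS1
  -- On expansions, Frobenius is the semilinear substitution of `S` for `T`: the two agree on
  -- constants and on `w`, and every element is a constant plus a multiple of `w`.
  have hσ : ∀ y, toRobba p r' (((Y.loc w).frob p a s') (i y)) = (σT ⟨toRobba p r y, H.toRobba_mem_plus p y⟩).1 :=
    fun y => by
      rw [← hiσ, hji]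
      exact comp_eq_of_param hSp hS0 hσC hσT (toRobba p r) (H.toRobba_mem_plus p) (Y.frob p a s) hjw rfl
        (H.exists_gen_eq_add_mul p hs a hτ) y
  set ψ := genMap p (φ : X.int →+* (Y.loc w).int) with hψ
  have hψσ : ∀ x, ψ (X.frob p a σ x) = ((Y.loc w).frob p a s') (ψ x) :=
    genMap_frob p (φ := (φ : X.int →+* (Y.loc w).int)) hφ a
  obtain ⟨n, ⟨b⟩⟩ : ∃ n, Nonempty (Module.Basis (Fin n) (X.gen p) M.M) :=
    ⟨_, ⟨(Module.Free.chooseBasis (X.gen p) M.M).reindex (Fintype.equivFin _)⟩⟩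
  obtain ⟨t, ht, -⟩ := exists_logOmega_hom p hπ hjZ cZ.j_der ψ
    ((r' : (Y.loc w).int →+* Rint K).comp (φ : X.int →+* (Y.loc w).int)) (τ := id)
    (fun c => by
      change r' (φ _) = _
      rw [AlgHom.commutes, AlgHom.commutes]; rfl) dvd_rfl (fun x => by
      rw [hψ, genMap_algebraMap, toRobba_algebraMap]; rfl) (v := 1) (c := cZ.der (ψ 1))
    (by rw [map_one, one_mul])
  let t' : X.LogOmega p 1 →ₛₗ[(toRobba p r').comp ψ] Robba K :=
    { toFun := fun ω => toRobba p r' (t ω)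
      map_add' := fun x y => by rw [map_add, map_add]
      map_smul' := fun c x => by rw [LinearMap.map_smulₛₗ, smul_eq_mul, map_mul]; rfl }
  obtain ⟨U, N₀, hN₀, hU⟩ := hM.exists_gauge b t' (fun c => by
    change toRobba p r' (t _) = _
    rw [ht, cZ.j_der]; rfl)
  rw [← connMatrix_map (j := toRobba p r') (fun _ => rfl) M.D b t t' (fun _ => rfl)] at hU
  obtain ⟨Φ₀, hΦ₀⟩ := exists_units_frobMatrix M.isBaseChange_F b
  let Φ : (Matrix (Fin n) (Fin n) ((Y.loc w).gen p))ˣ := Units.map ψ.mapMatrix.toMonoidHom Φ₀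
  have hΦ : Φ.1 = frobMatrix M.F ψ b := by
    rw [frobMatrix_comp, ← hΦ₀]; rfl
  have hΦ' : Φ.1.map cZ.der + connMatrix M.D b t * Φ.1 =
      κ • (Φ.1 * (connMatrix M.D b t).map ((Y.loc w).frob p a s')) := by
    obtain ⟨dσ, hdσ, -, hF⟩ := M.horizontal
    rw [hΦ]
    refine frobMatrix_horizontal M.D b t ht M.F hψσ (dσ := dσ) (fun ω => ?_) hF
    have hω : ω ∈ Submodule.span (X.gen p) (Set.range (X.logD p 1)) := by
      rw [span_logD_one]; trivial
    induction hω using Submodule.span_induction with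
    | mem x h =>
      obtain ⟨c, rfl⟩ := h
      rw [hdσ, ht, ht, hψσ, hDσ]
    | zero => simp
    | add x y _ _ hx hy => rw [map_add, map_add, map_add, map_add, hx, hy, mul_add]
    | smul c x _ hx =>
      rw [LinearMap.map_smulₛₗ dσ, LinearMap.map_smulₛₗ t, LinearMap.map_smulₛₗ t, hx, hψσ,
        smul_eq_mul, smul_eq_mul, map_mul, mul_left_comm]
  obtain ⟨W, ν, Ψ, hW, hWΦ, hΨ⟩ := exists_extension (Fact.out : p.Prime) hp hji
    (H.toRobba_mem_plus p) hjY hjZ (H.exists_eq_of_mem_mero p hp) (H.exists_eq_of_mem_plus p)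
    cZ.j_der hDσ hσ hκp (hθ _ hκp hθS) (connMatrix M.D b t) Φ hΦ' U hN₀ hU
  obtain ⟨Ψ', hΨ'⟩ : ∃ Ψ' : (Matrix (Fin n) (Fin n) ((Y.loc w).gen p))ˣ, Ψ'.1 = Ψ.1.map i :=
    ⟨Units.map i.mapMatrix.toMonoidHom Ψ, rfl⟩
  rw [← hΨ'] at hWΦ hΨ
  obtain ⟨N, bN, hNA, hNΦ⟩ := exists_logSigmaNabla cY.coef (cY.logD_mul hjY) tY htY htYd ν Ψ
    -- Horizontality over the unpunctured algebra is tested after the injection into the punctured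
    -- one, where it has been established; the derivations, the Frobenius lifts and the factors `κ`
    -- correspond.
    (map_matrix_injective hiinj (by
      rw [hΨ', ← hκi] at hΨ
      have e1 : ((Ψ.1.map fun x => cY.coef (Y.logD p (Y.el p w) x)) + ν * Ψ.1).map i =
          (Ψ.1.map i).map cZ.der + ν.map i * Ψ.1.map i := by
        rw [← Matrix.map_mul]
        refine Matrix.ext fun k l => ?_
        simp only [Matrix.map_apply, Matrix.add_apply, map_add, ← hiδ, Frame.der_apply]
      have e2 : (tY (cY.coef.symm 1) • (Ψ.1 * ν.map (Y.frob p a s))).map i =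
          i (tY (cY.coef.symm 1)) •
            (Ψ.1.map i * (ν.map i).map ((Y.loc w).frob p a s')) := by
        have e3 : (ν.map i).map ((Y.loc w).frob p a s') = (ν.map (Y.frob p a s)).map i :=
          Matrix.ext fun k l => (hiσ _).symm
        rw [e3, ← Matrix.map_mul]
        refine Matrix.ext fun k l => ?_
        simp only [Matrix.map_apply, Matrix.smul_apply, smul_eq_mul, map_mul]
      rw [e1, e2, hΨ]))
  obtain ⟨P, bP, hPA, hPΦ⟩ := exists_logSigmaNabla cZ.coef (cZ.logD_mul hjZ) tZ htZ htZd (ν.map i)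
    Ψ' hΨ
  -- The map on differentials induced by the puncture. It takes `dlog w` to the frame `w⁻¹ dw`, that
  -- is, to coefficient `1`, so the connection matrix of `N` is carried over without a factor.
  obtain ⟨tN, htN, htNd⟩ := exists_logOmega_hom p hπ hjZ cZ.j_der i
    (r : Y.int →+* Rint K) (τ := id) (fun c => r.commutes c) dvd_rfl (fun x => by
      rw [hji, toRobba_algebraMap]; rfl) (v := Y.el p w) (c := 1)
    (by rw [mul_one, ← hiδ, hdw])
  have htN1 : tN (cY.coef.symm 1) = 1 := by
    refine (hiw'.mul_left_inj).mp ?_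
    have h1 := semilinear_eq_mul cY.coef tN (Y.logD p (Y.el p w) (Y.el p w))
    rw [htN, ← hiδ, ← cY.der_apply, hdw] at h1
    rw [← h1, one_mul]
  refine ⟨N, P, ?_, ?_⟩
  · refine isPullback_of_matrix M P b bP cZ.coef (cZ.logD_mul hjZ) t ht hψσ W ?_ ?_
    · rw [hPA]; exact hW
    · rw [hPΦ, ← hΦ]; exact hWΦ
  · refine isPullback_of_matrix N P bN bP cZ.coef (cZ.logD_mul hjZ) tN htN hiσ 1 ?_ ?_
    · rw [hPA, connMatrix_comp N.D bN cY.coef, hNA, htN1, one_smul]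
      have e1 : ((1 : (Matrix (Fin n) (Fin n) ((Y.loc w).gen p))ˣ).1.map fun x =>
          cZ.coef ((Y.loc w).logD p 1 x)) = 0 := by
        refine Matrix.ext fun k l => hjZ ?_
        rw [Matrix.map_apply, cZ.j_coef_logD, Units.val_one, Matrix.one_apply, Matrix.zero_apply,
          map_zero]
        split_ifs
        · rw [map_one, theta_one]
        · rw [map_zero, map_zero]
      rw [e1, zero_add, Units.val_one, mul_one, one_mul]
    · rw [hPΦ, frobMatrix_comp, hNΦ, hΨ', Units.val_one, one_mul,
        Matrix.map_one _ (map_zero _) (map_one _), mul_one]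

end DaggerPres

end

/-! ### Existence of a neighbourhood with a parameter. -/

section

variable {K : Type u} [NormedField K] [IsUltrametricDist K] [CompleteSpace K]
  [IsDiscreteValuationRing (OK K)] {π : OK K}

open Robba

namespace Robba

lemma ofPS_mem_plus (f : PowerSeries (OK K)) : (ofPS f).1 ∈ plus K :=
  mem_plus.mpr fun i hi => by rw [coeff_ofPS, if_neg (by omega)]

lemma low_of_mem_plus {f : Robba K} (hf : f ∈ plus K) (d : ℕ) : Low d f := fun i hi =>
  mem_plus.mp hf i (by omega)

lemma low_Tpow_neg_one : Low 1 (Tpow K (-1)).1 := fun i hi => by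
  change (mono (-1) 1 : Robba K).1 i = 0
  rw [coeff_mono, if_neg (by push_cast at hi; omega)]

lemma ofPS_X : ofPS (PowerSeries.X : PowerSeries (OK K)) = Tpow K 1 := by
  refine Subtype.ext (ext_coeff fun i => ?_)
  change _ = (mono 1 1 : Robba K).1 i
  rw [coeff_ofPS, coeff_mono, PowerSeries.coeff_X]
  by_cases h : i = 1
  · subst h; simp
  · rw [if_neg h]
    split_ifs with h1 h2
    · omega
    · rfl
    · rfl

end Robba

namespace DaggerPres

variable {X : DaggerPres K} {w : MW K X.n} {ρ : X.int →ₐ[OK K] PowerSeries (OK K)}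

/-- After a localization, the generators of an affine curve are constant to first order at a
rational point, and the differentials are generated by that of the parameter. -/
lemma exists_generators (hπ : Irreducible π)
    (hw : Function.Surjective
      (algebraMap (IsLocalRing.ResidueField (OK K)) (X.special ⧸ Ideal.span {X.red w})))
    (hρ : ρ (X.proj w) = PowerSeries.X) :
    ∃ (c : Fin X.n → OK K) (y : Fin X.n → MW K X.n) (e : X.int),
      (∀ i, X.proj (MW.X i) = algebraMap _ _ (c i) + X.proj w * X.proj (y i)) ∧
      X.proj (Matrix.det (1 - Matrix.of fun j k => w * MW.pderiv k (y j))) =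
        1 - X.proj w * e := by
  have hc : ∀ i, ∃ y : MW K X.n, X.proj (MW.X i) =
      algebraMap _ _ (PowerSeries.coeff 0 (ρ (X.proj (MW.X i)))) + X.proj w * X.proj y := by
    intro i
    obtain ⟨z, hz⟩ := exists_eq_mul_of_coeff_zero hπ hw hρ (X.proj (MW.X i) -
      algebraMap _ _ (PowerSeries.coeff 0 (ρ (X.proj (MW.X i))))) (by
        rw [map_sub, map_sub, AlgHom.commutes, sub_eq_zero]
        simp)
    obtain ⟨y, rfl⟩ := X.proj_surjective z
    exact ⟨y, by rw [← hz, add_sub_cancel]⟩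
  choose y hy using hc
  -- At the point `w = 0` the matrix is the identity, so its determinant has constant term `1` and
  -- differs from `1` by a multiple of `w`.
  obtain ⟨e, he⟩ := exists_eq_mul_of_coeff_zero hπ hw hρ
    (1 - X.proj (Matrix.det (1 - Matrix.of fun j k => w * MW.pderiv k (y j)))) (by
      let f : MW K X.n →+* OK K := (PowerSeries.constantCoeff (R := OK K)).comp
        ((ρ : X.int →+* PowerSeries (OK K)).comp (X.proj : MW K X.n →+* X.int))
      have hfw : f w = 0 := by
        change PowerSeries.constantCoeff (ρ (X.proj w)) = 0
        rw [hρ, PowerSeries.constantCoeff_X]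
      have h1 : f (Matrix.det (1 - Matrix.of fun j k => w * MW.pderiv k (y j))) = 1 := by
        rw [RingHom.map_det]
        have : f.mapMatrix (1 - Matrix.of fun j k => w * MW.pderiv k (y j)) = 1 := by
          rw [map_sub, map_one, sub_eq_self]
          refine Matrix.ext fun j k => ?_
          change f (w * _) = 0
          rw [map_mul, hfw, zero_mul]
        rw [this, Matrix.det_one]
      rw [map_sub, map_sub, map_one, PowerSeries.coeff_zero_eq_constantCoeff, map_one, sub_eq_zero]
      exact h1.symm)
  exact ⟨_, y, e, hy, by rw [← he, sub_sub_cancel]⟩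

/-- On a suitable neighbourhood of a rational point of a smooth affine curve, functions are
expanded in terms of a parameter, and the differentials are generated by that of the parameter. -/
theorem exists_isParam [CharZero K] (p : ℕ) [Fact p.Prime] (hπ : Irreducible π)
    (hX : Algebra.Smooth (IsLocalRing.ResidueField (OK K)) X.special)
    (hconn : ConnectedSpace (PrimeSpectrum X.special)) (hw' : (Ideal.span {X.red w}).IsPrime)
    (hw : Function.Surjective
      (algebraMap (IsLocalRing.ResidueField (OK K)) (X.special ⧸ Ideal.span {X.red w})))
    (hρ : ρ (X.proj w) = PowerSeries.X) :
    ∃ (g : MW K X.n) (r : (X.loc g).int →ₐ[OK K] Rint K)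
      (r' : ((X.loc g).loc (MW.incl X.n w)).int →ₐ[OK K] Rint K),
      IsParam π (Y := X.loc g) (MW.incl X.n w) r r' ∧
      (∀ x, r (X.toLoc g x) = ofPS (ρ x)) ∧ Function.Injective (expand ρ) ∧
      Submodule.span ((X.loc g).gen p) {(X.loc g).d p (X.elLoc p g (MW.incl X.n w))} = ⊤ := by
  obtain ⟨c, y, e, hy, he⟩ := exists_generators hπ hw hρ
  -- The localization is at this determinant. Its expansion has constant term `1`, so it is an
  -- invertible power series and the expansion map extends.
  set g := Matrix.det (1 - Matrix.of fun j k => w * MW.pderiv k (y j)) with hg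
  have hmod := modInj_expand hπ (dvd_of_dvd_coeff hπ hX hconn hw' hw hρ)
  have hunit : IsUnit (ρ (X.proj g)) := by
    rw [PowerSeries.isUnit_iff_constantCoeff, he, map_sub, map_mul, hρ, map_one, map_sub, map_mul,
      PowerSeries.constantCoeff_X, zero_mul, map_one, sub_zero]
    exact isUnit_one
  obtain ⟨v, hv⟩ := hunit.exists_right_inv
  obtain ⟨r, hr, hr1, hr2⟩ := exists_extend_loc hπ (expand ρ)
    (fun i => low_of_mem_plus (ofPS_mem_plus _) 1) (f := g) (v := ofPS v)
    (by rw [expand_apply, ← map_mul, hv, map_one]) (low_of_mem_plus (ofPS_mem_plus _) 1)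
  have hrw : r ((X.loc g).proj (MW.incl X.n w)) = Tpow K 1 :=
    (congrArg r (X.toLoc_proj g w).symm).trans ((hr _).trans (by rw [expand_apply, hρ, ofPS_X]))
  obtain ⟨r', hr', hr1', -⟩ := exists_extend_loc hπ r hr2 (f := MW.incl X.n w) (v := Tpow K (-1))
    (by
      rw [hrw, Tpow_mul]
      exact Tpow_zero) low_Tpow_neg_one
  have hmodY := hmod.loc hπ hr
  refine ⟨g, r, r', ⟨hπ, hmodY.injective hπ (Rint_eq_zero_of_mul hπ),
    (hmodY.loc hπ hr').injective hπ (Rint_eq_zero_of_mul hπ), hr', hrw, hr1', ?_, ?_⟩, hr,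
    hmod.injective hπ (Rint_eq_zero_of_mul hπ),
    X.span_d_loc p hπ g w (X.det_smul_d_mem p w y c hy)⟩
  · have hw1 : (X.loc g).proj (MW.incl X.n w) = X.toLoc g (X.proj w) := (X.toLoc_proj g w).symm
    refine fun i => Fin.lastCases ?_ (fun i => ?_) (i : Fin (X.n + 1))
    -- The new generator `1 / g` is a constant to first order as well: `g = 1 - w e` gives `1 / g =
    -- 1 + w e / g`.
    · obtain ⟨q, hq⟩ := (X.loc g).proj_surjective (X.toLoc g e * X.locInv g)
      refine ⟨1, q, ?_⟩
      rw [hq, hw1, map_one]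
      have h1 := X.toLoc_mul_locInv g
      rw [he, map_sub, map_one, map_mul] at h1
      change X.locInv g = _
      linear_combination h1
    · refine ⟨c i, MW.incl X.n (y i), ?_⟩
      have h1 := congrArg (X.toLoc g) (hy i)
      rw [toLoc_proj, MW.incl_X, map_add, map_mul, AlgHom.commutes, toLoc_proj, toLoc_proj] at h1
      exact h1
  · refine mem_plus_of_generators hπ r fun i => Fin.lastCases ?_ (fun i => ?_) (i : Fin (X.n + 1))
    · change (r (X.locInv g)).1 ∈ _
      rw [hr1]
      exact ofPS_mem_plus _
    · have h1 : r ((X.loc g).proj (MW.X i.castSucc : MW K (X.n + 1))) = ofPS (ρ (X.proj (MW.X i))) := by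
        have h2 := hr (X.proj (MW.X i))
        rw [toLoc_proj, MW.incl_X] at h2
        exact h2
      exact h1 ▸ ofPS_mem_plus _

end DaggerPres

end

end Dagger

end

/-- The field `K` is complete and discretely valued of characteristic zero, with valuation ring
`O = OK K` of residue characteristic `p`; `σK` is a lift of the `p`-power Frobenius to `O`, and
`q = p ^ a`. The dagger algebra `A` has integral model `X.int`, and `u` is given by a representative
in `W_n`. The map `ρ : A^int → O⟦T⟧` is the (unique) `O`-algebra homomorphism with `ρ(u) = T`, and
`ρ'` is its extension to the localization at `u`, with values in the series with coefficients
in `O` in the Robba ring. The endomorphism `σ'` is the (unique) extension of `σ` to the localization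
at `u`. The conclusion: over some localization `X.loc g` in which `u` is not invertible there is a
log-module `N` with respect to `u` such that `M` and `N` become isomorphic (to `P`) over the common
localization in which `u` and `g` are inverted. -/
theorem mainTheorem2 {K : Type u} [NormedField K] [IsUltrametricDist K] [CompleteSpace K]
    [CharZero K] [IsDiscreteValuationRing (OK K)]
    (p : ℕ) [Fact p.Prime] (hp : ‖(p : K)‖ < 1) (a : ℕ) (ha : 0 < a)
    (σK : OK K →+* OK K) (hσK : ∀ c, σK c - c ^ p ∈ IsLocalRing.maximalIdeal (OK K))
    (X : DaggerPres K) (hX : X.IsDagger)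
    (hdim : ringKrullDim X.special = 1) (hconn : ConnectedSpace (PrimeSpectrum X.special))
    (σ : X.int →+* X.int) (hσ : X.IsFrobeniusLift p σK σ)
    (u : MW K X.n)
    (hu_prime : (Ideal.span {X.red u}).IsPrime)
    (hu_residue : Function.Bijective
      (algebraMap (IsLocalRing.ResidueField (OK K)) (X.special ⧸ Ideal.span {X.red u})))
    (h : (X.gen p)ˣ) (hu : X.frob p a σ (X.el p u) = h * X.el p u ^ p ^ a)
    (ρ : X.int →ₐ[OK K] PowerSeries (OK K)) (hρ : ρ (X.proj u) = PowerSeries.X)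
    (ρ' : (X.loc u).int →+* Robba K)
    (hρ' : ∀ x (i : ℤ), (ρ' (X.toLoc u x)).1 i =
      if 0 ≤ i then ((PowerSeries.coeff i.toNat (ρ x) : OK K) : K) else 0)
    (hρ'_int : ∀ y (i : ℤ), ‖(ρ' y).1 i‖ ≤ 1)
    (σ' : (X.loc u).int →+* (X.loc u).int) (hσ' : (X.loc u).IsFrobeniusLift p σK σ')
    (hσσ' : ∀ x, σ' (X.toLoc u x) = X.toLoc u (σ x))
    (M : LogSigmaNabla.{u, v} (X.loc u) p (p ^ a) ((X.loc u).frob p a σ') 1 1)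
    [Module.Free ((X.loc u).gen p) M.M]
    (hM : IsUnipotentAlong M (Robba.extend (X.loc u) p ρ')) :
    ∃ g : MW K X.n, X.el p g ∈ nonZeroDivisors (X.gen p) ∧
      ¬ IsUnit ((X.loc g).el p (MW.incl X.n u)) ∧
      ∃ σg : (X.loc g).int →+* (X.loc g).int,
        (X.loc g).IsFrobeniusLift p σK σg ∧
        (∀ x, σg (X.toLoc g x) = X.toLoc g (σ x)) ∧
      ∃ N : LogSigmaNabla.{u, u} (X.loc g) p (p ^ a) ((X.loc g).frob p a σg)
          ((X.loc g).el p (MW.incl X.n u))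
          (Units.map (DaggerPres.genMap p (X.toLoc g : X.int →+* (X.loc g).int)).toMonoidHom h),
      ∃ (σB : ((X.loc g).loc (MW.incl X.n u)).int →+* ((X.loc g).loc (MW.incl X.n u)).int)
        (φ : (X.loc u).int →ₐ[OK K] ((X.loc g).loc (MW.incl X.n u)).int),
        ((X.loc g).loc (MW.incl X.n u)).IsFrobeniusLift p σK σB ∧
        (∀ y, σB ((X.loc g).toLoc (MW.incl X.n u) y) =
          (X.loc g).toLoc (MW.incl X.n u) (σg y)) ∧
        (∀ x, φ (X.toLoc u x) = (X.loc g).toLoc (MW.incl X.n u) (X.toLoc g x)) ∧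
      ∃ P : LogSigmaNabla.{u, u} ((X.loc g).loc (MW.incl X.n u)) p (p ^ a)
          (((X.loc g).loc (MW.incl X.n u)).frob p a σB) 1 1,
        IsPullback (DaggerPres.genMap p (φ : (X.loc u).int →+* _)) M P ∧
        IsPullback (DaggerPres.genMap p
          ((X.loc g).toLoc (MW.incl X.n u) : (X.loc g).int →+* _)) N P := by
  obtain ⟨π, hπ⟩ := IsDiscreteValuationRing.exists_irreducible (OK K)
  have hp0 : p ≠ 0 := (Fact.out : p.Prime).ne_zero
  have hσπ : π ∣ σK π := dvd_map_of_frobenius hπ hp0 hσK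
  obtain ⟨g, r, r', H, hr, hinj, hspan⟩ := DaggerPres.exists_isParam p hπ hX.smooth hconn hu_prime
    hu_residue.surjective hρ
  have hsepY := DaggerPres.isSep_of_injective hπ H.inj
  have hsepZ := DaggerPres.isSep_of_injective hπ H.inj'
  obtain ⟨σg, hσg, hσg'⟩ := hσ.exists_loc hπ hp hσK g hsepY
  obtain ⟨σB, hσB, hσB'⟩ := hσg.exists_loc hπ hp hσK (MW.incl X.n u) hsepZ
  obtain ⟨φ₀, hφc, hφt⟩ := DaggerPres.exists_loc_hom hπ hsepZ (σK := RingHom.id _) dvd_rfl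
    (((X.loc g).toLoc (MW.incl X.n u) : (X.loc g).int →+* _).comp
      (X.toLoc g : X.int →+* (X.loc g).int))
    (fun c => (congrArg ((X.loc g).toLoc (MW.incl X.n u)) ((X.toLoc g).commutes c)).trans
      (((X.loc g).toLoc (MW.incl X.n u)).commutes c)) (f := u)
    (by
      have h1 := DaggerPres.isUnit_toLoc (X.loc g) (MW.incl X.n u)
      rwa [show (X.loc g).proj (MW.incl X.n u) = X.toLoc g (X.proj u) from
        (X.toLoc_proj g u).symm] at h1)
  let φ : (X.loc u).int →ₐ[OK K] ((X.loc g).loc (MW.incl X.n u)).int := ⟨φ₀, hφc⟩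
  have hφ : ∀ x, φ (X.toLoc u x) = (X.loc g).toLoc (MW.incl X.n u) (X.toLoc g x) := hφt
  -- Both composites extend the same map on `X.int`, and homomorphisms from a localization to a
  -- separated ring are determined by their restriction.
  have hφσ : ∀ x, φ (σ' x) = σB (φ x) := by
    refine fun x => RingHom.congr_fun (DaggerPres.loc_ringHom_ext hπ hsepZ
      (r₁ := (φ : (X.loc u).int →+* _).comp σ') (r₂ := σB.comp (φ : (X.loc u).int →+* _))
      ?_ fun x => ?_) x
    · change _ ∣ φ (σ' _)
      rw [hσ'.extends_base, AlgHom.commutes]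
      exact map_dvd _ hσπ
    · change φ (σ' _) = σB (φ _)
      rw [hσσ', hφ, hφ, hσB', hσg']
  -- The given `ρ'` takes values in series with integral coefficients, a separated ring, so the same
  -- uniqueness identifies it with the expansion constructed through the smaller neighbourhood.
  have hφρ : ∀ x, (r' (φ x)).1 = ρ' x := by
    let ρ₁ : (X.loc u).int →+* Robba.Rint K := ρ'.codRestrict _ hρ'_int
    refine fun x => congrArg Subtype.val (RingHom.congr_fun (DaggerPres.loc_ringHom_ext hπ
      (Robba.isSep_Rint hπ) (r₁ := (r'.comp φ : (X.loc u).int →+* Robba.Rint K)) (r₂ := ρ₁)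
      ?_ fun x => ?_) x)
    · change _ ∣ (r'.comp φ) _
      rw [AlgHom.commutes]
    · refine Subtype.ext (Robba.ext_coeff fun i => ?_)
      change (r' (φ (X.toLoc u x))).1.1 i = (ρ' (X.toLoc u x)).1 i
      rw [hφ, H.toLoc, hr, hρ', Robba.coeff_ofPS]
  have hρφ : Robba.extend (X.loc u) p ρ' = (DaggerPres.toRobba p r').comp
      (DaggerPres.genMap p (φ : (X.loc u).int →+* _)) := by
    refine RingHom.ext fun y => DaggerPres.genMap_ext p (fun x => ?_) y
    rw [RingHom.comp_apply, DaggerPres.genMap_algebraMap, DaggerPres.toRobba_algebraMap]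
    exact (IsLocalization.Away.lift_eq _ _ x).trans (hφρ x).symm
  have hug : DaggerPres.genMap p (X.toLoc g : X.int →+* (X.loc g).int) (X.el p u) =
      (X.loc g).el p (MW.incl X.n u) := X.genMap_toLoc_el p g u
  have hh : (X.loc g).frob p a σg ((X.loc g).el p (MW.incl X.n u)) =
      (Units.map (DaggerPres.genMap p
        (X.toLoc g : X.int →+* (X.loc g).int)).toMonoidHom h).1 *
        (X.loc g).el p (MW.incl X.n u) ^ p ^ a := by
    have h1 := DaggerPres.genMap_frob p (φ := (X.toLoc g : X.int →+* (X.loc g).int))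
      (fun x => (hσg' x).symm) a (X.el p u)
    rw [hu, hug, map_mul, map_pow, hug] at h1
    exact h1.symm
  rw [hρφ] at hM
  obtain ⟨N, P, hMP, hNP⟩ := H.exists_logExtension hp hspan hσπ (pow_pos (Fact.out : p.Prime).pos a)
    hσg.extends_base hσB.extends_base hσB' hh φ hφσ M hM
  refine ⟨g, ?_, ?_, σg, hσg, hσg', N, σB, φ, hσB, hσB', hφ, P, hMP, hNP⟩
  -- The expansion of `g` is invertible in the Robba ring, and expansions are injective.
  · refine mem_nonZeroDivisors_iff_right.mpr fun x hx => DaggerPres.toRobba_injective p hinj ?_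
    have h1 : (DaggerPres.expand ρ (X.proj g)).1 * (r (X.locInv g)).1 = 1 := by
      have h2 := congrArg r (X.toLoc_mul_locInv g)
      rw [map_mul, hr, map_one] at h2
      exact congrArg Subtype.val h2
    have h3 := congrArg (DaggerPres.toRobba p (DaggerPres.expand ρ)) hx
    rw [map_mul, map_zero, DaggerPres.el, DaggerPres.toRobba_algebraMap] at h3
    rw [map_zero, ← mul_one (DaggerPres.toRobba p _ x), ← h1, ← mul_assoc, h3, zero_mul]
  -- An inverse of `u` would have an expansion without negative powers, and multiplying such a
  -- series by `T` kills the constant term, which would have to be `1`.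
  · intro hunit
    obtain ⟨b, hb⟩ := hunit.exists_right_inv
    have h1 := congrArg (DaggerPres.toRobba p r) hb
    have h3 : DaggerPres.toRobba p r ((X.loc g).el p (MW.incl X.n u)) = (Robba.Tpow K 1).1 :=
      (DaggerPres.toRobba_algebraMap p r _).trans (congrArg Subtype.val H.param)
    rw [map_mul, map_one, h3] at h1
    have h2 := congrArg (fun f : Robba K => f.1 0) h1
    change (Robba.mono 1 1 * _ : Robba K).1 0 = (1 : Robba K).1 0 at h2
    rw [Robba.coeff_mono_mul, Robba.mem_plus.mp (H.toRobba_mem_plus p b) _ (by norm_num),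
      mul_zero, Robba.coeff_one, if_pos rfl] at h2
    exact zero_ne_one h2
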